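/- **Setting.** Let $M,n,n_0$ be nonnegative integers and consider the plant $$\dot x=Ax+Bu,\qquad y=Cx,\qquad y_0=C_0x,$$ with real constant matrices $A\in\mathbb R^{n\times n}$, $B\in\mathbb R^{n\times M}$, $C\in\mathbb R^{M\times n}$, $C_0\in\mathbb R^{n_0\times n}$; $A,B,C$ are unknown to the controller. Let $G(s)=C(sI-A)^{-1}B$. A polynomial is called stable if all its roots have negative real part. Assume: * (A1) all transmission zeros of $G$ have negative real part, $(A,B)$ is stabilizable and $(A,C)$ is detectable; * (A2) $G$ has full rank (it is nonsingular as a rational matrix), and a modified left interactor matrix $\xi_m(s)$ of $G$ is known: a lower triangular real polynomial matrix with monic stable diagonal entries of positive degree such that $K_p=\lim_{s\to\infty}\xi_m(s)G(s)$ is finite and nonsingular; * (A3) $y_0$ is measured, $(A,C_0)$ is observable and $\operatorname{rank}C_0=n_0$; * (A4) all leading principal minors $\Delta_1,\dots,\Delta_M$ of $K_p$ are nonzero and their signs are known. Put $d_1^*=\Delta_1$ and $d_i^*=\Delta_i/\Delta_{i-1}$ for $i\ge 2$. For a proper rational matrix $T(s)$ with stable monic denominator, $T(s)[v]$ denotes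 the output of a filter with transfer matrix $T$ and input $v$, started from arbitrary initial values (in the controllable canonical realization). Differential equations are understood in the sense of Carathéodory on $[0,\infty)$. **Reference model.** $y_m=\xi_m^{-1}(s)[r]$ with $r:[0,\infty)\to\mathbb R^M$ bounded and measurable, and $e=y-y_m$. **Controller.** Let $\Lambda$ be a monic stable polynomial of degree $n-n_0$, let $A_1(s)=[I_M,sI_M,\dots,s^{n-n_0-1}I_M]^{\rm T}$, $A_2(s)=[I_{n_0},sI_{n_0},\dots,s^{n-n_0-1}I_{n_0}]^{\rm T}$, and $$\omega_1=\tfrac{A_1(s)}{\Lambda(s)}[u],\quad \omega_2=\tfrac{A_2(s)}{\Lambda(s)}[y_0],\quad u=\Theta_1^{\rm T}\omega_1+\Theta_2^{\rm T}\omega_2+\Theta_{20}^{\rm T}y_0+\Theta_3r,$$ $\omega=[\omega_1^{\rm T},\omega_2^{\rm T},y_0^{\rm T},r^{\rm T}]^{\rm T}$, $\Theta=[\Theta_1^{\rm T},\Theta_2^{\rm T},\Theta_{20}^{\rm T},\Theta_3]^{\rm T}$ (all $\Theta$'s time-varying). **Adaptive laws.** Let $f$ be a monic stable polynomial whose degree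 is the maximal degree of the entries of $\xi_m$, let $h(s)=1/f(s)$, and put $$\bar e=\xi_m(s)h(s)[e],\quad \eta_i=[\bar e_1,\dots,\bar e_{i-1}]^{\rm T},\quad \zeta=h(s)[\omega],\quad \xi=\Theta^{\rm T}\zeta-h(s)[\Theta^{\rm T}\omega],$$ $$\epsilon=[0,\theta_2^{\rm T}\eta_2,\dots,\theta_M^{\rm T}\eta_M]^{\rm T}+\Psi\xi+\bar e,\qquad m^2=1+\zeta^{\rm T}\zeta+\xi^{\rm T}\xi+\sum_{i=2}^M\eta_i^{\rm T}\eta_i .$$ With $D_s=\operatorname{diag}(\operatorname{sign}(d_1^*)\gamma_1,\dots,\operatorname{sign}(d_M^*)\gamma_M)$ for chosen constants $\gamma_i>0$, and chosen symmetric positive definite gains $\Gamma_{\theta i}$, $\Gamma$, the estimates $\theta_i\in\mathbb R^{i-1}$, $\Theta$, $\Psi\in\mathbb R^{M\times M}$ are updated by $$\dot\theta_i=-\frac{\Gamma_{\theta i}\,\epsilon_i\,\eta_i}{m^2}\ (i=2,\dots,M),\qquad \dot\Theta^{\rm T}=-\frac{D_s\,\epsilon\,\zeta^{\rm T}}{m^2},\qquad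 \dot\Psi=-\frac{\Gamma\,\epsilon\,\xi^{\rm T}}{m^2}.$$ **Theorem.** For all initial values of the plant state, of the parameter estimates and of the filters, the closed-loop system has a solution on $[0,\infty)$, and for every such solution all closed-loop signals ($x,u,y,y_0,y_m,e,\omega_1,\omega_2,\omega,\Theta,\theta_i,\Psi,\bar e,\eta_i,\zeta,h(s)[\Theta^{\rm T}\omega],\xi,\epsilon,m^2$ and all filter states) are bounded on $[0,\infty)$, and $$\lim_{t\to\infty}\bigl(y(t)-y_m(t)\bigr)=0 .$$ -/

import Mathlib

open Polynomial Filter Topology MeasureTheory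

noncomputable section

namespace PartialStateMRAC

/-! ### Linear systems -/

/-- A real polynomial is stable: all its complex roots lie in the open left half plane. -/
def StablePoly (p : ℝ[X]) : Prop := ∀ z : ℂ, aeval z p = 0 → z.re < 0

/-- A real square matrix all of whose eigenvalues lie in the open left half plane. -/
def Hurwitz {n : ℕ} (A : Matrix (Fin n) (Fin n) ℝ) : Prop := StablePoly A.charpoly

/-- `(A, B)` is stabilizable. -/
def Stabilizable {n m : ℕ} (A : Matrix (Fin n) (Fin n) ℝ) (B : Matrix (Fin n) (Fin m) ℝ) : Prop :=
  ∃ K : Matrix (Fin m) (Fin n) ℝ, Hurwitz (A + B * K)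

/-- `(A, C)` is detectable. -/
def Detectable {n m : ℕ} (A : Matrix (Fin n) (Fin n) ℝ) (C : Matrix (Fin m) (Fin n) ℝ) : Prop :=
  ∃ L : Matrix (Fin n) (Fin m) ℝ, Hurwitz (A - L * C)

/-- `(A, C)` is observable: the unobservable subspace is trivial. -/
def Observable {n m : ℕ} (A : Matrix (Fin n) (Fin n) ℝ) (C : Matrix (Fin m) (Fin n) ℝ) : Prop :=
  ∀ v : Fin n → ℝ, (∀ k : ℕ, C.mulVec ((A ^ k).mulVec v) = 0) → v = 0

/-- The transfer matrix `G(s) = C (sI - A)⁻¹ B`, for `s` not an eigenvalue of `A` (the value at the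
finitely many eigenvalues is irrelevant below: only limits of `G` are used there). -/
def transferMatrix {n m l : ℕ} (A : Matrix (Fin n) (Fin n) ℝ) (B : Matrix (Fin n) (Fin m) ℝ)
    (C : Matrix (Fin l) (Fin n) ℝ) (s : ℂ) : Matrix (Fin l) (Fin m) ℂ :=
  C.map Complex.ofReal * (s • (1 : Matrix (Fin n) (Fin n) ℂ) - A.map Complex.ofReal)⁻¹ *
    B.map Complex.ofReal

/-- `z` is a (transmission) zero of the square, generically nonsingular rational matrix `G`: there
is an input direction `φ`, analytic and nonzero at `z`, such that `G φ` vanishes at `z`.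
If `z` is not a pole of `G` this says that `G z` is singular; in general it says that `det Z`
vanishes at `z` for a right coprime polynomial factorization `G = Z P⁻¹`. -/
def IsTransmissionZero {m : ℕ} (G : ℂ → Matrix (Fin m) (Fin m) ℂ) (z : ℂ) : Prop :=
  ∃ φ : ℂ → Fin m → ℂ, AnalyticAt ℂ φ z ∧ φ z ≠ 0 ∧
    Tendsto (fun s => (G s).mulVec (φ s)) (𝓝[≠] z) (𝓝 0)

/-- Value at `s` of a real polynomial matrix. -/
def evalMatrix {m l : ℕ} (N : Matrix (Fin m) (Fin l) ℝ[X]) (s : ℂ) : Matrix (Fin m) (Fin l) ℂ :=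
  N.map fun p => aeval s p

/-- `ξ` is a modified left interactor matrix of `G`, with high-frequency gain matrix `Kp`: it is
lower triangular, its diagonal entries are monic stable polynomials of positive degree, and
`Kp = lim ξ(s) G(s)` as `s → ∞` is finite and nonsingular. -/
structure IsModifiedInteractor {m : ℕ} (ξ : Matrix (Fin m) (Fin m) ℝ[X])
    (G : ℂ → Matrix (Fin m) (Fin m) ℂ) (Kp : Matrix (Fin m) (Fin m) ℝ) : Prop where
  lower : ∀ i j, i < j → ξ i j = 0
  diag_monic : ∀ i, (ξ i i).Monic
  diag_stable : ∀ i, StablePoly (ξ i i)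
  diag_degree : ∀ i, 0 < (ξ i i).natDegree
  gain : Tendsto (fun s => evalMatrix ξ s * G s) (Bornology.cobounded ℂ)
    (𝓝 (Kp.map Complex.ofReal))
  nonsingular : Kp.det ≠ 0

/-- The leading principal minor `Δ_k` (top left `k × k` block); `Δ_0 = 1`. -/
def leadingMinor {m : ℕ} (K : Matrix (Fin m) (Fin m) ℝ) (k : ℕ) : ℝ :=
  (K.submatrix (fun i : {i : Fin m // i.val < k} => i.val)
    (fun i : {i : Fin m // i.val < k} => i.val)).det

/-- The maximal degree of the entries of a polynomial matrix. -/
def maxDegree {m : ℕ} (N : Matrix (Fin m) (Fin m) ℝ[X]) : ℕ :=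
  Finset.univ.sup fun i => Finset.univ.sup fun j => (N i j).natDegree

/-! ### Signals on `[0, ∞)` and filters -/

/-- `ż = f` on `[0, ∞)` in the sense of Carathéodory. -/
def HasRate (z f : ℝ → ℝ) : Prop :=
  ∀ t, 0 ≤ t → IntervalIntegrable f volume 0 t ∧ z t = z 0 + ∫ s in (0 : ℝ)..t, f s

/-- `v` is bounded on `[0, ∞)`. -/
def BoundedSignal (v : ℝ → ℝ) : Prop := ∃ K : ℝ, ∀ t, 0 ≤ t → |v t| ≤ K

/-- For a monic `p` of degree `N`: `q · j` is the solution `q, q̇, …, q^(N)` of `p(d/dt) q = v_j`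
with initial values `q^(k)(0) = c j k`, `k < N`, i.e. the controllable canonical realization of
filters with denominator `p` and input `v`. Only the indices `k ≤ N` of `q` matter. -/
def FilterState {b : Type} (p : ℝ[X]) (c : b → ℕ → ℝ) (v : ℝ → b → ℝ) (q : ℝ → b → ℕ → ℝ) :
    Prop :=
  (∀ j, ∀ k < p.natDegree,
    HasRate (fun t => q t j k) (fun t => q t j (k + 1)) ∧ q 0 j k = c j k) ∧
  ∀ t, 0 ≤ t → ∀ j, ∑ k ∈ Finset.range (p.natDegree + 1), p.coeff k * q t j k = v t j

/-- `w = (N(s) / p(s))[v]`, where `q` is the state of the filter (see `FilterState`) and `c` its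
initial value, for a proper `N(s) / p(s)`. -/
def FilterOutput {a b : Type} [Fintype b] (N : Matrix a b ℝ[X]) (p : ℝ[X]) (c : b → ℕ → ℝ)
    (v : ℝ → b → ℝ) (q : ℝ → b → ℕ → ℝ) (w : ℝ → a → ℝ) : Prop :=
  FilterState p c v q ∧
  ∀ t, 0 ≤ t → ∀ i, w t i = ∑ j, (N i j).sum fun k x => x * q t j k

/-- `[I_m, s I_m, …, s^(N-1) I_m]ᵀ`. -/
def powerStack (N m : ℕ) : Matrix (Fin N × Fin m) (Fin m) ℝ[X] :=
  Matrix.of fun kj j => if kj.2 = j then X ^ kj.1.val else 0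

/-! ### The adaptive controller -/

/-- Index set of the regressor `ω = [ω₁; ω₂; y₀; r]`. -/
abbrev RegIdx (M n n₀ : ℕ) : Type :=
  (Fin (n - n₀) × Fin M) ⊕ (Fin (n - n₀) × Fin n₀) ⊕ Fin n₀ ⊕ Fin M

/-- What the designer knows (the interactor `ξ` and the signs `sgn`) and chooses (the rest).
Indices are zero-based: `i : Fin M` stands for the output channel `i + 1`, so that `θ i` and
`η i` have `i` components (none for the first channel). -/
structure Design (M n n₀ : ℕ) where
  /-- The modified left interactor matrix; the reference model is `W_m = ξ⁻¹`. -/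
  ξ : Matrix (Fin M) (Fin M) ℝ[X]
  /-- The signs of `d_i* = Δ_i / Δ_{i-1}`. -/
  sgn : Fin M → ℝ
  /-- The denominator of the controller filters. -/
  Lam : ℝ[X]
  Lam_monic : Lam.Monic
  Lam_stable : StablePoly Lam
  Lam_degree : Lam.natDegree = n - n₀
  /-- The denominator of the filter `h(s) = 1 / f(s)`. -/
  f : ℝ[X]
  f_monic : f.Monic
  f_stable : StablePoly f
  f_degree : f.natDegree = maxDegree ξ
  /-- Adaptation gains. -/
  γ : Fin M → ℝ
  γ_pos : ∀ i, 0 < γ i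
  Γθ : (i : Fin M) → Matrix (Fin i.val) (Fin i.val) ℝ
  Γθ_pos : ∀ i, (Γθ i).PosDef
  Γ : Matrix (Fin M) (Fin M) ℝ
  Γ_pos : Γ.PosDef

/-- `D_s = diag(sign(d_i*) γ_i)`. -/
def Design.Ds {M n n₀ : ℕ} (D : Design M n n₀) : Matrix (Fin M) (Fin M) ℝ :=
  Matrix.diagonal fun i => D.sgn i * D.γ i

/-- `Θ = [Θ₁ᵀ, Θ₂ᵀ, Θ₂₀ᵀ, Θ₃]ᵀ`. -/
def stack {M n n₀ : ℕ} (Θ₁ : Matrix (Fin (n - n₀) × Fin M) (Fin M) ℝ)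
    (Θ₂ : Matrix (Fin (n - n₀) × Fin n₀) (Fin M) ℝ) (Θ₂₀ : Matrix (Fin n₀) (Fin M) ℝ)
    (Θ₃ : Matrix (Fin M) (Fin M) ℝ) : Matrix (RegIdx M n n₀) (Fin M) ℝ :=
  Matrix.fromRows Θ₁ (Matrix.fromRows Θ₂ (Matrix.fromRows Θ₂₀ Θ₃.transpose))

/-- Initial values of the plant state, of the parameter estimates, and of all filters (named after
their inputs; `c j k` is the initial value of the `k`-th state of the copy driven by the `j`-th
input). -/
structure InitialData (M n n₀ : ℕ) where
  x : Fin n → ℝ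
  Θ₁ : Matrix (Fin (n - n₀) × Fin M) (Fin M) ℝ
  Θ₂ : Matrix (Fin (n - n₀) × Fin n₀) (Fin M) ℝ
  Θ₂₀ : Matrix (Fin n₀) (Fin M) ℝ
  Θ₃ : Matrix (Fin M) (Fin M) ℝ
  θ : (i : Fin M) → Fin i.val → ℝ
  Ψ : Matrix (Fin M) (Fin M) ℝ
  c_u : Fin M → ℕ → ℝ
  c_y₀ : Fin n₀ → ℕ → ℝ
  c_r : Fin M → ℕ → ℝ
  c_ω : RegIdx M n n₀ → ℕ → ℝ
  c_Θω : Fin M → ℕ → ℝ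
  c_e : Fin M → ℕ → ℝ

/-- The signals of the closed loop, as functions of time. -/
structure Signals (M n n₀ : ℕ) where
  /-- Plant state, input, output, and measured partial state. -/
  x : ℝ → Fin n → ℝ
  u : ℝ → Fin M → ℝ
  y : ℝ → Fin M → ℝ
  y₀ : ℝ → Fin n₀ → ℝ
  /-- Reference output and tracking error. -/
  y_m : ℝ → Fin M → ℝ
  e : ℝ → Fin M → ℝ
  /-- Controller filters and regressor. -/
  ω₁ : ℝ → Fin (n - n₀) × Fin M → ℝ
  ω₂ : ℝ → Fin (n - n₀) × Fin n₀ → ℝ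
  ω : ℝ → RegIdx M n n₀ → ℝ
  /-- Parameter estimates. -/
  Θ₁ : ℝ → Matrix (Fin (n - n₀) × Fin M) (Fin M) ℝ
  Θ₂ : ℝ → Matrix (Fin (n - n₀) × Fin n₀) (Fin M) ℝ
  Θ₂₀ : ℝ → Matrix (Fin n₀) (Fin M) ℝ
  Θ₃ : ℝ → Matrix (Fin M) (Fin M) ℝ
  θ : ℝ → (i : Fin M) → Fin i.val → ℝ
  Ψ : ℝ → Matrix (Fin M) (Fin M) ℝ
  /-- Signals of the error model: `ē = ξ(s)h(s)[e]`, `η_i`, `ζ = h(s)[ω]`, `hΘω = h(s)[Θᵀω]`,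
  `Xi = Θᵀζ - hΘω`, the estimation error `ε`, and `msq = m²`. -/
  ebar : ℝ → Fin M → ℝ
  η : ℝ → (i : Fin M) → Fin i.val → ℝ
  ζ : ℝ → RegIdx M n n₀ → ℝ
  hΘω : ℝ → Fin M → ℝ
  Xi : ℝ → Fin M → ℝ
  ε : ℝ → Fin M → ℝ
  msq : ℝ → ℝ
  /-- Filter states (named after the filter inputs). -/
  q_u : ℝ → Fin M → ℕ → ℝ
  q_y₀ : ℝ → Fin n₀ → ℕ → ℝ
  q_r : ℝ → Fin M → ℕ → ℝ
  q_ω : ℝ → RegIdx M n n₀ → ℕ → ℝ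
  q_Θω : ℝ → Fin M → ℕ → ℝ
  q_e : ℝ → Fin M → ℕ → ℝ

/-- The stacked controller parameter `Θ(t)`. -/
def Signals.Θ {M n n₀ : ℕ} (σ : Signals M n n₀) (t : ℝ) : Matrix (RegIdx M n n₀) (Fin M) ℝ :=
  stack (σ.Θ₁ t) (σ.Θ₂ t) (σ.Θ₂₀ t) (σ.Θ₃ t)

/-- `σ` is a trajectory on `[0, ∞)` of the closed loop formed by the plant `(A, B, C)` with measured
partial state `C₀ x`, the reference model, and the adaptive controller with design data `D`, for
the reference input `r` and the initial data `I`. The controller uses only `D`, `r`, `y`, `y₀`. -/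
structure IsClosedLoop {M n n₀ : ℕ} (A : Matrix (Fin n) (Fin n) ℝ) (B : Matrix (Fin n) (Fin M) ℝ)
    (C : Matrix (Fin M) (Fin n) ℝ) (C₀ : Matrix (Fin n₀) (Fin n) ℝ) (D : Design M n n₀)
    (r : ℝ → Fin M → ℝ) (I : InitialData M n n₀) (σ : Signals M n n₀) : Prop where
  /-- plant -/
  state : ∀ i, HasRate (fun t => σ.x t i) (fun t => (A.mulVec (σ.x t) + B.mulVec (σ.u t)) i)
  output : ∀ t, 0 ≤ t → σ.y t = C.mulVec (σ.x t)
  partialState : ∀ t, 0 ≤ t → σ.y₀ t = C₀.mulVec (σ.x t)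
  /-- reference model `y_m = ξ⁻¹(s)[r]`, with `ξ⁻¹ = adj ξ / det ξ` -/
  reference : FilterOutput D.ξ.adjugate D.ξ.det I.c_r r σ.q_r σ.y_m
  error : ∀ t, 0 ≤ t → σ.e t = σ.y t - σ.y_m t
  /-- controller -/
  filter₁ : FilterOutput (powerStack (n - n₀) M) D.Lam I.c_u σ.u σ.q_u σ.ω₁
  filter₂ : FilterOutput (powerStack (n - n₀) n₀) D.Lam I.c_y₀ σ.y₀ σ.q_y₀ σ.ω₂
  regressor : ∀ t, 0 ≤ t → σ.ω t = Sum.elim (σ.ω₁ t) (Sum.elim (σ.ω₂ t) (Sum.elim (σ.y₀ t) (r t)))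
  control : ∀ t, 0 ≤ t → σ.u t = (σ.Θ₁ t).transpose.mulVec (σ.ω₁ t) +
    (σ.Θ₂ t).transpose.mulVec (σ.ω₂ t) + (σ.Θ₂₀ t).transpose.mulVec (σ.y₀ t) +
    (σ.Θ₃ t).mulVec (r t)
  /-- estimation error model -/
  filter_e : FilterOutput D.ξ D.f I.c_e σ.e σ.q_e σ.ebar
  eta : ∀ t, 0 ≤ t → ∀ i j, σ.η t i j = σ.ebar t (Fin.castLE i.isLt.le j)
  filter_ω : FilterOutput 1 D.f I.c_ω σ.ω σ.q_ω σ.ζ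
  filter_Θω : FilterOutput 1 D.f I.c_Θω (fun t => (σ.Θ t).transpose.mulVec (σ.ω t)) σ.q_Θω σ.hΘω
  xi : ∀ t, 0 ≤ t → σ.Xi t = (σ.Θ t).transpose.mulVec (σ.ζ t) - σ.hΘω t
  eps : ∀ t, 0 ≤ t → ∀ i,
    σ.ε t i = dotProduct (σ.θ t i) (σ.η t i) + (σ.Ψ t).mulVec (σ.Xi t) i + σ.ebar t i
  normalization : ∀ t, 0 ≤ t → σ.msq t = 1 + dotProduct (σ.ζ t) (σ.ζ t) +
    dotProduct (σ.Xi t) (σ.Xi t) + ∑ i, dotProduct (σ.η t i) (σ.η t i)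
  /-- adaptive laws -/
  law_θ : ∀ i j, HasRate (fun t => σ.θ t i j)
    (fun t => -((D.Γθ i).mulVec (σ.ε t i • σ.η t i) j) / σ.msq t)
  law_Θ : ∀ a i, HasRate (fun t => σ.Θ t a i)
    (fun t => -((D.Ds * Matrix.vecMulVec (σ.ε t) (σ.ζ t)) i a) / σ.msq t)
  law_Ψ : ∀ i j, HasRate (fun t => σ.Ψ t i j)
    (fun t => -((D.Γ * Matrix.vecMulVec (σ.ε t) (σ.Xi t)) i j) / σ.msq t)
  /-- initial values (those of the filters are prescribed above) -/
  init_x : σ.x 0 = I.x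
  init_Θ₁ : σ.Θ₁ 0 = I.Θ₁
  init_Θ₂ : σ.Θ₂ 0 = I.Θ₂
  init_Θ₂₀ : σ.Θ₂₀ 0 = I.Θ₂₀
  init_Θ₃ : σ.Θ₃ 0 = I.Θ₃
  init_θ : σ.θ 0 = I.θ
  init_Ψ : σ.Ψ 0 = I.Ψ

/-- All signals of the closed loop are bounded on `[0, ∞)`. -/
structure AllBounded {M n n₀ : ℕ} (D : Design M n n₀) (σ : Signals M n n₀) : Prop where
  x : ∀ i, BoundedSignal fun t => σ.x t i
  u : ∀ i, BoundedSignal fun t => σ.u t i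
  y : ∀ i, BoundedSignal fun t => σ.y t i
  y₀ : ∀ i, BoundedSignal fun t => σ.y₀ t i
  y_m : ∀ i, BoundedSignal fun t => σ.y_m t i
  e : ∀ i, BoundedSignal fun t => σ.e t i
  ω₁ : ∀ i, BoundedSignal fun t => σ.ω₁ t i
  ω₂ : ∀ i, BoundedSignal fun t => σ.ω₂ t i
  ω : ∀ i, BoundedSignal fun t => σ.ω t i
  Θ₁ : ∀ i j, BoundedSignal fun t => σ.Θ₁ t i j
  Θ₂ : ∀ i j, BoundedSignal fun t => σ.Θ₂ t i j
  Θ₂₀ : ∀ i j, BoundedSignal fun t => σ.Θ₂₀ t i j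
  Θ₃ : ∀ i j, BoundedSignal fun t => σ.Θ₃ t i j
  θ : ∀ i j, BoundedSignal fun t => σ.θ t i j
  Ψ : ∀ i j, BoundedSignal fun t => σ.Ψ t i j
  ebar : ∀ i, BoundedSignal fun t => σ.ebar t i
  η : ∀ i j, BoundedSignal fun t => σ.η t i j
  ζ : ∀ i, BoundedSignal fun t => σ.ζ t i
  hΘω : ∀ i, BoundedSignal fun t => σ.hΘω t i
  Xi : ∀ i, BoundedSignal fun t => σ.Xi t i
  ε : ∀ i, BoundedSignal fun t => σ.ε t i
  msq : BoundedSignal σ.msq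
  q_u : ∀ j, ∀ k ≤ D.Lam.natDegree, BoundedSignal fun t => σ.q_u t j k
  q_y₀ : ∀ j, ∀ k ≤ D.Lam.natDegree, BoundedSignal fun t => σ.q_y₀ t j k
  q_r : ∀ j, ∀ k ≤ D.ξ.det.natDegree, BoundedSignal fun t => σ.q_r t j k
  q_ω : ∀ j, ∀ k ≤ D.f.natDegree, BoundedSignal fun t => σ.q_ω t j k
  q_Θω : ∀ j, ∀ k ≤ D.f.natDegree, BoundedSignal fun t => σ.q_Θω t j k
  q_e : ∀ j, ∀ k ≤ D.f.natDegree, BoundedSignal fun t => σ.q_e t j k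

end PartialStateMRAC

end

/-! Write `ξ(s) = ∑ s^k ξ_k` and `R = ∑ ξ_k C A^k`. Dividing powers of `s` by `s - A` splits `ξ(s)
G(s)` into a polynomial and a strictly proper part; since the limit `Kp` is finite, the polynomial
part is the constant `Kp`. In the time domain this reads `ξ(d/dt) y = R x + Kp u`, without
derivatives of `u`. The state feedback `u = Kp⁻¹ (r - R x)` would therefore give `ξ(d/dt) y = r`. It
is stabilizing: an eigenvector of `A - B Kp⁻¹ R` with eigenvalue in the closed right half plane
would yield an undetectable mode or a transmission zero (`IsModifiedInteractor.hurwitz`). The state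
is not measured, but the rows of `C₀ A^k`, `k ≤ n - n₀`, span the whole space, so this feedback is
reproduced by the controller structure with constant parameters `Θ*`, up to exponentially decaying
terms (`exists_matching`). Filtering by `1 / f` gives the linear error model `ē = Kp (h[Θᵀω] - Θ*ᵀζ)
+ decay` (`exists_error_model`). The matrix `Kp` itself has no definite sign. Its leading minors
provide a factorization `W Kp = D_s S` with `W` unit lower triangular and `S` positive definite
(`exists_unitLower_mul_eq`). Multiplying the error model by `W` makes `ε` linear in the errors of
`θ_i` (about row `i` of `W`), of `Ψ` (about `D_s S`) and of `Θ` (about `Θ*`). A quadratic function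
of these errors, weighted by `S` in `Θ`, has rate at most `(decay - |ε|²) / m²`. Hence, whatever the
states do, the estimates are bounded and `|ε|² / m²` is integrable (`exists_lyapunov_bound`).
Boundedness of the states is proved by comparison with the running maximum `W(t)` of the norm of all
plant and filter states. Suppose that `W` is unbounded. The swapping signal `Ξ` is `o(W)`, being the
response of a stable filter to a square integrable multiple of `O(W)` signals. Channel by channel `ē
= o(W)`, since `ē` varies slowly relative to `W` and differs by `o(W)` from a square integrable
multiple of `W`. The error model then makes `h[(Θ - Θ*)ᵀω]` small, and slow variation passes this to
its derivatives and to `(Θ - Θ*)ᵀω` itself. So the plant is a Hurwitz system driven by `o(W)`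
inputs, all states are `o(W)`, and this is impossible for the running maximum
(`exists_le_of_isLittleO_sSup`). Once everything is bounded, the same argument with weight `1` gives
`ē → 0`, and solving the triangular system `ξ` row by row gives `e → 0`. For existence, the closed
loop is a Carathéodory equation with locally Lipschitz right hand side. The Lyapunov estimate bounds
the estimates on every interval of existence, and with bounded estimates all signals grow at most
linearly in the linear states, so Gronwall excludes finite escape. This is why the estimates are
stated for families of trajectories on compact intervals, with constants that do not depend on the
member of the family. -/

namespace PartialStateMRAC

/-! ### Carathéodory rates on compact intervals -/

/-- `ż = f` on `[0, T]` in the sense of Carathéodory. -/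
def HasRateOn (T : ℝ) (z f : ℝ → ℝ) : Prop :=
  ∀ t, 0 ≤ t → t ≤ T → IntervalIntegrable f volume 0 t ∧ z t = z 0 + ∫ s in (0 : ℝ)..t, f s

theorem HasRate.hasRateOn {z f : ℝ → ℝ} (h : HasRate z f) (T : ℝ) : HasRateOn T z f :=
  fun t ht _ => h t ht

theorem hasRate_of_hasRateOn {z f : ℝ → ℝ} (h : ∀ T, 0 ≤ T → HasRateOn T z f) : HasRate z f :=
  fun t ht => h t ht t ht le_rfl

theorem HasRateOn.congr {T : ℝ} {z z' f f' : ℝ → ℝ} (h : HasRateOn T z f)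
    (hz : ∀ t, 0 ≤ t → t ≤ T → z' t = z t) (hf : ∀ t, 0 ≤ t → t ≤ T → f' t = f t) :
    HasRateOn T z' f' := by
  intro t ht htT
  obtain ⟨h1, h2⟩ := h t ht htT
  have key : ∀ s ∈ Set.uIcc 0 t, f' s = f s := by
    intro s hs
    rw [Set.uIcc_of_le ht] at hs
    exact hf s hs.1 (hs.2.trans htT)
  refine ⟨h1.congr fun s hs => (key s (Set.uIoc_subset_uIcc hs)).symm, ?_⟩
  rw [hz t ht htT, hz 0 le_rfl (ht.trans htT), h2, intervalIntegral.integral_congr key]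

theorem HasRateOn.const (T c : ℝ) : HasRateOn T (fun _ => c) (fun _ => 0) :=
  fun t _ _ => ⟨by simp, by simp⟩

theorem HasRateOn.add {T : ℝ} {z z' f f' : ℝ → ℝ} (h : HasRateOn T z f) (h' : HasRateOn T z' f') :
    HasRateOn T (fun t => z t + z' t) (fun t => f t + f' t) := by
  intro t ht htT
  obtain ⟨h1, h2⟩ := h t ht htT
  obtain ⟨h3, h4⟩ := h' t ht htT
  refine ⟨h1.add h3, ?_⟩
  rw [intervalIntegral.integral_add h1 h3]
  linarith

theorem HasRateOn.const_mul {T : ℝ} {z f : ℝ → ℝ} (c : ℝ) (h : HasRateOn T z f) :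
    HasRateOn T (fun t => c * z t) (fun t => c * f t) := by
  intro t ht htT
  obtain ⟨h1, h2⟩ := h t ht htT
  refine ⟨h1.const_mul c, ?_⟩
  rw [intervalIntegral.integral_const_mul]
  change c * z t = c * z 0 + _
  rw [h2]
  ring

theorem HasRateOn.neg {T : ℝ} {z f : ℝ → ℝ} (h : HasRateOn T z f) :
    HasRateOn T (fun t => -z t) (fun t => -f t) :=
  (h.const_mul (-1)).congr (fun _ _ _ => by ring) (fun _ _ _ => by ring)

theorem HasRateOn.sub {T : ℝ} {z z' f f' : ℝ → ℝ} (h : HasRateOn T z f) (h' : HasRateOn T z' f') :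
    HasRateOn T (fun t => z t - z' t) (fun t => f t - f' t) :=
  (h.add h'.neg).congr (fun _ _ _ => by ring) (fun _ _ _ => by ring)

theorem HasRateOn.sum {ι : Type*} (s : Finset ι) {T : ℝ} {z f : ι → ℝ → ℝ}
    (h : ∀ i ∈ s, HasRateOn T (z i) (f i)) :
    HasRateOn T (fun t => ∑ i ∈ s, z i t) (fun t => ∑ i ∈ s, f i t) := by
  classical
  induction s using Finset.induction_on with
  | empty => simpa using HasRateOn.const T 0
  | insert a s ha ih =>
    have := (h a (Finset.mem_insert_self a s)).add
      (ih fun i hi => h i (Finset.mem_insert_of_mem hi))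
    exact this.congr (fun _ _ _ => by rw [Finset.sum_insert ha])
      (fun _ _ _ => by rw [Finset.sum_insert ha])

theorem HasRateOn.intervalIntegrable {T : ℝ} {z f : ℝ → ℝ} (h : HasRateOn T z f) {s t : ℝ}
    (hs : 0 ≤ s) (hst : s ≤ t) (ht : t ≤ T) : IntervalIntegrable f volume s t :=
  (h s hs (hst.trans ht)).1.symm.trans (h t (hs.trans hst) ht).1

theorem HasRateOn.sub_eq {T : ℝ} {z f : ℝ → ℝ} (h : HasRateOn T z f) {s t : ℝ}
    (hs : 0 ≤ s) (hst : s ≤ t) (ht : t ≤ T) : z t - z s = ∫ τ in s..t, f τ := by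
  have h1 := h s hs (hst.trans ht)
  have h2 := h t (hs.trans hst) ht
  rw [h1.2, h2.2, ← intervalIntegral.integral_interval_sub_left h2.1 h1.1]
  ring

theorem HasRateOn.abs_sub_le {T : ℝ} {z f : ℝ → ℝ} (h : HasRateOn T z f) {s t B : ℝ}
    (hs : 0 ≤ s) (hst : s ≤ t) (ht : t ≤ T) (hB : ∀ τ, s ≤ τ → τ ≤ t → |f τ| ≤ B) :
    |z t - z s| ≤ B * (t - s) := by
  rw [h.sub_eq hs hst ht, ← abs_of_nonneg (sub_nonneg.2 hst), ← Real.norm_eq_abs]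
  refine intervalIntegral.norm_integral_le_of_norm_le_const fun τ hτ => ?_
  rw [Set.uIoc_of_le hst] at hτ
  exact hB τ hτ.1.le hτ.2

/-- Stated for the primitive and not for `z`, because the two are only known to agree on `[0, T]`;
the primitive is the function that is differentiated almost everywhere in the product rule. -/
theorem HasRateOn.absolutelyContinuous {T : ℝ} {z f : ℝ → ℝ} (h : HasRateOn T z f) {t : ℝ}
    (ht : 0 ≤ t) (htT : t ≤ T) :
    AbsolutelyContinuousOnInterval (fun s => z 0 + ∫ τ in (0 : ℝ)..s, f τ) 0 t := by
  have h1 := (h t ht htT).1.absolutelyContinuousOnInterval_intervalIntegral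
    (c := 0) (by simp)
  have h2 : AbsolutelyContinuousOnInterval (fun _ : ℝ => z 0) 0 t :=
    (LipschitzWith.const (z 0)).lipschitzOnWith.absolutelyContinuousOnInterval
  exact h2.add h1

theorem HasRateOn.continuousOn {T : ℝ} {z f : ℝ → ℝ} (h : HasRateOn T z f) :
    ContinuousOn z (Set.Icc 0 T) := by
  rcases le_or_gt 0 T with hT | hT
  · have := (h.absolutelyContinuous hT le_rfl).continuousOn
    rw [Set.uIcc_of_le hT] at this
    exact this.congr fun s hs => (h s hs.1 hs.2).2
  · rw [Set.Icc_eq_empty (not_le.2 hT)]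
    exact continuousOn_empty _

theorem HasRateOn.continuousOn_uIcc {T : ℝ} {z f : ℝ → ℝ} (h : HasRateOn T z f) {t : ℝ}
    (ht : 0 ≤ t) (htT : t ≤ T) : ContinuousOn z (Set.uIcc 0 t) := by
  rw [Set.uIcc_of_le ht]
  exact h.continuousOn.mono (Set.Icc_subset_Icc_right htT)

/-- Product rule for Carathéodory rates. -/
theorem HasRateOn.mul {T : ℝ} {z w f g : ℝ → ℝ} (hz : HasRateOn T z f) (hw : HasRateOn T w g) :
    HasRateOn T (fun t => z t * w t) (fun t => f t * w t + z t * g t) := by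
  intro t ht htT
  have hz1 := hz t ht htT
  have hw1 := hw t ht htT
  refine ⟨(hz1.1.mul_continuousOn (hw.continuousOn_uIcc ht htT)).add
    (hw1.1.continuousOn_mul (hz.continuousOn_uIcc ht htT)), ?_⟩
  -- Integration by parts for the two absolutely continuous primitives; by Lebesgue differentiation
  -- their derivatives are `f` and `g` almost everywhere.
  have key := (hz.absolutelyContinuous ht htT).integral_deriv_mul_eq_sub
    (hw.absolutelyContinuous ht htT)
  rw [← hz1.2, ← hw1.2] at key
  simp only [intervalIntegral.integral_same, add_zero] at key
  have hcongr : ∫ s in (0 : ℝ)..t, (f s * w s + z s * g s) = z t * w t - z 0 * w 0 := by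
    rw [← key]
    apply intervalIntegral.integral_congr_ae
    filter_upwards [hz1.1.ae_hasDerivAt_integral, hw1.1.ae_hasDerivAt_integral] with s h1 h2 hs
    have hs' := Set.uIoc_subset_uIcc hs
    have d1 := ((h1 hs' 0 (by simp)).const_add (z 0)).deriv
    have d2 := ((h2 hs' 0 (by simp)).const_add (w 0)).deriv
    rw [d1, d2]
    rw [Set.uIcc_of_le ht] at hs'
    rw [← (hz s hs'.1 (hs'.2.trans htT)).2, ← (hw s hs'.1 (hs'.2.trans htT)).2]
  rw [hcongr]
  ring

theorem HasRateOn.of_hasDerivAt {T : ℝ} {z f : ℝ → ℝ} (h : ∀ t, HasDerivAt z (f t) t)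
    (hf : Continuous f) : HasRateOn T z f := by
  intro t _ _
  refine ⟨hf.intervalIntegrable _ _, ?_⟩
  rw [intervalIntegral.integral_eq_sub_of_hasDerivAt (fun s _ => h s) (hf.intervalIntegrable _ _)]
  ring

theorem HasRateOn.exp_mul (T a : ℝ) :
    HasRateOn T (fun t => Real.exp (a * t)) (fun t => a * Real.exp (a * t)) := by
  refine HasRateOn.of_hasDerivAt (fun t => ?_) (by fun_prop)
  have := ((hasDerivAt_id t).const_mul a).exp
  simpa [mul_comm] using this

/-- Comparison principle: `V̇ ≤ -a V + β`. -/
theorem HasRateOn.le_of_rate_le {T a : ℝ} {V v β : ℝ → ℝ} (h : HasRateOn T V v)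
    (hβ : ∀ t, 0 ≤ t → t ≤ T → IntervalIntegrable β volume 0 t)
    (hv : ∀ t, 0 ≤ t → t ≤ T → v t ≤ -a * V t + β t) {t : ℝ} (ht : 0 ≤ t) (htT : t ≤ T) :
    V t ≤ Real.exp (-a * t) * V 0 + ∫ s in (0 : ℝ)..t, Real.exp (-a * (t - s)) * β s := by
  -- Integrating factor: the rate of `exp (a s) V s` is at most `exp (a s) β s`. No sign of `a` is
  -- needed, so `a = 0` and negative `a` (Gronwall) are covered.
  have h1 := ((HasRateOn.exp_mul T a).mul h) t ht htT
  have hcont : Continuous fun s : ℝ => Real.exp (a * s) := by fun_prop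
  have hi : IntervalIntegrable (fun s => Real.exp (a * s) * β s) volume 0 t :=
    (hβ t ht htT).continuousOn_mul hcont.continuousOn
  have h2 : ∫ s in (0 : ℝ)..t, (a * Real.exp (a * s) * V s + Real.exp (a * s) * v s) ≤
      ∫ s in (0 : ℝ)..t, Real.exp (a * s) * β s := by
    refine intervalIntegral.integral_mono_on ht h1.1 hi fun s hs => ?_
    have := mul_le_mul_of_nonneg_left (hv s hs.1 (hs.2.trans htT)) (Real.exp_pos (a * s)).le
    nlinarith
  have h3 : ∫ s in (0 : ℝ)..t, Real.exp (-a * (t - s)) * β s =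
      Real.exp (-a * t) * ∫ s in (0 : ℝ)..t, Real.exp (a * s) * β s := by
    rw [← intervalIntegral.integral_const_mul]
    congr 1
    ext s
    rw [← mul_assoc, ← Real.exp_add]
    congr 2
    ring
  have h4 : V t = Real.exp (-a * t) * (Real.exp (a * t) * V t) := by
    rw [← mul_assoc, ← Real.exp_add]
    simp
  rw [h3, h4, ← mul_add]
  refine mul_le_mul_of_nonneg_left ?_ (Real.exp_pos _).le
  have h5 := h1.2
  simp only [mul_zero, Real.exp_zero, one_mul] at h5
  rw [h5]
  linarith

theorem HasRateOn.le_add_integral {T : ℝ} {V v β : ℝ → ℝ} (h : HasRateOn T V v)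
    (hβ : ∀ t, 0 ≤ t → t ≤ T → IntervalIntegrable β volume 0 t)
    (hv : ∀ t, 0 ≤ t → t ≤ T → v t ≤ β t) {t : ℝ} (ht : 0 ≤ t) (htT : t ≤ T) :
    V t ≤ V 0 + ∫ s in (0 : ℝ)..t, β s := by
  simpa using h.le_of_rate_le (a := 0) hβ (by simpa using hv) ht htT

/-- The rate of a quadratic form with symmetric matrix `P`. -/
theorem HasRateOn.quadratic {ι : Type*} [Fintype ι] {P : Matrix ι ι ℝ} (hP : P.IsSymm) {T : ℝ}
    {z f : ℝ → ι → ℝ} (h : ∀ i, HasRateOn T (fun t => z t i) (fun t => f t i)) :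
    HasRateOn T (fun t => z t ⬝ᵥ P.mulVec (z t)) (fun t => 2 * (z t ⬝ᵥ P.mulVec (f t))) := by
  have h1 : HasRateOn T (fun t => ∑ i, ∑ j, P i j * (z t i * z t j))
      (fun t => ∑ i, ∑ j, P i j * (f t i * z t j + z t i * f t j)) :=
    HasRateOn.sum _ fun i _ => HasRateOn.sum _ fun j _ => ((h i).mul (h j)).const_mul _
  refine h1.congr (fun t _ _ => ?_) (fun t _ _ => ?_)
  · simp only [dotProduct, Matrix.mulVec, Finset.mul_sum]
    exact Finset.sum_congr rfl fun i _ => Finset.sum_congr rfl fun j _ => by ring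
  · have hsw : ∑ i, ∑ j, P i j * (f t i * z t j) = ∑ i, ∑ j, P i j * (z t i * f t j) := by
      rw [Finset.sum_comm]
      exact Finset.sum_congr rfl fun i _ => Finset.sum_congr rfl fun j _ => by
        rw [hP.apply i j]; ring
    simp only [mul_add, Finset.sum_add_distrib]
    rw [hsw, ← two_mul]
    simp only [dotProduct, Matrix.mulVec, Finset.mul_sum]
    exact Finset.sum_congr rfl fun i _ => Finset.sum_congr rfl fun j _ => by ring

end PartialStateMRAC

namespace PartialStateMRAC

/-! ### Quadratic Lyapunov functions -/

/-- The real part of a complex inner product, as a real bilinear form. -/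
noncomputable def reInner (E : Type*) [NormedAddCommGroup E] [InnerProductSpace ℂ E] :
    E →ₗ[ℝ] E →ₗ[ℝ] ℝ :=
  LinearMap.mk₂ ℝ (fun x y => (inner ℂ x y).re)
    (fun x y z => by rw [inner_add_left, Complex.add_re])
    (fun c x y => by
      rw [← Complex.coe_smul c x, inner_smul_left]
      simp)
    (fun x y z => by rw [inner_add_right, Complex.add_re])
    (fun c x y => by
      rw [← Complex.coe_smul c y, inner_smul_right]
      simp)

section reInner

variable {E : Type*} [NormedAddCommGroup E] [InnerProductSpace ℂ E]

theorem reInner_apply (x y : E) : reInner E x y = (inner ℂ x y).re := rfl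

theorem reInner_comm (x y : E) : reInner E x y = reInner E y x := by
  rw [reInner_apply, reInner_apply, ← inner_conj_symm, Complex.conj_re]

theorem reInner_self (x : E) : reInner E x x = ‖x‖ ^ 2 := by
  rw [reInner_apply, inner_self_eq_norm_sq_to_K]
  simp [← Complex.ofReal_pow]

theorem reInner_le (x y : E) : reInner E x y ≤ ‖x‖ * ‖y‖ :=
  ((le_abs_self _).trans (Complex.abs_re_le_norm _)).trans (norm_inner_le_norm x y)

end reInner

/-- For a linear map annihilated, up to a remainder, by a polynomial with roots in the open left
half plane there is a quadratic Lyapunov function, with dissipation up to that remainder. -/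
theorem exists_lyapunov_form {E : Type*} [NormedAddCommGroup E] [InnerProductSpace ℂ E]
    (A : E →ₗ[ℂ] E) {K₀ : ℝ} (hA : ∀ x, ‖A x‖ ≤ K₀ * ‖x‖) (l : List ℂ) (hl : ∀ μ ∈ l, μ.re < 0) :
    ∃ (B : E →ₗ[ℝ] E →ₗ[ℝ] ℝ) (a K : ℝ), 0 < a ∧ 0 ≤ K ∧ (∀ x y, B x y = B y x) ∧
      (∀ x, ‖x‖ ^ 2 ≤ B x x) ∧
      ∀ x, 2 * B x (A x) ≤
        -a * ‖x‖ ^ 2 + K * ‖aeval A (l.map fun μ => X - C μ).prod x‖ ^ 2 := by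
  induction l with
  | nil =>
    -- For the empty product the remainder is `‖x‖ ^ 2` itself, which absorbs both the growth `2
    -- |K₀|` and the dissipation demanded with `a = 1`.
    refine ⟨reInner E, 1, 2 * |K₀| + 1, one_pos, by positivity, reInner_comm,
      fun x => (reInner_self x).ge, fun x => ?_⟩
    · simp only [List.map_nil, List.prod_nil, map_one, Module.End.one_apply]
      have h1 := reInner_le x (A x)
      have h2 := hA x
      have h3 : K₀ * ‖x‖ ≤ |K₀| * ‖x‖ := mul_le_mul_of_nonneg_right (le_abs_self _) (norm_nonneg _)
      nlinarith [norm_nonneg x, mul_le_mul_of_nonneg_left (h2.trans h3) (norm_nonneg x)]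
  | cons μ l ih =>
    obtain ⟨B', a', K', ha', hK', hsymm, hpos, hdiss⟩ := ih fun ν hν => hl ν (by simp [hν])
    have hμ : 0 < -μ.re := by
      have := hl μ (by simp)
      linarith
    set b := -μ.re with hb
    set L : E →ₗ[ℂ] E := A - μ • LinearMap.id with hL
    -- The new form is `‖x‖ ^ 2 + c B' (L x) (L x)` with `L = A - μ`. Its first term dissipates `2 b
    -- ‖x‖ ^ 2` up to a cross term with `L x`; Young's inequality turns that term into `b ‖x‖ ^ 2 +
    -- ‖L x‖ ^ 2 / b`. The choice `c a' = 1 / b` lets the dissipation of `B'` cancel the last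
    -- summand. Since `L` commutes with `A`, repeated roots cause no difficulty.
    set c := (1 / b) / a' with hc
    have hcpos : 0 < c := by positivity
    let B : E →ₗ[ℝ] E →ₗ[ℝ] ℝ :=
      reInner E + c • B'.compl₁₂ (L.restrictScalars ℝ) (L.restrictScalars ℝ)
    have hBval : ∀ x y, B x y = reInner E x y + c * B' (L x) (L y) := fun x y => by simp [B]
    have hLA : ∀ x, L (A x) = A (L x) := fun x => by simp [hL]
    refine ⟨B, b, c * K', hμ, by positivity, fun x y => ?_, fun x => ?_, fun x => ?_⟩
    · rw [hBval, hBval, hsymm, reInner_comm]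
    · rw [hBval, reInner_self]
      have := hpos (L x)
      nlinarith [sq_nonneg ‖L x‖]
    · rw [hBval, hLA]
      have h1 := hdiss (L x)
      have h2 : aeval A ((μ :: l).map fun μ => X - C μ).prod x =
          aeval A (l.map fun μ => X - C μ).prod (L x) := by
        rw [List.map_cons, List.prod_cons, mul_comm, map_mul, Module.End.mul_apply]
        congr 1
        simp [hL, Algebra.algebraMap_eq_smul_one]
      rw [h2]
      set R := ‖aeval A (l.map fun μ => X - C μ).prod (L x)‖
      have h3 : reInner E x (A x) = -b * ‖x‖ ^ 2 + reInner E x (L x) := by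
        have : A x = L x + μ • x := by simp [hL]
        rw [this, map_add, add_comm]
        congr 1
        rw [reInner_apply]
        rw [inner_smul_right, inner_self_eq_norm_sq_to_K, hb]
        simp [← Complex.ofReal_pow]
      have h4 := reInner_le x (L x)
      have h5 : 2 * (‖x‖ * ‖L x‖) ≤ b * ‖x‖ ^ 2 + (1 / b) * ‖L x‖ ^ 2 := by
        have : 0 ≤ (b * ‖x‖ - ‖L x‖) ^ 2 / b := by positivity
        have e : (b * ‖x‖ - ‖L x‖) ^ 2 / b =
          b * ‖x‖ ^ 2 - 2 * (‖x‖ * ‖L x‖) + (1 / b) * ‖L x‖ ^ 2 := by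
          field_simp
          ring
        linarith
      have h6 : c * (2 * B' (L x) (A (L x))) ≤ c * (-a' * ‖L x‖ ^ 2 + K' * R ^ 2) :=
        mul_le_mul_of_nonneg_left h1 hcpos.le
      have h7 : c * a' = 1 / b := by rw [hc]; field_simp
      have h8 : c * (-a' * ‖L x‖ ^ 2 + K' * R ^ 2) =
        -(c * a') * ‖L x‖ ^ 2 + c * K' * R ^ 2 := by ring
      rw [h8, h7] at h6
      rw [h3]
      linarith

theorem StablePoly.ne_zero {p : ℝ[X]} (hp : StablePoly p) : p ≠ 0 := by
  rintro rfl
  have := hp 1 (by simp)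
  norm_num at this

/-- A real matrix annihilated by a stable polynomial has a quadratic Lyapunov function. -/
theorem exists_lyapunov_matrix {ι : Type*} [Fintype ι] [DecidableEq ι] (A : Matrix ι ι ℝ)
    {p : ℝ[X]} (hp : StablePoly p) (hpA : aeval A p = 0) :
    ∃ (P : Matrix ι ι ℝ) (a : ℝ), 0 < a ∧ P.IsSymm ∧ (∀ x, x ⬝ᵥ x ≤ x ⬝ᵥ P.mulVec x) ∧
      ∀ x, 2 * (x ⬝ᵥ P.mulVec (A.mulVec x)) ≤ -a * (x ⬝ᵥ x) := by
  -- Over `ℂ` the polynomial splits into linear factors with roots in the left half plane; their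
  -- product annihilates the matrix, so the remainder in `exists_lyapunov_form` vanishes.
  let Ac : Matrix ι ι ℂ := A.map Complex.ofReal
  let L : EuclideanSpace ℂ ι →ₗ[ℂ] EuclideanSpace ℂ ι := Matrix.toLpLin 2 2 Ac
  let pc : ℂ[X] := p.map (algebraMap ℝ ℂ)
  have hAc : aeval Ac pc = 0 := by
    have h1 : aeval Ac pc = aeval Ac p := by simp [pc]
    have h2 : Ac = (Algebra.ofId ℝ ℂ).mapMatrix A := rfl
    rw [h1, h2, aeval_algHom_apply, hpA, map_zero]
  have hLp : aeval L pc = 0 := by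
    have : L = Matrix.toLpLinAlgEquiv 2 Ac := rfl
    rw [this, aeval_algHom_apply (Matrix.toLpLinAlgEquiv 2 : Matrix ι ι ℂ ≃ₐ[ℂ] _), hAc, map_zero]
  have hpc : pc ≠ 0 := by
    simpa [pc] using hp.ne_zero
  obtain ⟨l, hl⟩ : ∃ l : List ℂ, (l : Multiset ℂ) = pc.roots := ⟨pc.roots.toList, by simp⟩
  have hprod : pc = C pc.leadingCoeff * (l.map fun μ => X - C μ).prod := by
    conv_lhs => rw [(IsAlgClosed.splits pc).eq_prod_roots, ← hl]
    simp
  have hLprod : aeval L (l.map fun μ => X - C μ).prod = 0 := by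
    rw [hprod, map_mul, aeval_C] at hLp
    have hlc : pc.leadingCoeff ≠ 0 := by simpa using hpc
    simpa [Algebra.algebraMap_eq_smul_one, hlc] using hLp
  have hroots : ∀ μ ∈ l, μ.re < 0 := by
    intro μ hμ
    have h1 : μ ∈ pc.roots := by rw [← hl]; simpa using hμ
    refine hp μ ?_
    have h2 := (mem_roots hpc).1 h1
    simpa [pc, IsRoot, eval_map_algebraMap] using h2
  obtain ⟨B, a, K, ha, -, hsymm, hpos, hdiss⟩ := exists_lyapunov_form L
    (K₀ := ‖LinearMap.toContinuousLinearMap L‖)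
    (fun x => (LinearMap.toContinuousLinearMap L).le_opNorm x) l hroots
  let e : (ι → ℝ) →ₗ[ℝ] EuclideanSpace ℂ ι :=
    { toFun := fun x => WithLp.toLp 2 fun i => (x i : ℂ)
      map_add' := fun x y => PiLp.ext fun i => by simp
      map_smul' := fun r x => PiLp.ext fun i => by simp }
  have he : ∀ x, e x = ∑ i, x i • e (Pi.single i 1) := by
    intro x
    conv_lhs => rw [← Finset.univ_sum_single x]
    rw [map_sum]
    refine Finset.sum_congr rfl fun i _ => ?_
    rw [← map_smul]
    congr 1
    ext j
    by_cases h : j = i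
    · subst h; simp
    · simp [h]
  -- The Gram matrix of the form on the real vectors, which `A` maps to real vectors.
  let P : Matrix ι ι ℝ := Matrix.of fun i j => B (e (Pi.single i 1)) (e (Pi.single j 1))
  have hPB : ∀ x y, x ⬝ᵥ P.mulVec y = B (e x) (e y) := by
    intro x y
    rw [he x, he y]
    simp only [map_sum, map_smul, LinearMap.sum_apply, LinearMap.smul_apply, smul_eq_mul,
      dotProduct, Matrix.mulVec, P, Matrix.of_apply]
    simp only [Finset.mul_sum]
    rw [Finset.sum_comm]
    exact Finset.sum_congr rfl fun i _ => Finset.sum_congr rfl fun j _ => by ring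
  have hnorm : ∀ x, ‖e x‖ ^ 2 = x ⬝ᵥ x := by
    intro x
    rw [EuclideanSpace.norm_sq_eq]
    simp [e, dotProduct, sq]
  have heA : ∀ x, e (A.mulVec x) = L (e x) := by
    intro x
    refine PiLp.ext fun i => ?_
    simp [e, L, Ac, Matrix.mulVec, dotProduct]
  refine ⟨P, a, ha, ?_, fun x => ?_, fun x => ?_⟩
  · ext i j
    exact hsymm _ _
  · rw [hPB, ← hnorm]
    exact hpos _
  · rw [hPB, ← hnorm, heA]
    have := hdiss (e x)
    rw [hLprod, LinearMap.zero_apply, norm_zero] at this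
    linarith

/-- Young's inequality entry by entry; the added `1` only makes `S` positive. The free parameter `ε`
allows the cross term with an input to be absorbed by the dissipation. -/
theorem exists_bilin_bound {ι : Type*} [Fintype ι] (P : Matrix ι ι ℝ) :
    ∃ S : ℝ, 0 < S ∧ ∀ ε, 0 < ε → ∀ x y : ι → ℝ,
      2 * (x ⬝ᵥ P.mulVec y) ≤ S * (ε * (x ⬝ᵥ x) + (y ⬝ᵥ y) / ε) := by
  refine ⟨∑ i, ∑ j, |P i j| + 1, by positivity, fun ε hε x y => ?_⟩
  have hx : 0 ≤ x ⬝ᵥ x := Finset.sum_nonneg fun i _ => mul_self_nonneg _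
  have hy : 0 ≤ y ⬝ᵥ y := Finset.sum_nonneg fun i _ => mul_self_nonneg _
  have hQ : 0 ≤ ε * (x ⬝ᵥ x) + (y ⬝ᵥ y) / ε := by positivity
  have h1 : ∀ i j, 2 * (x i * (P i j * y j)) ≤ |P i j| * (ε * (x ⬝ᵥ x) + (y ⬝ᵥ y) / ε) := by
    intro i j
    have hxi : x i * x i ≤ x ⬝ᵥ x :=
      Finset.single_le_sum (f := fun i => x i * x i) (fun i _ => mul_self_nonneg _)
        (Finset.mem_univ i)
    have hyj : y j * y j ≤ y ⬝ᵥ y :=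
      Finset.single_le_sum (f := fun i => y i * y i) (fun i _ => mul_self_nonneg _)
        (Finset.mem_univ j)
    have h2 : 2 * (|x i| * |y j|) ≤ ε * (x ⬝ᵥ x) + (y ⬝ᵥ y) / ε := by
      have h3 : 0 ≤ (ε * |x i| - |y j|) ^ 2 / ε := by positivity
      have e : (ε * |x i| - |y j|) ^ 2 / ε =
          ε * (x i * x i) - 2 * (|x i| * |y j|) + (y j * y j) / ε := by
        rw [← abs_mul_abs_self (x i), ← abs_mul_abs_self (y j)]
        field_simp
        ring
      have h4 : ε * (x i * x i) ≤ ε * (x ⬝ᵥ x) := mul_le_mul_of_nonneg_left hxi hε.le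
      have h5 : (y j * y j) / ε ≤ (y ⬝ᵥ y) / ε := by gcongr
      linarith
    calc 2 * (x i * (P i j * y j)) ≤ |2 * (x i * (P i j * y j))| := le_abs_self _
      _ = |P i j| * (2 * (|x i| * |y j|)) := by
        rw [abs_mul, abs_mul, abs_mul, abs_two]; ring
      _ ≤ _ := mul_le_mul_of_nonneg_left h2 (abs_nonneg _)
  have h2 : 2 * (x ⬝ᵥ P.mulVec y) = ∑ i, ∑ j, 2 * (x i * (P i j * y j)) := by
    simp only [dotProduct, Matrix.mulVec, Finset.mul_sum]
  rw [h2, add_mul, Finset.sum_mul]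
  refine (Finset.sum_le_sum fun i _ => ?_).trans (le_add_of_nonneg_right (by positivity))
  rw [Finset.sum_mul]
  exact Finset.sum_le_sum fun j _ => h1 i j

/-- Input-to-state stability of a linear system whose matrix is annihilated by a stable
polynomial. -/
theorem exists_iss_bound {ι : Type*} [Fintype ι] [DecidableEq ι] (A : Matrix ι ι ℝ) {p : ℝ[X]}
    (hp : StablePoly p) (hpA : aeval A p = 0) :
    ∃ K a : ℝ, 0 < K ∧ 0 < a ∧ ∀ (T : ℝ) (z w : ℝ → ι → ℝ) (β : ℝ → ℝ),
      (∀ i, HasRateOn T (fun t => z t i) (fun t => A.mulVec (z t) i + w t i)) →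
      (∀ t, 0 ≤ t → t ≤ T → IntervalIntegrable β volume 0 t) →
      (∀ t, 0 ≤ t → t ≤ T → w t ⬝ᵥ w t ≤ β t) →
      ∀ t, 0 ≤ t → t ≤ T → z t ⬝ᵥ z t ≤ K * (Real.exp (-a * t) * (z 0 ⬝ᵥ z 0) +
        ∫ s in (0 : ℝ)..t, Real.exp (-a * (t - s)) * β s) := by
  obtain ⟨P, a, ha, hsymm, hpos, hdiss⟩ := exists_lyapunov_matrix A hp hpA
  obtain ⟨S, hS, hbil⟩ := exists_bilin_bound P
  -- With `S ε = a / 2` the cross term with the input costs half of the dissipation `a |z|²`. The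
  -- other half dominates `a' V`, because `V ≤ S |z|²`. Only the majorant `β` of `|w|²` has to be
  -- integrable.
  set a' := a / (2 * S) with ha'
  have ha'pos : 0 < a' := by positivity
  set ε := a / (2 * S) with hε
  set K₁ := S / ε with hK₁
  have hK₁pos : 0 < K₁ := by positivity
  refine ⟨S + K₁, a', by positivity, ha'pos, fun T z w β hz hβ hw t ht htT => ?_⟩
  have hV := HasRateOn.quadratic hsymm (z := z) (f := fun t => A.mulVec (z t) + w t) hz
  have hupper : ∀ x : ι → ℝ, x ⬝ᵥ P.mulVec x ≤ S * (x ⬝ᵥ x) := by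
    intro x
    have := hbil 1 one_pos x x
    rw [div_one, one_mul] at this
    linarith
  have hrate : ∀ t, 0 ≤ t → t ≤ T → 2 * (z t ⬝ᵥ P.mulVec (A.mulVec (z t) + w t)) ≤
      -a' * (z t ⬝ᵥ P.mulVec (z t)) + K₁ * β t := by
    intro t ht htT
    rw [Matrix.mulVec_add, dotProduct_add, mul_add]
    have h1 := hdiss (z t)
    have h2 := hbil ε (by positivity) (z t) (w t)
    have h3 := hupper (z t)
    have h4 : S * (ε * (z t ⬝ᵥ z t) + (w t ⬝ᵥ w t) / ε) =
        (a / 2) * (z t ⬝ᵥ z t) + K₁ * (w t ⬝ᵥ w t) := by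
      rw [hK₁, hε]; field_simp
    have h5 : K₁ * (w t ⬝ᵥ w t) ≤ K₁ * β t := mul_le_mul_of_nonneg_left (hw t ht htT) hK₁pos.le
    have h6 : a' * (z t ⬝ᵥ P.mulVec (z t)) ≤ a' * (S * (z t ⬝ᵥ z t)) :=
      mul_le_mul_of_nonneg_left h3 ha'pos.le
    have h7 : a' * (S * (z t ⬝ᵥ z t)) = a / 2 * (z t ⬝ᵥ z t) := by
      rw [ha', hε]; field_simp
    linarith
  have h1 := hV.le_of_rate_le (fun t ht htT => (hβ t ht htT).const_mul K₁) hrate ht htT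
  have h2 : ∫ s in (0 : ℝ)..t, Real.exp (-a' * (t - s)) * (K₁ * β s) =
      K₁ * ∫ s in (0 : ℝ)..t, Real.exp (-a' * (t - s)) * β s := by
    rw [← intervalIntegral.integral_const_mul]
    congr 1
    ext s
    ring
  rw [h2] at h1
  have hI : 0 ≤ ∫ s in (0 : ℝ)..t, Real.exp (-a' * (t - s)) * β s := by
    refine intervalIntegral.integral_nonneg ht fun s hs => mul_nonneg (Real.exp_pos _).le ?_
    exact (Finset.sum_nonneg fun i _ => mul_self_nonneg _).trans (hw s hs.1 (hs.2.trans htT))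
  have hz0 : 0 ≤ z 0 ⬝ᵥ z 0 := Finset.sum_nonneg fun i _ => mul_self_nonneg _
  have h3 : Real.exp (-a' * t) * (z 0 ⬝ᵥ P.mulVec (z 0)) ≤
      S * (Real.exp (-a' * t) * (z 0 ⬝ᵥ z 0)) := by
    have := mul_le_mul_of_nonneg_left (hupper (z 0)) (Real.exp_pos (-a' * t)).le
    linarith
  have h4 := hpos (z t)
  have h5 : 0 ≤ K₁ * (Real.exp (-a' * t) * (z 0 ⬝ᵥ z 0)) := by positivity
  have h6 : 0 ≤ S * ∫ s in (0 : ℝ)..t, Real.exp (-a' * (t - s)) * β s := by positivity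
  nlinarith

/-! ### Companion matrices and filters -/

/-- The companion matrix of `z^(N) = -∑ k < N, p_k z^(k)` in phase coordinates. -/
def companionMatrix (p : ℝ[X]) : Matrix (Fin p.natDegree) (Fin p.natDegree) ℝ :=
  Matrix.of fun k j =>
    if k.val + 1 < p.natDegree then (if j.val = k.val + 1 then 1 else 0) else -p.coeff j.val

theorem companionMatrix_mulVec_of_lt (p : ℝ[X]) (z : Fin p.natDegree → ℝ) {k : ℕ}
    (hk : k + 1 < p.natDegree) :
    (companionMatrix p).mulVec z ⟨k, by omega⟩ = z ⟨k + 1, hk⟩ := by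
  simp only [Matrix.mulVec, dotProduct, companionMatrix, Matrix.of_apply, hk, if_true]
  rw [Finset.sum_eq_single ⟨k + 1, hk⟩]
  · simp
  · intro j _ hj
    rw [if_neg fun h => hj (Fin.ext h), zero_mul]
  · simp

theorem companionMatrix_mulVec_last (p : ℝ[X]) (z : Fin p.natDegree → ℝ) {k : ℕ}
    (hk : k + 1 = p.natDegree) :
    (companionMatrix p).mulVec z ⟨k, by omega⟩ = -∑ j : Fin p.natDegree, p.coeff j * z j := by
  simp [Matrix.mulVec, dotProduct, companionMatrix, hk]

/-- The coordinate `0` of `F ^ k z` is the coordinate `k` of `z`, and by the last row of `F` the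
coordinate `0` of `p(F) z` is zero. Since `p(F)` commutes with `F ^ k`, the coordinate `k` of `p(F)
z` is the coordinate `0` of `p(F) (F ^ k z)`, hence zero as well. -/
theorem aeval_companionMatrix {p : ℝ[X]} (hp : p.Monic) : aeval (companionMatrix p) p = 0 := by
  set N := p.natDegree with hN
  set F := companionMatrix p
  have hshift : ∀ (k : ℕ) (z : Fin N → ℝ) (j : ℕ) (h : j + k < N),
      (F ^ k).mulVec z ⟨j, by omega⟩ = z ⟨j + k, h⟩ := by
    intro k
    induction k with
    | zero => intro z j h; simp
    | succ k ih =>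
      intro z j h
      rw [pow_succ, ← Matrix.mulVec_mulVec, ih _ j (by omega),
        companionMatrix_mulVec_of_lt p z (k := j + k) (by omega)]
      rfl
  have hzero : ∀ (z : Fin N → ℝ) (h : 0 < N), (aeval F p).mulVec z ⟨0, h⟩ = 0 := by
    intro z h
    rw [aeval_eq_sum_range, Finset.sum_range_succ, Matrix.add_mulVec, Matrix.sum_mulVec,
      Pi.add_apply, Finset.sum_apply]
    change ∑ k ∈ Finset.range N, (p.coeff k • F ^ k).mulVec z ⟨0, h⟩ +
      (p.coeff N • F ^ N).mulVec z ⟨0, h⟩ = 0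
    have h1 : (p.coeff N • F ^ N).mulVec z ⟨0, h⟩ = -∑ j : Fin N, p.coeff j * z j := by
      rw [show p.coeff N = 1 from hp.coeff_natDegree, one_smul]
      obtain ⟨m, hm⟩ : ∃ m, N = m + 1 := ⟨N - 1, by omega⟩
      have h2 : F ^ N = F ^ m * F := by rw [← pow_succ, ← hm]
      rw [h2, ← Matrix.mulVec_mulVec, hshift m _ 0 (by omega)]
      simp only [zero_add]
      exact companionMatrix_mulVec_last p z hm.symm
    rw [h1, Finset.sum_range]
    rw [add_neg_eq_zero]
    refine Finset.sum_congr rfl fun j _ => ?_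
    rw [Matrix.smul_mulVec, Pi.smul_apply, hshift j z 0 (by omega), smul_eq_mul]
    simp
  refine Matrix.toLin'.injective (LinearMap.ext fun z => funext fun k => ?_)
  rw [Matrix.toLin'_apply, map_zero, LinearMap.zero_apply, Pi.zero_apply]
  have h1 := hshift k ((aeval F p).mulVec z) 0 (lt_of_eq_of_lt (zero_add _) k.2)
  simp only [zero_add] at h1
  rw [Fin.eta] at h1
  have hcomm : F ^ (k : ℕ) * aeval F p = aeval F p * F ^ (k : ℕ) := by
    have : F ^ (k : ℕ) = aeval F (X ^ (k : ℕ) : ℝ[X]) := by simp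
    rw [this, ← map_mul, ← map_mul, mul_comm]
  rw [← h1, Matrix.mulVec_mulVec, hcomm, ← Matrix.mulVec_mulVec]
  exact hzero _ (Nat.zero_lt_of_lt k.2)

/-- Input-to-state stability of a filter with stable denominator, with disturbances `w k` in the
chain of integrators. -/
theorem exists_filter_bound {p : ℝ[X]} (hm : p.Monic) (hp : StablePoly p) :
    ∃ K a : ℝ, 0 < K ∧ 0 < a ∧ ∀ (T : ℝ) (q w : ℝ → ℕ → ℝ) (v β : ℝ → ℝ),
      (∀ k < p.natDegree, HasRateOn T (fun t => q t k) (fun t => q t (k + 1) + w t k)) →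
      (∀ t, 0 ≤ t → t ≤ T → ∑ k ∈ Finset.range (p.natDegree + 1), p.coeff k * q t k = v t) →
      (∀ t, 0 ≤ t → t ≤ T → IntervalIntegrable β volume 0 t) →
      (∀ t, 0 ≤ t → t ≤ T → v t ^ 2 + ∑ k ∈ Finset.range p.natDegree, w t k ^ 2 ≤ β t) →
      ∀ t, 0 ≤ t → t ≤ T → ∀ k < p.natDegree, q t k ^ 2 ≤
        K * (Real.exp (-a * t) * ∑ k ∈ Finset.range p.natDegree, q 0 k ^ 2 +
          ∫ s in (0 : ℝ)..t, Real.exp (-a * (t - s)) * β s) := by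
  obtain ⟨K, a, hK, ha, hb⟩ := exists_iss_bound (companionMatrix p) hp (aeval_companionMatrix hm)
  refine ⟨2 * K, a, by positivity, ha, fun T q w v β hq hv hβ hw t ht htT k hk => ?_⟩
  set N := p.natDegree with hN
  let z : ℝ → Fin N → ℝ := fun t k => q t k
  -- In phase coordinates the input enters only the last equation, through `q_N = v - ∑ p_k q_k` for
  -- monic `p`. It may meet a disturbance there, whence the factor `2` in the bound of `w'`.
  let w' : ℝ → Fin N → ℝ := fun t k => w t k + if k.val + 1 < N then 0 else v t
  have h1 : ∀ i, HasRateOn T (fun t => z t i)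
      (fun t => (companionMatrix p).mulVec (z t) i + w' t i) := by
    intro i
    refine (hq i i.2).congr (fun _ _ _ => rfl) fun t ht htT => ?_
    by_cases hi : i.val + 1 < N
    · have := companionMatrix_mulVec_of_lt p (z t) (k := i.val) hi
      rw [Fin.eta] at this
      rw [this]
      simp [w', hi, z]
    · have := companionMatrix_mulVec_last p (z t) (k := i.val) (by omega)
      rw [Fin.eta] at this
      rw [this]
      have hiN : i.val + 1 = N := by omega
      simp only [w', hi, if_false]
      rw [← hv t ht htT, Finset.sum_range_succ, hm.coeff_natDegree, hiN, Finset.sum_range]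
      simp only [z]
      ring
  have h2 : ∀ t, 0 ≤ t → t ≤ T → w' t ⬝ᵥ w' t ≤ 2 * β t := by
    intro t ht htT
    have h3 : w' t ⬝ᵥ w' t ≤ ∑ k : Fin N, (2 * w t k ^ 2 +
        2 * (if k.val + 1 < N then 0 else v t ^ 2)) := by
      refine Finset.sum_le_sum fun k _ => ?_
      by_cases hk : k.val + 1 < N
      · simp only [w', hk, if_true]; nlinarith [sq_nonneg (w t k)]
      · simp only [w', hk, if_false]; nlinarith [sq_nonneg (w t k - v t)]
    have h4 : ∑ k : Fin N, (if k.val + 1 < N then 0 else v t ^ 2) ≤ v t ^ 2 := by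
      rw [Finset.sum_ite, Finset.sum_const_zero, zero_add, Finset.sum_const, nsmul_eq_mul]
      have : (Finset.univ.filter fun k : Fin N => ¬ k.val + 1 < N).card ≤ 1 := by
        rw [Finset.card_le_one]
        intro a ha b hb
        simp at ha hb
        ext
        omega
      have h5 : ((Finset.univ.filter fun k : Fin N => ¬ k.val + 1 < N).card : ℝ) ≤ 1 := by
        exact_mod_cast this
      nlinarith [sq_nonneg (v t)]
    rw [Finset.sum_add_distrib, ← Finset.mul_sum, ← Finset.mul_sum,
      ← Finset.sum_range (f := fun k => w t k ^ 2)] at h3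
    have := hw t ht htT
    linarith
  have h3 := hb T z w' _ h1 (fun t ht htT => (hβ t ht htT).const_mul 2) h2 t ht htT
  have h4 : q t k ^ 2 ≤ z t ⬝ᵥ z t := by
    have := Finset.single_le_sum (f := fun i => z t i * z t i) (fun i _ => mul_self_nonneg _)
      (Finset.mem_univ (⟨k, hk⟩ : Fin N))
    rw [sq]
    exact this
  have h5 : z 0 ⬝ᵥ z 0 = ∑ k ∈ Finset.range N, q 0 k ^ 2 := by
    rw [Finset.sum_range]
    simp [dotProduct, z, sq]
  have h6 : ∫ s in (0 : ℝ)..t, Real.exp (-a * (t - s)) * (2 * β s) =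
      2 * ∫ s in (0 : ℝ)..t, Real.exp (-a * (t - s)) * β s := by
    rw [← intervalIntegral.integral_const_mul]
    congr 1
    ext s
    ring
  rw [h5, h6] at h3
  have h7 : 0 ≤ K * (Real.exp (-a * t) * ∑ k ∈ Finset.range N, q 0 k ^ 2) := by positivity
  nlinarith

end PartialStateMRAC

namespace PartialStateMRAC

/-! ### Carathéodory differential equations -/

section Existence

variable {E : Type*} [NormedAddCommGroup E] [NormedSpace ℝ E]

/-- The radial retraction onto the ball of radius `R`. -/
noncomputable def radialProj (R : ℝ) (x : E) : E := (R / max R ‖x‖) • x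

theorem radialProj_of_le {R : ℝ} (hR : 0 < R) {x : E} (hx : ‖x‖ ≤ R) : radialProj R x = x := by
  rw [radialProj, max_eq_left hx, div_self hR.ne', one_smul]

theorem norm_radialProj_le {R : ℝ} (hR : 0 < R) (x : E) : ‖radialProj R x‖ ≤ R := by
  have hm : 0 < max R ‖x‖ := lt_max_of_lt_left hR
  rw [radialProj, norm_smul, Real.norm_of_nonneg (by positivity), div_mul_eq_mul_div,
    div_le_iff₀ hm]
  exact mul_le_mul_of_nonneg_left (le_max_right _ _) hR.le

/-- In a general normed space the retraction need not be nonexpansive. The constant `2` comes from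
moving the point and the scaling factor separately. -/
theorem norm_radialProj_sub_le {R : ℝ} (hR : 0 < R) (x y : E) :
    ‖radialProj R x - radialProj R y‖ ≤ 2 * ‖x - y‖ := by
  have hx : 0 < max R ‖x‖ := lt_max_of_lt_left hR
  have hy : 0 < max R ‖y‖ := lt_max_of_lt_left hR
  have e : radialProj R x - radialProj R y =
      (R / max R ‖x‖) • (x - y) + (R / max R ‖x‖ - R / max R ‖y‖) • y := by
    simp only [radialProj]
    module
  rw [e]
  refine (norm_add_le _ _).trans ?_
  have h1 : ‖(R / max R ‖x‖) • (x - y)‖ ≤ ‖x - y‖ := by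
    rw [norm_smul, Real.norm_of_nonneg (by positivity)]
    have : R / max R ‖x‖ ≤ 1 := (div_le_one hx).2 (le_max_left _ _)
    exact mul_le_of_le_one_left (norm_nonneg _) this
  have h2 : ‖(R / max R ‖x‖ - R / max R ‖y‖) • y‖ ≤ ‖x - y‖ := by
    have h3 : R / max R ‖x‖ - R / max R ‖y‖ =
        (R / max R ‖x‖) * ((max R ‖y‖ - max R ‖x‖) / max R ‖y‖) := by
      field_simp
    have h4 : |max R ‖y‖ - max R ‖x‖| ≤ ‖x - y‖ := by
      refine (abs_max_sub_max_le_max _ _ _ _).trans ?_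
      rw [sub_self, abs_zero]
      refine max_le (norm_nonneg _) ?_
      rw [norm_sub_rev]
      exact abs_norm_sub_norm_le y x
    have h5 : R / max R ‖x‖ ≤ 1 := (div_le_one hx).2 (le_max_left _ _)
    have h6 : ‖y‖ / max R ‖y‖ ≤ 1 := (div_le_one hy).2 (le_max_right _ _)
    rw [norm_smul, h3, norm_mul, Real.norm_of_nonneg (by positivity), norm_div,
      Real.norm_of_nonneg hy.le, Real.norm_eq_abs]
    calc R / max R ‖x‖ * (|max R ‖y‖ - max R ‖x‖| / max R ‖y‖) * ‖y‖
        = R / max R ‖x‖ * (|max R ‖y‖ - max R ‖x‖| * (‖y‖ / max R ‖y‖)) := by ring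
      _ ≤ 1 * (‖x - y‖ * 1) := by gcongr
      _ = ‖x - y‖ := by ring
  linarith

variable [CompleteSpace E]

/-- Global existence for a Carathéodory equation with time-dependent Lipschitz constant. -/
theorem exists_integral_solution_of_lipschitz {G : ℝ → E → E} {L : ℝ → ℝ} (hL : Continuous L)
    (hlip : ∀ t, 0 ≤ t → ∀ x y, ‖G t x - G t y‖ ≤ L t * ‖x - y‖)
    (hzero : ∀ t, 0 ≤ t → ‖G t 0‖ ≤ L t)
    (hmeas : ∀ x : ℝ → E, Continuous x → AEStronglyMeasurable (fun t => G t (x t)) volume)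
    (x₀ : E) :
    ∃ x : ℝ → E, Continuous x ∧ ∀ t, 0 ≤ t →
      IntervalIntegrable (fun s => G s (x s)) volume 0 t ∧
      x t = x₀ + ∫ s in (0 : ℝ)..t, G s (x s) := by
  have hL0 : ∀ t, 0 ≤ t → 0 ≤ L t := fun t ht => (norm_nonneg _).trans (hzero t ht)
  -- Picard iteration with a weight: after the substitution `x = exp (2 Λ) y` the integral operator
  -- contracts with constant `1 / 2` on bounded continuous functions of the whole line, because `∫ L
  -- exp (2 Λ) = (exp (2 Λ) - 1) / 2`. No gluing of local solutions is needed.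
  set Λ : ℝ → ℝ := fun t => ∫ s in (0 : ℝ)..t, L s with hΛ
  have hΛd : ∀ t, HasDerivAt Λ (L t) t := fun t => hL.integral_hasStrictDerivAt 0 t |>.hasDerivAt
  have hΛc : Continuous Λ := continuous_iff_continuousAt.2 fun t => (hΛd t).continuousAt
  have hΛ0 : ∀ t, 0 ≤ t → 0 ≤ Λ t := fun t ht =>
    intervalIntegral.integral_nonneg ht fun s hs => hL0 s hs.1
  have hint : ∀ t, ∫ s in (0 : ℝ)..t, L s * Real.exp (2 * Λ s) =
      (Real.exp (2 * Λ t) - 1) / 2 := by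
    intro t
    have hd : ∀ s ∈ Set.uIcc 0 t, HasDerivAt (fun s => Real.exp (2 * Λ s) / 2)
        (L s * Real.exp (2 * Λ s)) s := by
      intro s _
      have := (((hΛd s).const_mul 2).exp).div_const 2
      convert! this using 1
      ring
    rw [intervalIntegral.integral_eq_sub_of_hasDerivAt hd
      ((by fun_prop : Continuous fun s => L s * Real.exp (2 * Λ s)).intervalIntegrable _ _)]
    simp [hΛ]
    ring
  have hgrow : ∀ t, 0 ≤ t → ∀ x, ‖G t x‖ ≤ L t * (1 + ‖x‖) := by
    intro t ht x
    have h1 := hlip t ht x 0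
    have h2 := hzero t ht
    have h3 := norm_le_norm_add_norm_sub' (G t x) (G t 0)
    rw [sub_zero] at h1
    linarith
  have hii : ∀ x : ℝ → E, Continuous x → ∀ t, 0 ≤ t →
      IntervalIntegrable (fun s => G s (x s)) volume 0 t := by
    intro x hx t ht
    have hb : IntervalIntegrable (fun s => L s * (1 + ‖x s‖)) volume 0 t :=
      (by fun_prop : Continuous fun s => L s * (1 + ‖x s‖)).intervalIntegrable _ _
    refine hb.mono_fun' (hmeas x hx).restrict ?_
    rw [Set.uIoc_of_le ht]
    refine (ae_restrict_iff' measurableSet_Ioc).2 (ae_of_all _ fun s hs => ?_)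
    exact hgrow s hs.1.le _
  have hexpand : ∀ y : BoundedContinuousFunction ℝ E,
      Continuous fun s => Real.exp (2 * Λ s) • y s := fun y => by fun_prop
  -- Replacing `t` by `max t 0` freezes negative times, which keeps the operator within continuous
  -- functions on `ℝ`.
  let Φ₀ : BoundedContinuousFunction ℝ E → ℝ → E := fun y t =>
    Real.exp (-(2 * Λ (max t 0))) •
      (x₀ + ∫ s in (0 : ℝ)..(max t 0), G s (Real.exp (2 * Λ s) • y s))
  have hΦc : ∀ y, Continuous (Φ₀ y) := by
    intro y
    have hprim : Continuous fun t : ℝ =>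
        ∫ s in (0 : ℝ)..(max t 0), G s (Real.exp (2 * Λ s) • y s) := by
      rw [continuous_iff_continuousAt]
      intro t
      have hT : (0 : ℝ) ≤ |t| + 1 := by positivity
      have h1 : ContinuousOn (fun u : ℝ => ∫ s in (0 : ℝ)..u, G s (Real.exp (2 * Λ s) • y s))
          (Set.Icc 0 (|t| + 1)) := by
        refine intervalIntegral.continuousOn_primitive_interval (μ := volume) (a := 0)
          (b := |t| + 1) ?_ |>.mono ?_
        · have := (hii _ (hexpand y) _ hT)
          rw [intervalIntegrable_iff, Set.uIoc_of_le hT] at this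
          rwa [Set.uIcc_of_le hT, integrableOn_Icc_iff_integrableOn_Ioc]
        · rw [Set.uIcc_of_le hT]
      have h2 : ContinuousOn (fun u : ℝ => max u 0) (Set.Iio (|t| + 1)) :=
        (continuous_id.max continuous_const).continuousOn
      have h3 : ContinuousOn (fun u : ℝ =>
          ∫ s in (0 : ℝ)..(max u 0), G s (Real.exp (2 * Λ s) • y s)) (Set.Iio (|t| + 1)) :=
        h1.comp h2 fun u hu => ⟨le_max_right _ _, max_le (le_of_lt hu) hT⟩
      exact h3.continuousAt (Iio_mem_nhds (by linarith [le_abs_self t]))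
    have : Continuous fun t : ℝ => Real.exp (-(2 * Λ (max t 0))) := by fun_prop
    exact this.smul (continuous_const.add hprim)
  have hdiff : ∀ y z : BoundedContinuousFunction ℝ E, ∀ t, ‖Φ₀ y t - Φ₀ z t‖ ≤
      1 / 2 * dist y z := by
    intro y z t
    set u := max t 0 with hu
    have hu0 : 0 ≤ u := le_max_right _ _
    have h1 : Φ₀ y t - Φ₀ z t = Real.exp (-(2 * Λ u)) •
        ∫ s in (0 : ℝ)..u, (G s (Real.exp (2 * Λ s) • y s) - G s (Real.exp (2 * Λ s) • z s)) := by
      rw [intervalIntegral.integral_sub (hii _ (hexpand y) _ hu0) (hii _ (hexpand z) _ hu0)]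
      simp only [Φ₀, ← hu]
      module
    have h2 : ‖∫ s in (0 : ℝ)..u,
        (G s (Real.exp (2 * Λ s) • y s) - G s (Real.exp (2 * Λ s) • z s))‖ ≤
        ∫ s in (0 : ℝ)..u, L s * Real.exp (2 * Λ s) * dist y z := by
      refine intervalIntegral.norm_integral_le_of_norm_le hu0 (ae_of_all _ fun s hs => ?_)
        ((by fun_prop : Continuous fun s => L s * Real.exp (2 * Λ s) * dist y z).intervalIntegrable
          _ _)
      refine (hlip s hs.1.le _ _).trans ?_
      rw [← smul_sub, norm_smul, Real.norm_of_nonneg (Real.exp_pos _).le, mul_assoc]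
      have : ‖y s - z s‖ ≤ dist y z := by
        rw [← dist_eq_norm]
        exact BoundedContinuousFunction.dist_coe_le_dist s
      exact mul_le_mul_of_nonneg_left (mul_le_mul_of_nonneg_left this (Real.exp_pos _).le)
        (hL0 s hs.1.le)
    rw [intervalIntegral.integral_mul_const, hint] at h2
    rw [h1, norm_smul, Real.norm_of_nonneg (Real.exp_pos _).le]
    have h3 := mul_le_mul_of_nonneg_left h2 (Real.exp_pos (-(2 * Λ u))).le
    refine h3.trans ?_
    have h4 : Real.exp (-(2 * Λ u)) * Real.exp (2 * Λ u) = 1 := by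
      rw [← Real.exp_add]; simp
    have h5 : Real.exp (-(2 * Λ u)) * ((Real.exp (2 * Λ u) - 1) / 2 * dist y z) =
        1 / 2 * dist y z - Real.exp (-(2 * Λ u)) * dist y z / 2 := by
      linear_combination (dist y z / 2) * h4
    rw [h5]
    have : 0 ≤ Real.exp (-(2 * Λ u)) * dist y z / 2 := by positivity
    linarith
  have hzb : ∀ t, ‖Φ₀ 0 t‖ ≤ ‖x₀‖ + 1 / 2 := by
    intro t
    set u := max t 0 with hu
    have hu0 : 0 ≤ u := le_max_right _ _
    have h1 : ‖∫ s in (0 : ℝ)..u, G s (Real.exp (2 * Λ s) • (0 : BoundedContinuousFunction ℝ E) s)‖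
        ≤ ∫ s in (0 : ℝ)..u, L s * Real.exp (2 * Λ s) := by
      refine intervalIntegral.norm_integral_le_of_norm_le hu0 (ae_of_all _ fun s hs => ?_)
        ((by fun_prop : Continuous fun s => L s * Real.exp (2 * Λ s)).intervalIntegrable _ _)
      simp only [BoundedContinuousFunction.coe_zero, Pi.zero_apply, smul_zero]
      refine (hzero s hs.1.le).trans ?_
      refine le_mul_of_one_le_right (hL0 s hs.1.le) (Real.one_le_exp ?_)
      have := hΛ0 s hs.1.le
      linarith
    rw [hint] at h1
    simp only [Φ₀, ← hu]
    rw [norm_smul, Real.norm_of_nonneg (Real.exp_pos _).le]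
    have h2 := norm_add_le x₀
      (∫ s in (0 : ℝ)..u, G s (Real.exp (2 * Λ s) • (0 : BoundedContinuousFunction ℝ E) s))
    have h3 := mul_le_mul_of_nonneg_left (h2.trans (add_le_add_right h1 _))
      (Real.exp_pos (-(2 * Λ u))).le
    refine h3.trans ?_
    have h4 : Real.exp (-(2 * Λ u)) * Real.exp (2 * Λ u) = 1 := by
      rw [← Real.exp_add]; simp
    have h5 : Real.exp (-(2 * Λ u)) ≤ 1 := by
      rw [Real.exp_le_one_iff]
      have := hΛ0 u hu0
      linarith
    have h6 := mul_le_of_le_one_left (norm_nonneg x₀) h5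
    have h7 := Real.exp_pos (-(2 * Λ u))
    nlinarith
  let Φ : BoundedContinuousFunction ℝ E → BoundedContinuousFunction ℝ E := fun y =>
    BoundedContinuousFunction.ofNormedAddCommGroup (Φ₀ y) (hΦc y)
      (‖x₀‖ + 1 / 2 + 1 / 2 * dist y 0) fun t => by
        have h1 := hdiff y 0 t
        have h2 := hzb t
        have h3 := norm_le_norm_add_norm_sub' (Φ₀ y t) (Φ₀ 0 t)
        linarith
  have hcontr : ContractingWith (1 / 2) Φ := by
    refine ⟨by rw [← NNReal.coe_lt_coe]; norm_num, LipschitzWith.of_dist_le_mul fun y z => ?_⟩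
    have : ((1 / 2 : NNReal) : ℝ) = 1 / 2 := by norm_num
    rw [this]
    refine (BoundedContinuousFunction.dist_le (by positivity)).2 fun t => ?_
    rw [dist_eq_norm]
    exact hdiff y z t
  let y := ContractingWith.fixedPoint Φ hcontr
  have hy : Φ y = y := hcontr.fixedPoint_isFixedPt
  refine ⟨fun t => Real.exp (2 * Λ t) • y t, hexpand y, fun t ht => ⟨hii _ (hexpand y) t ht, ?_⟩⟩
  have h1 : y t = Φ₀ y t := by
    conv_lhs => rw [← hy]
    rfl
  change Real.exp (2 * Λ t) • y t = _
  rw [h1]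
  simp only [Φ₀, max_eq_left ht]
  rw [smul_smul, ← Real.exp_add]
  simp

/-- Global existence for a locally Lipschitz Carathéodory equation with a priori bounds. -/
theorem exists_integral_solution_of_apriori {F : ℝ → E → E} (x₀ : E)
    (hlip : ∀ R : ℝ, ∃ L, ∀ t, 0 ≤ t → ∀ x y, ‖x‖ ≤ R → ‖y‖ ≤ R → ‖F t x - F t y‖ ≤ L * ‖x - y‖)
    (hzero : ∃ L, ∀ t, 0 ≤ t → ‖F t 0‖ ≤ L)
    (hmeas : ∀ x : ℝ → E, Continuous x → AEStronglyMeasurable (fun t => F t (x t)) volume)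
    (hbound : ∀ T, 0 ≤ T → ∃ R, ∀ τ, 0 ≤ τ → τ ≤ T → ∀ x : ℝ → E, Continuous x →
      (∀ t, 0 ≤ t → t ≤ τ → IntervalIntegrable (fun s => F s (x s)) volume 0 t ∧
        x t = x₀ + ∫ s in (0 : ℝ)..t, F s (x s)) → ‖x τ‖ ≤ R) :
    ∃ x : ℝ → E, Continuous x ∧ ∀ t, 0 ≤ t →
      IntervalIntegrable (fun s => F s (x s)) volume 0 t ∧
      x t = x₀ + ∫ s in (0 : ℝ)..t, F s (x s) := by
  -- A continuous radius strictly above the norm of every solution at every time. Such radii form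
  -- convex sets and exist locally as constants by the a priori bound, so a partition of unity
  -- provides `ρ`.
  obtain ⟨ρ, hρ⟩ : ∃ ρ : C(ℝ, ℝ), ∀ τ, ρ τ ∈ {c : ℝ | 0 < c ∧ (0 ≤ τ → ∀ x : ℝ → E,
      Continuous x → (∀ t, 0 ≤ t → t ≤ τ → IntervalIntegrable (fun s => F s (x s)) volume 0 t ∧
        x t = x₀ + ∫ s in (0 : ℝ)..t, F s (x s)) → ‖x τ‖ < c)} := by
    refine exists_continuous_forall_mem_convex_of_local_const (fun τ => ?_) fun τ₀ => ?_
    · refine convex_iff_forall_pos.2 fun c hc d hd a b ha hb hab => ?_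
      have hle : min c d ≤ a • c + b • d := by
        have h1 := mul_le_mul_of_nonneg_left (min_le_left c d) ha.le
        have h2 := mul_le_mul_of_nonneg_left (min_le_right c d) hb.le
        have h3 : min c d = a * min c d + b * min c d := by rw [← add_mul, hab, one_mul]
        simp only [smul_eq_mul]
        linarith
      exact ⟨(lt_min hc.1 hd.1).trans_le hle, fun hτ x hx hs =>
        (lt_min (hc.2 hτ x hx hs) (hd.2 hτ x hx hs)).trans_le hle⟩
    · obtain ⟨R, hR⟩ := hbound (|τ₀| + 1) (by positivity)
      refine ⟨|R| + 1, ?_⟩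
      filter_upwards [Iio_mem_nhds (show τ₀ < |τ₀| + 1 by linarith [le_abs_self τ₀])] with τ hτ
      refine ⟨by positivity, fun hτ0 x hx hs => ?_⟩
      have := hR τ hτ0 (le_of_lt hτ) x hx hs
      linarith [le_abs_self R]
  have hρpos : ∀ t, 0 < ρ t := fun t => (hρ t).1
  -- A continuous Lipschitz constant on the ball of radius `ρ t`. The factor `2` compensates the
  -- Lipschitz constant of the radial retraction.
  obtain ⟨L, hL⟩ : ∃ L : C(ℝ, ℝ), ∀ t, L t ∈ {c : ℝ | 0 ≤ t →
      (‖F t 0‖ ≤ c ∧ ∀ x y, ‖x‖ ≤ ρ t → ‖y‖ ≤ ρ t → 2 * ‖F t x - F t y‖ ≤ c * ‖x - y‖)} := by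
    refine exists_continuous_forall_mem_convex_of_local_const (fun τ => ?_) fun t₀ => ?_
    · refine convex_iff_forall_pos.2 fun c hc d hd a b ha hb hab hτ => ?_
      refine ⟨?_, fun x y hx hy => ?_⟩
      · have h1 := mul_le_mul_of_nonneg_left (hc hτ).1 ha.le
        have h2 := mul_le_mul_of_nonneg_left (hd hτ).1 hb.le
        simp only [smul_eq_mul]
        have h3 : ‖F τ 0‖ = a * ‖F τ 0‖ + b * ‖F τ 0‖ := by rw [← add_mul, hab, one_mul]
        linarith
      · have h1 := mul_le_mul_of_nonneg_left ((hc hτ).2 x y hx hy) ha.le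
        have h2 := mul_le_mul_of_nonneg_left ((hd hτ).2 x y hx hy) hb.le
        simp only [smul_eq_mul]
        have h3 : 2 * ‖F τ x - F τ y‖ =
          a * (2 * ‖F τ x - F τ y‖) + b * (2 * ‖F τ x - F τ y‖) := by rw [← add_mul, hab, one_mul]
        linarith
    · obtain ⟨c, hc⟩ := hlip (ρ t₀ + 1)
      obtain ⟨d, hd⟩ := hzero
      refine ⟨max (2 * c) d, ?_⟩
      have hev : ∀ᶠ t in 𝓝 t₀, ρ t < ρ t₀ + 1 :=
        ρ.continuous.continuousAt.eventually_lt_const (by linarith)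
      filter_upwards [hev] with t ht ht0
      refine ⟨(hd t ht0).trans (le_max_right _ _), fun x y hx hy => ?_⟩
      have h1 := hc t ht0 x y (hx.trans ht.le) (hy.trans ht.le)
      have h2 := mul_le_mul_of_nonneg_right (le_max_left (2 * c) d) (norm_nonneg (x - y))
      linarith
  obtain ⟨x, hxc, hx⟩ := exists_integral_solution_of_lipschitz
    (G := fun t x => F t (radialProj (ρ t) x)) L.continuous
    (fun t ht x y => by
      have h1 := (hL t ht).2 _ _ (norm_radialProj_le (hρpos t) x) (norm_radialProj_le (hρpos t) y)
      have h2 := norm_radialProj_sub_le (hρpos t) x y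
      have h3 : 0 ≤ L t := (norm_nonneg _).trans (hL t ht).1
      nlinarith)
    (fun t ht => by
      simpa [radialProj] using (hL t ht).1)
    (fun x hx => hmeas _ <| by
      unfold radialProj
      refine Continuous.smul (Continuous.div ρ.continuous (by fun_prop) fun t => ?_) hx
      exact (lt_max_of_lt_left (hρpos t)).ne') x₀
  -- The equation truncated by the retraction has a global solution. At the first time `τ` where its
  -- norm reaches `ρ`, it has solved the original equation on all of `[0, τ]` (the end point being a
  -- null set), so the strict a priori bound at `τ` is contradicted.
  have hlt : ∀ t, 0 ≤ t → ‖x t‖ < ρ t := by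
    by_contra! hcon
    set S : Set ℝ := {t | 0 ≤ t ∧ ρ t ≤ ‖x t‖} with hS
    have hSc : IsClosed S :=
      (isClosed_le continuous_const continuous_id).inter
        (isClosed_le ρ.continuous hxc.norm)
    have hSb : BddBelow S := ⟨0, fun t ht => ht.1⟩
    have hτ := hSc.csInf_mem hcon hSb
    set τ := sInf S
    have hbefore : ∀ s, 0 ≤ s → s < τ → ‖x s‖ ≤ ρ s := by
      intro s hs hsτ
      by_contra! h
      exact (not_le.2 hsτ) (csInf_le hSb ⟨hs, h.le⟩)
    have hsol : ∀ t, 0 ≤ t → t ≤ τ → IntervalIntegrable (fun s => F s (x s)) volume 0 t ∧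
        x t = x₀ + ∫ s in (0 : ℝ)..t, F s (x s) := by
      intro t ht htτ
      have hae : ∀ᵐ s ∂volume, s ∈ Set.uIoc 0 t → F s (radialProj (ρ s) (x s)) = F s (x s) := by
        have : ∀ᵐ s ∂(volume : Measure ℝ), s ≠ t := by simp [ae_iff]
        filter_upwards [this] with s hst hs
        rw [Set.uIoc_of_le ht] at hs
        rw [radialProj_of_le (hρpos s)
          (hbefore s hs.1.le ((lt_of_le_of_ne hs.2 hst).trans_le htτ))]
      refine ⟨(hx t ht).1.congr_ae ((ae_restrict_iff' measurableSet_uIoc).2 hae), ?_⟩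
      rw [(hx t ht).2, intervalIntegral.integral_congr_ae hae]
    exact absurd ((hρ τ).2 hτ.1 x hxc hsol) (not_lt.2 hτ.2)
  refine ⟨x, hxc, fun t ht => ?_⟩
  have hcongr : ∀ s ∈ Set.uIcc 0 t, F s (radialProj (ρ s) (x s)) = F s (x s) := by
    intro s hs
    rw [Set.uIcc_of_le ht] at hs
    rw [radialProj_of_le (hρpos s) (hlt s hs.1).le]
  refine ⟨(hx t ht).1.congr fun s hs => hcongr s (Set.uIoc_subset_uIcc hs), ?_⟩
  rw [(hx t ht).2, intervalIntegral.integral_congr hcongr]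

end Existence

end PartialStateMRAC

namespace PartialStateMRAC

/-! ### Observability -/

/-- If `(A, C₀)` is observable and `C₀` has full row rank, the rows of `C₀, C₀ A, …, C₀ A^(n - n₀)`
span the whole space. -/
theorem Observable.exists_krylov {n n₀ : ℕ} {A : Matrix (Fin n) (Fin n) ℝ}
    {C₀ : Matrix (Fin n₀) (Fin n) ℝ} (hobs : Observable A C₀) (hrank : C₀.rank = n₀)
    (κ : Fin n → ℝ) :
    ∃ b : ℕ → Fin n₀ → ℝ, κ = ∑ k ∈ Finset.range (n - n₀ + 1), Matrix.vecMul (b k) (C₀ * A ^ k) := by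
  -- The range `V k` of `Φ k` is the span of the rows of `C₀, C₀ A, …, C₀ A ^ k`.
  let Φ : ℕ → (ℕ → Fin n₀ → ℝ) →ₗ[ℝ] (Fin n → ℝ) := fun k =>
    ∑ j ∈ Finset.range (k + 1), (Matrix.vecMulLinear (C₀ * A ^ j)).comp (LinearMap.proj j)
  have hΦ : ∀ k b, Φ k b = ∑ j ∈ Finset.range (k + 1), Matrix.vecMul (b j) (C₀ * A ^ j) := by
    intro k b
    simp [Φ]
  let V : ℕ → Submodule ℝ (Fin n → ℝ) := fun k => LinearMap.range (Φ k)
  have hmono : ∀ k, V k ≤ V (k + 1) := by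
    rintro k _ ⟨b, rfl⟩
    refine ⟨fun j => if j ≤ k then b j else 0, ?_⟩
    rw [hΦ, hΦ, Finset.sum_range_succ]
    simp only [show ¬ (k + 1 ≤ k) by omega, if_false, Matrix.zero_vecMul, add_zero]
    refine Finset.sum_congr rfl fun j hj => ?_
    rw [if_pos (by simpa [Nat.lt_succ_iff] using hj)]
  have hshift : ∀ k, ∀ w ∈ V k, Matrix.vecMul w A ∈ V (k + 1) := by
    rintro k _ ⟨b, rfl⟩
    refine ⟨fun j => if j = 0 then 0 else b (j - 1), ?_⟩
    rw [hΦ, hΦ, Finset.sum_range_succ']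
    simp only [if_true, Matrix.zero_vecMul, add_zero, Matrix.sum_vecMul, Matrix.vecMul_vecMul]
    refine Finset.sum_congr rfl fun j _ => ?_
    rw [if_neg (by omega), Nat.add_sub_cancel, pow_succ, Matrix.mul_assoc]
  have hrow : ∀ c, ∀ k, Matrix.vecMul c C₀ ∈ V k := by
    intro c k
    refine ⟨fun j => if j = 0 then c else 0, ?_⟩
    rw [hΦ, Finset.sum_range_succ']
    simp
  -- If the chain stops growing at `k`, then `V k` is invariant under `A` and contains the rows of
  -- all `C₀ A ^ j`. A nonzero functional vanishing on `V k` would be a nonzero unobservable vector.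
  have hstep : ∀ k, V (k + 1) ≤ V k → V k = ⊤ := by
    intro k hk
    have hinv : ∀ c j, Matrix.vecMul c (C₀ * A ^ j) ∈ V k := by
      intro c j
      induction j with
      | zero => simpa using hrow c k
      | succ j ih =>
        have := hk (hshift k _ ih)
        rwa [Matrix.vecMul_vecMul, Matrix.mul_assoc, ← pow_succ] at this
    by_contra hne
    obtain ⟨f, hf0, hf⟩ := Submodule.exists_le_ker_of_lt_top (V k) (lt_top_iff_ne_top.2 hne)
    apply hf0
    let v : Fin n → ℝ := fun i => f (Pi.single i 1)
    have hfv : ∀ w, f w = w ⬝ᵥ v := by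
      intro w
      conv_lhs => rw [pi_eq_sum_univ' w]
      simp [v, dotProduct]
    have hv : v = 0 := by
      refine hobs v fun j => ?_
      ext i
      have h1 : f (Matrix.vecMul (Pi.single i 1) (C₀ * A ^ j)) = 0 := hf (hinv _ _)
      rw [hfv, ← Matrix.dotProduct_mulVec, ← Matrix.mulVec_mulVec, single_one_dotProduct] at h1
      exact h1
    ext i
    have : f (Pi.single i 1) = v i := rfl
    simp [this, hv]
  have hn₀ : n₀ ≤ n := by
    rw [← hrank]
    simpa using C₀.rank_le_width
  -- The rank hypothesis gives dimension `n₀` at `k = 0`, and each step gains at least one dimension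
  -- until the whole space is reached; hence `n - n₀` steps suffice.
  have hdim : ∀ k, V k = ⊤ ∨ n₀ + k ≤ Module.finrank ℝ (V k) := by
    intro k
    induction k with
    | zero =>
      right
      have : V 0 = LinearMap.range C₀.vecMulLinear := by
        apply le_antisymm
        · rintro _ ⟨b, rfl⟩
          exact ⟨b 0, by rw [hΦ]; simp⟩
        · rintro _ ⟨c, rfl⟩
          exact hrow c 0
      rw [this, add_zero]
      have h2 : LinearMap.range C₀.vecMulLinear = LinearMap.range C₀.transpose.mulVecLin := by
        congr 1
        ext1
        simp
      rw [h2]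
      change n₀ ≤ C₀.transpose.rank
      rw [Matrix.rank_transpose, hrank]
    | succ k ih =>
      by_cases htop : V (k + 1) = ⊤
      · exact Or.inl htop
      · right
        have hVk : V k ≠ ⊤ := fun h => htop (top_le_iff.1 (h ▸ hmono k))
        have h1 := ih.resolve_left hVk
        have h2 : V k < V (k + 1) := lt_of_le_not_ge (hmono k) fun h => hVk (hstep k h)
        have h3 := Submodule.finrank_lt_finrank_of_lt h2
        omega
  have htop : V (n - n₀) = ⊤ := by
    refine (hdim (n - n₀)).elim id fun h => Submodule.eq_top_of_finrank_eq (le_antisymm ?_ ?_)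
    · exact Submodule.finrank_le _
    · simp only [Module.finrank_pi, Fintype.card_fin]
      omega
  have : κ ∈ V (n - n₀) := htop ▸ Submodule.mem_top
  obtain ⟨b, hb⟩ := this
  exact ⟨b, by rw [← hb, hΦ]⟩

/-! ### Resolvents -/

theorem inv_smul_one_sub {n : ℕ} (A : Matrix (Fin n) (Fin n) ℂ) (s : ℂ) :
    (s • (1 : Matrix (Fin n) (Fin n) ℂ) - A)⁻¹ =
      (A.charpoly.eval s)⁻¹ • (A.charmatrix.adjugate).map (eval s) := by
  have h1 : s • (1 : Matrix (Fin n) (Fin n) ℂ) - A = (evalRingHom s).mapMatrix A.charmatrix := by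
    ext i j
    by_cases h : i = j
    · subst h; simp [Matrix.charmatrix]
    · simp [Matrix.charmatrix, h]
  rw [Matrix.inv_def, h1, ← RingHom.map_adjugate, ← RingHom.map_det, Ring.inverse_eq_inv']
  rfl

theorem isUnit_smul_one_sub_iff {n : ℕ} (A : Matrix (Fin n) (Fin n) ℂ) (s : ℂ) :
    IsUnit (s • (1 : Matrix (Fin n) (Fin n) ℂ) - A).det ↔ A.charpoly.eval s ≠ 0 := by
  rw [Matrix.eval_charpoly, isUnit_iff_ne_zero]
  simp [Matrix.scalar_apply, Matrix.smul_one_eq_diagonal]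

theorem charpoly_map_eval {n : ℕ} (A : Matrix (Fin n) (Fin n) ℝ) (s : ℂ) :
    (A.map Complex.ofReal).charpoly.eval s = aeval s A.charpoly := by
  have : (A.map Complex.ofReal).charpoly = A.charpoly.map Complex.ofRealHom :=
    A.charpoly_map Complex.ofRealHom
  rw [this, eval_map]
  rfl

theorem Hurwitz.re_neg {n : ℕ} {A : Matrix (Fin n) (Fin n) ℝ} (hA : Hurwitz A) {s : ℂ}
    {v : Fin n → ℂ} (hv : v ≠ 0)
    (h : (s • (1 : Matrix (Fin n) (Fin n) ℂ) - A.map Complex.ofReal).mulVec v = 0) : s.re < 0 := by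
  refine hA s ?_
  rw [← charpoly_map_eval]
  by_contra hne
  rw [← ne_eq, ← isUnit_smul_one_sub_iff] at hne
  apply hv
  have : v = (s • (1 : Matrix (Fin n) (Fin n) ℂ) - A.map Complex.ofReal)⁻¹.mulVec
      ((s • (1 : Matrix (Fin n) (Fin n) ℂ) - A.map Complex.ofReal).mulVec v) := by
    rw [Matrix.mulVec_mulVec, Matrix.nonsing_inv_mul _ hne, Matrix.one_mulVec]
  rw [this, h, Matrix.mulVec_zero]

theorem tendsto_inv_smul_one_sub {n : ℕ} (A : Matrix (Fin n) (Fin n) ℂ) :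
    Tendsto (fun s : ℂ => (s • (1 : Matrix (Fin n) (Fin n) ℂ) - A)⁻¹) (Bornology.cobounded ℂ)
      (𝓝 0) := by
  let _ : NormedRing (Matrix (Fin n) (Fin n) ℂ) := Matrix.linftyOpNormedRing
  let _ : NormedAlgebra ℂ (Matrix (Fin n) (Fin n) ℂ) := Matrix.linftyOpNormedAlgebra
  have h := spectrum.resolvent_tendsto_cobounded (𝕜 := ℂ) A
  refine h.congr fun s => ?_
  rw [resolvent, Matrix.nonsing_inv_eq_ringInverse, Algebra.algebraMap_eq_smul_one]

theorem eventually_isUnit_smul_one_sub_nhdsNE {n : ℕ} (A : Matrix (Fin n) (Fin n) ℂ) (z : ℂ) :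
    ∀ᶠ s in 𝓝[≠] z, IsUnit (s • (1 : Matrix (Fin n) (Fin n) ℂ) - A).det := by
  have hfin : {s | A.charpoly.eval s = 0}.Finite := by
    refine (A.charpoly.roots.toFinset.finite_toSet).subset fun s hs => ?_
    simpa [A.charpoly_monic.ne_zero] using hs
  have h1 : {s | A.charpoly.eval s = 0}ᶜ ∈ 𝓝[≠] z := by
    have h2 : ({s | A.charpoly.eval s = 0} \ {z})ᶜ ∈ 𝓝 z :=
      (hfin.subset Set.sdiff_subset).isClosed.isOpen_compl.mem_nhds (by simp)
    filter_upwards [nhdsWithin_le_nhds h2, self_mem_nhdsWithin] with s hs hsz hs0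
    exact hs ⟨hs0, hsz⟩
  filter_upwards [h1] with s hs
  exact (isUnit_smul_one_sub_iff A s).2 hs

theorem eventually_isUnit_smul_one_sub_cobounded {n : ℕ} (A : Matrix (Fin n) (Fin n) ℂ) :
    ∀ᶠ s in Bornology.cobounded ℂ, IsUnit (s • (1 : Matrix (Fin n) (Fin n) ℂ) - A).det := by
  have hfin : {s | A.charpoly.eval s = 0}.Finite := by
    refine (A.charpoly.roots.toFinset.finite_toSet).subset fun s hs => ?_
    simpa [A.charpoly_monic.ne_zero] using hs
  filter_upwards [Bornology.isBounded_def.1 hfin.isBounded] with s hs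
  exact (isUnit_smul_one_sub_iff A s).2 hs

/-- Telescoping of `s ^ k - A ^ k`: this is the division of `s ^ k` by `s - A`, which separates the
polynomial from the strictly proper part of `ξ(s) C (sI - A)⁻¹ B`. -/
theorem pow_smul_one_eq {n : ℕ} (A : Matrix (Fin n) (Fin n) ℂ) (s : ℂ) (k : ℕ) :
    s ^ k • (1 : Matrix (Fin n) (Fin n) ℂ) = A ^ k +
      ∑ l ∈ Finset.range k, s ^ l • (A ^ (k - 1 - l) * (s • (1 : Matrix (Fin n) (Fin n) ℂ) - A)) := by
  have hc : Commute (s • (1 : Matrix (Fin n) (Fin n) ℂ)) A := by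
    simp [Commute, SemiconjBy]
  have h := hc.geom_sum₂_mul k
  simp only [_root_.smul_pow, one_pow, smul_mul_assoc, one_mul, Finset.sum_mul] at h
  rw [h, add_sub_cancel]

/-! ### The interactor -/

/-- The coefficient of degree `k` of a polynomial matrix. -/
def coeffMatrix {m l : ℕ} (N : Matrix (Fin m) (Fin l) ℝ[X]) (k : ℕ) : Matrix (Fin m) (Fin l) ℝ :=
  N.map fun p => p.coeff k

theorem natDegree_le_maxDegree {m : ℕ} (N : Matrix (Fin m) (Fin m) ℝ[X]) (i j : Fin m) :
    (N i j).natDegree ≤ maxDegree N :=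
  (Finset.le_sup (f := fun j => (N i j).natDegree) (Finset.mem_univ j)).trans
    (Finset.le_sup (f := fun i => Finset.univ.sup fun j => (N i j).natDegree) (Finset.mem_univ i))

theorem evalMatrix_eq_sum {m : ℕ} (N : Matrix (Fin m) (Fin m) ℝ[X]) (s : ℂ) :
    evalMatrix N s =
      ∑ k ∈ Finset.range (maxDegree N + 1), s ^ k • (coeffMatrix N k).map Complex.ofReal := by
  ext i j
  rw [Matrix.sum_apply, evalMatrix, Matrix.map_apply,
    aeval_eq_sum_range' (Nat.lt_succ_of_le (natDegree_le_maxDegree N i j))]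
  refine Finset.sum_congr rfl fun k _ => ?_
  simp [coeffMatrix, mul_comm]

/-- The coefficient of degree `l` of the polynomial part of `ξ(s) C (sI - A)⁻¹ B`. -/
def interactorCoeff {m n : ℕ} (ξ : Matrix (Fin m) (Fin m) ℝ[X]) (A : Matrix (Fin n) (Fin n) ℝ)
    (B : Matrix (Fin n) (Fin m) ℝ) (C : Matrix (Fin m) (Fin n) ℝ) (l : ℕ) :
    Matrix (Fin m) (Fin m) ℝ :=
  ∑ k ∈ Finset.range (maxDegree ξ + 1),
    if l < k then coeffMatrix ξ k * C * A ^ (k - 1 - l) * B else 0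

/-- `∑ k, ξ_k C A^k`, for `ξ(s) = ∑ k, s^k ξ_k`. -/
def interactorState {m n : ℕ} (ξ : Matrix (Fin m) (Fin m) ℝ[X]) (A : Matrix (Fin n) (Fin n) ℝ)
    (C : Matrix (Fin m) (Fin n) ℝ) : Matrix (Fin m) (Fin n) ℝ :=
  ∑ k ∈ Finset.range (maxDegree ξ + 1), coeffMatrix ξ k * C * A ^ k

theorem map_ofReal_mul {a b c : ℕ} (P : Matrix (Fin a) (Fin b) ℝ) (Q : Matrix (Fin b) (Fin c) ℝ) :
    (P * Q).map Complex.ofReal = P.map Complex.ofReal * Q.map Complex.ofReal :=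
  Matrix.map_mul (f := Complex.ofRealHom)

theorem map_ofReal_pow {a : ℕ} (P : Matrix (Fin a) (Fin a) ℝ) (k : ℕ) :
    (P ^ k).map Complex.ofReal = P.map Complex.ofReal ^ k :=
  map_pow (Complex.ofRealHom.mapMatrix) P k

theorem map_ofReal_sum {a b : ℕ} {ι : Type*} (s : Finset ι) (f : ι → Matrix (Fin a) (Fin b) ℝ) :
    (∑ i ∈ s, f i).map Complex.ofReal = ∑ i ∈ s, (f i).map Complex.ofReal := by
  ext i j
  simp [Matrix.sum_apply]

theorem sum_range_ite_lt (k N : ℕ) (hk : k ≤ N) {α : Type*} [AddCommMonoid α] (f : ℕ → α) :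
    ∑ l ∈ Finset.range k, f l = ∑ l ∈ Finset.range N, if l < k then f l else 0 := by
  rw [← Finset.sum_filter]
  refine Finset.sum_congr ?_ fun _ _ => rfl
  ext l
  simp only [Finset.mem_range, Finset.mem_filter]
  omega

/-- `ξ(s) C v` in terms of `v` and `(sI - A) v`. -/
theorem evalMatrix_mul_eq {m n : ℕ} (ξ : Matrix (Fin m) (Fin m) ℝ[X])
    (A : Matrix (Fin n) (Fin n) ℝ) (B : Matrix (Fin n) (Fin m) ℝ) (C : Matrix (Fin m) (Fin n) ℝ)
    (s : ℂ) {r : ℕ} (v : Matrix (Fin n) (Fin r) ℂ) (w : Matrix (Fin m) (Fin r) ℂ)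
    (h : (s • (1 : Matrix (Fin n) (Fin n) ℂ) - A.map Complex.ofReal) * v =
      B.map Complex.ofReal * w) :
    evalMatrix ξ s * (C.map Complex.ofReal * v) = (interactorState ξ A C).map Complex.ofReal * v +
      (∑ l ∈ Finset.range (maxDegree ξ + 1),
        s ^ l • (interactorCoeff ξ A B C l).map Complex.ofReal) * w := by
  have h1 : ∀ k, s ^ k • v = (A.map Complex.ofReal) ^ k * v +
      ∑ l ∈ Finset.range k, s ^ l • ((A.map Complex.ofReal) ^ (k - 1 - l) *
        (B.map Complex.ofReal * w)) := by
    intro k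
    have := congrArg (· * v) (pow_smul_one_eq (A.map Complex.ofReal) s k)
    simp only [Matrix.smul_mul, Matrix.one_mul, Matrix.add_mul, Matrix.sum_mul] at this
    rw [this]
    congr 1
    refine Finset.sum_congr rfl fun l _ => ?_
    rw [Matrix.mul_assoc, h]
  rw [evalMatrix_eq_sum, Matrix.sum_mul]
  have h2 : ∀ k ∈ Finset.range (maxDegree ξ + 1),
      s ^ k • (coeffMatrix ξ k).map Complex.ofReal * (C.map Complex.ofReal * v) =
      (coeffMatrix ξ k * C * A ^ k).map Complex.ofReal * v +
      ∑ l ∈ Finset.range (maxDegree ξ + 1), (s ^ l •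
        (if l < k then coeffMatrix ξ k * C * A ^ (k - 1 - l) * B else 0).map Complex.ofReal) * w := by
    intro k hk
    rw [Matrix.smul_mul, ← Matrix.mul_smul, ← Matrix.mul_smul, h1, Matrix.mul_add, Matrix.mul_add,
      sum_range_ite_lt k (maxDegree ξ + 1) (Finset.mem_range.1 hk).le]
    congr 1
    · simp only [map_ofReal_mul, map_ofReal_pow, Matrix.mul_assoc]
    · rw [Matrix.mul_sum, Matrix.mul_sum]
      refine Finset.sum_congr rfl fun l _ => ?_
      split_ifs
      · simp only [map_ofReal_mul, map_ofReal_pow, Matrix.mul_assoc, Matrix.mul_smul,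
          Matrix.smul_mul]
      · simp
  rw [Finset.sum_congr rfl h2, Finset.sum_add_distrib, Finset.sum_comm, interactorState,
    map_ofReal_sum, Matrix.sum_mul, Matrix.sum_mul]
  congr 1
  refine Finset.sum_congr rfl fun l _ => ?_
  rw [interactorCoeff, map_ofReal_sum, Finset.smul_sum, Matrix.sum_mul]

theorem tendsto_transferMatrix {m n l : ℕ} (A : Matrix (Fin n) (Fin n) ℝ)
    (B : Matrix (Fin n) (Fin m) ℝ) (C : Matrix (Fin l) (Fin n) ℝ) :
    Tendsto (transferMatrix A B C) (Bornology.cobounded ℂ) (𝓝 0) := by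
  have h := tendsto_inv_smul_one_sub (A.map Complex.ofReal)
  have h1 : Continuous fun Q : Matrix (Fin n) (Fin n) ℂ =>
      C.map Complex.ofReal * Q * B.map Complex.ofReal := by fun_prop
  have h2 := h1.tendsto 0
  simp only [Matrix.mul_zero, Matrix.zero_mul] at h2
  exact h2.comp h

theorem _root_.Polynomial.natDegree_eq_zero_of_tendsto {p : ℂ[X]} {c : ℂ}
    (h : Tendsto (fun s => p.eval s) (Bornology.cobounded ℂ) (𝓝 c)) : p.natDegree = 0 := by
  by_contra hne
  have h1 := p.tendsto_norm_atTop (natDegree_pos_iff_degree_pos.1 (Nat.pos_of_ne_zero hne))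
    tendsto_norm_cobounded_atTop
  exact not_tendsto_nhds_of_tendsto_atTop h1 _ h.norm

section Interactor

variable {m n : ℕ} {ξ : Matrix (Fin m) (Fin m) ℝ[X]} {A : Matrix (Fin n) (Fin n) ℝ}
  {B : Matrix (Fin n) (Fin m) ℝ} {C : Matrix (Fin m) (Fin n) ℝ} {Kp : Matrix (Fin m) (Fin m) ℝ}

/-- The product `ξ(s) G(s)` is the polynomial with these coefficients plus `R (sI - A)⁻¹ B`, which
vanishes at infinity. A polynomial with a finite limit at infinity is constant, and the limit is
`Kp`. Consequently `ξ(d/dt) y = R x + Kp u` contains no derivative of the input. -/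
theorem IsModifiedInteractor.interactorCoeff_eq
    (h : IsModifiedInteractor ξ (transferMatrix A B C) Kp) (l : ℕ) :
    interactorCoeff ξ A B C l = if l = 0 then Kp else 0 := by
  rcases lt_or_ge l (maxDegree ξ + 1) with hl | hl
  swap
  · rw [if_neg (by omega), interactorCoeff]
    refine Finset.sum_eq_zero fun k hk => if_neg ?_
    have := Finset.mem_range.1 hk
    omega
  ext i j
  let P : ℂ[X] := ∑ l ∈ Finset.range (maxDegree ξ + 1),
    Polynomial.C ((interactorCoeff ξ A B C l i j : ℝ) : ℂ) * X ^ l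
  have hP : ∀ s, P.eval s = (∑ l ∈ Finset.range (maxDegree ξ + 1),
      s ^ l • (interactorCoeff ξ A B C l).map Complex.ofReal) i j := by
    intro s
    simp only [P, eval_finsetSum, eval_mul, eval_C, eval_pow, eval_X, Matrix.sum_apply,
      Matrix.smul_apply, Matrix.map_apply, smul_eq_mul]
    exact Finset.sum_congr rfl fun _ _ => mul_comm _ _
  have hPt : Tendsto (fun s => P.eval s) (Bornology.cobounded ℂ) (𝓝 (Kp i j : ℂ)) := by
    have h1 : Tendsto (fun s => (interactorState ξ A C).map Complex.ofReal *
        ((s • (1 : Matrix (Fin n) (Fin n) ℂ) - A.map Complex.ofReal)⁻¹ * B.map Complex.ofReal))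
        (Bornology.cobounded ℂ) (𝓝 0) := by
      have h2 : Continuous fun Q : Matrix (Fin n) (Fin n) ℂ =>
        (interactorState ξ A C).map Complex.ofReal * (Q * B.map Complex.ofReal) := by fun_prop
      have h3 := h2.tendsto 0
      simp only [Matrix.mul_zero, Matrix.zero_mul] at h3
      exact h3.comp (tendsto_inv_smul_one_sub (A.map Complex.ofReal))
    have h3 := (h.gain.sub h1)
    have h4 := (continuous_id.matrix_elem i j).continuousAt.tendsto.comp h3
    simp only [sub_zero, id, Matrix.map_apply] at h4
    refine h4.congr' ?_
    filter_upwards [eventually_isUnit_smul_one_sub_cobounded (A.map Complex.ofReal)] with s hs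
    have h5 := evalMatrix_mul_eq ξ A B C s
      ((s • (1 : Matrix (Fin n) (Fin n) ℂ) - A.map Complex.ofReal)⁻¹ * B.map Complex.ofReal) 1
      (by rw [← Matrix.mul_assoc, Matrix.mul_nonsing_inv _ hs, Matrix.one_mul, Matrix.mul_one])
    rw [Matrix.mul_one] at h5
    rw [hP]
    simp only [Function.comp, transferMatrix, Matrix.mul_assoc]
    rw [h5, add_sub_cancel_left]
  have hdeg := natDegree_eq_zero_of_tendsto hPt
  have hcoeff : ∀ l < maxDegree ξ + 1, P.coeff l = interactorCoeff ξ A B C l i j := by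
    intro l hl
    simp only [P, finsetSum_coeff, coeff_C_mul, coeff_X_pow]
    rw [Finset.sum_eq_single l]
    · simp
    · intro b _ hb
      simp [Ne.symm hb]
    · intro h
      exact absurd (Finset.mem_range.2 hl) h
  by_cases hl0 : l = 0
  · subst hl0
    have hc : P = Polynomial.C (P.coeff 0) := eq_C_of_natDegree_eq_zero hdeg
    rw [hc] at hPt
    simp only [eval_C] at hPt
    have := tendsto_nhds_unique hPt tendsto_const_nhds
    rw [hcoeff 0 hl] at this
    simpa using Complex.ofReal_injective this.symm
  · rw [if_neg hl0]
    have h1 := hcoeff l hl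
    rw [coeff_eq_zero_of_natDegree_lt (by omega)] at h1
    simpa using Complex.ofReal_injective h1.symm

theorem IsModifiedInteractor.det_eq (h : IsModifiedInteractor ξ (transferMatrix A B C) Kp) :
    ξ.det = ∏ i, ξ i i :=
  Matrix.det_of_isLowerTriangular ξ fun i j hij => h.lower i j hij

theorem IsModifiedInteractor.det_monic (h : IsModifiedInteractor ξ (transferMatrix A B C) Kp) :
    ξ.det.Monic := by
  rw [h.det_eq]
  exact monic_prod_of_monic _ _ fun i _ => h.diag_monic i

theorem IsModifiedInteractor.det_stable (h : IsModifiedInteractor ξ (transferMatrix A B C) Kp) :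
    StablePoly ξ.det := by
  intro z hz
  rw [h.det_eq, map_prod, Finset.prod_eq_zero_iff] at hz
  obtain ⟨i, -, hi⟩ := hz
  exact h.diag_stable i z hi

theorem evalMatrix_det {m : ℕ} (N : Matrix (Fin m) (Fin m) ℝ[X]) (s : ℂ) :
    (evalMatrix N s).det = aeval s N.det :=
  ((aeval s : ℝ[X] →ₐ[ℝ] ℂ).map_det N).symm

theorem evalMatrix_adjugate {m : ℕ} (N : Matrix (Fin m) (Fin m) ℝ[X]) (s : ℂ) :
    (evalMatrix N s).adjugate = evalMatrix N.adjugate s :=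
  ((aeval s : ℝ[X] →ₐ[ℝ] ℂ).map_adjugate N).symm

/-- The reference model is strictly proper. -/
theorem IsModifiedInteractor.adjugate_natDegree_lt
    (h : IsModifiedInteractor ξ (transferMatrix A B C) Kp) (i j : Fin m) :
    (ξ.adjugate i j).natDegree < ξ.det.natDegree := by
  have hdetpos : 0 < ξ.det.natDegree := by
    rw [h.det_eq, natDegree_prod_of_monic _ _ fun i _ => h.diag_monic i]
    exact (h.diag_degree i).trans_le
      (Finset.single_le_sum (f := fun i => (ξ i i).natDegree) (fun _ _ => Nat.zero_le _)
        (Finset.mem_univ i))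
  have hdetK : (Kp.map Complex.ofReal).det ≠ 0 := by
    have : (Kp.map Complex.ofReal).det = ((Kp.det : ℝ) : ℂ) :=
      (Complex.ofRealHom.map_det Kp).symm
    rw [this]
    exact_mod_cast h.nonsingular
  -- As `ξ⁻¹ = G (ξ G)⁻¹`, it tends to `0 · Kp⁻¹ = 0`; along the real axis this compares the degrees
  -- of `adj ξ` and `det ξ`. Triangularity alone would not suffice, since the entries below the
  -- diagonal may have large degree.
  have hlim : Tendsto (fun s => (evalMatrix ξ s)⁻¹) (Bornology.cobounded ℂ) (𝓝 0) := by
    have hd : Continuous fun Q : Matrix (Fin m) (Fin m) ℂ => Q.det := continuous_id.matrix_det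
    have h0 := (hd.tendsto _).comp h.gain
    have h1 : Tendsto (fun s => (evalMatrix ξ s * transferMatrix A B C s)⁻¹)
        (Bornology.cobounded ℂ) (𝓝 (Kp.map Complex.ofReal)⁻¹) := by
      simp only [Matrix.inv_def, Ring.inverse_eq_inv']
      have ha : Continuous fun Q : Matrix (Fin m) (Fin m) ℂ => Q.adjugate :=
        continuous_id.matrix_adjugate
      exact (h0.inv₀ hdetK).smul ((ha.tendsto _).comp h.gain)
    have h2 := (tendsto_transferMatrix A B C).mul h1
    rw [zero_mul] at h2
    refine h2.congr' ?_
    filter_upwards [h0.eventually_ne hdetK] with s hs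
    have hs' : IsUnit (evalMatrix ξ s * transferMatrix A B C s).det := isUnit_iff_ne_zero.2 hs
    have hprod : evalMatrix ξ s * (transferMatrix A B C s *
        (evalMatrix ξ s * transferMatrix A B C s)⁻¹) = 1 := by
      rw [← Matrix.mul_assoc, Matrix.mul_nonsing_inv _ hs']
    exact (Matrix.inv_eq_right_inv hprod).symm
  have hreal : Tendsto (fun t : ℝ => (ξ.adjugate i j).eval t / ξ.det.eval t) atTop (𝓝 0) := by
    have hcob : Tendsto (fun t : ℝ => (t : ℂ)) atTop (Bornology.cobounded ℂ) := by
      rw [← tendsto_norm_atTop_iff_cobounded]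
      simpa using tendsto_abs_atTop_atTop
    have h1 := ((continuous_id.matrix_elem i j).tendsto _).comp (hlim.comp hcob)
    simp only [id, Matrix.zero_apply] at h1
    have h2 := (Complex.continuous_re.tendsto _).comp h1
    simp only [Complex.zero_re] at h2
    refine h2.congr fun t => ?_
    have hev : ∀ p : ℝ[X], aeval (t : ℂ) p = ((p.eval t : ℝ) : ℂ) := by
      intro p
      have := aeval_algebraMap_apply ℂ t p
      simpa using this
    simp only [Function.comp]
    rw [Matrix.inv_def, evalMatrix_adjugate, evalMatrix_det, Ring.inverse_eq_inv',
      Matrix.smul_apply, evalMatrix, Matrix.map_apply, hev, hev, smul_eq_mul, ← Complex.ofReal_inv,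
      ← Complex.ofReal_mul, Complex.ofReal_re, inv_mul_eq_div]
  rw [Polynomial.div_tendsto_atTop_zero_iff_degree_lt _ _ h.det_monic.ne_zero] at hreal
  by_cases h0 : ξ.adjugate i j = 0
  · simpa [h0] using hdetpos
  · exact natDegree_lt_natDegree h0 hreal

/-- State feedback decoupling the plant into the inverse of the interactor is stabilizing. -/
theorem IsModifiedInteractor.hurwitz (h : IsModifiedInteractor ξ (transferMatrix A B C) Kp)
    (hzeros : ∀ z : ℂ, IsTransmissionZero (transferMatrix A B C) z → z.re < 0)
    (hstab : Stabilizable A B) (hdet : Detectable A C) :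
    Hurwitz (A - B * Kp⁻¹ * interactorState ξ A C) := by
  intro z hz
  rw [← charpoly_map_eval] at hz
  have hsing : (z • (1 : Matrix (Fin n) (Fin n) ℂ) -
      (A - B * Kp⁻¹ * interactorState ξ A C).map Complex.ofReal).det = 0 := by
    by_contra hne
    exact (isUnit_smul_one_sub_iff _ z).1 (isUnit_iff_ne_zero.2 hne) hz
  obtain ⟨v, hv0, hv⟩ := Matrix.exists_mulVec_eq_zero_iff.2 hsing
  by_contra hre
  set Ac := A.map Complex.ofReal with hAc
  set Bc := B.map Complex.ofReal with hBc
  set R := interactorState ξ A C with hR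
  -- The input direction produced by the feedback on the eigenvector `v`, so that `(z - A) v = B w`.
  set w : Fin m → ℂ := -(((Kp⁻¹ * R).map Complex.ofReal).mulVec v) with hw
  have hmapsub : (A - B * Kp⁻¹ * R).map Complex.ofReal =
      Ac - Bc * (Kp⁻¹ * R).map Complex.ofReal := by
    rw [hBc, ← map_ofReal_mul, Matrix.mul_assoc]
    ext i j
    simp [hAc]
  have hvw : (z • (1 : Matrix (Fin n) (Fin n) ℂ) - Ac).mulVec v = Bc.mulVec w := by
    rw [hmapsub, sub_sub_eq_add_sub, add_sub_right_comm, Matrix.add_mulVec,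
      ← Matrix.mulVec_mulVec] at hv
    rw [hw, Matrix.mulVec_neg]
    exact eq_neg_of_add_eq_zero_left hv
  -- The feedback is chosen such that `ξ(z) C v = R v + Kp w = 0`, and `ξ(z)` is nonsingular because
  -- `z` is not in the open left half plane.
  have hCv : (C.map Complex.ofReal).mulVec v = 0 := by
    have h1 := evalMatrix_mul_eq ξ A B C z (Matrix.replicateCol (Fin 1) v)
      (Matrix.replicateCol (Fin 1) w) (by
        rw [← Matrix.replicateCol_mulVec, hvw, Matrix.replicateCol_mulVec])
    have hK : ∑ l ∈ Finset.range (maxDegree ξ + 1),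
        z ^ l • (interactorCoeff ξ A B C l).map Complex.ofReal = Kp.map Complex.ofReal := by
      rw [Finset.sum_eq_single 0]
      · simp [h.interactorCoeff_eq]
      · intro l _ hl
        rw [h.interactorCoeff_eq, if_neg hl]
        ext
        simp
      · simp
    rw [hK, ← Matrix.replicateCol_mulVec, ← Matrix.replicateCol_mulVec,
      ← Matrix.replicateCol_mulVec, ← Matrix.replicateCol_mulVec, ← Matrix.replicateCol_add,
      Matrix.replicateCol_inj] at h1
    have h2 : (Kp.map Complex.ofReal).mulVec w = -((R.map Complex.ofReal).mulVec v) := by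
      rw [hw, Matrix.mulVec_neg, Matrix.mulVec_mulVec, ← map_ofReal_mul, ← Matrix.mul_assoc,
        Matrix.mul_nonsing_inv _ (isUnit_iff_ne_zero.2 h.nonsingular), Matrix.one_mul]
    rw [h2, ← hR, add_neg_cancel] at h1
    by_contra hne
    have h3 := Matrix.exists_mulVec_eq_zero_iff.1 ⟨_, hne, h1⟩
    rw [evalMatrix_det] at h3
    exact hre (h.det_stable z h3)
  -- If `w = 0`, then `v` is an eigenvector of `A` in the kernel of `C`, hence of `A - L C` for
  -- every `L`, against detectability.
  by_cases hw0 : w = 0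
  · obtain ⟨L, hL⟩ := hdet
    refine hre (hL.re_neg hv0 ?_)
    have : (A - L * C).map Complex.ofReal = Ac - L.map Complex.ofReal * C.map Complex.ofReal := by
      rw [← map_ofReal_mul]
      ext i j
      simp [hAc]
    rw [this, sub_sub_eq_add_sub, add_sub_right_comm, Matrix.add_mulVec, ← Matrix.mulVec_mulVec,
      hCv, hvw, hw0]
    simp
  -- If `w ≠ 0`, then `z` is a transmission zero. As `z` may be an eigenvalue of `A`, the zero
  -- direction is built from the resolvent of `A + B K`, which is analytic at `z`: with `g = w - K
  -- v` and `y(s) = (s - A - B K)⁻¹ B g` one has `y(z) = v` and, near `z`, `G(s) (g + K y(s)) = C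
  -- y(s)`. This tends to `C v = 0`, while the direction `g + K y(z)` is `w`.
  · obtain ⟨K, hK⟩ := hstab
    refine hre (hzeros z ?_)
    set AK := (A + B * K).map Complex.ofReal with hAKdef
    have hAK : AK = Ac + Bc * K.map Complex.ofReal := by
      rw [hAKdef, hBc, ← map_ofReal_mul]
      ext i j
      simp [hAc]
    have hz0 : AK.charpoly.eval z ≠ 0 := by
      rw [charpoly_map_eval]
      exact fun h => hre (hK z h)
    have hunit := (isUnit_smul_one_sub_iff AK z).2 hz0
    set g : Fin m → ℂ := w - (K.map Complex.ofReal).mulVec v with hg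
    let y : ℂ → Fin n → ℂ := fun s =>
      (s • (1 : Matrix (Fin n) (Fin n) ℂ) - AK)⁻¹.mulVec (Bc.mulVec g)
    have hyz : y z = v := by
      have h1 : (z • (1 : Matrix (Fin n) (Fin n) ℂ) - AK).mulVec v = Bc.mulVec g := by
        rw [hAK, ← sub_sub, Matrix.sub_mulVec, hvw, hg, Matrix.mulVec_sub, Matrix.mulVec_mulVec]
      simp only [y]
      rw [← h1, Matrix.mulVec_mulVec, Matrix.nonsing_inv_mul _ hunit, Matrix.one_mulVec]
    have hyan : AnalyticAt ℂ y z := by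
      rw [analyticAt_pi_iff]
      intro i
      have : (fun s => y s i) = fun s => (AK.charpoly.eval s)⁻¹ *
          ∑ j, (AK.charmatrix.adjugate i j).eval s * (Bc.mulVec g) j := by
        ext s
        simp only [y, inv_smul_one_sub, Matrix.smul_mulVec, Pi.smul_apply, smul_eq_mul]
        rfl
      rw [this]
      have hpoly : ∀ p : ℂ[X], AnalyticAt ℂ (fun s => p.eval s) z := fun p =>
        p.differentiable.analyticAt z
      exact ((hpoly _).inv hz0).mul
        (Finset.analyticAt_fun_sum _ fun j _ => (hpoly _).mul analyticAt_const)
    refine ⟨fun s => g + (K.map Complex.ofReal).mulVec (y s), ?_, ?_, ?_⟩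
    · rw [analyticAt_pi_iff]
      intro i
      have h1 : (fun s => (g + (K.map Complex.ofReal).mulVec (y s)) i) =
        fun s => g i + ∑ j, (K.map Complex.ofReal) i j * y s j := rfl
      rw [h1]
      refine analyticAt_const.add (Finset.analyticAt_fun_sum _ fun j _ => analyticAt_const.mul ?_)
      exact analyticAt_pi_iff.1 hyan j
    · simp only [hyz, hg, sub_add_cancel]
      exact hw0
    · have hlim : Tendsto (fun s => (C.map Complex.ofReal).mulVec (y s)) (𝓝[≠] z) (𝓝 0) := by
        have h1 : ContinuousAt (fun s => (C.map Complex.ofReal).mulVec (y s)) z := by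
          have h2 : Continuous fun x : Fin n → ℂ => (C.map Complex.ofReal).mulVec x := by fun_prop
          exact h2.continuousAt.comp hyan.continuousAt
        have h3 := h1.tendsto
        rw [hyz, hCv] at h3
        exact h3.mono_left nhdsWithin_le_nhds
      refine hlim.congr' ?_
      filter_upwards [eventually_isUnit_smul_one_sub_nhdsNE Ac z,
        eventually_isUnit_smul_one_sub_nhdsNE AK z] with s hs hsK
      have h1 : (s • (1 : Matrix (Fin n) (Fin n) ℂ) - Ac).mulVec (y s) =
          Bc.mulVec (g + (K.map Complex.ofReal).mulVec (y s)) := by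
        have h2 : (s • (1 : Matrix (Fin n) (Fin n) ℂ) - AK).mulVec (y s) = Bc.mulVec g := by
          simp only [y]
          rw [Matrix.mulVec_mulVec, Matrix.mul_nonsing_inv _ hsK, Matrix.one_mulVec]
        rw [Matrix.mulVec_add, ← h2, hAK, ← sub_sub, Matrix.sub_mulVec _ (Bc * _) (y s),
          Matrix.mulVec_mulVec (y s) Bc, sub_add_cancel]
      rw [transferMatrix, ← Matrix.mulVec_mulVec, ← Matrix.mulVec_mulVec, ← hAc, ← hBc, ← h1,
        Matrix.mulVec_mulVec (y s) _⁻¹ _, Matrix.nonsing_inv_mul _ hs, Matrix.one_mulVec]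

end Interactor

end PartialStateMRAC

namespace PartialStateMRAC

/-! ### Factorization of the high-frequency gain -/

theorem leadingMinor_castSucc {m : ℕ} (K : Matrix (Fin (m + 1)) (Fin (m + 1)) ℝ) {k : ℕ}
    (hk : k ≤ m) :
    leadingMinor (K.submatrix Fin.castSucc Fin.castSucc) k = leadingMinor K k := by
  let e : {i : Fin m // i.val < k} ≃ {i : Fin (m + 1) // i.val < k} :=
    { toFun := fun i => ⟨i.1.castSucc, i.2⟩
      invFun := fun i => ⟨⟨i.1.val, i.2.trans_le hk⟩, i.2⟩
      left_inv := fun i => rfl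
      right_inv := fun i => rfl }
  rw [leadingMinor, leadingMinor, ← Matrix.det_submatrix_equiv_self e]
  rfl

theorem leadingMinor_self {m : ℕ} (K : Matrix (Fin m) (Fin m) ℝ) : leadingMinor K m = K.det := by
  let e : Fin m ≃ {i : Fin m // i.val < m} :=
    { toFun := fun i => ⟨i, i.2⟩
      invFun := fun i => i.1
      left_inv := fun i => rfl
      right_inv := fun i => rfl }
  rw [leadingMinor, ← Matrix.det_submatrix_equiv_self e]
  rfl

theorem leadingMinor_zero {m : ℕ} (K : Matrix (Fin m) (Fin m) ℝ) : leadingMinor K 0 = 1 := by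
  have : IsEmpty {i : Fin m // i.val < 0} := ⟨fun i => absurd i.2 (Nat.not_lt_zero _)⟩
  exact Matrix.det_isEmpty

/-- Inductive step of the factorization `W K = D S`, in block form. -/
theorem exists_factor_step {m : ℕ} {K' : Matrix (Fin m) (Fin m) ℝ} {b c : Fin m → ℝ} {d δ : ℝ}
    {W' S' D' : Matrix (Fin m) (Fin m) ℝ} (hK' : IsUnit K'.det) (hD' : IsUnit D'.det)
    (hS' : S'.PosDef) (hW : W' * K' = D' * S')
    (hsign : 0 < δ * (d - c ⬝ᵥ K'⁻¹.mulVec b)) :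
    ∃ (w s : Fin m → ℝ) (σ : ℝ), W'.mulVec b = D'.mulVec s ∧
      Matrix.vecMul w K' + c = δ • s ∧ w ⬝ᵥ b + d = δ * σ ∧
      ∀ (x : Fin m → ℝ) (ξ : ℝ), (x ≠ 0 ∨ ξ ≠ 0) →
        0 < x ⬝ᵥ S'.mulVec x + 2 * ξ * (x ⬝ᵥ s) + ξ ^ 2 * σ := by
  have hδ : δ ≠ 0 := by rintro rfl; simp at hsign
  -- In blocks, `K = [K' b; c d]`, `W = [W' 0; w 1]`, `S = [S' s; sᵀ σ]` and the diagonal factor is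
  -- `diag(D', δ)`. The off-diagonal blocks of `W K = D S` force `s` and `w`. The vector `g = K'⁻¹
  -- b` satisfies `S' g = s`.
  set s : Fin m → ℝ := D'⁻¹.mulVec (W'.mulVec b) with hs
  set w : Fin m → ℝ := Matrix.vecMul (δ • s - c) K'⁻¹ with hw
  set g : Fin m → ℝ := K'⁻¹.mulVec b with hg
  have h1 : W'.mulVec b = D'.mulVec s := by
    rw [hs, Matrix.mulVec_mulVec, Matrix.mul_nonsing_inv _ hD', Matrix.one_mulVec]
  have hKg : K'.mulVec g = b := by
    rw [hg, Matrix.mulVec_mulVec, Matrix.mul_nonsing_inv _ hK', Matrix.one_mulVec]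
  have hSg : S'.mulVec g = s := by
    have h2 : W'.mulVec b = (D' * S').mulVec g := by rw [← hW, ← Matrix.mulVec_mulVec, hKg]
    rw [hs, h2, Matrix.mulVec_mulVec g D'⁻¹, ← Matrix.mul_assoc, Matrix.nonsing_inv_mul _ hD',
      Matrix.one_mul]
  have hsymm : ∀ x y : Fin m → ℝ, x ⬝ᵥ S'.mulVec y = y ⬝ᵥ S'.mulVec x := by
    intro x y
    have ht : S'.transpose = S' := by simpa using hS'.isHermitian.eq
    rw [Matrix.dotProduct_mulVec, ← Matrix.mulVec_transpose, ht, dotProduct_comm]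
  refine ⟨w, s, (w ⬝ᵥ b + d) / δ, h1, ?_, by field_simp, ?_⟩
  · rw [hw, Matrix.vecMul_vecMul, Matrix.nonsing_inv_mul _ hK', Matrix.vecMul_one, sub_add_cancel]
  · intro x ξ hx
    have hwb : w ⬝ᵥ b = δ * (s ⬝ᵥ g) - c ⬝ᵥ g := by
      rw [hw, ← Matrix.dotProduct_mulVec, ← hg, sub_dotProduct, smul_dotProduct, smul_eq_mul]
    have hσ : (w ⬝ᵥ b + d) / δ = g ⬝ᵥ S'.mulVec g + (d - c ⬝ᵥ g) / δ := by
      rw [hwb, hSg, dotProduct_comm g s]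
      field_simp
      ring
    have hpos : 0 < (d - c ⬝ᵥ g) / δ := by
      rw [div_eq_mul_inv]
      have : δ * (d - c ⬝ᵥ g) * (δ⁻¹ * δ⁻¹) = (d - c ⬝ᵥ g) * δ⁻¹ := by field_simp
      rw [← this]
      exact mul_pos hsign (mul_self_pos.2 (inv_ne_zero hδ))
    -- Completing the square: the Schur complement `σ - g ⬝ᵥ S' g` equals `(d - c ⬝ᵥ g) / δ`, which
    -- is positive by the sign hypothesis.
    have hexp : x ⬝ᵥ S'.mulVec x + 2 * ξ * (x ⬝ᵥ s) + ξ ^ 2 * ((w ⬝ᵥ b + d) / δ) =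
        (x + ξ • g) ⬝ᵥ S'.mulVec (x + ξ • g) + ξ ^ 2 * ((d - c ⬝ᵥ g) / δ) := by
      rw [hσ, Matrix.mulVec_add, Matrix.mulVec_smul, add_dotProduct, dotProduct_add, dotProduct_add,
        smul_dotProduct, smul_dotProduct, dotProduct_smul, dotProduct_smul, hsymm g x, ← hSg]
      simp only [smul_eq_mul]
      ring
    rw [hexp]
    by_cases hξ : ξ = 0
    · subst hξ
      have hx0 : x ≠ 0 := hx.resolve_right (by simp)
      simpa using hS'.dotProduct_mulVec_pos hx0
    · have h2 : 0 ≤ (x + ξ • g) ⬝ᵥ S'.mulVec (x + ξ • g) := by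
        simpa using hS'.posSemidef.dotProduct_mulVec_nonneg (x + ξ • g)
      have h3 : 0 < ξ ^ 2 * ((d - c ⬝ᵥ g) / δ) := by positivity
      linarith

/-- A matrix with nonzero leading principal minors, of known signs, becomes a signed diagonal times
a positive definite matrix after multiplication by a unit lower triangular matrix. -/
theorem exists_unitLower_mul_eq {m : ℕ} (K : Matrix (Fin m) (Fin m) ℝ) (δ : Fin m → ℝ)
    (hδ : ∀ i : Fin m, 0 < δ i * (leadingMinor K (i.val + 1) / leadingMinor K i.val)) :
    ∃ W S : Matrix (Fin m) (Fin m) ℝ, (∀ i, W i i = 1) ∧ (∀ i j, i < j → W i j = 0) ∧ S.PosDef ∧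
      W * K = Matrix.diagonal δ * S := by
  induction m with
  | zero =>
    refine ⟨1, 1, fun i => i.elim0, fun i => i.elim0, Matrix.PosDef.one, ?_⟩
    ext i
    exact i.elim0
  | succ m ih =>
    set K' := K.submatrix Fin.castSucc Fin.castSucc with hK'
    have hδ' : ∀ i : Fin m, 0 < δ i.castSucc *
        (leadingMinor K' (i.val + 1) / leadingMinor K' i.val) := by
      intro i
      rw [hK', leadingMinor_castSucc K (by omega), leadingMinor_castSucc K (by omega)]
      exact hδ i.castSucc
    obtain ⟨W', S', hW1, hW2, hS', hW⟩ := ih K' (fun i => δ i.castSucc) hδ'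
    set b : Fin m → ℝ := fun i => K i.castSucc (Fin.last m)
    set c : Fin m → ℝ := fun i => K (Fin.last m) i.castSucc
    set d : ℝ := K (Fin.last m) (Fin.last m)
    have hlast := hδ (Fin.last m)
    rw [Fin.val_last] at hlast
    have hdetK' : K'.det = leadingMinor K m := by
      rw [← leadingMinor_self, hK', leadingMinor_castSucc K le_rfl]
    have hK'unit : IsUnit K'.det := by
      rw [isUnit_iff_ne_zero, hdetK']
      intro h
      simp [h] at hlast
    -- The quotient of consecutive leading minors is the Schur complement `d - c ⬝ᵥ K'⁻¹ b`, the
    -- scalar whose sign the block step requires.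
    have hdetK : K.det = K'.det * (d - c ⬝ᵥ K'⁻¹.mulVec b) := by
      let e : Fin m ⊕ Unit ≃ Fin (m + 1) :=
        (Equiv.sumCongr (Equiv.refl _) (Equiv.ofUnique Unit (Fin 1))).trans finSumFinEquiv
      have hel : ∀ i, e (Sum.inl i) = i.castSucc := fun i => rfl
      have her : ∀ i, e (Sum.inr i) = Fin.last m := fun i => by
        ext
        simp [e]
      have hblock : K.submatrix e e =
          Matrix.fromBlocks K' (Matrix.replicateCol Unit b) (Matrix.replicateRow Unit c)
            (Matrix.of fun _ _ => d) := by
        ext i j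
        rcases i with i | i <;> rcases j with j | j <;>
          simp only [Matrix.submatrix_apply, hel, her, Matrix.fromBlocks_apply₁₁,
            Matrix.fromBlocks_apply₁₂, Matrix.fromBlocks_apply₂₁, Matrix.fromBlocks_apply₂₂] <;> rfl
      let _ : Invertible K' := K'.invertibleOfIsUnitDet hK'unit
      rw [← Matrix.det_submatrix_equiv_self e, hblock, Matrix.det_fromBlocks₁₁]
      congr 1
      rw [Matrix.det_unique]
      simp only [Matrix.sub_apply, Matrix.of_apply, Matrix.invOf_eq_nonsing_inv, Matrix.mul_assoc]
      rfl
    have hschur : 0 < δ (Fin.last m) * (d - c ⬝ᵥ K'⁻¹.mulVec b) := by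
      rw [leadingMinor_self, hdetK, ← hdetK', mul_div_cancel_left₀ _ hK'unit.ne_zero] at hlast
      exact hlast
    have hD' : IsUnit (Matrix.diagonal fun i : Fin m => δ i.castSucc).det := by
      rw [Matrix.det_diagonal, isUnit_iff_ne_zero, Finset.prod_ne_zero_iff]
      intro i _ h
      simpa [h] using hδ' i
    obtain ⟨w, s, σ, h1, h2, h3, h4⟩ := exists_factor_step hK'unit hD' hS' hW hschur
    let W : Matrix (Fin (m + 1)) (Fin (m + 1)) ℝ := Matrix.of
      (Fin.snoc (fun i => Fin.snoc (W' i) (0 : ℝ)) (Fin.snoc w (1 : ℝ)))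
    let S : Matrix (Fin (m + 1)) (Fin (m + 1)) ℝ := Matrix.of
      (Fin.snoc (fun i => Fin.snoc (S' i) (s i)) (Fin.snoc s σ))
    have hS't : ∀ i j, S' i j = S' j i := fun i j => by
      simpa using (hS'.isHermitian.apply i j).symm
    refine ⟨W, S, fun i => ?_, fun i j hij => ?_, ?_, ?_⟩
    · refine Fin.lastCases ?_ (fun i => ?_) i
      · simp [W]
      · simpa [W] using hW1 i
    · revert hij
      refine Fin.lastCases ?_ (fun i => ?_) i <;> refine Fin.lastCases ?_ (fun j => ?_) j
      · simp
      · intro h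
        exact absurd h (not_lt.2 (Fin.le_last _))
      · simp [W]
      · intro h
        simpa [W] using hW2 i j (by simpa using h)
    · refine Matrix.PosDef.of_dotProduct_mulVec_pos ?_ fun x hx => ?_
      · ext i j
        refine Fin.lastCases ?_ (fun i => ?_) i <;> refine Fin.lastCases ?_ (fun j => ?_) j <;>
          simp [S, Matrix.conjTranspose_apply]
        exact hS't _ _
      · have h5 := h4 (fun i => x i.castSucc) (x (Fin.last m)) (by
          by_contra! h
          apply hx
          ext i
          refine Fin.lastCases h.2 (fun i => congrFun h.1 i) i)
        have h6 : star x ⬝ᵥ S.mulVec x = (fun i => x i.castSucc) ⬝ᵥ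
            S'.mulVec (fun i => x i.castSucc) + 2 * x (Fin.last m) *
            ((fun i => x i.castSucc) ⬝ᵥ s) + x (Fin.last m) ^ 2 * σ := by
          simp only [dotProduct, Matrix.mulVec, Fin.sum_univ_castSucc, S, Matrix.of_apply,
            Fin.snoc_castSucc, Fin.snoc_last, star_trivial, mul_add, Finset.sum_add_distrib,
            Finset.mul_sum]
          have : ∀ i : Fin m, x i.castSucc * (s i * x (Fin.last m)) =
            x (Fin.last m) * (s i * x i.castSucc) := fun i => by ring
          simp only [this]
          have h7 : ∀ i : Fin m, 2 * x (Fin.last m) * (x i.castSucc * s i) =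
            x (Fin.last m) * (s i * x i.castSucc) + x (Fin.last m) * (s i * x i.castSucc) :=
              fun i => by ring
          simp only [h7, Finset.sum_add_distrib]
          ring
        rw [h6]
        exact h5
    · ext i j
      rw [Matrix.diagonal_mul, Matrix.mul_apply, Fin.sum_univ_castSucc]
      have hWij : ∀ i j, ∑ k, W' i k * K' k j = δ i.castSucc * S' i j := fun i j => by
        rw [← Matrix.mul_apply, hW, Matrix.diagonal_mul]
      refine Fin.lastCases ?_ (fun i => ?_) i <;> refine Fin.lastCases ?_ (fun j => ?_) j
      · simpa [W, S, dotProduct] using h3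
      · simpa [W, S, Matrix.vecMul, dotProduct, hK'] using congrFun h2 j
      · have := congrFun h1 i
        rw [Matrix.mulVec_diagonal] at this
        simpa [W, S, Matrix.mulVec, dotProduct] using this
      · simpa [W, S, hK'] using hWij i j

end PartialStateMRAC

namespace PartialStateMRAC

/-! ### Uniform bounds for families of signals -/

/-- `v = O(w)`, uniformly on the index set. -/
def UBd {ι : Type*} (w v : ι → ℝ) : Prop := ∃ C : ℝ, ∀ i, |v i| ≤ C * w i

section UBd

variable {ι : Type*} {w v v' : ι → ℝ}

theorem UBd.congr (h : UBd w v) (he : ∀ i, v' i = v i) : UBd w v' := by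
  obtain ⟨C, hC⟩ := h
  exact ⟨C, fun i => by rw [he]; exact hC i⟩

theorem UBd.zero : UBd w (fun _ => 0) := ⟨0, fun i => by simp⟩

theorem UBd.add (h : UBd w v) (h' : UBd w v') : UBd w fun i => v i + v' i := by
  obtain ⟨C, hC⟩ := h
  obtain ⟨C', hC'⟩ := h'
  exact ⟨C + C', fun i => (abs_add_le _ _).trans (by linarith [hC i, hC' i])⟩

theorem UBd.mul_bdd (h : UBd w v) (h' : UBd (fun _ => 1) v') : UBd w fun i => v' i * v i := by
  obtain ⟨C, hC⟩ := h
  obtain ⟨C', hC'⟩ := h'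
  refine ⟨|C'| * C, fun i => ?_⟩
  rw [abs_mul, mul_assoc]
  have h1 : |v' i| ≤ |C'| := (hC' i).trans (by simpa using le_abs_self C')
  exact mul_le_mul h1 (hC i) (abs_nonneg _) (abs_nonneg _)

theorem UBd.const_mul (c : ℝ) (h : UBd w v) : UBd w fun i => c * v i :=
  h.mul_bdd (v' := fun _ => c) ⟨|c|, fun _ => by simp⟩

theorem UBd.neg (h : UBd w v) : UBd w fun i => -v i :=
  (h.const_mul (-1)).congr fun i => by ring

theorem UBd.sub (h : UBd w v) (h' : UBd w v') : UBd w fun i => v i - v' i :=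
  (h.add h'.neg).congr fun i => by ring

theorem UBd.sum {α : Type*} (s : Finset α) {f : α → ι → ℝ} (h : ∀ a ∈ s, UBd w (f a)) :
    UBd w fun i => ∑ a ∈ s, f a i := by
  classical
  induction s using Finset.induction_on with
  | empty => simpa using UBd.zero
  | insert a s ha ih =>
    refine ((h a (Finset.mem_insert_self a s)).add
      (ih fun i hi => h i (Finset.mem_insert_of_mem hi))).congr fun i => ?_
    rw [Finset.sum_insert ha]

theorem UBd.mono {w' : ι → ℝ} (h : UBd w v) (hw : ∀ i, 0 ≤ w i) (hww : ∀ i, w i ≤ w' i) :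
    UBd w' v := by
  obtain ⟨C, hC⟩ := h
  refine ⟨|C|, fun i => (hC i).trans ?_⟩
  exact (mul_le_mul_of_nonneg_right (le_abs_self C) (hw i)).trans
    (mul_le_mul_of_nonneg_left (hww i) (abs_nonneg _))

theorem UBd.comp {κ : Type*} (h : UBd w v) (φ : κ → ι) : UBd (fun k => w (φ k)) fun k => v (φ k) := by
  obtain ⟨C, hC⟩ := h
  exact ⟨C, fun k => hC _⟩

theorem UBd.of_abs_le {c : ℝ} (h : ∀ i, |v i| ≤ c) : UBd (fun _ => 1) v :=
  ⟨c, fun i => by simpa using h i⟩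

theorem UBd.mulVec {a b : Type*} [Fintype b] {x : ι → b → ℝ} (Q : Matrix a b ℝ)
    (h : ∀ j, UBd w fun i => x i j) (k : a) : UBd w fun i => Q.mulVec (x i) k :=
  UBd.sum _ fun j _ => (h j).const_mul (Q k j)

end UBd

/-- Pairs of a member of a family of trajectories and a time in its interval of definition. -/
abbrev Times {J : Type*} (T : J → ℝ) : Type _ := {p : J × ℝ // 0 ≤ p.2 ∧ p.2 ≤ T p.1}

/-- `v` decays exponentially, uniformly on the family. -/
def UDecay {J : Type*} (T : J → ℝ) (v : J → ℝ → ℝ) : Prop :=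
  ∃ b : ℝ, 0 < b ∧ UBd (fun p : Times T => Real.exp (-b * p.1.2)) fun p => v p.1.1 p.1.2

section UDecay

variable {J : Type*} {T : J → ℝ} {v v' : J → ℝ → ℝ}

theorem UDecay.congr (h : UDecay T v) (he : ∀ j t, 0 ≤ t → t ≤ T j → v' j t = v j t) :
    UDecay T v' := by
  obtain ⟨b, hb, h⟩ := h
  exact ⟨b, hb, h.congr fun p => he _ _ p.2.1 p.2.2⟩

theorem UDecay.zero : UDecay T (fun _ _ => 0) := ⟨1, one_pos, UBd.zero⟩

theorem exp_mono_weight {b b' : ℝ} (hb : b' ≤ b) (p : Times T) :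
    Real.exp (-b * p.1.2) ≤ Real.exp (-b' * p.1.2) := by
  rw [Real.exp_le_exp]
  nlinarith [p.2.1]

theorem UDecay.add (h : UDecay T v) (h' : UDecay T v') : UDecay T fun j t => v j t + v' j t := by
  obtain ⟨b, hb, h⟩ := h
  obtain ⟨b', hb', h'⟩ := h'
  exact ⟨min b b', lt_min hb hb',
    (h.mono (fun _ => (Real.exp_pos _).le) (exp_mono_weight (min_le_left _ _))).add
      (h'.mono (fun _ => (Real.exp_pos _).le) (exp_mono_weight (min_le_right _ _)))⟩

theorem UDecay.const_mul (c : ℝ) (h : UDecay T v) : UDecay T fun j t => c * v j t := by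
  obtain ⟨b, hb, h⟩ := h
  exact ⟨b, hb, h.const_mul c⟩

theorem UDecay.neg (h : UDecay T v) : UDecay T fun j t => -v j t :=
  (h.const_mul (-1)).congr fun _ _ _ _ => by ring

theorem UDecay.sub (h : UDecay T v) (h' : UDecay T v') : UDecay T fun j t => v j t - v' j t :=
  (h.add h'.neg).congr fun _ _ _ _ => by ring

theorem UDecay.sum {α : Type*} (s : Finset α) {f : α → J → ℝ → ℝ} (h : ∀ a ∈ s, UDecay T (f a)) :
    UDecay T fun j t => ∑ a ∈ s, f a j t := by
  classical
  induction s using Finset.induction_on with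
  | empty => simpa using UDecay.zero
  | insert a s ha ih =>
    refine ((h a (Finset.mem_insert_self a s)).add
      (ih fun i hi => h i (Finset.mem_insert_of_mem hi))).congr fun j t _ _ => ?_
    rw [Finset.sum_insert ha]

theorem UDecay.mulVec {a b : Type*} [Fintype b] {x : J → ℝ → b → ℝ} (Q : Matrix a b ℝ)
    (h : ∀ i, UDecay T fun j t => x j t i) (k : a) : UDecay T fun j t => Q.mulVec (x j t) k :=
  UDecay.sum _ fun i _ => (h i).const_mul (Q k i)

end UDecay

/-! ### Filters on compact intervals -/

/-- The single-channel version of `FilterState` on `[0, T]`, without initial values. -/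
def FilterOn (T : ℝ) (p : ℝ[X]) (v : ℝ → ℝ) (q : ℝ → ℕ → ℝ) : Prop :=
  (∀ k < p.natDegree, HasRateOn T (fun t => q t k) (fun t => q t (k + 1))) ∧
  ∀ t, 0 ≤ t → t ≤ T → ∑ k ∈ Finset.range (p.natDegree + 1), p.coeff k * q t k = v t

section FilterOn

variable {T : ℝ} {p : ℝ[X]} {v v' : ℝ → ℝ} {q q' : ℝ → ℕ → ℝ}

theorem FilterOn.congr (h : FilterOn T p v q) (hv : ∀ t, 0 ≤ t → t ≤ T → v' t = v t)
    (hq : ∀ t, 0 ≤ t → t ≤ T → ∀ k ≤ p.natDegree, q' t k = q t k) : FilterOn T p v' q' := by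
  refine ⟨fun k hk => (h.1 k hk).congr (fun t ht htT => hq t ht htT k hk.le)
    (fun t ht htT => hq t ht htT (k + 1) hk), fun t ht htT => ?_⟩
  rw [hv t ht htT, ← h.2 t ht htT]
  refine Finset.sum_congr rfl fun k hk => ?_
  rw [hq t ht htT k (Nat.lt_succ_iff.1 (Finset.mem_range.1 hk))]

theorem FilterOn.const_mul (c : ℝ) (h : FilterOn T p v q) :
    FilterOn T p (fun t => c * v t) (fun t k => c * q t k) := by
  refine ⟨fun k hk => (h.1 k hk).const_mul c, fun t ht htT => ?_⟩
  change ∑ k ∈ Finset.range (p.natDegree + 1), p.coeff k * (c * q t k) = c * v t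
  rw [← h.2 t ht htT, Finset.mul_sum]
  exact Finset.sum_congr rfl fun k _ => by ring

theorem FilterOn.add (h : FilterOn T p v q) (h' : FilterOn T p v' q') :
    FilterOn T p (fun t => v t + v' t) (fun t k => q t k + q' t k) := by
  refine ⟨fun k hk => (h.1 k hk).add (h'.1 k hk), fun t ht htT => ?_⟩
  change ∑ k ∈ Finset.range (p.natDegree + 1), p.coeff k * (q t k + q' t k) = v t + v' t
  rw [← h.2 t ht htT, ← h'.2 t ht htT, ← Finset.sum_add_distrib]
  exact Finset.sum_congr rfl fun k _ => by ring

theorem FilterOn.sub (h : FilterOn T p v q) (h' : FilterOn T p v' q') :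
    FilterOn T p (fun t => v t - v' t) (fun t k => q t k - q' t k) :=
  (h.add (h'.const_mul (-1))).congr (fun _ _ _ => by ring) (fun _ _ _ _ _ => by ring)

theorem FilterOn.sum {α : Type*} (s : Finset α) {v : α → ℝ → ℝ} {q : α → ℝ → ℕ → ℝ}
    (h : ∀ a ∈ s, FilterOn T p (v a) (q a)) :
    FilterOn T p (fun t => ∑ a ∈ s, v a t) (fun t k => ∑ a ∈ s, q a t k) := by
  refine ⟨fun k hk => HasRateOn.sum s fun a ha => (h a ha).1 k hk, fun t ht htT => ?_⟩
  simp only [Finset.mul_sum]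
  rw [Finset.sum_comm]
  exact Finset.sum_congr rfl fun a ha => (h a ha).2 t ht htT

theorem FilterOn.mulVec {a b : Type*} [Fintype b] {v : ℝ → b → ℝ} {q : ℝ → b → ℕ → ℝ}
    (Q : Matrix a b ℝ) (h : ∀ j, FilterOn T p (fun t => v t j) (fun t => q t j)) (i : a) :
    FilterOn T p (fun t => Q.mulVec (v t) i) (fun t k => Q.mulVec (fun j => q t j k) i) :=
  FilterOn.sum _ fun j _ => (h j).const_mul (Q i j)

theorem FilterOn.top_eq (h : FilterOn T p v q) (hm : p.Monic) {t : ℝ} (ht : 0 ≤ t) (htT : t ≤ T) :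
    q t p.natDegree = v t - ∑ k ∈ Finset.range p.natDegree, p.coeff k * q t k := by
  rw [← h.2 t ht htT, Finset.sum_range_succ, hm.coeff_natDegree]
  ring

/-- The derivative of a filter state is a filter state for the derivative of the input. -/
theorem FilterOn.deriv (h : FilterOn T p v q) (hm : p.Monic) {g : ℝ → ℝ} (hv : HasRateOn T v g) :
    FilterOn T p g (fun t k => if k < p.natDegree then q t (k + 1) else
      g t - ∑ l ∈ Finset.range p.natDegree, p.coeff l * q t (l + 1)) := by
  refine ⟨fun k hk => ?_, fun t ht htT => ?_⟩
  · simp only [hk, if_true]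
    by_cases hk1 : k + 1 < p.natDegree
    · simp only [hk1, if_true]
      exact h.1 (k + 1) hk1
    · simp only [hk1, if_false]
      have hk2 : k + 1 = p.natDegree := by omega
      refine (hv.sub (HasRateOn.sum _ fun l hl =>
        (h.1 l (Finset.mem_range.1 hl)).const_mul (p.coeff l))).congr (fun t ht htT => ?_)
          fun t _ _ => rfl
      rw [hk2]
      exact h.top_eq hm ht htT
  · rw [Finset.sum_range_succ, hm.coeff_natDegree]
    simp only [lt_irrefl, if_false]
    have : ∑ k ∈ Finset.range p.natDegree, p.coeff k * (if k < p.natDegree then q t (k + 1) else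
        g t - ∑ l ∈ Finset.range p.natDegree, p.coeff l * q t (l + 1)) =
        ∑ k ∈ Finset.range p.natDegree, p.coeff k * q t (k + 1) :=
      Finset.sum_congr rfl fun k hk => by rw [if_pos (Finset.mem_range.1 hk)]
    rw [this]
    ring

end FilterOn

theorem hasRateOn_clm {E : Type*} [NormedAddCommGroup E] [NormedSpace ℝ E] [CompleteSpace E]
    {T : ℝ} {x g : ℝ → E} {x₀ : E}
    (h : ∀ t, 0 ≤ t → t ≤ T → IntervalIntegrable g volume 0 t ∧
      x t = x₀ + ∫ s in (0 : ℝ)..t, g s) (ℓ : E →L[ℝ] ℝ) :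
    HasRateOn T (fun t => ℓ (x t)) (fun t => ℓ (g t)) := by
  intro t ht htT
  obtain ⟨h1, h2⟩ := h t ht htT
  refine ⟨⟨ℓ.integrable_comp h1.1, ℓ.integrable_comp h1.2⟩, ?_⟩
  have h0 := (h 0 le_rfl (ht.trans htT)).2
  rw [intervalIntegral.integral_same, add_zero] at h0
  change ℓ (x t) = ℓ (x 0) + _
  rw [h2, h0, map_add, ℓ.intervalIntegral_comp_comm h1]

/-- Filters exist for bounded measurable inputs. -/
theorem exists_filterOn {p : ℝ[X]} (hm : p.Monic) {v : ℝ → ℝ} (hv : Measurable v) {B : ℝ}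
    (hB : ∀ t, 0 ≤ t → |v t| ≤ B) :
    ∃ q : ℝ → ℕ → ℝ, (∀ T, FilterOn T p v q) ∧ ∀ k < p.natDegree, q 0 k = 0 := by
  set N := p.natDegree with hN
  let e : ℝ → Fin N → ℝ := fun t k => if k.val + 1 < N then 0 else v t
  let L : (Fin N → ℝ) →L[ℝ] (Fin N → ℝ) := LinearMap.toContinuousLinearMap
    (companionMatrix p).mulVecLin
  have hLapp : ∀ z, L z = (companionMatrix p).mulVec z := fun z => rfl
  have hB0 : 0 ≤ B := (abs_nonneg _).trans (hB 0 le_rfl)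
  obtain ⟨z, hzc, hz⟩ := exists_integral_solution_of_lipschitz (E := Fin N → ℝ)
    (G := fun t z => L z + e t) (L := fun _ => ‖L‖ + B) continuous_const
    (fun t _ x y => by
      rw [add_sub_add_right_eq_sub, ← map_sub]
      refine (L.le_opNorm _).trans ?_
      exact mul_le_mul_of_nonneg_right (by linarith) (norm_nonneg _))
    (fun t ht => by
      rw [map_zero, zero_add]
      refine (pi_norm_le_iff_of_nonneg (by positivity)).2 fun k => ?_
      have := hB t ht
      simp only [e]
      split_ifs
      · simp; positivity
      · rw [Real.norm_eq_abs]; linarith [norm_nonneg L])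
    (fun x hx => by
      refine ((L.continuous.comp hx).aestronglyMeasurable).add ?_
      refine (measurable_pi_iff.2 fun k => ?_).aestronglyMeasurable
      simp only [e]
      split_ifs
      · exact measurable_const
      · exact hv) 0
  let q : ℝ → ℕ → ℝ := fun t k => if h : k < N then z t ⟨k, h⟩ else
    v t - ∑ j : Fin N, p.coeff j * z t j
  have hq : ∀ t (k : Fin N), q t k = z t k := fun t k => by simp [q]
  have hqN : ∀ t, q t N = v t - ∑ j : Fin N, p.coeff j * z t j := fun t => by simp [q]
  refine ⟨q, fun T => ⟨fun k hk => ?_, fun t _ _ => ?_⟩, fun k hk => ?_⟩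
  · have h1 := hasRateOn_clm (T := T) (fun t ht _ => hz t ht)
      (ContinuousLinearMap.proj (R := ℝ) (φ := fun _ : Fin N => ℝ) ⟨k, hk⟩)
    refine h1.congr (fun t _ _ => hq t ⟨k, hk⟩) fun t _ _ => ?_
    simp only [ContinuousLinearMap.proj_apply, Pi.add_apply, hLapp, e]
    by_cases hk1 : k + 1 < N
    · rw [companionMatrix_mulVec_of_lt p (z t) hk1, if_pos hk1, add_zero]
      exact hq t ⟨k + 1, hk1⟩
    · have hk2 : k + 1 = p.natDegree := by omega
      have h2 : q t (k + 1) = v t - ∑ j : Fin N, p.coeff j * z t j := by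
        rw [show k + 1 = N from hk2]
        exact hqN t
      rw [companionMatrix_mulVec_last p (z t) hk2, if_neg hk1, h2]
      ring
  · rw [Finset.sum_range_succ, hm.coeff_natDegree, ← hN, hqN, Finset.sum_range]
    simp only [hq]
    ring
  · have h0 := (hz 0 le_rfl).2
    rw [intervalIntegral.integral_same, add_zero] at h0
    have := hq 0 ⟨k, hk⟩
    simp only at this
    rw [this, h0]
    rfl

theorem integral_exp_mul_exp_le {a b t : ℝ} (hab : 2 * b < a) :
    ∫ s in (0 : ℝ)..t, Real.exp (-a * (t - s)) * Real.exp (-b * s) ^ 2 ≤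
      Real.exp (-b * t) ^ 2 / (a - 2 * b) := by
  have h1 : ∀ s, Real.exp (-a * (t - s)) * Real.exp (-b * s) ^ 2 =
      Real.exp (-a * t) * Real.exp ((a - 2 * b) * s) := by
    intro s
    rw [sq, ← Real.exp_add, ← Real.exp_add, ← Real.exp_add]
    congr 1
    ring
  have hpos : 0 < a - 2 * b := by linarith
  have h2 : ∫ s in (0 : ℝ)..t, Real.exp ((a - 2 * b) * s) =
      (Real.exp ((a - 2 * b) * t) - 1) / (a - 2 * b) := by
    rw [intervalIntegral.integral_comp_mul_left (fun x => Real.exp x) hpos.ne', integral_exp]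
    simp [div_eq_inv_mul]
  simp only [h1]
  rw [intervalIntegral.integral_const_mul, h2, ← mul_div_assoc]
  gcongr
  have h3 : Real.exp (-b * t) ^ 2 = Real.exp (-a * t) * Real.exp ((a - 2 * b) * t) := by
    rw [sq, ← Real.exp_add, ← Real.exp_add]
    congr 1
    ring
  rw [h3, mul_sub]
  linarith [Real.exp_pos (-a * t)]

/-- Stable filters preserve uniform exponential decay. -/
theorem UDecay.filter {J : Type*} {T : J → ℝ} {p : ℝ[X]} (hm : p.Monic) (hp : StablePoly p)
    {v : J → ℝ → ℝ} {q : J → ℝ → ℕ → ℝ} (hq : ∀ j, FilterOn (T j) p (v j) (q j))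
    (hv : UDecay T v) (h0 : ∀ k < p.natDegree, UBd (fun _ : J => 1) fun j => q j 0 k)
    {k : ℕ} (hk : k ≤ p.natDegree) : UDecay T fun j t => q j t k := by
  obtain ⟨K, a, hK, ha, hb⟩ := exists_filter_bound hm hp
  have hlow : ∀ k < p.natDegree, UDecay T fun j t => q j t k := by
    intro k hk
    obtain ⟨b, hbpos, hvb⟩ := hv
    -- The rate is lowered so that `2 b' < a`: squares decaying with rate `2 b'` keep this rate when
    -- convolved with `exp (-a ·)`, at the price of `1 / (a - 2 b')`.
    set b' := min b (a / 4) with hb'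
    have hb'pos : 0 < b' := lt_min hbpos (by positivity)
    have hb'a : 2 * b' < a := by
      have := min_le_right b (a / 4)
      linarith
    obtain ⟨C, hC⟩ := hvb.mono (fun _ => (Real.exp_pos _).le)
      (exp_mono_weight (min_le_left b (a / 4)))
    choose! D hD using h0
    set Q := ∑ k ∈ Finset.range p.natDegree, D k ^ 2 with hQ
    have hQ0 : 0 ≤ Q := Finset.sum_nonneg fun _ _ => sq_nonneg _
    have hgap : 0 < a - 2 * b' := by linarith
    refine ⟨b', hb'pos, Real.sqrt (K * (Q + C ^ 2 / (a - 2 * b'))), fun ⟨⟨j, t⟩, ht, htT⟩ => ?_⟩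
    simp only at ht htT ⊢
    have hbound := hb (T j) (q j) (fun _ _ => 0) (v j)
      (fun s => C ^ 2 * Real.exp (-b' * s) ^ 2)
      (fun k hk => by simpa using (hq j).1 k hk) (hq j).2
      (fun t _ _ => (by fun_prop : Continuous fun s : ℝ =>
        C ^ 2 * Real.exp (-b' * s) ^ 2).intervalIntegrable _ _)
      (fun t ht htT => by
        have := hC ⟨⟨j, t⟩, ht, htT⟩
        simp only at this
        simp only [ne_eq, OfNat.ofNat_ne_zero, not_false_eq_true, zero_pow, Finset.sum_const_zero,
          add_zero]
        rw [← sq_abs, ← mul_pow]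
        exact pow_le_pow_left₀ (abs_nonneg _) this 2) t ht htT k hk
    have hinit : ∑ k ∈ Finset.range p.natDegree, q j 0 k ^ 2 ≤ Q := by
      refine Finset.sum_le_sum fun k hk => ?_
      have := hD k (Finset.mem_range.1 hk) j
      rw [mul_one] at this
      rw [← sq_abs]
      exact pow_le_pow_left₀ (abs_nonneg _) this 2
    have hint : ∫ s in (0 : ℝ)..t, Real.exp (-a * (t - s)) * (C ^ 2 * Real.exp (-b' * s) ^ 2) ≤
        C ^ 2 / (a - 2 * b') * Real.exp (-b' * t) ^ 2 := by
      have h1 : ∀ s, Real.exp (-a * (t - s)) * (C ^ 2 * Real.exp (-b' * s) ^ 2) =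
        C ^ 2 * (Real.exp (-a * (t - s)) * Real.exp (-b' * s) ^ 2) := fun s => by ring
      simp only [h1]
      rw [intervalIntegral.integral_const_mul]
      refine (mul_le_mul_of_nonneg_left (integral_exp_mul_exp_le hb'a) (sq_nonneg C)).trans ?_
      rw [← mul_div_assoc, div_mul_eq_mul_div]
    have hexp : Real.exp (-a * t) ≤ Real.exp (-b' * t) ^ 2 := by
      rw [sq, ← Real.exp_add, Real.exp_le_exp]
      nlinarith
    have hfin : q j t k ^ 2 ≤
        K * (Q + C ^ 2 / (a - 2 * b')) * Real.exp (-b' * t) ^ 2 := by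
      refine hbound.trans ?_
      rw [mul_assoc]
      refine mul_le_mul_of_nonneg_left ?_ hK.le
      rw [add_mul]
      refine add_le_add ?_ hint
      rw [mul_comm Q]
      exact mul_le_mul hexp hinit (Finset.sum_nonneg fun _ _ => sq_nonneg _) (sq_nonneg _)
    refine abs_le_of_sq_le_sq ?_ (by positivity)
    rw [mul_pow, Real.sq_sqrt (by positivity)]
    exact hfin
  rcases hk.lt_or_eq with hk | rfl
  · exact hlow k hk
  · refine (hv.sub (UDecay.sum (Finset.range p.natDegree) fun k hk =>
      (hlow k (Finset.mem_range.1 hk)).const_mul (p.coeff k))).congr fun j t ht htT => ?_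
    exact (hq j).top_eq hm ht htT

/-! ### Filtered plants -/

/-- Variation of constants for successive derivatives, with the sums exchanged so that free motion
and inputs separate. It serves twice: with `∑ Q_k A ^ k = 0`, which removes the state, and with `Q_k
= ξ_k C`, where the coefficient of the free motion is `R`. -/
theorem sum_mulVec_power {n m : ℕ} {A : Matrix (Fin n) (Fin n) ℝ} {N : ℕ} {P G : ℕ → Fin n → ℝ}
    (hP : ∀ k ≤ N, P k = (A ^ k).mulVec (P 0) +
      ∑ l ∈ Finset.range k, (A ^ (k - 1 - l)).mulVec (G l)) (Q : ℕ → Matrix (Fin m) (Fin n) ℝ) :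
    ∑ k ∈ Finset.range (N + 1), (Q k).mulVec (P k) =
      (∑ k ∈ Finset.range (N + 1), Q k * A ^ k).mulVec (P 0) +
      ∑ l ∈ Finset.range (N + 1), (∑ k ∈ Finset.range (N + 1),
        if l < k then Q k * A ^ (k - 1 - l) else 0).mulVec (G l) := by
  simp only [Matrix.sum_mulVec]
  rw [Finset.sum_comm (f := fun l k =>
    (if l < k then Q k * A ^ (k - 1 - l) else 0).mulVec (G l)), ← Finset.sum_add_distrib]
  refine Finset.sum_congr rfl fun k hk => ?_
  have hk' := Finset.mem_range.1 hk
  conv_lhs => rw [hP k (by omega)]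
  rw [Matrix.mulVec_add, Matrix.mulVec_mulVec, sum_range_ite_lt k (N + 1) hk'.le,
    Matrix.mulVec_sum]
  congr 1
  refine Finset.sum_congr rfl fun l _ => ?_
  split_ifs
  · rw [Matrix.mulVec_mulVec]
  · simp

/-- Filtering state and input of a plant by the same stable filter gives, up to exponentially
decaying terms, a solution of the plant equation. -/
theorem exists_filtered_plant {J : Type*} {T : J → ℝ} (hT : ∀ j, 0 ≤ T j) {p : ℝ[X]} (hm : p.Monic)
    (hp : StablePoly p) {n m : ℕ} (A : Matrix (Fin n) (Fin n) ℝ) (B : Matrix (Fin n) (Fin m) ℝ)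
    {x : J → ℝ → Fin n → ℝ} {u : J → ℝ → Fin m → ℝ} {U : J → ℝ → Fin m → ℕ → ℝ}
    (hx : ∀ j i, HasRateOn (T j) (fun t => x j t i)
      (fun t => (A.mulVec (x j t) + B.mulVec (u j t)) i))
    (hx0 : ∀ i, UBd (fun _ : J => 1) fun j => x j 0 i)
    (hU : ∀ j i, FilterOn (T j) p (fun t => u j t i) (fun t => U j t i))
    (hU0 : ∀ i, ∀ k < p.natDegree, UBd (fun _ : J => 1) fun j => U j 0 i k) :
    ∃ P S : J → ℝ → Fin n → ℕ → ℝ,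
      (∀ j i, FilterOn (T j) p (fun t => x j t i) (fun t => P j t i)) ∧
      (∀ j i, ∀ k < p.natDegree, P j 0 i k = 0) ∧
      (∀ i, ∀ k ≤ p.natDegree, UDecay T fun j t => S j t i k) ∧
      ∀ j t, 0 ≤ t → t ≤ T j → ∀ k ≤ p.natDegree,
        (fun i => P j t i k) = (A ^ k).mulVec (fun i => P j t i 0) +
          ∑ l ∈ Finset.range k, (A ^ (k - 1 - l)).mulVec
            (B.mulVec (fun i => U j t i l) + fun i => S j t i l) := by
  -- These filters of the unmeasured state are auxiliary and start at rest. Outside `[0, T j]`,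
  -- where nothing is known of `x j`, it is replaced by its values at the end points to obtain a
  -- bounded measurable input.
  have hex : ∀ j i, ∃ q : ℝ → ℕ → ℝ, FilterOn (T j) p (fun t => x j t i) q ∧
      ∀ k < p.natDegree, q 0 k = 0 := by
    intro j i
    have hc : Continuous fun t => x j (Set.projIcc 0 (T j) (hT j) t) i := by
      have h1 := (hx j i).continuousOn
      exact h1.comp_continuous (continuous_subtype_val.comp continuous_projIcc) fun t =>
        (Set.projIcc 0 (T j) (hT j) t).2
    obtain ⟨C, hC⟩ := (isCompact_Icc (a := (0 : ℝ)) (b := T j)).exists_bound_of_continuousOn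
      (hx j i).continuousOn
    obtain ⟨q, hq, hq0⟩ := exists_filterOn hm hc.measurable (B := C) fun t _ => by
      exact hC _ (Set.projIcc 0 (T j) (hT j) t).2
    refine ⟨q, (hq (T j)).congr (fun t ht htT => ?_) fun _ _ _ _ _ => rfl, hq0⟩
    rw [Set.projIcc_of_mem (hT j) ⟨ht, htT⟩]
  choose P hP hP0 using hex
  have hd := fun j i => (hP j i).deriv hm (hx j i)
  set P' : J → ℝ → Fin n → ℕ → ℝ := fun j t i k => if k < p.natDegree then P j i t (k + 1) else
    (A.mulVec (x j t) + B.mulVec (u j t)) i -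
      ∑ l ∈ Finset.range p.natDegree, p.coeff l * P j i t (l + 1) with hP'
  -- Filtering both sides of `ẋ = A x + B u` by the same filter, the defect of the plant equation is
  -- a filter state with zero input. It depends on initial values only, hence decays, uniformly
  -- because these are bounded over the family.
  have hS : ∀ j i, FilterOn (T j) p (fun _ => 0) (fun t k => P' j t i k -
      (A.mulVec (fun i => P j i t k) i + B.mulVec (fun i => U j t i k) i)) := by
    intro j i
    refine ((hd j i).sub ((FilterOn.mulVec (q := fun t i k => P j i t k) A (hP j) i).add
      (FilterOn.mulVec B (hU j) i))).congr (fun t _ _ => ?_) (fun t _ _ k _ => rfl)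
    simp
  have hPx0 : ∀ i, UBd (fun _ : J => 1) fun j => P j i 0 p.natDegree := by
    intro i
    refine (hx0 i).congr fun j => ?_
    rw [(hP j i).top_eq hm le_rfl (hT j), Finset.sum_eq_zero, sub_zero]
    intro k hk
    rw [hP0 j i k (Finset.mem_range.1 hk), mul_zero]
  have hPk0 : ∀ i, ∀ k ≤ p.natDegree, UBd (fun _ : J => 1) fun j => P j i 0 k := by
    intro i k hk
    rcases hk.lt_or_eq with hk | rfl
    · exact UBd.zero.congr fun j => hP0 j i k hk
    · exact hPx0 i
  refine ⟨fun j t i k => P j i t k, fun j t i k => P' j t i k -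
      (A.mulVec (fun i => P j i t k) i + B.mulVec (fun i => U j t i k) i), hP, hP0,
      fun i k hk => UDecay.filter hm hp (fun j => hS j i) UDecay.zero (fun k hk => ?_) hk, ?_⟩
  · refine UBd.sub ?_ (UBd.add (UBd.mulVec A (fun i => hPk0 i k hk.le) i)
      (UBd.mulVec B (fun i => hU0 i k hk) i))
    exact (hPk0 i (k + 1) hk).congr fun j => by simp [hP', hk]
  · intro j t ht htT k
    induction k with
    | zero => simp
    | succ k ih =>
      intro hk
      have h1 : (fun i => P j i t (k + 1)) = A.mulVec (fun i => P j i t k) +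
          (B.mulVec (fun i => U j t i k) + fun i => P' j t i k -
          (A.mulVec (fun i => P j i t k) i + B.mulVec (fun i => U j t i k) i)) := by
        ext i
        simp only [Pi.add_apply, hP', show k < p.natDegree from hk, if_true]
        ring
      have hA : A.mulVec (fun i => P j i t k) = (A ^ (k + 1)).mulVec (fun i => P j i t 0) +
          ∑ l ∈ Finset.range k, (A ^ (k + 1 - 1 - l)).mulVec
            (B.mulVec (fun i => U j t i l) + fun i => P' j t i l -
              (A.mulVec (fun i => P j i t l) i + B.mulVec (fun i => U j t i l) i)) := by
        conv_lhs => rw [ih (by omega)]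
        rw [Matrix.mulVec_add, Matrix.mulVec_mulVec, ← pow_succ', Matrix.mulVec_sum]
        congr 1
        refine Finset.sum_congr rfl fun l hl => ?_
        have := Finset.mem_range.1 hl
        rw [Matrix.mulVec_mulVec, ← pow_succ', show k - 1 - l + 1 = k + 1 - 1 - l by omega]
      rw [Finset.sum_range_succ, ← add_assoc, ← hA, h1]
      simp

end PartialStateMRAC

namespace PartialStateMRAC

/-! ### Differential operators applied to filter states -/

/-- `g(d/dt) q`, for a sequence `q` of successive derivatives. -/
noncomputable def polyOp (q : ℕ → ℝ) : ℝ[X] →ₗ[ℝ] ℝ :=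
  Polynomial.lsum fun k => LinearMap.mulRight ℝ (q k)

theorem polyOp_apply (q : ℕ → ℝ) (g : ℝ[X]) : polyOp q g = g.sum fun k x => x * q k := by
  simp [polyOp, Polynomial.lsum_apply]

theorem polyOp_eq_sum (q : ℕ → ℝ) {g : ℝ[X]} {N : ℕ} (h : g.natDegree ≤ N) :
    polyOp q g = ∑ k ∈ Finset.range (N + 1), g.coeff k * q k := by
  rw [polyOp_apply, Polynomial.sum_over_range' g (f := fun k x => x * q k) (fun k => zero_mul (q k)) _
    (Nat.lt_succ_of_le h)]

theorem polyOp_X_pow (q : ℕ → ℝ) (k : ℕ) : polyOp q (X ^ k) = q k := by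
  rw [polyOp_apply, ← Polynomial.monomial_one_right_eq_X_pow,
    Polynomial.sum_monomial_index (1 : ℝ) (fun k (x : ℝ) => x * q k) (zero_mul (q k)), one_mul]

theorem polyOp_mul (q : ℕ → ℝ) {g : ℝ[X]} {N : ℕ} (h : g.natDegree ≤ N) (g' : ℝ[X]) :
    polyOp q (g * g') = ∑ k ∈ Finset.range (N + 1), g.coeff k * polyOp q (X ^ k * g') := by
  conv_lhs => rw [g.as_sum_range' (N + 1) (Nat.lt_succ_of_le h), Finset.sum_mul, map_sum]
  refine Finset.sum_congr rfl fun k _ => ?_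
  rw [← C_mul_X_pow_eq_monomial, mul_assoc, ← smul_eq_C_mul, map_smul, smul_eq_mul]

theorem HasRateOn.polyOp {T : ℝ} {q : ℝ → ℕ → ℝ} {N : ℕ}
    (h : ∀ k < N, HasRateOn T (fun t => q t k) (fun t => q t (k + 1))) {g : ℝ[X]}
    (hg : g.natDegree < N) :
    HasRateOn T (fun t => polyOp (q t) g) (fun t => polyOp (q t) (X * g)) := by
  refine (HasRateOn.sum (Finset.range N) fun k hk =>
    (h k (Finset.mem_range.1 hk)).const_mul (g.coeff k)).congr (fun t _ _ => ?_) fun t _ _ => ?_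
  · rw [polyOp_eq_sum (q t) (Nat.le_sub_one_of_lt hg), Nat.sub_add_cancel (by omega)]
  · have : (X * g).natDegree ≤ N := (natDegree_mul_le).trans (by rw [natDegree_X]; omega)
    rw [polyOp_eq_sum (q t) this, Finset.sum_range_succ']
    simp

/-- Filtering by `1 / (f p)` and applying `g(d/dt)` is filtering `(f g / (f p))[v]` by `1 / f`. -/
theorem FilterOn.subfilter {T : ℝ} {f p g : ℝ[X]} {v : ℝ → ℝ} {Z : ℝ → ℕ → ℝ}
    (h : FilterOn T (f * p) v Z) (hf : f.Monic) (hp : p.Monic) (hg : g.natDegree ≤ p.natDegree) :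
    FilterOn T f (fun t => polyOp (Z t) (f * g)) (fun t k => polyOp (Z t) (X ^ k * g)) := by
  have hd : (f * p).natDegree = f.natDegree + p.natDegree := hf.natDegree_mul hp
  refine ⟨fun k hk => ?_, fun t _ _ => ?_⟩
  · have h1 : (X ^ k * g).natDegree < (f * p).natDegree := by
      have := natDegree_mul_le (p := (X : ℝ[X]) ^ k) (q := g)
      rw [natDegree_X_pow] at this
      omega
    refine (HasRateOn.polyOp h.1 h1).congr (fun _ _ _ => rfl) fun t _ _ => ?_
    rw [← mul_assoc, ← pow_succ']
  · exact (polyOp_mul (Z t) le_rfl g).symm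

theorem FilterOn.polyOp_eq {T : ℝ} {p : ℝ[X]} {v : ℝ → ℝ} {q : ℝ → ℕ → ℝ} (h : FilterOn T p v q)
    {t : ℝ} (ht : 0 ≤ t) (htT : t ≤ T) : polyOp (q t) p = v t := by
  rw [polyOp_eq_sum (q t) le_rfl]
  exact h.2 t ht htT

/-! ### The closed loop on a compact interval -/

/-- `FilterOutput` on `[0, T]`. -/
structure FilterOutputOn {a b : Type} [Fintype b] (T : ℝ) (N : Matrix a b ℝ[X]) (p : ℝ[X])
    (c : b → ℕ → ℝ) (v : ℝ → b → ℝ) (q : ℝ → b → ℕ → ℝ) (w : ℝ → a → ℝ) : Prop where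
  filter : ∀ j, FilterOn T p (fun t => v t j) (fun t => q t j)
  init : ∀ j, ∀ k < p.natDegree, q 0 j k = c j k
  out : ∀ t, 0 ≤ t → t ≤ T → ∀ i, w t i = ∑ j, polyOp (q t j) (N i j)

theorem FilterOutput.on {a b : Type} [Fintype b] {N : Matrix a b ℝ[X]} {p : ℝ[X]}
    {c : b → ℕ → ℝ} {v : ℝ → b → ℝ} {q : ℝ → b → ℕ → ℝ} {w : ℝ → a → ℝ}
    (h : FilterOutput N p c v q w) (T : ℝ) : FilterOutputOn T N p c v q w where
  filter j := ⟨fun k hk => (h.1.1 j k hk).1.hasRateOn T, fun t ht _ => h.1.2 t ht j⟩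
  init j k hk := (h.1.1 j k hk).2
  out t ht _ i := by simp only [polyOp_apply]; exact h.2 t ht i

theorem filterOutput_of_on {a b : Type} [Fintype b] {N : Matrix a b ℝ[X]} {p : ℝ[X]}
    {c : b → ℕ → ℝ} {v : ℝ → b → ℝ} {q : ℝ → b → ℕ → ℝ} {w : ℝ → a → ℝ}
    (h : ∀ T, 0 ≤ T → FilterOutputOn T N p c v q w) : FilterOutput N p c v q w :=
  ⟨⟨fun j k hk => ⟨hasRate_of_hasRateOn fun T hT => ((h T hT).filter j).1 k hk, (h 0 le_rfl).init j k hk⟩,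
    fun t ht j => ((h t ht).filter j).2 t ht le_rfl⟩, fun t ht i => by
      simp only [← polyOp_apply]; exact (h t ht).out t ht le_rfl i⟩

/-- The closed loop on `[0, T]`. -/
structure IsClosedLoopOn {M n n₀ : ℕ} (T : ℝ) (A : Matrix (Fin n) (Fin n) ℝ)
    (B : Matrix (Fin n) (Fin M) ℝ) (C : Matrix (Fin M) (Fin n) ℝ) (C₀ : Matrix (Fin n₀) (Fin n) ℝ)
    (D : Design M n n₀) (r : ℝ → Fin M → ℝ) (I : InitialData M n n₀) (σ : Signals M n n₀) :
    Prop where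
  nonneg : 0 ≤ T
  state : ∀ i, HasRateOn T (fun t => σ.x t i) (fun t => (A.mulVec (σ.x t) + B.mulVec (σ.u t)) i)
  output : ∀ t, 0 ≤ t → t ≤ T → σ.y t = C.mulVec (σ.x t)
  partialState : ∀ t, 0 ≤ t → t ≤ T → σ.y₀ t = C₀.mulVec (σ.x t)
  reference : FilterOutputOn T D.ξ.adjugate D.ξ.det I.c_r r σ.q_r σ.y_m
  error : ∀ t, 0 ≤ t → t ≤ T → σ.e t = σ.y t - σ.y_m t
  filter₁ : FilterOutputOn T (powerStack (n - n₀) M) D.Lam I.c_u σ.u σ.q_u σ.ω₁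
  filter₂ : FilterOutputOn T (powerStack (n - n₀) n₀) D.Lam I.c_y₀ σ.y₀ σ.q_y₀ σ.ω₂
  regressor : ∀ t, 0 ≤ t → t ≤ T →
    σ.ω t = Sum.elim (σ.ω₁ t) (Sum.elim (σ.ω₂ t) (Sum.elim (σ.y₀ t) (r t)))
  control : ∀ t, 0 ≤ t → t ≤ T → σ.u t = (σ.Θ t).transpose.mulVec (σ.ω t)
  filter_e : FilterOutputOn T D.ξ D.f I.c_e σ.e σ.q_e σ.ebar
  eta : ∀ t, 0 ≤ t → t ≤ T → ∀ i j, σ.η t i j = σ.ebar t (Fin.castLE i.isLt.le j)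
  filter_ω : FilterOutputOn T 1 D.f I.c_ω σ.ω σ.q_ω σ.ζ
  filter_Θω : FilterOutputOn T 1 D.f I.c_Θω (fun t => (σ.Θ t).transpose.mulVec (σ.ω t))
    σ.q_Θω σ.hΘω
  xi : ∀ t, 0 ≤ t → t ≤ T → σ.Xi t = (σ.Θ t).transpose.mulVec (σ.ζ t) - σ.hΘω t
  eps : ∀ t, 0 ≤ t → t ≤ T → ∀ i,
    σ.ε t i = dotProduct (σ.θ t i) (σ.η t i) + (σ.Ψ t).mulVec (σ.Xi t) i + σ.ebar t i
  normalization : ∀ t, 0 ≤ t → t ≤ T → σ.msq t = 1 + dotProduct (σ.ζ t) (σ.ζ t) +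
    dotProduct (σ.Xi t) (σ.Xi t) + ∑ i, dotProduct (σ.η t i) (σ.η t i)
  law_θ : ∀ i j, HasRateOn T (fun t => σ.θ t i j)
    (fun t => -((D.Γθ i).mulVec (σ.ε t i • σ.η t i) j) / σ.msq t)
  law_Θ : ∀ a i, HasRateOn T (fun t => σ.Θ t a i)
    (fun t => -((D.Ds * Matrix.vecMulVec (σ.ε t) (σ.ζ t)) i a) / σ.msq t)
  law_Ψ : ∀ i j, HasRateOn T (fun t => σ.Ψ t i j)
    (fun t => -((D.Γ * Matrix.vecMulVec (σ.ε t) (σ.Xi t)) i j) / σ.msq t)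
  init_x : σ.x 0 = I.x
  init_Θ : σ.Θ 0 = stack I.Θ₁ I.Θ₂ I.Θ₂₀ I.Θ₃
  init_θ : σ.θ 0 = I.θ
  init_Ψ : σ.Ψ 0 = I.Ψ

theorem transpose_stack_mulVec {M n n₀ : ℕ} (Θ₁ : Matrix (Fin (n - n₀) × Fin M) (Fin M) ℝ)
    (Θ₂ : Matrix (Fin (n - n₀) × Fin n₀) (Fin M) ℝ) (Θ₂₀ : Matrix (Fin n₀) (Fin M) ℝ)
    (Θ₃ : Matrix (Fin M) (Fin M) ℝ) (w₁ : Fin (n - n₀) × Fin M → ℝ)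
    (w₂ : Fin (n - n₀) × Fin n₀ → ℝ) (w₃ : Fin n₀ → ℝ) (w₄ : Fin M → ℝ) :
    (stack Θ₁ Θ₂ Θ₂₀ Θ₃).transpose.mulVec (Sum.elim w₁ (Sum.elim w₂ (Sum.elim w₃ w₄))) =
      Θ₁.transpose.mulVec w₁ + Θ₂.transpose.mulVec w₂ + Θ₂₀.transpose.mulVec w₃ +
        Θ₃.mulVec w₄ := by
  rw [stack, Matrix.transpose_fromRows, Matrix.transpose_fromRows, Matrix.transpose_fromRows,
    Matrix.fromCols_mulVec_sumElim, Matrix.fromCols_mulVec_sumElim, Matrix.fromCols_mulVec_sumElim,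
    Matrix.transpose_transpose, add_assoc, add_assoc]

section

variable {M n n₀ : ℕ} {A : Matrix (Fin n) (Fin n) ℝ} {B : Matrix (Fin n) (Fin M) ℝ}
  {C : Matrix (Fin M) (Fin n) ℝ} {C₀ : Matrix (Fin n₀) (Fin n) ℝ} {D : Design M n n₀}
  {r : ℝ → Fin M → ℝ} {I : InitialData M n n₀}

theorem IsClosedLoop.on {σ : Signals M n n₀} (h : IsClosedLoop A B C C₀ D r I σ) {T : ℝ}
    (hT : 0 ≤ T) : IsClosedLoopOn T A B C C₀ D r I σ where
  nonneg := hT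
  state i := (h.state i).hasRateOn T
  output t ht _ := h.output t ht
  partialState t ht _ := h.partialState t ht
  reference := h.reference.on T
  error t ht _ := h.error t ht
  filter₁ := h.filter₁.on T
  filter₂ := h.filter₂.on T
  regressor t ht _ := h.regressor t ht
  control t ht _ := by
    rw [h.control t ht, h.regressor t ht, Signals.Θ, transpose_stack_mulVec]
  filter_e := h.filter_e.on T
  eta t ht _ := h.eta t ht
  filter_ω := h.filter_ω.on T
  filter_Θω := h.filter_Θω.on T
  xi t ht _ := h.xi t ht
  eps t ht _ := h.eps t ht
  normalization t ht _ := h.normalization t ht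
  law_θ i j := (h.law_θ i j).hasRateOn T
  law_Θ i j := (h.law_Θ i j).hasRateOn T
  law_Ψ i j := (h.law_Ψ i j).hasRateOn T
  init_x := h.init_x
  init_Θ := by rw [Signals.Θ, h.init_Θ₁, h.init_Θ₂, h.init_Θ₂₀, h.init_Θ₃]
  init_θ := h.init_θ
  init_Ψ := h.init_Ψ

theorem isClosedLoop_of_on {σ : Signals M n n₀}
    (h : ∀ T, 0 ≤ T → IsClosedLoopOn T A B C C₀ D r I σ) : IsClosedLoop A B C C₀ D r I σ where
  state i := hasRate_of_hasRateOn fun T hT => (h T hT).state i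
  output t ht := (h t ht).output t ht le_rfl
  partialState t ht := (h t ht).partialState t ht le_rfl
  reference := filterOutput_of_on fun T hT => (h T hT).reference
  error t ht := (h t ht).error t ht le_rfl
  filter₁ := filterOutput_of_on fun T hT => (h T hT).filter₁
  filter₂ := filterOutput_of_on fun T hT => (h T hT).filter₂
  regressor t ht := (h t ht).regressor t ht le_rfl
  control t ht := by
    rw [(h t ht).control t ht le_rfl, (h t ht).regressor t ht le_rfl, Signals.Θ,
      transpose_stack_mulVec]
  filter_e := filterOutput_of_on fun T hT => (h T hT).filter_e
  eta t ht := (h t ht).eta t ht le_rfl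
  filter_ω := filterOutput_of_on fun T hT => (h T hT).filter_ω
  filter_Θω := filterOutput_of_on fun T hT => (h T hT).filter_Θω
  xi t ht := (h t ht).xi t ht le_rfl
  eps t ht := (h t ht).eps t ht le_rfl
  normalization t ht := (h t ht).normalization t ht le_rfl
  law_θ i j := hasRate_of_hasRateOn fun T hT => (h T hT).law_θ i j
  law_Θ i j := hasRate_of_hasRateOn fun T hT => (h T hT).law_Θ i j
  law_Ψ i j := hasRate_of_hasRateOn fun T hT => (h T hT).law_Ψ i j
  init_x := (h 0 le_rfl).init_x
  init_Θ₁ := by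
    have := (h 0 le_rfl).init_Θ
    ext a b
    exact congrFun (congrFun this (Sum.inl a)) b
  init_Θ₂ := by
    have := (h 0 le_rfl).init_Θ
    ext a b
    exact congrFun (congrFun this (Sum.inr (Sum.inl a))) b
  init_Θ₂₀ := by
    have := (h 0 le_rfl).init_Θ
    ext a b
    exact congrFun (congrFun this (Sum.inr (Sum.inr (Sum.inl a)))) b
  init_Θ₃ := by
    have := (h 0 le_rfl).init_Θ
    ext a b
    exact congrFun (congrFun this (Sum.inr (Sum.inr (Sum.inr b)))) a
  init_θ := (h 0 le_rfl).init_θ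
  init_Ψ := (h 0 le_rfl).init_Ψ

end

end PartialStateMRAC

namespace PartialStateMRAC

/-! ### The error model -/

theorem UBd.of_eq {ι : Type*} {v : ι → ℝ} (c : ℝ) (h : ∀ i, v i = c) : UBd (fun _ => 1) v :=
  ⟨|c|, fun i => by rw [h, mul_one]⟩

theorem sum_polyOp_powerStack {N m : ℕ} (q : Fin m → ℕ → ℝ) (lj : Fin N × Fin m) :
    ∑ j, polyOp (q j) (powerStack N m lj j) = q lj.2 lj.1 := by
  rw [Finset.sum_eq_single lj.2]
  · simp [powerStack, polyOp_X_pow]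
  · intro j _ hj
    simp [powerStack, hj.symm]
  · simp

theorem FilterOutputOn.out_powerStack {T : ℝ} {N m : ℕ} {p : ℝ[X]} {c : Fin m → ℕ → ℝ}
    {v : ℝ → Fin m → ℝ} {q : ℝ → Fin m → ℕ → ℝ} {w : ℝ → Fin N × Fin m → ℝ}
    (h : FilterOutputOn T (powerStack N m) p c v q w) {t : ℝ} (ht : 0 ≤ t) (htT : t ≤ T)
    (kj : Fin N × Fin m) : w t kj = q t kj.2 kj.1 := by
  rw [h.out t ht htT, sum_polyOp_powerStack]

theorem FilterOutputOn.out_one {T : ℝ} {a : Type} [Fintype a] [DecidableEq a] {p : ℝ[X]}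
    {c : a → ℕ → ℝ} {v : ℝ → a → ℝ} {q : ℝ → a → ℕ → ℝ} {w : ℝ → a → ℝ}
    (h : FilterOutputOn T (1 : Matrix a a ℝ[X]) p c v q w) {t : ℝ} (ht : 0 ≤ t) (htT : t ≤ T)
    (i : a) : w t i = q t i 0 := by
  rw [h.out t ht htT, Finset.sum_eq_single i]
  · rw [Matrix.one_apply_eq, ← pow_zero X, polyOp_X_pow]
  · intro j _ hj
    rw [Matrix.one_apply_ne hj.symm, map_zero]
  · simp

theorem Observable.exists_krylov_matrix {n n₀ m : ℕ} {A : Matrix (Fin n) (Fin n) ℝ}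
    {C₀ : Matrix (Fin n₀) (Fin n) ℝ} (hobs : Observable A C₀) (hrank : C₀.rank = n₀)
    (κ : Matrix (Fin m) (Fin n) ℝ) :
    ∃ b : ℕ → Matrix (Fin m) (Fin n₀) ℝ,
      κ = ∑ k ∈ Finset.range (n - n₀ + 1), b k * (C₀ * A ^ k) := by
  choose b hb using fun i => hobs.exists_krylov hrank (κ i)
  refine ⟨fun k => Matrix.of fun i => b i k, ?_⟩
  ext i j
  rw [Matrix.sum_apply]
  have := congrFun (hb i) j
  rw [this, Finset.sum_apply]
  rfl

section

variable {M n n₀ : ℕ} {A : Matrix (Fin n) (Fin n) ℝ} {B : Matrix (Fin n) (Fin M) ℝ}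
  {C : Matrix (Fin M) (Fin n) ℝ} {C₀ : Matrix (Fin n₀) (Fin n) ℝ} {D : Design M n n₀}
  {r : ℝ → Fin M → ℝ} {I : InitialData M n n₀} {J : Type*} {T : J → ℝ} {σ : J → Signals M n n₀}

/-- Every state feedback is reproduced by the controller structure, up to decaying terms. -/
theorem exists_matching (h : ∀ j, IsClosedLoopOn (T j) A B C C₀ D r I (σ j))
    (hobs : Observable A C₀) (hrank : C₀.rank = n₀) (κ : Matrix (Fin M) (Fin n) ℝ)
    (G : Matrix (Fin M) (Fin M) ℝ) :
    ∃ Θs : Matrix (RegIdx M n n₀) (Fin M) ℝ, ∀ i, UDecay T fun j t =>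
      Θs.transpose.mulVec ((σ j).ω t) i - (κ.mulVec ((σ j).x t) + G.mulVec (r t)) i := by
  set d := D.Lam.natDegree with hd
  have hdn : d = n - n₀ := D.Lam_degree
  -- The identity `κ Λ(A) = ∑ b_k C₀ A ^ k`, with `k ≤ d`, is the matching equation for the part of
  -- the controller fed by `y₀`.
  obtain ⟨b, hb⟩ := hobs.exists_krylov_matrix hrank (κ * aeval A D.Lam)
  rw [← hdn] at hb
  obtain ⟨P, S, hP, hP0, hS, hPS⟩ := exists_filtered_plant (T := T) (fun j => (h j).nonneg)
    D.Lam_monic D.Lam_stable A B (x := fun j => (σ j).x) (u := fun j => (σ j).u)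
    (U := fun j => (σ j).q_u) (fun j => (h j).state)
    (fun i => .of_eq (I.x i) fun j => congrFun (h j).init_x i)
    (fun j i => (h j).filter₁.filter i)
    (fun i k hk => .of_eq (I.c_u i k) fun j => (h j).filter₁.init i k hk)
  -- The filter of `y₀` and `C₀` times the filter of `x` have the same input, so they differ by the
  -- effect of the initial values.
  have hy : ∀ i, ∀ k ≤ d, UDecay T fun j t =>
      (σ j).q_y₀ t i k - C₀.mulVec (fun l => P j t l k) i := by
    intro i k hk
    refine UDecay.filter (v := fun _ _ => 0) (q := fun j t k => (σ j).q_y₀ t i k -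
      C₀.mulVec (fun l => P j t l k) i) D.Lam_monic D.Lam_stable (fun j => ?_) UDecay.zero
      (fun k hk => ?_) hk
    · refine (((h j).filter₂.filter i).sub (FilterOn.mulVec C₀ (hP j) i)).congr
        (fun t ht htT => ?_) fun _ _ _ _ _ => rfl
      rw [(h j).partialState t ht htT, sub_self]
    · refine .of_eq (I.c_y₀ i k) fun j => ?_
      rw [(h j).filter₂.init i k hk]
      simp only [hP0 j _ k hk]
      have : C₀.mulVec (fun _ => (0 : ℝ)) = 0 := C₀.mulVec_zero
      rw [this]
      simp
  -- Here `κ x = ∑ Λ_k κ P_k`, with `P_k` the filtered state and its derivatives. Subtracting `∑ b_k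
  -- C₀ P_k` leaves `∑ Q_k P_k`, and `∑ Q_k A ^ k = 0` means that this depends on the filtered input
  -- only, with coefficients `a l * B`.
  set Q : ℕ → Matrix (Fin M) (Fin n) ℝ := fun k => D.Lam.coeff k • κ - b k * C₀ with hQ
  have hQ0 : ∑ k ∈ Finset.range (d + 1), Q k * A ^ k = 0 := by
    simp only [hQ, Matrix.sub_mul, Finset.sum_sub_distrib, Matrix.mul_assoc, Matrix.smul_mul]
    rw [← hb, aeval_eq_sum_range, Matrix.mul_sum, sub_eq_zero]
    exact Finset.sum_congr rfl fun k _ => by rw [Matrix.mul_smul]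
  set a : ℕ → Matrix (Fin M) (Fin n) ℝ := fun l => ∑ k ∈ Finset.range (d + 1),
    if l < k then Q k * A ^ (k - 1 - l) else 0 with ha
  have had : a d = 0 := Finset.sum_eq_zero fun k hk => if_neg (by
    have := Finset.mem_range.1 hk
    omega)
  -- The top filter state of `y₀` is not part of the regressor; since `Λ` is monic it is `y₀ - ∑ Λ_k
  -- q_k`. This gives the gain `b d` on `y₀` and the corrections `-Λ_k b d` on `ω₂`. For the input,
  -- `a d = 0`, so the states in `ω₁` suffice.
  let Θs : Matrix (RegIdx M n n₀) (Fin M) ℝ := Matrix.of fun c i =>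
    Sum.elim (fun lj : Fin (n - n₀) × Fin M => (a lj.1 * B) i lj.2)
      (Sum.elim (fun kj : Fin (n - n₀) × Fin n₀ => (b kj.1 - D.Lam.coeff kj.1 • b d) i kj.2)
        (Sum.elim (fun j => b d i j) fun j => G i j)) c
  refine ⟨Θs, fun i => ?_⟩
  refine ((UDecay.sum (Finset.range (d + 1)) fun k hk => UDecay.mulVec (T := T) (b k)
    (x := fun j t i => (σ j).q_y₀ t i k - C₀.mulVec (fun l => P j t l k) i)
    (fun i => hy i k (Nat.lt_succ_iff.1 (Finset.mem_range.1 hk))) i).sub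
    (UDecay.sum (Finset.range (d + 1)) fun k hk => UDecay.mulVec (T := T) (a k)
      (x := fun j t i => S j t i k)
      (fun i => hS i k (Nat.lt_succ_iff.1 (Finset.mem_range.1 hk))) i)).congr fun j t ht htT => ?_
  have h1 := congrFun (sum_mulVec_power (N := d) (P := fun k l => P j t l k) (hPS j t ht htT) Q) i
  rw [hQ0, Matrix.zero_mulVec, zero_add] at h1
  have hx : ∑ k ∈ Finset.range (d + 1), D.Lam.coeff k • (fun l => P j t l k) = (σ j).x t := by
    ext l
    rw [Finset.sum_apply]
    exact (hP j l).2 t ht htT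
  have h2 : ∑ k ∈ Finset.range (d + 1), (Q k).mulVec (fun l => P j t l k) =
      κ.mulVec ((σ j).x t) -
        ∑ k ∈ Finset.range (d + 1), (b k).mulVec (C₀.mulVec fun l => P j t l k) := by
    rw [← hx, Matrix.mulVec_sum, ← Finset.sum_sub_distrib]
    refine Finset.sum_congr rfl fun k _ => ?_
    rw [hQ]
    simp only [Matrix.sub_mulVec, Matrix.smul_mulVec, Matrix.mulVec_smul, Matrix.mulVec_mulVec]
  rw [h2] at h1
  have h3 : Θs.transpose.mulVec ((σ j).ω t) i =
      ∑ l ∈ Finset.range d, (a l).mulVec (B.mulVec fun k => (σ j).q_u t k l) i +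
      ∑ k ∈ Finset.range (d + 1), (b k).mulVec (fun l => (σ j).q_y₀ t l k) i +
      G.mulVec (r t) i := by
    have hy0 : ∀ l, (σ j).y₀ t l = ∑ k ∈ Finset.range d, D.Lam.coeff k * (σ j).q_y₀ t l k +
        (σ j).q_y₀ t l d := by
      intro l
      refine (((h j).filter₂.filter l).2 t ht htT).symm.trans ?_
      rw [Finset.sum_range_succ,
        D.Lam_monic.coeff_natDegree, one_mul]
    have e1 : ∑ c : Fin (n - n₀) × Fin M, (a c.1 * B) i c.2 * (σ j).ω₁ t c =
        ∑ l ∈ Finset.range d, (a l).mulVec (B.mulVec fun k => (σ j).q_u t k l) i := by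
      rw [hdn, Finset.sum_range, Fintype.sum_prod_type]
      refine Finset.sum_congr rfl fun l _ => ?_
      rw [Matrix.mulVec_mulVec]
      refine Finset.sum_congr rfl fun k _ => ?_
      rw [(h j).filter₁.out_powerStack ht htT]
    have e2 : ∑ c : Fin (n - n₀) × Fin n₀, (b c.1 - D.Lam.coeff c.1 • b d) i c.2 * (σ j).ω₂ t c =
        ∑ k ∈ Finset.range d, ((b k).mulVec (fun l => (σ j).q_y₀ t l k) i -
          D.Lam.coeff k * (b d).mulVec (fun l => (σ j).q_y₀ t l k) i) := by
      rw [hdn, Finset.sum_range, Fintype.sum_prod_type]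
      refine Finset.sum_congr rfl fun l _ => ?_
      simp only [Matrix.mulVec, dotProduct, Finset.mul_sum]
      rw [← Finset.sum_sub_distrib]
      refine Finset.sum_congr rfl fun k _ => ?_
      rw [(h j).filter₂.out_powerStack ht htT, Matrix.sub_apply, Matrix.smul_apply, smul_eq_mul]
      ring
    have e3 : ∑ l, b d i l * (σ j).y₀ t l =
        ∑ k ∈ Finset.range d, D.Lam.coeff k * (b d).mulVec (fun l => (σ j).q_y₀ t l k) i +
          (b d).mulVec (fun l => (σ j).q_y₀ t l d) i := by
      simp only [hy0, Matrix.mulVec, dotProduct, mul_add, Finset.sum_add_distrib, Finset.mul_sum]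
      rw [Finset.sum_comm]
      congr 1
      exact Finset.sum_congr rfl fun _ _ => Finset.sum_congr rfl fun _ _ => by ring
    have e0 : Θs.transpose.mulVec ((σ j).ω t) i =
        ∑ c : Fin (n - n₀) × Fin M, (a c.1 * B) i c.2 * (σ j).ω₁ t c +
        (∑ c : Fin (n - n₀) × Fin n₀, (b c.1 - D.Lam.coeff c.1 • b d) i c.2 * (σ j).ω₂ t c +
        (∑ l, b d i l * (σ j).y₀ t l + G.mulVec (r t) i)) := by
      rw [(h j).regressor t ht htT]
      simp only [Matrix.mulVec, dotProduct, Fintype.sum_sum_type]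
      rfl
    rw [e0, e1, e2, e3, Finset.sum_range_succ _ d, Finset.sum_sub_distrib]
    ring
  have h4 : (∑ l ∈ Finset.range (d + 1), (a l).mulVec
      (B.mulVec (fun i => (σ j).q_u t i l) + fun i => S j t i l)) i =
      ∑ l ∈ Finset.range d, (a l).mulVec (B.mulVec fun k => (σ j).q_u t k l) i +
      ∑ l ∈ Finset.range (d + 1), (a l).mulVec (fun i => S j t i l) i := by
    rw [Finset.sum_apply]
    simp only [Matrix.mulVec_add, Pi.add_apply, Finset.sum_add_distrib]
    rw [Finset.sum_range_succ _ d, had]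
    simp
  rw [h4] at h1
  rw [Pi.sub_apply, Finset.sum_apply] at h1
  rw [h3, Pi.add_apply]
  have h5 : ∑ k ∈ Finset.range (d + 1), (b k).mulVec (fun i => (σ j).q_y₀ t i k -
      C₀.mulVec (fun l => P j t l k) i) i =
      ∑ k ∈ Finset.range (d + 1), (b k).mulVec (fun l => (σ j).q_y₀ t l k) i -
      ∑ k ∈ Finset.range (d + 1), (b k).mulVec (C₀.mulVec fun l => P j t l k) i := by
    rw [← Finset.sum_sub_distrib]
    refine Finset.sum_congr rfl fun k _ => ?_
    rw [← Pi.sub_apply, ← Matrix.mulVec_sub]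
    rfl
  rw [h5]
  linarith

end

end PartialStateMRAC

/-! ### Filtered tracking error and derivation of the linear error model -/

namespace PartialStateMRAC

section

variable {M n n₀ : ℕ} {A : Matrix (Fin n) (Fin n) ℝ} {B : Matrix (Fin n) (Fin M) ℝ}
  {C : Matrix (Fin M) (Fin n) ℝ} {C₀ : Matrix (Fin n₀) (Fin n) ℝ} {D : Design M n n₀}
  {r : ℝ → Fin M → ℝ} {I : InitialData M n n₀} {J : Type*} {T : J → ℝ} {σ : J → Signals M n n₀}
  {Kp : Matrix (Fin M) (Fin M) ℝ}

/-- Filtering of the reference model: `q_e` is the filtered plant output minus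
`(X^k adj ξ)(d/dt) Z`, up to decaying terms. -/
theorem exists_filtered_error (h : ∀ j, IsClosedLoopOn (T j) A B C C₀ D r I (σ j))
    (hxi : IsModifiedInteractor D.ξ (transferMatrix A B C) Kp)
    {Z : Fin M → ℝ → ℕ → ℝ}
    (hZ : ∀ l T, FilterOn T (D.f * D.ξ.det) (fun t => r t l) (Z l))
    {P : J → ℝ → Fin n → ℕ → ℝ}
    (hP : ∀ j i, FilterOn (T j) D.f (fun t => (σ j).x t i) (fun t => P j t i))
    (hP0 : ∀ j i, ∀ k < D.f.natDegree, P j 0 i k = 0) (i : Fin M) {k : ℕ}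
    (hk : k ≤ D.f.natDegree) :
    UDecay T fun j t => (σ j).q_e t i k - C.mulVec (fun l => P j t l k) i +
      ∑ l, polyOp (Z l t) (X ^ k * D.ξ.adjugate i l) := by
  have hdeg : ∀ i l, (D.ξ.adjugate i l).natDegree ≤ D.ξ.det.natDegree :=
    fun i l => (hxi.adjugate_natDegree_lt i l).le
  have hcst : ∀ c : ℝ, UBd (fun _ : J => (1 : ℝ)) fun _ => c := fun c => .of_eq c fun _ => rfl
  -- Both signals are states of a filter with denominator `det ξ` and input `r`; they differ by
  -- their initial values.
  have hV : ∀ l, ∀ k ≤ D.ξ.det.natDegree, UDecay T fun j t =>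
      (σ j).q_r t l k - polyOp (Z l t) (X ^ k * D.f) := by
    intro l k hk
    have hZ' : ∀ T, FilterOn T (D.ξ.det * D.f) (fun t => r t l) (Z l) := fun T => by
      rw [mul_comm]
      exact hZ l T
    refine UDecay.filter (v := fun _ _ => 0) (q := fun j t k =>
      (σ j).q_r t l k - polyOp (Z l t) (X ^ k * D.f)) hxi.det_monic hxi.det_stable (fun j => ?_)
      UDecay.zero (fun k hk => ?_) hk
    · refine (((h j).reference.filter l).sub
        ((hZ' (T j)).subfilter hxi.det_monic D.f_monic le_rfl)).congr (fun t ht htT => ?_)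
        fun _ _ _ _ _ => rfl
      rw [(hZ' (T j)).polyOp_eq ht htT, sub_self]
    · refine (UBd.sub (hcst (I.c_r l k)) (hcst (polyOp (Z l 0) (X ^ k * D.f)))).congr fun j => ?_
      rw [(h j).reference.init l k hk]
  have hop : ∀ l, ∀ g : ℝ[X], g.natDegree ≤ D.ξ.det.natDegree → UDecay T fun j t =>
      polyOp ((σ j).q_r t l) g - polyOp (Z l t) (D.f * g) := by
    intro l g hg
    refine (UDecay.sum (Finset.range (D.ξ.det.natDegree + 1)) fun k hk =>
      (hV l k (Nat.lt_succ_iff.1 (Finset.mem_range.1 hk))).const_mul (g.coeff k)).congr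
      fun j t _ _ => ?_
    rw [polyOp_eq_sum ((σ j).q_r t l) hg, mul_comm D.f, polyOp_mul _ hg, ← Finset.sum_sub_distrib]
    exact Finset.sum_congr rfl fun k _ => (mul_sub _ _ _).symm
  refine UDecay.filter (v := fun j t => -∑ l, (polyOp ((σ j).q_r t l) (D.ξ.adjugate i l) -
      polyOp (Z l t) (D.f * D.ξ.adjugate i l))) (q := fun j t k =>
      (σ j).q_e t i k - C.mulVec (fun l => P j t l k) i +
      ∑ l, polyOp (Z l t) (X ^ k * D.ξ.adjugate i l)) D.f_monic D.f_stable (fun j => ?_)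
      (UDecay.neg (UDecay.sum _ fun l _ => hop l _ (hdeg i l))) (fun k hk => ?_) hk
  · refine ((((h j).filter_e.filter i).sub (FilterOn.mulVec C (hP j) i)).add
      (FilterOn.sum Finset.univ fun l _ =>
        (hZ l (T j)).subfilter D.f_monic hxi.det_monic (hdeg i l))).congr (fun t ht htT => ?_)
      fun _ _ _ _ _ => rfl
    rw [(h j).error t ht htT, Pi.sub_apply, (h j).output t ht htT, (h j).reference.out t ht htT,
      Finset.sum_sub_distrib]
    ring
  · refine (UBd.add (hcst (I.c_e i k))
      (hcst (∑ l, polyOp (Z l 0) (X ^ k * D.ξ.adjugate i l)))).congr fun j => ?_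
    rw [(h j).filter_e.init i k hk]
    simp only [hP0 j _ k hk]
    have : C.mulVec (fun _ => (0 : ℝ)) = 0 := C.mulVec_zero
    rw [this]
    simp

/-- The error model. -/
theorem exists_error_model (h : ∀ j, IsClosedLoopOn (T j) A B C C₀ D r I (σ j))
    (hxi : IsModifiedInteractor D.ξ (transferMatrix A B C) Kp)
    (hobs : Observable A C₀) (hrank : C₀.rank = n₀) (hr_meas : Measurable r)
    (hr_bdd : ∀ i, BoundedSignal fun t => r t i) :
    ∃ Θs : Matrix (RegIdx M n n₀) (Fin M) ℝ,
      (∀ i, UDecay T fun j t => Θs.transpose.mulVec ((σ j).ω t) i -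
        (-(Kp⁻¹ * interactorState D.ξ A C).mulVec ((σ j).x t) + Kp⁻¹.mulVec (r t)) i) ∧
      ∀ i, UDecay T fun j t => (σ j).ebar t i -
        Kp.mulVec ((σ j).hΘω t - Θs.transpose.mulVec ((σ j).ζ t)) i := by
  set N := D.f.natDegree with hN
  have hNd : N = maxDegree D.ξ := D.f_degree
  have hKinv : Kp * Kp⁻¹ = 1 := Matrix.mul_nonsing_inv _ (isUnit_iff_ne_zero.2 hxi.nonsingular)
  set R := interactorState D.ξ A C with hR
  -- The feedback to be matched is `u = Kp⁻¹ (r - R x)`, which turns `ξ(d/dt) y = R x + Kp u` into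
  -- `ξ(d/dt) y = r`.
  obtain ⟨Θs, hΘs⟩ := exists_matching h hobs hrank (-(Kp⁻¹ * R)) Kp⁻¹
  simp only [Matrix.neg_mulVec] at hΘs
  refine ⟨Θs, hΘs, fun i => ?_⟩
  obtain ⟨P, S, hP, hP0, hS, hPS⟩ := exists_filtered_plant (T := T) (fun j => (h j).nonneg)
    D.f_monic D.f_stable A B (x := fun j => (σ j).x) (u := fun j => (σ j).u)
    (U := fun j => (σ j).q_Θω) (fun j => (h j).state)
    (fun i => .of_eq (I.x i) fun j => congrFun (h j).init_x i)
    (fun j i => ((h j).filter_Θω.filter i).congr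
      (fun t ht htT => by rw [(h j).control t ht htT]) fun _ _ _ _ _ => rfl)
    (fun i k hk => .of_eq (I.c_Θω i k) fun j => (h j).filter_Θω.init i k hk)
  -- Filtering `r` by `1 / (f det ξ)` gives one signal from which both `h[r]` (apply `det ξ`) and
  -- `h[y_m]` (apply `adj ξ`) are obtained by differential operators, up to decaying terms.
  have hZex : ∀ l, ∃ q : ℝ → ℕ → ℝ, ∀ T, FilterOn T (D.f * D.ξ.det) (fun t => r t l) q := by
    intro l
    obtain ⟨b, hb⟩ := hr_bdd l
    obtain ⟨q, hq, -⟩ := exists_filterOn (D.f_monic.mul hxi.det_monic)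
      (measurable_pi_iff.1 hr_meas l) hb
    exact ⟨q, hq⟩
  choose Z hZ using hZex
  have hE := exists_filtered_error h hxi hZ hP hP0
  -- The matching relation passed through the filter `1 / f`; `polyOp (Z l t) D.ξ.det` plays the
  -- role of `h[r]`.
  have hF : ∀ i, UDecay T fun j t => Θs.transpose.mulVec ((σ j).ζ t) i -
      (-(Kp⁻¹ * R).mulVec (fun l => P j t l 0) i +
        Kp⁻¹.mulVec (fun l => polyOp (Z l t) D.ξ.det) i) := by
    intro i
    refine (UDecay.filter (v := fun j t => Θs.transpose.mulVec ((σ j).ω t) i -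
        (-(Kp⁻¹ * R).mulVec ((σ j).x t) + Kp⁻¹.mulVec (r t)) i)
      (q := fun j t k => Θs.transpose.mulVec (fun a => (σ j).q_ω t a k) i -
      ((-(Kp⁻¹ * R)).mulVec (fun l => P j t l k) i +
        Kp⁻¹.mulVec (fun l => polyOp (Z l t) (X ^ k * D.ξ.det)) i)) D.f_monic D.f_stable
      (fun j => ?_) (hΘs i) (fun k hk => ?_) (Nat.zero_le _)).congr fun j t ht htT => ?_
    · refine ((FilterOn.mulVec Θs.transpose (h j).filter_ω.filter i).sub
        ((FilterOn.mulVec (-(Kp⁻¹ * R)) (hP j) i).add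
          (FilterOn.mulVec (v := fun t l => polyOp (Z l t) (D.f * D.ξ.det))
            (q := fun t l k => polyOp (Z l t) (X ^ k * D.ξ.det)) Kp⁻¹ (fun l =>
            (hZ l (T j)).subfilter D.f_monic hxi.det_monic le_rfl) i))).congr
        (fun t ht htT => ?_) fun _ _ _ _ _ => rfl
      have : (fun l => polyOp (Z l t) (D.f * D.ξ.det)) = r t :=
        funext fun l => (hZ l (T j)).polyOp_eq ht htT
      rw [this, Matrix.neg_mulVec]
      rfl
    · refine ⟨|Θs.transpose.mulVec (fun a => I.c_ω a k) i -
        ((-(Kp⁻¹ * R)).mulVec (fun _ => 0) i +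
          Kp⁻¹.mulVec (fun l => polyOp (Z l 0) (X ^ k * D.ξ.det)) i)|, fun j => ?_⟩
      rw [mul_one]
      simp only [hP0 j _ k hk, (h j).filter_ω.init _ k hk]
      exact le_rfl
    · have : (σ j).ζ t = fun a => (σ j).q_ω t a 0 :=
        funext fun a => (h j).filter_ω.out_one ht htT a
      simp only [this, pow_zero, one_mul, Matrix.neg_mulVec, Pi.neg_apply]
  set S' : ℕ → Matrix (Fin M) (Fin n) ℝ := fun l => ∑ k ∈ Finset.range (N + 1),
    if l < k then coeffMatrix D.ξ k * C * A ^ (k - 1 - l) else 0 with hS'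
  -- The interactor property: of all derivatives of the filtered input only the one of order zero
  -- contributes, with gain `Kp`.
  have hS'B : ∀ l, S' l * B = if l = 0 then Kp else 0 := by
    intro l
    rw [← hxi.interactorCoeff_eq l, interactorCoeff, hS', Matrix.sum_mul, hNd]
    refine Finset.sum_congr rfl fun k _ => ?_
    split_ifs
    · rfl
    · simp
  -- Up to decaying terms, `ē = R P₀ + Kp h[Θᵀω] - h[r]` and `Kp Θ*ᵀζ = -R P₀ + h[r]`, where `P₀` is
  -- the filtered state. In the sum of the two relations the unmeasured `P₀` and the reference
  -- cancel.
  refine (((UDecay.sum Finset.univ fun m _ => UDecay.sum (Finset.range (N + 1)) fun k hk =>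
      (hE m (Nat.lt_succ_iff.1 (Finset.mem_range.1 hk))).const_mul ((D.ξ i m).coeff k)).add
    (UDecay.sum (Finset.range (N + 1)) fun k hk => UDecay.mulVec (T := T) (S' k)
      (x := fun j t i => S j t i k)
      (fun i => hS i k (Nat.lt_succ_iff.1 (Finset.mem_range.1 hk))) i)).add
    (UDecay.mulVec (T := T) Kp (x := fun j t i => Θs.transpose.mulVec ((σ j).ζ t) i -
      (-(Kp⁻¹ * R).mulVec (fun l => P j t l 0) i +
        Kp⁻¹.mulVec (fun l => polyOp (Z l t) D.ξ.det) i)) hF i)).congr fun j t ht htT => ?_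
  have hdeg : ∀ i m, (D.ξ i m).natDegree ≤ N := fun i m => by
    rw [hNd]
    exact natDegree_le_maxDegree D.ξ i m
  have e1 : (σ j).ebar t i =
      ∑ m, ∑ k ∈ Finset.range (N + 1), (D.ξ i m).coeff k * (σ j).q_e t m k := by
    rw [(h j).filter_e.out t ht htT]
    exact Finset.sum_congr rfl fun m _ => polyOp_eq_sum _ (hdeg i m)
  have e2 : ∑ m, ∑ k ∈ Finset.range (N + 1), (D.ξ i m).coeff k *
      (∑ l, polyOp (Z l t) (X ^ k * D.ξ.adjugate m l)) = polyOp (Z i t) D.ξ.det := by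
    have h1 : ∀ l, ∑ m, ∑ k ∈ Finset.range (N + 1), (D.ξ i m).coeff k *
        polyOp (Z l t) (X ^ k * D.ξ.adjugate m l) =
        polyOp (Z l t) ((D.ξ * D.ξ.adjugate) i l) := by
      intro l
      rw [Matrix.mul_apply, map_sum]
      refine Finset.sum_congr rfl fun m _ => ?_
      exact (polyOp_mul _ (hdeg i m) _).symm
    have h2 : ∑ l, polyOp (Z l t) ((D.ξ * D.ξ.adjugate) i l) = polyOp (Z i t) D.ξ.det := by
      rw [Finset.sum_eq_single i]
      · rw [Matrix.mul_adjugate, Matrix.smul_apply, Matrix.one_apply_eq, smul_eq_mul, mul_one]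
      · intro l _ hl
        rw [Matrix.mul_adjugate, Matrix.smul_apply, Matrix.one_apply_ne hl.symm, smul_zero,
          map_zero]
      · simp
    rw [← h2]
    simp only [← h1, Finset.mul_sum]
    conv_rhs => rw [Finset.sum_comm]
    refine Finset.sum_congr rfl fun m _ => ?_
    rw [Finset.sum_comm]
  have e3 : ∑ m, ∑ k ∈ Finset.range (N + 1), (D.ξ i m).coeff k *
      C.mulVec (fun l => P j t l k) m = R.mulVec (fun l => P j t l 0) i +
        Kp.mulVec ((σ j).hΘω t) i + ∑ k ∈ Finset.range (N + 1),
          (S' k).mulVec (fun i => S j t i k) i := by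
    have h1 := congrFun (sum_mulVec_power (N := N) (P := fun k l => P j t l k) (hPS j t ht htT)
      fun k => coeffMatrix D.ξ k * C) i
    have h2 : (∑ k ∈ Finset.range (N + 1), (coeffMatrix D.ξ k * C).mulVec
        (fun l => P j t l k)) i = ∑ m, ∑ k ∈ Finset.range (N + 1), (D.ξ i m).coeff k *
      C.mulVec (fun l => P j t l k) m := by
      rw [Finset.sum_apply, Finset.sum_comm]
      refine Finset.sum_congr rfl fun k _ => ?_
      rw [← Matrix.mulVec_mulVec]
      rfl
    rw [← h2, h1, Pi.add_apply, Finset.sum_apply, add_assoc]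
    congr 1
    · rw [hR, interactorState, hNd]
    · simp only [Matrix.mulVec_add, Pi.add_apply, Finset.sum_add_distrib]
      congr 1
      rw [Finset.sum_eq_single 0]
      · rw [Matrix.mulVec_mulVec]
        change (S' 0 * B).mulVec _ i = _
        rw [hS'B, if_pos rfl]
        congr 2
        exact funext fun a => ((h j).filter_Θω.out_one ht htT a).symm
      · intro l _ hl
        rw [Matrix.mulVec_mulVec]
        change (S' l * B).mulVec _ i = _
        rw [hS'B, if_neg hl, Matrix.zero_mulVec]
        rfl
      · simp
  have e4 : Kp.mulVec (fun i => Θs.transpose.mulVec ((σ j).ζ t) i -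
      (-(Kp⁻¹ * R).mulVec (fun l => P j t l 0) i +
        Kp⁻¹.mulVec (fun l => polyOp (Z l t) D.ξ.det) i)) i =
      Kp.mulVec (Θs.transpose.mulVec ((σ j).ζ t)) i + R.mulVec (fun l => P j t l 0) i -
        polyOp (Z i t) D.ξ.det := by
    have h1 : (fun i => Θs.transpose.mulVec ((σ j).ζ t) i -
      (-(Kp⁻¹ * R).mulVec (fun l => P j t l 0) i +
        Kp⁻¹.mulVec (fun l => polyOp (Z l t) D.ξ.det) i)) = Θs.transpose.mulVec ((σ j).ζ t) -
      (-(Kp⁻¹ * R).mulVec (fun l => P j t l 0) +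
        Kp⁻¹.mulVec (fun l => polyOp (Z l t) D.ξ.det)) := rfl
    rw [h1, Matrix.mulVec_sub, Matrix.mulVec_add, Matrix.mulVec_neg,
      Matrix.mulVec_mulVec _ Kp (Kp⁻¹ * R), Matrix.mulVec_mulVec _ Kp Kp⁻¹, ← Matrix.mul_assoc,
      hKinv, Matrix.one_mul, Matrix.one_mulVec]
    simp only [Pi.sub_apply, Pi.add_apply, Pi.neg_apply]
    ring
  rw [e4, e1, Matrix.mulVec_sub, Pi.sub_apply]
  simp only [mul_add, mul_sub, Finset.sum_add_distrib, Finset.sum_sub_distrib]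
  rw [e2, e3]
  ring

end

end PartialStateMRAC

namespace PartialStateMRAC

/-! ### Boundedness of the parameter estimates -/

/-- Cauchy–Schwarz for the form `P`, applied to `z` and `w = P⁻¹ e_i`, for which `z ⬝ᵥ P w = z i`.
It is used in the form that `P` is nonnegative at `z - (z i / c) w`, with `c = w ⬝ᵥ P w`. -/
theorem _root_.Matrix.PosDef.exists_sq_le {ι : Type*} [Fintype ι] {P : Matrix ι ι ℝ}
    (hP : P.PosDef) : ∃ c : ℝ, 0 ≤ c ∧ ∀ (z : ι → ℝ) (i : ι), z i ^ 2 ≤ c * (z ⬝ᵥ P.mulVec z) := by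
  classical
  have hnn : ∀ z : ι → ℝ, 0 ≤ z ⬝ᵥ P.mulVec z := fun z => by
    simpa using hP.posSemidef.dotProduct_mulVec_nonneg z
  have hsymm : ∀ x y : ι → ℝ, x ⬝ᵥ P.mulVec y = y ⬝ᵥ P.mulVec x := fun x y => by
    have hT : P.transpose = P := by simpa using hP.isHermitian.eq
    rw [Matrix.dotProduct_mulVec, ← Matrix.mulVec_transpose, hT, dotProduct_comm]
  have key : ∀ i, ∃ c : ℝ, 0 ≤ c ∧ ∀ z : ι → ℝ, z i ^ 2 ≤ c * (z ⬝ᵥ P.mulVec z) := by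
    intro i
    set w : ι → ℝ := P⁻¹.mulVec (Pi.single i 1) with hw
    have hPw : P.mulVec w = Pi.single i 1 := by
      rw [hw, Matrix.mulVec_mulVec, Matrix.mul_nonsing_inv _
        ((Matrix.isUnit_iff_isUnit_det _).1 hP.isUnit), Matrix.one_mulVec]
    have hzw : ∀ z : ι → ℝ, z ⬝ᵥ P.mulVec w = z i := fun z => by rw [hPw]; simp
    have hw0 : w ≠ 0 := by
      rintro h0
      have := hzw (Pi.single i 1)
      rw [h0, Matrix.mulVec_zero, dotProduct_zero] at this
      simp at this
    have hc : 0 < w ⬝ᵥ P.mulVec w := by simpa using hP.dotProduct_mulVec_pos hw0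
    set c := w ⬝ᵥ P.mulVec w with hcdef
    refine ⟨c, hc.le, fun z => ?_⟩
    have h1 := hnn (z - (z i / c) • w)
    rw [Matrix.mulVec_sub, Matrix.mulVec_smul, sub_dotProduct, dotProduct_sub, dotProduct_sub,
      dotProduct_smul, dotProduct_smul, smul_dotProduct, smul_dotProduct, hzw, hsymm w z, hzw,
      ← hcdef] at h1
    simp only [smul_eq_mul] at h1
    have h2 : z i / c * (z i / c * c) = z i / c * z i := by field_simp
    rw [h2] at h1
    have h3 : z i / c * z i ≤ z ⬝ᵥ P.mulVec z := by linarith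
    have h4 := mul_le_mul_of_nonneg_left h3 hc.le
    calc z i ^ 2 = c * (z i / c * z i) := by field_simp
      _ ≤ _ := h4
  choose c hc hcz using key
  refine ⟨∑ i, c i, Finset.sum_nonneg fun i _ => hc i, fun z i => (hcz i z).trans ?_⟩
  exact mul_le_mul_of_nonneg_right (Finset.single_le_sum (fun i _ => hc i) (Finset.mem_univ i))
    (hnn z)

theorem _root_.Matrix.PosDef.isSymm_of_real {ι : Type*} [Fintype ι] {P : Matrix ι ι ℝ}
    (hP : P.PosDef) : P.IsSymm := by
  simpa [Matrix.IsSymm] using hP.isHermitian.eq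

theorem UDecay.uBd {J : Type*} {T : J → ℝ} {v : J → ℝ → ℝ} (h : UDecay T v) :
    UBd (fun _ : Times T => 1) fun p => v p.1.1 p.1.2 := by
  obtain ⟨b, hb, h⟩ := h
  refine h.mono (fun _ => (Real.exp_pos _).le) fun p => ?_
  rw [Real.exp_le_one_iff]
  nlinarith [p.2.1]

section

variable {M n n₀ : ℕ} {A : Matrix (Fin n) (Fin n) ℝ} {B : Matrix (Fin n) (Fin M) ℝ}
  {C : Matrix (Fin M) (Fin n) ℝ} {C₀ : Matrix (Fin n₀) (Fin n) ℝ} {D : Design M n n₀}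
  {r : ℝ → Fin M → ℝ} {I : InitialData M n n₀}
  {Kp : Matrix (Fin M) (Fin M) ℝ}

theorem IsClosedLoopOn.one_le_msq {σ : Signals M n n₀} {T : ℝ}
    (h : IsClosedLoopOn T A B C C₀ D r I σ) {t : ℝ} (ht : 0 ≤ t) (htT : t ≤ T) : 1 ≤ σ.msq t := by
  rw [h.normalization t ht htT]
  have h1 : 0 ≤ dotProduct (σ.ζ t) (σ.ζ t) := Finset.sum_nonneg fun _ _ => mul_self_nonneg _
  have h2 : 0 ≤ dotProduct (σ.Xi t) (σ.Xi t) := Finset.sum_nonneg fun _ _ => mul_self_nonneg _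
  have h3 : 0 ≤ ∑ i, dotProduct (σ.η t i) (σ.η t i) :=
    Finset.sum_nonneg fun _ _ => Finset.sum_nonneg fun _ _ => mul_self_nonneg _
  linarith

theorem sum_castLE {i : Fin M} (g : Fin M → ℝ) :
    ∑ j : Fin i.val, g (Fin.castLE i.isLt.le j) = ∑ j, if j < i then g j else 0 := by
  rw [← Finset.sum_filter]
  refine Finset.sum_bij (fun j _ => Fin.castLE i.isLt.le j) (fun j _ => ?_) (fun a _ b _ hab => ?_)
    (fun b hb => ?_) fun _ _ => rfl
  · exact Finset.mem_filter.2 ⟨Finset.mem_univ _, j.isLt⟩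
  · simpa [Fin.ext_iff] using hab
  · have hb' : b < i := by simpa using hb
    exact ⟨⟨b.val, hb'⟩, Finset.mem_univ _, rfl⟩

/-- The estimation error in terms of the parameter errors. -/
theorem IsClosedLoopOn.eps_eq {σ : Signals M n n₀} {T : ℝ}
    (h : IsClosedLoopOn T A B C C₀ D r I σ) {W S : Matrix (Fin M) (Fin M) ℝ}
    (hW1 : ∀ i, W i i = 1) (hW0 : ∀ i j, i < j → W i j = 0) (hWS : W * Kp = D.Ds * S)
    (Θs : Matrix (RegIdx M n n₀) (Fin M) ℝ) {t : ℝ} (ht : 0 ≤ t) (htT : t ≤ T) (i : Fin M) :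
    σ.ε t i = (fun j => σ.θ t i j - W i (Fin.castLE i.isLt.le j)) ⬝ᵥ σ.η t i +
      (σ.Ψ t - D.Ds * S).mulVec (σ.Xi t) i +
      (D.Ds * S).mulVec ((σ.Θ t - Θs).transpose.mulVec (σ.ζ t)) i +
      W.mulVec (fun i => σ.ebar t i -
        Kp.mulVec (σ.hΘω t - Θs.transpose.mulVec (σ.ζ t)) i) i := by
  -- Multiplying the error model by `W` replaces `Kp` by `D_s S`. As `W` is unit lower triangular,
  -- row `i` of `W ē` is `ē_i` plus a combination of the entries of `η_i`, so the true values are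
  -- row `i` of `W` for `θ_i` and `D_s S` for `Ψ`.
  have h1 : W.mulVec (fun i => σ.ebar t i -
        Kp.mulVec (σ.hΘω t - Θs.transpose.mulVec (σ.ζ t)) i) =
      W.mulVec (σ.ebar t) - (D.Ds * S).mulVec (σ.hΘω t - Θs.transpose.mulVec (σ.ζ t)) := by
    rw [← hWS, ← Matrix.mulVec_mulVec, ← Matrix.mulVec_sub]
    rfl
  have h2 : W.mulVec (σ.ebar t) i =
      ∑ j : Fin i.val, W i (Fin.castLE i.isLt.le j) * σ.η t i j + σ.ebar t i := by
    have : ∀ j, σ.η t i j = σ.ebar t (Fin.castLE i.isLt.le j) := h.eta t ht htT i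
    simp only [this]
    rw [sum_castLE fun j => W i j * σ.ebar t j]
    have h3 : ∀ j, W i j * σ.ebar t j = (if j < i then W i j * σ.ebar t j else 0) +
        if j = i then σ.ebar t i else 0 := by
      intro j
      rcases lt_trichotomy j i with hj | rfl | hj
      · simp [hj, hj.ne]
      · simp [hW1]
      · simp [hj.not_gt, hj.ne', hW0 i j hj]
    rw [Matrix.mulVec, dotProduct, Finset.sum_congr rfl fun j _ => h3 j, Finset.sum_add_distrib]
    simp
  have h4 : σ.hΘω t - Θs.transpose.mulVec (σ.ζ t) =
      (σ.Θ t - Θs).transpose.mulVec (σ.ζ t) - σ.Xi t := by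
    rw [h.xi t ht htT, Matrix.transpose_sub, Matrix.sub_mulVec]
    abel
  rw [h1, Pi.sub_apply, h2, h4, h.eps t ht htT i, Matrix.mulVec_sub, Pi.sub_apply,
    Matrix.sub_mulVec, Pi.sub_apply]
  simp only [dotProduct, sub_mul, Finset.sum_sub_distrib]
  ring

end

end PartialStateMRAC

/-! ### The Lyapunov function of the parameter errors; rates of `e` and `ē` -/

namespace PartialStateMRAC

theorem FilterOn.hasRateOn_top {T : ℝ} {p : ℝ[X]} {v g : ℝ → ℝ} {q : ℝ → ℕ → ℝ}
    (h : FilterOn T p v q) (hm : p.Monic) (hv : HasRateOn T v g) :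
    HasRateOn T (fun t => q t p.natDegree)
      (fun t => g t - ∑ k ∈ Finset.range p.natDegree, p.coeff k * q t (k + 1)) :=
  (hv.sub (HasRateOn.sum _ fun k hk => (h.1 k (Finset.mem_range.1 hk)).const_mul _)).congr
    (fun _ ht htT => h.top_eq hm ht htT) fun _ _ _ => rfl

theorem HasRateOn.dotProduct_mulVec {ι : Type*} [Fintype ι] {P : Matrix ι ι ℝ} (hP : P.IsSymm)
    {T : ℝ} {z f : ℝ → ι → ℝ} (z₀ : ι → ℝ)
    (h : ∀ i, HasRateOn T (fun t => z t i) (fun t => f t i)) :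
    HasRateOn T (fun t => (z t - z₀) ⬝ᵥ P.mulVec (z t - z₀))
      (fun t => 2 * ((z t - z₀) ⬝ᵥ P.mulVec (f t))) :=
  HasRateOn.quadratic hP (z := fun t => z t - z₀) fun i =>
    ((h i).sub (HasRateOn.const T (z₀ i))).congr (fun _ _ _ => rfl) fun _ _ _ => by ring

section

variable {M n n₀ : ℕ} {A : Matrix (Fin n) (Fin n) ℝ} {B : Matrix (Fin n) (Fin M) ℝ}
  {C : Matrix (Fin M) (Fin n) ℝ} {C₀ : Matrix (Fin n₀) (Fin n) ℝ} {D : Design M n n₀}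
  {r : ℝ → Fin M → ℝ} {I : InitialData M n n₀}
  {Kp : Matrix (Fin M) (Fin M) ℝ}

/-- The Lyapunov function of the parameter errors. -/
noncomputable def lyapunov (D : Design M n n₀) (W S : Matrix (Fin M) (Fin M) ℝ)
    (Θs : Matrix (RegIdx M n n₀) (Fin M) ℝ) (σ : Signals M n n₀) (t : ℝ) : ℝ :=
  ∑ i, (σ.θ t i - fun j => W i (Fin.castLE i.isLt.le j)) ⬝ᵥ
      (D.Γθ i)⁻¹.mulVec (σ.θ t i - fun j => W i (Fin.castLE i.isLt.le j)) +
    ∑ j, ((fun i => σ.Ψ t i j) - fun i => (D.Ds * S) i j) ⬝ᵥ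
      D.Γ⁻¹.mulVec ((fun i => σ.Ψ t i j) - fun i => (D.Ds * S) i j) +
    ∑ a, (σ.Θ t a - Θs a) ⬝ᵥ S.mulVec (σ.Θ t a - Θs a)

/-- In the terms of `θ_i` and `Ψ` the inverse gains cancel the gains of the adaptive laws. In the
term of `Θ` the law contains only `D_s`; the weight `S` supplies the missing factor, because `(D_s
S)ᵀ = S D_s`. The three contributions add up to `ε ⬝ᵥ (ε - W δ)`, where `δ` is the decaying residual
of the error model and `ε - W δ` is the part of `ε` linear in the parameter errors. -/
theorem IsClosedLoopOn.hasRateOn_lyapunov {σ : Signals M n n₀} {T : ℝ}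
    (h : IsClosedLoopOn T A B C C₀ D r I σ) {W S : Matrix (Fin M) (Fin M) ℝ}
    (hW1 : ∀ i, W i i = 1) (hW0 : ∀ i j, i < j → W i j = 0) (hWS : W * Kp = D.Ds * S)
    (hS : S.PosDef) (Θs : Matrix (RegIdx M n n₀) (Fin M) ℝ) :
    HasRateOn T (lyapunov D W S Θs σ) (fun t => -2 * (σ.ε t ⬝ᵥ (σ.ε t -
      W.mulVec (fun i => σ.ebar t i -
        Kp.mulVec (σ.hΘω t - Θs.transpose.mulVec (σ.ζ t)) i)) / σ.msq t)) := by
  have h1 : ∀ i, HasRateOn T (fun t => (σ.θ t i - fun j => W i (Fin.castLE i.isLt.le j)) ⬝ᵥ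
      (D.Γθ i)⁻¹.mulVec (σ.θ t i - fun j => W i (Fin.castLE i.isLt.le j)))
      (fun t => 2 * ((σ.θ t i - fun j => W i (Fin.castLE i.isLt.le j)) ⬝ᵥ
        (D.Γθ i)⁻¹.mulVec (fun j => -((D.Γθ i).mulVec (σ.ε t i • σ.η t i) j) / σ.msq t))) :=
    fun i => HasRateOn.dotProduct_mulVec (D.Γθ_pos i).inv.isSymm_of_real _ (h.law_θ i)
  have h2 : ∀ j, HasRateOn T (fun t => ((fun i => σ.Ψ t i j) - fun i => (D.Ds * S) i j) ⬝ᵥ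
      D.Γ⁻¹.mulVec ((fun i => σ.Ψ t i j) - fun i => (D.Ds * S) i j))
      (fun t => 2 * (((fun i => σ.Ψ t i j) - fun i => (D.Ds * S) i j) ⬝ᵥ
        D.Γ⁻¹.mulVec (fun i => -((D.Γ * Matrix.vecMulVec (σ.ε t) (σ.Xi t)) i j) / σ.msq t))) :=
    fun j => HasRateOn.dotProduct_mulVec (z := fun t i => σ.Ψ t i j) D.Γ_pos.inv.isSymm_of_real _
      fun i => h.law_Ψ i j
  have h3 : ∀ a, HasRateOn T (fun t => (σ.Θ t a - Θs a) ⬝ᵥ S.mulVec (σ.Θ t a - Θs a))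
      (fun t => 2 * ((σ.Θ t a - Θs a) ⬝ᵥ S.mulVec
        (fun i => -((D.Ds * Matrix.vecMulVec (σ.ε t) (σ.ζ t)) i a) / σ.msq t))) :=
    fun a => HasRateOn.dotProduct_mulVec hS.isSymm_of_real _ (h.law_Θ a)
  refine (((HasRateOn.sum Finset.univ fun i _ => h1 i).add
    (HasRateOn.sum Finset.univ fun i _ => h2 i)).add
    (HasRateOn.sum Finset.univ fun i _ => h3 i)).congr (fun _ _ _ => rfl) fun t ht htT => ?_
  set m := σ.msq t with hm
  have e1 : ∀ i, 2 * ((σ.θ t i - fun j => W i (Fin.castLE i.isLt.le j)) ⬝ᵥ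
      (D.Γθ i)⁻¹.mulVec (fun j => -((D.Γθ i).mulVec (σ.ε t i • σ.η t i) j) / m)) =
      -2 * (σ.ε t i * ((fun j => σ.θ t i j - W i (Fin.castLE i.isLt.le j)) ⬝ᵥ σ.η t i) / m) := by
    intro i
    have : (fun j => -((D.Γθ i).mulVec (σ.ε t i • σ.η t i) j) / m) =
        (-(σ.ε t i) / m) • (D.Γθ i).mulVec (σ.η t i) := by
      ext j
      rw [Matrix.mulVec_smul, Pi.smul_apply, Pi.smul_apply, smul_eq_mul, smul_eq_mul]
      ring
    rw [this, Matrix.mulVec_smul, Matrix.mulVec_mulVec, Matrix.nonsing_inv_mul _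
      ((Matrix.isUnit_iff_isUnit_det _).1 (D.Γθ_pos i).isUnit), Matrix.one_mulVec, dotProduct_smul,
      smul_eq_mul]
    change 2 * (-σ.ε t i / m *
      ((fun j => σ.θ t i j - W i (Fin.castLE i.isLt.le j)) ⬝ᵥ σ.η t i)) = _
    ring
  have e2 : ∀ j, 2 * (((fun i => σ.Ψ t i j) - fun i => (D.Ds * S) i j) ⬝ᵥ
      D.Γ⁻¹.mulVec (fun i => -((D.Γ * Matrix.vecMulVec (σ.ε t) (σ.Xi t)) i j) / m)) =
      -2 * (∑ i, σ.ε t i * ((σ.Ψ t i j - (D.Ds * S) i j) * σ.Xi t j)) / m := by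
    intro j
    have : (fun i => -((D.Γ * Matrix.vecMulVec (σ.ε t) (σ.Xi t)) i j) / m) =
        (-(σ.Xi t j) / m) • D.Γ.mulVec (σ.ε t) := by
      ext i
      rw [Matrix.mul_vecMulVec, Matrix.vecMulVec_apply, Pi.smul_apply, smul_eq_mul]
      ring
    rw [this, Matrix.mulVec_smul, Matrix.mulVec_mulVec, Matrix.nonsing_inv_mul _
      ((Matrix.isUnit_iff_isUnit_det _).1 D.Γ_pos.isUnit), Matrix.one_mulVec, dotProduct_smul,
      smul_eq_mul]
    simp only [dotProduct, Pi.sub_apply, Finset.mul_sum, Finset.sum_div]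
    exact Finset.sum_congr rfl fun i _ => by ring
  have e3 : ∀ a, 2 * ((σ.Θ t a - Θs a) ⬝ᵥ S.mulVec
        (fun i => -((D.Ds * Matrix.vecMulVec (σ.ε t) (σ.ζ t)) i a) / m)) =
      -2 * (∑ i, σ.ε t i * ((D.Ds * S).mulVec (σ.Θ t a - Θs a) i * σ.ζ t a)) / m := by
    intro a
    have : (fun i => -((D.Ds * Matrix.vecMulVec (σ.ε t) (σ.ζ t)) i a) / m) =
        (-(σ.ζ t a) / m) • D.Ds.mulVec (σ.ε t) := by
      ext i
      rw [Matrix.mul_vecMulVec, Matrix.vecMulVec_apply, Pi.smul_apply, smul_eq_mul]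
      ring
    have hsym : (σ.Θ t a - Θs a) ⬝ᵥ S.mulVec (D.Ds.mulVec (σ.ε t)) =
        ∑ i, σ.ε t i * (D.Ds * S).mulVec (σ.Θ t a - Θs a) i := by
      have hDs : D.Ds.transpose = D.Ds := Matrix.diagonal_transpose _
      rw [← Matrix.mulVec_mulVec, Matrix.dotProduct_mulVec, ← Matrix.mulVec_transpose,
        hS.isSymm_of_real.eq, Matrix.dotProduct_mulVec, ← Matrix.mulVec_transpose, hDs,
        dotProduct_comm]
      rfl
    rw [this, Matrix.mulVec_smul, dotProduct_smul, hsym, smul_eq_mul]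
    simp only [Finset.mul_sum, Finset.sum_div]
    exact Finset.sum_congr rfl fun i _ => by ring
  simp only [e1, e2, e3]
  have hsplit : σ.ε t ⬝ᵥ (σ.ε t - W.mulVec (fun i => σ.ebar t i -
      Kp.mulVec (σ.hΘω t - Θs.transpose.mulVec (σ.ζ t)) i)) =
      ∑ i, σ.ε t i * ((fun j => σ.θ t i j - W i (Fin.castLE i.isLt.le j)) ⬝ᵥ σ.η t i) +
      ∑ j, ∑ i, σ.ε t i * ((σ.Ψ t i j - (D.Ds * S) i j) * σ.Xi t j) +
      ∑ a, ∑ i, σ.ε t i * ((D.Ds * S).mulVec (σ.Θ t a - Θs a) i * σ.ζ t a) := by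
    rw [Finset.sum_comm (s := (Finset.univ : Finset (Fin M))) (t := (Finset.univ : Finset (Fin M))),
      Finset.sum_comm (s := (Finset.univ : Finset (RegIdx M n n₀))), ← Finset.sum_add_distrib,
      ← Finset.sum_add_distrib]
    refine Finset.sum_congr rfl fun i _ => ?_
    rw [← Finset.mul_sum, ← Finset.mul_sum, ← mul_add, ← mul_add, Pi.sub_apply,
      h.eps_eq hW1 hW0 hWS Θs ht htT i, add_sub_cancel_right]
    congr 2
    have : (σ.Θ t - Θs).transpose.mulVec (σ.ζ t) = ∑ a, σ.ζ t a • (σ.Θ t a - Θs a) := by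
      ext k
      rw [Finset.sum_apply]
      exact Finset.sum_congr rfl fun a _ => mul_comm _ _
    rw [this, Matrix.mulVec_sum, Finset.sum_apply]
    refine Finset.sum_congr rfl fun a _ => ?_
    rw [Matrix.mulVec_smul, Pi.smul_apply, smul_eq_mul, mul_comm]
  rw [hsplit]
  simp only [← Finset.mul_sum, ← Finset.sum_div]
  ring

theorem IsClosedLoopOn.hasRateOn_y_m {σ : Signals M n n₀} {T : ℝ}
    (h : IsClosedLoopOn T A B C C₀ D r I σ)
    (hadj : ∀ i j, (D.ξ.adjugate i j).natDegree < D.ξ.det.natDegree) (i : Fin M) :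
    HasRateOn T (fun t => σ.y_m t i)
      (fun t => ∑ l, polyOp (σ.q_r t l) (X * D.ξ.adjugate i l)) :=
  (HasRateOn.sum Finset.univ fun l _ =>
    HasRateOn.polyOp (h.reference.filter l).1 (hadj i l)).congr
      (fun t ht htT => h.reference.out t ht htT i) fun _ _ _ => rfl

/-- The rate of the tracking error. -/
noncomputable def errorRate (A : Matrix (Fin n) (Fin n) ℝ) (B : Matrix (Fin n) (Fin M) ℝ)
    (C : Matrix (Fin M) (Fin n) ℝ) (D : Design M n n₀) (σ : Signals M n n₀) (t : ℝ) (i : Fin M) :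
    ℝ :=
  C.mulVec (A.mulVec (σ.x t) + B.mulVec (σ.u t)) i -
    ∑ l, polyOp (σ.q_r t l) (X * D.ξ.adjugate i l)

theorem IsClosedLoopOn.hasRateOn_e {σ : Signals M n n₀} {T : ℝ}
    (h : IsClosedLoopOn T A B C C₀ D r I σ)
    (hadj : ∀ i j, (D.ξ.adjugate i j).natDegree < D.ξ.det.natDegree) (i : Fin M) :
    HasRateOn T (fun t => σ.e t i) (fun t => errorRate A B C D σ t i) := by
  have h1 : HasRateOn T (fun t => C.mulVec (σ.x t) i)
      (fun t => C.mulVec (A.mulVec (σ.x t) + B.mulVec (σ.u t)) i) :=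
    HasRateOn.sum Finset.univ fun k _ => (h.state k).const_mul (C i k)
  refine (h1.sub (h.hasRateOn_y_m hadj i)).congr (fun t ht htT => ?_) fun _ _ _ => rfl
  rw [h.error t ht htT, Pi.sub_apply, h.output t ht htT]

/-- The rate of `ē`. -/
noncomputable def ebarRate (A : Matrix (Fin n) (Fin n) ℝ) (B : Matrix (Fin n) (Fin M) ℝ)
    (C : Matrix (Fin M) (Fin n) ℝ) (D : Design M n n₀) (σ : Signals M n n₀) (t : ℝ) (i : Fin M) :
    ℝ :=
  ∑ j, (∑ k ∈ Finset.range D.f.natDegree, (D.ξ i j).coeff k * σ.q_e t j (k + 1) +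
    (D.ξ i j).coeff D.f.natDegree * (errorRate A B C D σ t j -
      ∑ k ∈ Finset.range D.f.natDegree, D.f.coeff k * σ.q_e t j (k + 1)))

theorem IsClosedLoopOn.hasRateOn_ebar {σ : Signals M n n₀} {T : ℝ}
    (h : IsClosedLoopOn T A B C C₀ D r I σ)
    (hadj : ∀ i j, (D.ξ.adjugate i j).natDegree < D.ξ.det.natDegree) (i : Fin M) :
    HasRateOn T (fun t => σ.ebar t i) (fun t => ebarRate A B C D σ t i) := by
  refine (HasRateOn.sum Finset.univ fun j _ => (HasRateOn.sum (Finset.range D.f.natDegree)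
    fun k hk => ((h.filter_e.filter j).1 k (Finset.mem_range.1 hk)).const_mul
      ((D.ξ i j).coeff k)).add (((h.filter_e.filter j).hasRateOn_top D.f_monic
        (h.hasRateOn_e hadj j)).const_mul ((D.ξ i j).coeff D.f.natDegree))).congr
      (fun t ht htT => ?_) fun _ _ _ => rfl
  rw [h.filter_e.out t ht htT]
  refine Finset.sum_congr rfl fun j _ => ?_
  rw [polyOp_eq_sum _ ((natDegree_le_maxDegree D.ξ i j).trans D.f_degree.ge),
    Finset.sum_range_succ]

end

end PartialStateMRAC

/-! ### Energy estimate: bounded estimates and integrability of `|ε|² / m²` -/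

namespace PartialStateMRAC

theorem UDecay.mul {J : Type*} {T : J → ℝ} {v v' : J → ℝ → ℝ} (h : UDecay T v) (h' : UDecay T v') :
    UDecay T fun j t => v j t * v' j t := by
  obtain ⟨b', hb', hv⟩ := h'
  exact ⟨b', hb', hv.mul_bdd h.uBd⟩

theorem UBd.of_sq_sub_le {ι : Type*} {v : ι → ℝ} (c : ℝ) {K : ℝ} (h : ∀ i, (v i - c) ^ 2 ≤ K) :
    UBd (fun _ => 1) v := by
  refine ⟨Real.sqrt K + |c|, fun i => ?_⟩
  have h1 : |v i - c| ≤ Real.sqrt K := Real.abs_le_sqrt (h i)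
  have h2 := abs_add_le (v i - c) c
  rw [sub_add_cancel] at h2
  linarith

theorem integral_exp_neg_le {b t : ℝ} (hb : 0 < b) (_ht : 0 ≤ t) :
    ∫ s in (0 : ℝ)..t, Real.exp (-b * s) ≤ 1 / b := by
  rw [intervalIntegral.integral_comp_mul_left (fun x => Real.exp x) (neg_ne_zero.2 hb.ne'),
    integral_exp, smul_eq_mul, mul_zero, Real.exp_zero, inv_neg, neg_mul, ← mul_neg, neg_sub,
    one_div]
  exact mul_le_of_le_one_right (inv_nonneg.2 hb.le) (by linarith [Real.exp_pos (-b * t)])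

section

variable {M n n₀ : ℕ} {A : Matrix (Fin n) (Fin n) ℝ} {B : Matrix (Fin n) (Fin M) ℝ}
  {C : Matrix (Fin M) (Fin n) ℝ} {C₀ : Matrix (Fin n₀) (Fin n) ℝ} {D : Design M n n₀}
  {r : ℝ → Fin M → ℝ} {I : InitialData M n n₀}
  {Kp : Matrix (Fin M) (Fin M) ℝ}

theorem IsModifiedInteractor.filter_degree_pos {G : ℂ → Matrix (Fin M) (Fin M) ℂ}
    (h : IsModifiedInteractor D.ξ G Kp) (i : Fin M) : 0 < D.f.natDegree :=
  (h.diag_degree i).trans_le ((natDegree_le_maxDegree D.ξ i i).trans D.f_degree.ge)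

theorem IsClosedLoopOn.continuousOn_eps {σ : Signals M n n₀} {T : ℝ}
    (h : IsClosedLoopOn T A B C C₀ D r I σ)
    (hxi : IsModifiedInteractor D.ξ (transferMatrix A B C) Kp) (i : Fin M) :
    ContinuousOn (fun t => σ.ε t i) (Set.Icc 0 T) ∧ ContinuousOn σ.msq (Set.Icc 0 T) := by
  have hN := hxi.filter_degree_pos i
  have hebar : ∀ i, ContinuousOn (fun t => σ.ebar t i) (Set.Icc 0 T) :=
    fun i => (h.hasRateOn_ebar hxi.adjugate_natDegree_lt i).continuousOn
  have hη : ∀ i j, ContinuousOn (fun t => σ.η t i j) (Set.Icc 0 T) := fun i j =>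
    (hebar _).congr fun t ht => h.eta t ht.1 ht.2 i j
  have hζ : ∀ a, ContinuousOn (fun t => σ.ζ t a) (Set.Icc 0 T) := fun a =>
    ((h.filter_ω.filter a).1 0 hN).continuousOn.congr fun t ht => h.filter_ω.out_one ht.1 ht.2 a
  have hΘω : ∀ a, ContinuousOn (fun t => σ.hΘω t a) (Set.Icc 0 T) := fun a =>
    ((h.filter_Θω.filter a).1 0 hN).continuousOn.congr fun t ht =>
      h.filter_Θω.out_one ht.1 ht.2 a
  have hXi : ∀ i, ContinuousOn (fun t => σ.Xi t i) (Set.Icc 0 T) := by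
    intro i
    have : ContinuousOn (fun t => ∑ a, σ.Θ t a i * σ.ζ t a - σ.hΘω t i) (Set.Icc 0 T) :=
      (continuousOn_finsetSum _ fun a _ => (h.law_Θ a i).continuousOn.mul (hζ a)).sub (hΘω i)
    refine this.congr fun t ht => ?_
    rw [h.xi t ht.1 ht.2]
    rfl
  constructor
  · have : ContinuousOn (fun t => ∑ j, σ.θ t i j * σ.η t i j + ∑ j, σ.Ψ t i j * σ.Xi t j +
        σ.ebar t i) (Set.Icc 0 T) :=
      ((continuousOn_finsetSum _ fun j _ => (h.law_θ i j).continuousOn.mul (hη i j)).add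
        (continuousOn_finsetSum _ fun j _ => (h.law_Ψ i j).continuousOn.mul (hXi j))).add
        (hebar i)
    exact this.congr fun t ht => h.eps t ht.1 ht.2 i
  · have : ContinuousOn (fun t => 1 + ∑ a, σ.ζ t a * σ.ζ t a + ∑ j, σ.Xi t j * σ.Xi t j +
        ∑ i, ∑ j, σ.η t i j * σ.η t i j) (Set.Icc 0 T) :=
      ((continuousOn_const.add (continuousOn_finsetSum _ fun j _ => (hζ j).mul (hζ j))).add
        (continuousOn_finsetSum _ fun j _ => (hXi j).mul (hXi j))).add
        (continuousOn_finsetSum _ fun i _ => continuousOn_finsetSum _ fun j _ =>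
          (hη i j).mul (hη i j))
    exact this.congr fun t ht => h.normalization t ht.1 ht.2

theorem IsClosedLoopOn.intervalIntegrable_eps_sq {σ : Signals M n n₀} {T : ℝ}
    (h : IsClosedLoopOn T A B C C₀ D r I σ)
    (hxi : IsModifiedInteractor D.ξ (transferMatrix A B C) Kp) (i : Fin M) {t : ℝ} (ht : 0 ≤ t)
    (htT : t ≤ T) : IntervalIntegrable (fun s => σ.ε s i ^ 2 / σ.msq s) volume 0 t := by
  obtain ⟨h1, h2⟩ := h.continuousOn_eps hxi i
  refine ContinuousOn.intervalIntegrable (((h1.pow 2).div h2 fun s hs => ?_).mono ?_)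
  · linarith [h.one_le_msq hs.1 hs.2]
  · rw [Set.uIcc_of_le ht]
    exact Set.Icc_subset_Icc_right htT

theorem sign_mul_pos {x : ℝ} (hx : x ≠ 0) : 0 < Real.sign x * x := by
  rcases lt_or_gt_of_ne hx with h | h
  · rw [Real.sign_of_neg h]
    linarith
  · rw [Real.sign_of_pos h]
    linarith

/-- With `w = W δ`, Young's inequality gives `V̇ ≤ (|w|² - |ε|²) / m² ≤ |w|² - |ε|² / m²`, since `m²
≥ 1`. The square `|w|²` decays exponentially, so `V + ∫ |ε|² / m²` stays below `V(0)` plus a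
constant. Nothing is assumed about the size of the states, and `V(0)` depends only on the common
initial data; hence the bounds are uniform over the family. -/
theorem exists_lyapunov_bound {J : Type*} {T : J → ℝ} {σ : J → Signals M n n₀}
    (h : ∀ j, IsClosedLoopOn (T j) A B C C₀ D r I (σ j))
    (hxi : IsModifiedInteractor D.ξ (transferMatrix A B C) Kp)
    (hminors : ∀ k, 1 ≤ k → k ≤ M → leadingMinor Kp k ≠ 0)
    (hsgn : ∀ i : Fin M, D.sgn i =
      Real.sign (leadingMinor Kp (i.val + 1) / leadingMinor Kp i.val))
    {Θs : Matrix (RegIdx M n n₀) (Fin M) ℝ}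
    (hδ : ∀ i, UDecay T fun j t => (σ j).ebar t i -
      Kp.mulVec ((σ j).hΘω t - Θs.transpose.mulVec ((σ j).ζ t)) i) :
    (∀ i k, UBd (fun _ : Times T => 1) fun p => (σ p.1.1).θ p.1.2 i k) ∧
    (∀ i k, UBd (fun _ : Times T => 1) fun p => (σ p.1.1).Ψ p.1.2 i k) ∧
    (∀ a i, UBd (fun _ : Times T => 1) fun p => (σ p.1.1).Θ p.1.2 a i) ∧
    ∃ K : ℝ, ∀ j t, 0 ≤ t → t ≤ T j →
      ∀ i, ∫ s in (0 : ℝ)..t, (σ j).ε s i ^ 2 / (σ j).msq s ≤ K := by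
  obtain ⟨W, S, hW1, hW0, hS, hWS⟩ := exists_unitLower_mul_eq Kp (fun i => D.sgn i * D.γ i) (by
    intro i
    have h1 : leadingMinor Kp (i.val + 1) / leadingMinor Kp i.val ≠ 0 := by
      refine div_ne_zero (hminors _ (by omega) (by omega)) ?_
      rcases Nat.eq_zero_or_pos i.val with h0 | h0
      · rw [h0, leadingMinor_zero]
        exact one_ne_zero
      · exact hminors _ h0 i.isLt.le
    rw [hsgn i, mul_right_comm]
    exact mul_pos (sign_mul_pos h1) (D.γ_pos i))
  change W * Kp = D.Ds * S at hWS
  set w : J → ℝ → Fin M → ℝ := fun j t => W.mulVec (fun i => (σ j).ebar t i -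
        Kp.mulVec ((σ j).hΘω t - Θs.transpose.mulVec ((σ j).ζ t)) i) with hw
  have hwd : UDecay T fun j t => ∑ i, w j t i * w j t i :=
    UDecay.sum _ fun i _ => (UDecay.mulVec W hδ i).mul (UDecay.mulVec W hδ i)
  obtain ⟨b, hb, K₀, hK₀⟩ := hwd
  set c₀ := ∑ i, (I.θ i - fun j => W i (Fin.castLE i.isLt.le j)) ⬝ᵥ
      (D.Γθ i)⁻¹.mulVec (I.θ i - fun j => W i (Fin.castLE i.isLt.le j)) +
    ∑ j, ((fun i => I.Ψ i j) - fun i => (D.Ds * S) i j) ⬝ᵥ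
      D.Γ⁻¹.mulVec ((fun i => I.Ψ i j) - fun i => (D.Ds * S) i j) +
    ∑ a, (stack I.Θ₁ I.Θ₂ I.Θ₂₀ I.Θ₃ a - Θs a) ⬝ᵥ
      S.mulVec (stack I.Θ₁ I.Θ₂ I.Θ₂₀ I.Θ₃ a - Θs a) with hc₀
  have hV0 : ∀ j, lyapunov D W S Θs (σ j) 0 = c₀ := fun j => by
    rw [lyapunov, (h j).init_θ, (h j).init_Ψ, (h j).init_Θ]
  have hmain : ∀ j t, 0 ≤ t → t ≤ T j → lyapunov D W S Θs (σ j) t +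
      ∑ i, ∫ s in (0 : ℝ)..t, (σ j).ε s i ^ 2 / (σ j).msq s ≤ c₀ + |K₀| * (1 / b) := by
    intro j t ht htT
    have hii : ∀ t, 0 ≤ t → t ≤ T j → IntervalIntegrable
        (fun s => ∑ i, (σ j).ε s i ^ 2 / (σ j).msq s) volume 0 t := fun t ht htT => by
      have := IntervalIntegrable.sum (μ := volume) (a := 0) (b := t) Finset.univ
        (f := fun i s => (σ j).ε s i ^ 2 / (σ j).msq s)
        fun i _ => (h j).intervalIntegrable_eps_sq hxi i ht htT
      exact this.congr fun s _ => by simp [Finset.sum_apply]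
    have hexp : ∀ t, IntervalIntegrable (fun s => |K₀| * Real.exp (-b * s)) volume 0 t :=
      fun t => (by fun_prop : Continuous fun s : ℝ => |K₀| * Real.exp (-b * s)).intervalIntegrable
        _ _
    have h1 := ((h j).hasRateOn_lyapunov hW1 hW0 hWS hS Θs).le_add_integral
      (β := fun s => |K₀| * Real.exp (-b * s) - ∑ i, (σ j).ε s i ^ 2 / (σ j).msq s)
      (fun t ht htT => (hexp t).sub (hii t ht htT)) (fun s hs hsT => by
        have hm := (h j).one_le_msq hs hsT
        have hm0 : 0 < (σ j).msq s := by linarith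
        have hww := (le_abs_self _).trans (hK₀ ⟨⟨j, s⟩, hs, hsT⟩)
        simp only at hww
        have hww' : ∑ i, w j s i * w j s i ≤ |K₀| * Real.exp (-b * s) :=
          hww.trans (mul_le_mul_of_nonneg_right (le_abs_self _) (Real.exp_pos _).le)
        have hwn : 0 ≤ ∑ i, w j s i * w j s i := Finset.sum_nonneg fun _ _ => mul_self_nonneg _
        have hyoung : -2 * ((σ j).ε s ⬝ᵥ ((σ j).ε s - w j s)) ≤
            ∑ i, w j s i * w j s i - ∑ i, (σ j).ε s i ^ 2 := by
          rw [dotProduct, Finset.mul_sum, ← Finset.sum_sub_distrib]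
          refine Finset.sum_le_sum fun i _ => ?_
          rw [Pi.sub_apply]
          nlinarith [sq_nonneg ((σ j).ε s i - w j s i)]
        calc -2 * ((σ j).ε s ⬝ᵥ ((σ j).ε s - w j s) / (σ j).msq s)
            = -2 * ((σ j).ε s ⬝ᵥ ((σ j).ε s - w j s)) / (σ j).msq s := by ring
          _ ≤ (∑ i, w j s i * w j s i - ∑ i, (σ j).ε s i ^ 2) / (σ j).msq s :=
              div_le_div_of_nonneg_right hyoung hm0.le
          _ = (∑ i, w j s i * w j s i) / (σ j).msq s - ∑ i, (σ j).ε s i ^ 2 / (σ j).msq s := by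
              rw [sub_div, Finset.sum_div Finset.univ (fun i => (σ j).ε s i ^ 2)]
          _ ≤ _ := by
              have := div_le_self hwn hm
              linarith) ht htT
    rw [hV0, intervalIntegral.integral_sub (hexp t) (hii t ht htT),
      intervalIntegral.integral_const_mul, intervalIntegral.integral_finsetSum fun i _ =>
        (h j).intervalIntegrable_eps_sq hxi i ht htT] at h1
    have h2 := mul_le_mul_of_nonneg_left (integral_exp_neg_le hb ht) (abs_nonneg K₀)
    linarith
  have hint : ∀ j t, 0 ≤ t → t ≤ T j → ∀ i,
      0 ≤ ∫ s in (0 : ℝ)..t, (σ j).ε s i ^ 2 / (σ j).msq s := fun j t ht htT i =>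
    intervalIntegral.integral_nonneg ht fun s hs => div_nonneg (sq_nonneg _)
      (by linarith [(h j).one_le_msq hs.1 (hs.2.trans htT)])
  set K := c₀ + |K₀| * (1 / b) with hK
  have hnn : ∀ {ι : Type} [Fintype ι] {P : Matrix ι ι ℝ}, P.PosDef → ∀ z : ι → ℝ,
      0 ≤ z ⬝ᵥ P.mulVec z := fun hP z => by
    simpa using hP.posSemidef.dotProduct_mulVec_nonneg z
  have hterm : ∀ j t, 0 ≤ t → t ≤ T j →
      (∀ i, ((σ j).θ t i - fun j => W i (Fin.castLE i.isLt.le j)) ⬝ᵥ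
        (D.Γθ i)⁻¹.mulVec ((σ j).θ t i - fun j => W i (Fin.castLE i.isLt.le j)) ≤ K) ∧
      (∀ k, ((fun i => (σ j).Ψ t i k) - fun i => (D.Ds * S) i k) ⬝ᵥ
        D.Γ⁻¹.mulVec ((fun i => (σ j).Ψ t i k) - fun i => (D.Ds * S) i k) ≤ K) ∧
      (∀ a, ((σ j).Θ t a - Θs a) ⬝ᵥ S.mulVec ((σ j).Θ t a - Θs a) ≤ K) ∧
      ∀ i, ∫ s in (0 : ℝ)..t, (σ j).ε s i ^ 2 / (σ j).msq s ≤ K := by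
    intro j t ht htT
    have h0 := hmain j t ht htT
    rw [lyapunov] at h0
    have n1 : ∀ i ∈ Finset.univ, 0 ≤ ((σ j).θ t i - fun j => W i (Fin.castLE i.isLt.le j)) ⬝ᵥ
        (D.Γθ i)⁻¹.mulVec ((σ j).θ t i - fun j => W i (Fin.castLE i.isLt.le j)) :=
      fun i _ => hnn (D.Γθ_pos i).inv _
    have n2 : ∀ k ∈ Finset.univ, 0 ≤ ((fun i => (σ j).Ψ t i k) - fun i => (D.Ds * S) i k) ⬝ᵥ
        D.Γ⁻¹.mulVec ((fun i => (σ j).Ψ t i k) - fun i => (D.Ds * S) i k) :=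
      fun k _ => hnn D.Γ_pos.inv _
    have n3 : ∀ a ∈ Finset.univ, 0 ≤ ((σ j).Θ t a - Θs a) ⬝ᵥ S.mulVec ((σ j).Θ t a - Θs a) :=
      fun a _ => hnn hS _
    have n4 : ∀ i ∈ Finset.univ, 0 ≤ ∫ s in (0 : ℝ)..t, (σ j).ε s i ^ 2 / (σ j).msq s :=
      fun i _ => hint j t ht htT i
    have s1 := Finset.sum_nonneg n1
    have s2 := Finset.sum_nonneg n2
    have s3 := Finset.sum_nonneg n3
    have s4 := Finset.sum_nonneg n4
    refine ⟨fun i => ?_, fun k => ?_, fun a => ?_, fun i => ?_⟩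
    · linarith [Finset.single_le_sum n1 (Finset.mem_univ i)]
    · linarith [Finset.single_le_sum n2 (Finset.mem_univ k)]
    · linarith [Finset.single_le_sum n3 (Finset.mem_univ a)]
    · linarith [Finset.single_le_sum n4 (Finset.mem_univ i)]
  refine ⟨fun i k => ?_, fun i k => ?_, fun a i => ?_, K, fun j t ht htT => (hterm j t ht htT).2.2.2⟩
  · obtain ⟨c, hc, hcz⟩ := (D.Γθ_pos i).inv.exists_sq_le
    exact UBd.of_sq_sub_le (W i (Fin.castLE i.isLt.le k)) (K := c * K) fun p =>
      (hcz _ k).trans (mul_le_mul_of_nonneg_left ((hterm _ _ p.2.1 p.2.2).1 i) hc)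
  · obtain ⟨c, hc, hcz⟩ := D.Γ_pos.inv.exists_sq_le
    exact UBd.of_sq_sub_le ((D.Ds * S) i k) (K := c * K) fun p =>
      (hcz _ i).trans (mul_le_mul_of_nonneg_left ((hterm _ _ p.2.1 p.2.2).2.1 k) hc)
  · obtain ⟨c, hc, hcz⟩ := hS.exists_sq_le
    exact UBd.of_sq_sub_le (Θs a i) (K := c * K) fun p =>
      (hcz _ i).trans (mul_le_mul_of_nonneg_left ((hterm _ _ p.2.1 p.2.2).2.2.1 a) hc)

end

end PartialStateMRAC

namespace PartialStateMRAC

/-! ### Bounds of all signals by the states of the linear part -/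

theorem UBd.polyOp {ι : Type*} {w : ι → ℝ} {q : ι → ℕ → ℝ} {g : ℝ[X]} {N : ℕ}
    (hg : g.natDegree ≤ N) (h : ∀ k ≤ N, UBd w fun p => q p k) :
    UBd w fun p => polyOp (q p) g :=
  (UBd.sum (Finset.range (N + 1)) fun k hk =>
    (h k (Nat.lt_succ_iff.1 (Finset.mem_range.1 hk))).const_mul (g.coeff k)).congr
    fun p => polyOp_eq_sum (q p) hg

theorem UBd.filter {ι : Type*} {w T τ : ι → ℝ} (hτ : ∀ p, 0 ≤ τ p) (hτT : ∀ p, τ p ≤ T p)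
    {P : ℝ[X]} (hm : P.Monic) {v : ι → ℝ → ℝ} {q : ι → ℝ → ℕ → ℝ}
    (hq : ∀ p, FilterOn (T p) P (v p) (q p)) (hv : UBd w fun p => v p (τ p))
    (hlow : ∀ k < P.natDegree, UBd w fun p => q p (τ p) k) {k : ℕ} (hk : k ≤ P.natDegree) :
    UBd w fun p => q p (τ p) k := by
  rcases hk.lt_or_eq with hk | rfl
  · exact hlow k hk
  · exact (hv.sub (UBd.sum (Finset.range P.natDegree) fun k hk =>
      (hlow k (Finset.mem_range.1 hk)).const_mul (P.coeff k))).congr fun p =>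
        (hq p).top_eq hm (hτ p) (hτT p)

theorem UBd.mul_div {ι : Type*} {m v v' : ι → ℝ} (hm : ∀ p, 0 < m p)
    (h : UBd (fun p => Real.sqrt (m p)) v) (h' : UBd (fun p => Real.sqrt (m p)) v') :
    UBd (fun _ => 1) fun p => v p * v' p / m p := by
  obtain ⟨c, hc⟩ := h
  obtain ⟨c', hc'⟩ := h'
  refine ⟨c * c', fun p => ?_⟩
  rw [abs_div, abs_mul, abs_of_pos (hm p), mul_one, div_le_iff₀ (hm p)]
  calc |v p| * |v' p| ≤ (c * Real.sqrt (m p)) * (c' * Real.sqrt (m p)) :=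
        mul_le_mul (hc p) (hc' p) (abs_nonneg _) ((abs_nonneg _).trans (hc p))
    _ = c * c' * m p := by
        rw [mul_mul_mul_comm, Real.mul_self_sqrt (hm p).le]

section

variable {M n n₀ : ℕ} {ι : Type*}

/-- The states of the linear part are `O(w)` at the times `τ`. -/
structure StateBound (D : Design M n n₀) (w : ι → ℝ) (σ : ι → Signals M n n₀) (τ : ι → ℝ) :
    Prop where
  x : ∀ i, UBd w fun p => (σ p).x (τ p) i
  q_u : ∀ j, ∀ k < D.Lam.natDegree, UBd w fun p => (σ p).q_u (τ p) j k
  q_y₀ : ∀ j, ∀ k < D.Lam.natDegree, UBd w fun p => (σ p).q_y₀ (τ p) j k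
  q_r : ∀ j, ∀ k < D.ξ.det.natDegree, UBd w fun p => (σ p).q_r (τ p) j k
  q_ω : ∀ j, ∀ k < D.f.natDegree, UBd w fun p => (σ p).q_ω (τ p) j k
  q_Θω : ∀ j, ∀ k < D.f.natDegree, UBd w fun p => (σ p).q_Θω (τ p) j k
  q_e : ∀ j, ∀ k < D.f.natDegree, UBd w fun p => (σ p).q_e (τ p) j k

/-- The parameter estimates are bounded at the times `τ`. -/
structure ParamBound (σ : ι → Signals M n n₀) (τ : ι → ℝ) : Prop where
  θ : ∀ i k, UBd (fun _ => 1) fun p => (σ p).θ (τ p) i k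
  Ψ : ∀ i k, UBd (fun _ => 1) fun p => (σ p).Ψ (τ p) i k
  Θ : ∀ a i, UBd (fun _ => 1) fun p => (σ p).Θ (τ p) a i

/-- The signals of the closed loop, and the rates of its states, are `O(w)` at the times `τ`. -/
structure SignalBound (A : Matrix (Fin n) (Fin n) ℝ) (B : Matrix (Fin n) (Fin M) ℝ)
    (C : Matrix (Fin M) (Fin n) ℝ) (D : Design M n n₀) (w : ι → ℝ) (σ : ι → Signals M n n₀)
    (τ : ι → ℝ) : Prop where
  x : ∀ i, UBd w fun p => (σ p).x (τ p) i
  u : ∀ i, UBd w fun p => (σ p).u (τ p) i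
  y : ∀ i, UBd w fun p => (σ p).y (τ p) i
  y₀ : ∀ i, UBd w fun p => (σ p).y₀ (τ p) i
  y_m : ∀ i, UBd w fun p => (σ p).y_m (τ p) i
  e : ∀ i, UBd w fun p => (σ p).e (τ p) i
  ω₁ : ∀ i, UBd w fun p => (σ p).ω₁ (τ p) i
  ω₂ : ∀ i, UBd w fun p => (σ p).ω₂ (τ p) i
  ω : ∀ i, UBd w fun p => (σ p).ω (τ p) i
  Θω : ∀ i, UBd w fun p => ((σ p).Θ (τ p)).transpose.mulVec ((σ p).ω (τ p)) i
  ebar : ∀ i, UBd w fun p => (σ p).ebar (τ p) i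
  η : ∀ i j, UBd w fun p => (σ p).η (τ p) i j
  ζ : ∀ i, UBd w fun p => (σ p).ζ (τ p) i
  hΘω : ∀ i, UBd w fun p => (σ p).hΘω (τ p) i
  Xi : ∀ i, UBd w fun p => (σ p).Xi (τ p) i
  ε : ∀ i, UBd w fun p => (σ p).ε (τ p) i
  msq : UBd (fun p => w p * w p) fun p => (σ p).msq (τ p)
  q_u : ∀ j, ∀ k ≤ D.Lam.natDegree, UBd w fun p => (σ p).q_u (τ p) j k
  q_y₀ : ∀ j, ∀ k ≤ D.Lam.natDegree, UBd w fun p => (σ p).q_y₀ (τ p) j k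
  q_r : ∀ j, ∀ k ≤ D.ξ.det.natDegree, UBd w fun p => (σ p).q_r (τ p) j k
  q_ω : ∀ j, ∀ k ≤ D.f.natDegree, UBd w fun p => (σ p).q_ω (τ p) j k
  q_Θω : ∀ j, ∀ k ≤ D.f.natDegree, UBd w fun p => (σ p).q_Θω (τ p) j k
  q_e : ∀ j, ∀ k ≤ D.f.natDegree, UBd w fun p => (σ p).q_e (τ p) j k
  stateRate : ∀ i, UBd w fun p =>
    (A.mulVec ((σ p).x (τ p)) + B.mulVec ((σ p).u (τ p))) i
  errorRate : ∀ i, UBd w fun p => errorRate A B C D (σ p) (τ p) i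
  ebarRate : ∀ i, UBd w fun p => ebarRate A B C D (σ p) (τ p) i

variable {A : Matrix (Fin n) (Fin n) ℝ} {B : Matrix (Fin n) (Fin M) ℝ}
  {C : Matrix (Fin M) (Fin n) ℝ} {C₀ : Matrix (Fin n₀) (Fin n) ℝ} {D : Design M n n₀}
  {r : ℝ → Fin M → ℝ} {I : InitialData M n n₀} {Kp : Matrix (Fin M) (Fin M) ℝ}
  {T τ w : ι → ℝ} {σ : ι → Signals M n n₀}

theorem UBd.mul_self {v v' : ι → ℝ} (h : UBd w v) (h' : UBd w v') :
    UBd (fun p => w p * w p) fun p => v p * v' p := by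
  obtain ⟨c, hc⟩ := h
  obtain ⟨c', hc'⟩ := h'
  refine ⟨c * c', fun p => ?_⟩
  rw [abs_mul]
  calc |v p| * |v' p| ≤ (c * w p) * (c' * w p) :=
        mul_le_mul (hc p) (hc' p) (abs_nonneg _) ((abs_nonneg _).trans (hc p))
    _ = c * c' * (w p * w p) := by ring

/-- Without an algebraic loop, every signal is obtained by substitution from the linear states and
`r`, with coefficients controlled by the parameter bounds; `r` is `O(w)` because `w ≥ 1`. The rate
of `e`, and with it that of `ē`, is available because the reference model is strictly proper. -/
theorem StateBound.signalBound (hs : StateBound D w σ τ) (hp : ParamBound σ τ)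
    (hw : ∀ p, 1 ≤ w p) (hτ : ∀ p, 0 ≤ τ p) (hτT : ∀ p, τ p ≤ T p)
    (h : ∀ p, IsClosedLoopOn (T p) A B C C₀ D r I (σ p))
    (hxi : IsModifiedInteractor D.ξ (transferMatrix A B C) Kp)
    (hr_bdd : ∀ i, BoundedSignal fun t => r t i) : SignalBound A B C D w σ τ := by
  have hone : UBd w fun _ => 1 := ⟨1, fun p => by simpa using hw p⟩
  have hadj := hxi.adjugate_natDegree_lt
  have hr : ∀ i, UBd w fun p => r (τ p) i := by
    intro i
    obtain ⟨K, hK⟩ := hr_bdd i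
    refine UBd.mono (w := fun _ => 1) ⟨K, fun p => ?_⟩ (fun _ => zero_le_one) hw
    simpa using hK _ (hτ p)
  have hy : ∀ i, UBd w fun p => (σ p).y (τ p) i := fun i =>
    (UBd.mulVec C hs.x i).congr fun p => by rw [(h p).output _ (hτ p) (hτT p)]
  have hy₀ : ∀ i, UBd w fun p => (σ p).y₀ (τ p) i := fun i =>
    (UBd.mulVec C₀ hs.x i).congr fun p => by rw [(h p).partialState _ (hτ p) (hτT p)]
  have hq_r : ∀ j, ∀ k ≤ D.ξ.det.natDegree, UBd w fun p => (σ p).q_r (τ p) j k := fun j k hk =>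
    UBd.filter hτ hτT hxi.det_monic (fun p => (h p).reference.filter j) (hr j) (hs.q_r j) hk
  have hy_m : ∀ i, UBd w fun p => (σ p).y_m (τ p) i := fun i =>
    (UBd.sum Finset.univ fun j _ => UBd.polyOp (hadj i j).le (hq_r j)).congr
      fun p => (h p).reference.out _ (hτ p) (hτT p) i
  have he : ∀ i, UBd w fun p => (σ p).e (τ p) i := fun i =>
    ((hy i).sub (hy_m i)).congr fun p => by rw [(h p).error _ (hτ p) (hτT p)]; rfl
  have hω₁ : ∀ i, UBd w fun p => (σ p).ω₁ (τ p) i := fun i =>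
    (hs.q_u i.2 i.1 (by rw [D.Lam_degree]; exact i.1.isLt)).congr
      fun p => (h p).filter₁.out_powerStack (hτ p) (hτT p) i
  have hω₂ : ∀ i, UBd w fun p => (σ p).ω₂ (τ p) i := fun i =>
    (hs.q_y₀ i.2 i.1 (by rw [D.Lam_degree]; exact i.1.isLt)).congr
      fun p => (h p).filter₂.out_powerStack (hτ p) (hτT p) i
  have hω : ∀ i, UBd w fun p => (σ p).ω (τ p) i := by
    rintro (i | i | i | i)
    · exact (hω₁ i).congr fun p => by rw [(h p).regressor _ (hτ p) (hτT p)]; rfl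
    · exact (hω₂ i).congr fun p => by rw [(h p).regressor _ (hτ p) (hτT p)]; rfl
    · exact (hy₀ i).congr fun p => by rw [(h p).regressor _ (hτ p) (hτT p)]; rfl
    · exact (hr i).congr fun p => by rw [(h p).regressor _ (hτ p) (hτT p)]; rfl
  have hΘω' : ∀ i, UBd w fun p => ((σ p).Θ (τ p)).transpose.mulVec ((σ p).ω (τ p)) i := fun i =>
    UBd.sum Finset.univ fun a _ => (hω a).mul_bdd (hp.Θ a i)
  have hu : ∀ i, UBd w fun p => (σ p).u (τ p) i := fun i =>
    (hΘω' i).congr fun p => by rw [(h p).control _ (hτ p) (hτT p)]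
  have hq_e : ∀ j, ∀ k ≤ D.f.natDegree, UBd w fun p => (σ p).q_e (τ p) j k := fun j k hk =>
    UBd.filter hτ hτT D.f_monic (fun p => (h p).filter_e.filter j) (he j) (hs.q_e j) hk
  have hq_ω : ∀ j, ∀ k ≤ D.f.natDegree, UBd w fun p => (σ p).q_ω (τ p) j k := fun j k hk =>
    UBd.filter hτ hτT D.f_monic (fun p => (h p).filter_ω.filter j) (hω j) (hs.q_ω j) hk
  have hq_Θω : ∀ j, ∀ k ≤ D.f.natDegree, UBd w fun p => (σ p).q_Θω (τ p) j k := fun j k hk =>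
    UBd.filter hτ hτT D.f_monic (fun p => (h p).filter_Θω.filter j) (hΘω' j) (hs.q_Θω j) hk
  have hebar : ∀ i, UBd w fun p => (σ p).ebar (τ p) i := fun i =>
    (UBd.sum Finset.univ fun j _ =>
      UBd.polyOp ((natDegree_le_maxDegree D.ξ i j).trans D.f_degree.ge) (hq_e j)).congr
      fun p => (h p).filter_e.out _ (hτ p) (hτT p) i
  have hη : ∀ i j, UBd w fun p => (σ p).η (τ p) i j := fun i j =>
    (hebar _).congr fun p => (h p).eta _ (hτ p) (hτT p) i j
  have hζ : ∀ i, UBd w fun p => (σ p).ζ (τ p) i := fun i =>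
    (hq_ω i 0 (Nat.zero_le _)).congr fun p => (h p).filter_ω.out_one (hτ p) (hτT p) i
  have hhΘω : ∀ i, UBd w fun p => (σ p).hΘω (τ p) i := fun i =>
    (hq_Θω i 0 (Nat.zero_le _)).congr fun p => (h p).filter_Θω.out_one (hτ p) (hτT p) i
  have hXi : ∀ i, UBd w fun p => (σ p).Xi (τ p) i := fun i =>
    (UBd.sub (UBd.sum Finset.univ fun a _ => (hζ a).mul_bdd (hp.Θ a i)) (hhΘω i)).congr
      fun p => by rw [(h p).xi _ (hτ p) (hτT p)]; rfl
  have hε : ∀ i, UBd w fun p => (σ p).ε (τ p) i := fun i =>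
    (UBd.add (UBd.add (UBd.sum Finset.univ fun j _ => (hη i j).mul_bdd (hp.θ i j))
      (UBd.sum Finset.univ fun j _ => (hXi j).mul_bdd (hp.Ψ i j))) (hebar i)).congr
      fun p => (h p).eps _ (hτ p) (hτT p) i
  have hstate : ∀ i, UBd w fun p => (A.mulVec ((σ p).x (τ p)) + B.mulVec ((σ p).u (τ p))) i :=
    fun i => (UBd.mulVec A hs.x i).add (UBd.mulVec B hu i)
  have hXdeg : ∀ i l, (X * D.ξ.adjugate i l).natDegree ≤ D.ξ.det.natDegree := fun i l => by
    have h1 := natDegree_mul_le (p := (X : ℝ[X])) (q := D.ξ.adjugate i l)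
    rw [natDegree_X] at h1
    have := hadj i l
    omega
  have herr : ∀ i, UBd w fun p => errorRate A B C D (σ p) (τ p) i := fun i =>
    (UBd.mulVec (x := fun p => A.mulVec ((σ p).x (τ p)) + B.mulVec ((σ p).u (τ p))) C hstate i).sub
      (UBd.sum Finset.univ fun l _ => UBd.polyOp (hXdeg i l) (hq_r l))
  refine ⟨hs.x, hu, hy, hy₀, hy_m, he, hω₁, hω₂, hω, hΘω', hebar, hη, hζ, hhΘω, hXi, hε, ?_,
    fun j k hk => UBd.filter hτ hτT D.Lam_monic (fun p => (h p).filter₁.filter j) (hu j)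
      (hs.q_u j) hk,
    fun j k hk => UBd.filter hτ hτT D.Lam_monic (fun p => (h p).filter₂.filter j) (hy₀ j)
      (hs.q_y₀ j) hk, hq_r, hq_ω, hq_Θω, hq_e, hstate, herr, fun i => ?_⟩
  · refine ((((hone.mul_self hone).add (UBd.sum Finset.univ fun a _ => (hζ a).mul_self (hζ a))).add
      (UBd.sum Finset.univ fun a _ => (hXi a).mul_self (hXi a))).add
      (UBd.sum Finset.univ fun i _ => UBd.sum Finset.univ fun j _ =>
        (hη i j).mul_self (hη i j))).congr fun p => ?_
    rw [(h p).normalization _ (hτ p) (hτT p), mul_one]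
    rfl
  · have hq : ∀ j, ∀ k ∈ Finset.range D.f.natDegree, UBd w fun p => (σ p).q_e (τ p) j (k + 1) :=
      fun j k hk => hq_e j (k + 1) (Finset.mem_range.1 hk)
    exact UBd.sum Finset.univ fun j _ =>
      (UBd.sum _ fun k hk => (hq j k hk).const_mul _).add
        (((herr j).sub (UBd.sum _ fun k hk => (hq j k hk).const_mul _)).const_mul _)

/-- The rates of the parameter estimates are bounded. -/
structure ParamRateBound (D : Design M n n₀) (σ : ι → Signals M n n₀) (τ : ι → ℝ) : Prop where
  θ : ∀ i j, UBd (fun _ => 1) fun p =>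
    -((D.Γθ i).mulVec ((σ p).ε (τ p) i • (σ p).η (τ p) i) j) / (σ p).msq (τ p)
  Ψ : ∀ i j, UBd (fun _ => 1) fun p =>
    -((D.Γ * Matrix.vecMulVec ((σ p).ε (τ p)) ((σ p).Xi (τ p))) i j) / (σ p).msq (τ p)
  Θ : ∀ a i, UBd (fun _ => 1) fun p =>
    -((D.Ds * Matrix.vecMulVec ((σ p).ε (τ p)) ((σ p).ζ (τ p))) i a) / (σ p).msq (τ p)

/-- By normalization `ζ`, `Ξ` and `η_i` are `O(m)`. The last component of `ē` occurs in no `η_i`;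
the error model bounds `ē` instead, through `h[Θᵀω] = Θᵀζ - Ξ`. So `ε = O(m)`, and each adaptive law
divides a product of two `O(m)` signals by `m²`. -/
theorem ParamBound.rateBound (hp : ParamBound σ τ) (hτ : ∀ p, 0 ≤ τ p) (hτT : ∀ p, τ p ≤ T p)
    (h : ∀ p, IsClosedLoopOn (T p) A B C C₀ D r I (σ p)) {Θs : Matrix (RegIdx M n n₀) (Fin M) ℝ}
    (hδ : ∀ i, UBd (fun _ => 1) fun p => (σ p).ebar (τ p) i -
      Kp.mulVec ((σ p).hΘω (τ p) - Θs.transpose.mulVec ((σ p).ζ (τ p))) i) :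
    ParamRateBound D σ τ := by
  have hm1 : ∀ p, 1 ≤ (σ p).msq (τ p) := fun p => (h p).one_le_msq (hτ p) (hτT p)
  have hm0 : ∀ p, 0 < (σ p).msq (τ p) := fun p => one_pos.trans_le (hm1 p)
  set m : ι → ℝ := fun p => Real.sqrt ((σ p).msq (τ p)) with hm
  have hnn : ∀ {κ : Type} [Fintype κ] (z : κ → ℝ), 0 ≤ z ⬝ᵥ z := fun z =>
    Finset.sum_nonneg fun _ _ => mul_self_nonneg _
  have hsq : ∀ {κ : Type} [Fintype κ] (z : κ → ℝ) (a : κ), z a ^ 2 ≤ z ⬝ᵥ z := fun z a => by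
    rw [sq]
    exact Finset.single_le_sum (f := fun a => z a * z a) (fun _ _ => mul_self_nonneg _)
      (Finset.mem_univ a)
  have hηn : ∀ p, 0 ≤ ∑ i, dotProduct ((σ p).η (τ p) i) ((σ p).η (τ p) i) := fun p =>
    Finset.sum_nonneg fun _ _ => hnn _
  have hζ : ∀ a, UBd m fun p => (σ p).ζ (τ p) a := fun a => ⟨1, fun p => by
    rw [one_mul]
    refine Real.abs_le_sqrt ?_
    rw [(h p).normalization _ (hτ p) (hτT p)]
    linarith [hsq ((σ p).ζ (τ p)) a, hnn ((σ p).Xi (τ p)), hηn p]⟩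
  have hXi : ∀ a, UBd m fun p => (σ p).Xi (τ p) a := fun a => ⟨1, fun p => by
    rw [one_mul]
    refine Real.abs_le_sqrt ?_
    rw [(h p).normalization _ (hτ p) (hτT p)]
    linarith [hsq ((σ p).Xi (τ p)) a, hnn ((σ p).ζ (τ p)), hηn p]⟩
  have hη : ∀ i j, UBd m fun p => (σ p).η (τ p) i j := fun i j => ⟨1, fun p => by
    rw [one_mul]
    refine Real.abs_le_sqrt ?_
    rw [(h p).normalization _ (hτ p) (hτT p)]
    have := Finset.single_le_sum (f := fun i => dotProduct ((σ p).η (τ p) i) ((σ p).η (τ p) i))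
      (fun _ _ => hnn _) (Finset.mem_univ i)
    linarith [hsq ((σ p).η (τ p) i) j, hnn ((σ p).ζ (τ p)), hnn ((σ p).Xi (τ p))]⟩
  have hm1' : ∀ p, 1 ≤ m p := fun p => Real.one_le_sqrt.2 (hm1 p)
  have hhΘω : ∀ i, UBd m fun p => (σ p).hΘω (τ p) i := fun i =>
    (UBd.sub (UBd.sum Finset.univ fun a _ => (hζ a).mul_bdd (hp.Θ a i)) (hXi i)).congr fun p => by
      have := congrFun ((h p).xi _ (hτ p) (hτT p)) i
      rw [Pi.sub_apply] at this
      change (σ p).hΘω (τ p) i =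
        ((σ p).Θ (τ p)).transpose.mulVec ((σ p).ζ (τ p)) i - (σ p).Xi (τ p) i
      linarith
  have hebar : ∀ i, UBd m fun p => (σ p).ebar (τ p) i := fun i =>
    (((hδ i).mono (fun _ => zero_le_one) hm1').add
      (UBd.mulVec (x := fun p => (σ p).hΘω (τ p) - Θs.transpose.mulVec ((σ p).ζ (τ p))) Kp
        (fun i => (hhΘω i).sub (UBd.mulVec Θs.transpose hζ i)) i)).congr fun p => by ring
  have hε : ∀ i, UBd m fun p => (σ p).ε (τ p) i := fun i =>
    (UBd.add (UBd.add (UBd.sum Finset.univ fun j _ => (hη i j).mul_bdd (hp.θ i j))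
      (UBd.sum Finset.univ fun j _ => (hXi j).mul_bdd (hp.Ψ i j))) (hebar i)).congr
      fun p => (h p).eps _ (hτ p) (hτT p) i
  have hmul : ∀ {a b : Type} [Fintype b] (Q : Matrix a b ℝ) (v : ι → b → ℝ) (v' : ι → ℝ),
      (∀ j, UBd m fun p => v p j) → UBd m v' → ∀ i, UBd (fun _ => 1) fun p =>
        -(Q.mulVec (v p) i * v' p) / (σ p).msq (τ p) := by
    intro a b _ Q v v' hv hv' i
    exact ((UBd.mulVec Q hv i).mul_div hm0 hv').neg.congr fun p => by ring
  refine ⟨fun i j => ?_, fun i j => ?_, fun a i => ?_⟩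
  · refine (hmul (D.Γθ i) (fun p => (σ p).η (τ p) i) (fun p => (σ p).ε (τ p) i) (hη i) (hε i)
      j).congr fun p => ?_
    rw [Matrix.mulVec_smul, Pi.smul_apply, smul_eq_mul, mul_comm ((σ p).ε (τ p) i)]
  · refine (hmul D.Γ (fun p => (σ p).ε (τ p)) (fun p => (σ p).Xi (τ p) j) hε (hXi j)
      i).congr fun p => ?_
    rw [Matrix.mul_vecMulVec, Matrix.vecMulVec_apply]
  · refine (hmul D.Ds (fun p => (σ p).ε (τ p)) (fun p => (σ p).ζ (τ p) a) hε (hζ a)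
      i).congr fun p => ?_
    rw [Matrix.mul_vecMulVec, Matrix.vecMulVec_apply]

end

end PartialStateMRAC

namespace PartialStateMRAC

/-! ### Asymptotics relative to a monotone weight -/

/-- A nondecreasing weight on `[0, ∞)` that is at least `1`. -/
structure IsWeight (W : ℝ → ℝ) : Prop where
  one_le : ∀ t, 0 ≤ t → 1 ≤ W t
  mono : ∀ s t, 0 ≤ s → s ≤ t → W s ≤ W t

section Tools

variable {W : ℝ → ℝ}

theorem IsWeight.pos (hW : IsWeight W) {t : ℝ} (ht : 0 ≤ t) : 0 < W t :=
  one_pos.trans_le (hW.one_le t ht)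

theorem IsWeight.isLittleO_iff (hW : IsWeight W) {v : ℝ → ℝ} :
    v =o[atTop] W ↔ ∀ c, 0 < c → ∀ᶠ t in atTop, |v t| ≤ c * W t := by
  rw [Asymptotics.isLittleO_iff]
  refine forall₂_congr fun c _ => ?_
  refine eventually_congr ?_
  filter_upwards [eventually_ge_atTop 0] with t ht
  rw [Real.norm_eq_abs, Real.norm_eq_abs, abs_of_pos (hW.pos ht)]

/-- A signal of vanishing size whose rate is the sum of a slowly varying term and a vanishing one:
the slowly varying term vanishes. -/
theorem IsWeight.isLittleO_of_rate (hW : IsWeight W) {v a b g : ℝ → ℝ} {C : ℝ}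
    (hr : ∀ T, 0 ≤ T → HasRateOn T v (fun t => a t + b t)) (hv : v =o[atTop] W)
    (hb : b =o[atTop] W) (ha : ∀ T, 0 ≤ T → HasRateOn T a g)
    (hg : ∀ t, 0 ≤ t → |g t| ≤ C * W t) : a =o[atTop] W := by
  rw [hW.isLittleO_iff] at hv hb ⊢
  intro c hc
  have hC : 0 ≤ C := by
    have h1 := (abs_nonneg _).trans (hg 0 le_rfl)
    exact nonneg_of_mul_nonneg_left h1 (hW.pos le_rfl)
  -- On a window of length `η` the signal `a` changes by at most `(c / 2) W t`, the weight being
  -- largest at the right end. The increment of `v` over the window thus determines `η a t` up to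
  -- small errors: `c / 4` is spent on the two values of `v`, `c / 4` on `b` and `c / 2` on the
  -- variation of `a`.
  set η := c / (2 * (C + 1)) with hη
  have hηpos : 0 < η := by positivity
  have hCη : C * η ≤ c / 2 := by
    rw [hη, mul_div_assoc', div_le_div_iff₀ (by positivity) (by positivity)]
    nlinarith
  obtain ⟨t₀, h₀⟩ := eventually_atTop.1
    ((hv (c * η / 8) (by positivity)).and (hb (c / 4) (by positivity)))
  filter_upwards [eventually_ge_atTop (max t₀ 0 + η)] with t ht
  set s := t - η with hs
  have hs0 : 0 ≤ s := by
    have := le_max_right t₀ 0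
    linarith
  have hst₀ : t₀ ≤ s := by
    have := le_max_left t₀ 0
    linarith
  have hst : s ≤ t := by linarith
  have ht0 : 0 ≤ t := hs0.trans hst
  have hWt := hW.pos ht0
  have hvar : ∀ σ, s ≤ σ → σ ≤ t → |a t - a σ| ≤ C * W t * η := by
    intro σ hσ hσt
    have h1 := (ha t ht0).abs_sub_le (hs0.trans hσ) hσt le_rfl (B := C * W t) fun τ hτ hτt =>
      (hg τ ((hs0.trans hσ).trans hτ)).trans
        (mul_le_mul_of_nonneg_left (hW.mono _ _ ((hs0.trans hσ).trans hτ) hτt) hC)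
    refine h1.trans (mul_le_mul_of_nonneg_left (by linarith) (by positivity))
  have hsub := (hr t ht0).sub_eq hs0 hst le_rfl
  have hi := (hr t ht0).intervalIntegrable hs0 hst le_rfl
  have hdiff : (∫ τ in s..t, (a τ + b τ)) - a t * (t - s) = ∫ τ in s..t, ((a τ + b τ) - a t) := by
    rw [intervalIntegral.integral_sub hi (by simp), intervalIntegral.integral_const, smul_eq_mul,
      mul_comm]
  have hbound : |(v t - v s) - a t * (t - s)| ≤ (C * W t * η + c / 4 * W t) * (t - s) := by
    rw [hsub, hdiff, ← abs_of_nonneg (sub_nonneg.2 hst), ← Real.norm_eq_abs,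
      ← Real.norm_eq_abs (t - s)]
    refine intervalIntegral.norm_integral_le_of_norm_le_const fun τ hτ => ?_
    rw [Set.uIoc_of_le hst] at hτ
    have h1 := hvar τ hτ.1.le hτ.2
    have h2 := (h₀ τ (hst₀.trans hτ.1.le)).2
    have h3 := mul_le_mul_of_nonneg_left (hW.mono τ t (hs0.trans hτ.1.le) hτ.2)
      (by positivity : 0 ≤ c / 4)
    rw [Real.norm_eq_abs]
    rw [abs_sub_comm] at h1
    have h4 := abs_add_le (a τ - a t) (b τ)
    have h5 : a τ + b τ - a t = a τ - a t + b τ := by ring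
    rw [h5]
    linarith
  have hvt := (h₀ t (hst₀.trans hst)).1
  have hvs := (h₀ s hst₀).1
  have hvs' : |v s| ≤ c * η / 8 * W t :=
    hvs.trans (mul_le_mul_of_nonneg_left (hW.mono s t hs0 hst) (by positivity))
  have hts : t - s = η := by rw [hs]; ring
  rw [hts] at hbound
  have hfin : |a t| * η ≤ c * W t * η := by
    have h1 : a t * η = (v t - v s) - ((v t - v s) - a t * η) := by ring
    have h2 : |a t| * η = |a t * η| := by rw [abs_mul, abs_of_pos hηpos]
    have h3 := abs_sub (v t - v s) ((v t - v s) - a t * η)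
    have h4 := abs_sub (v t) (v s)
    rw [← h1, ← h2] at h3
    have h5 : C * W t * η * η ≤ c / 2 * W t * η := by
      have := mul_le_mul_of_nonneg_right hCη (mul_nonneg hWt.le hηpos.le)
      nlinarith
    nlinarith
  exact le_of_mul_le_mul_right hfin hηpos

/-- The primitive is nondecreasing and bounded, hence convergent, so its increments are eventually
small. -/
theorem tendsto_integral_sub {G : ℝ → ℝ} {K : ℝ} (hG : ∀ t, 0 ≤ t → 0 ≤ G t)
    (hGi : ∀ t, 0 ≤ t → IntervalIntegrable G volume 0 t)
    (hGK : ∀ t, 0 ≤ t → ∫ s in (0 : ℝ)..t, G s ≤ K) {c : ℝ} (hc : 0 < c) :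
    ∃ t₀, 0 ≤ t₀ ∧ ∀ s t, t₀ ≤ s → s ≤ t → ∫ τ in s..t, G τ ≤ c := by
  set F : ℝ → ℝ := fun t => ∫ s in (0 : ℝ)..(max t 0), G s with hF
  have hsplit : ∀ s t, 0 ≤ s → s ≤ t →
      (∫ τ in (0 : ℝ)..t, G τ) = (∫ τ in (0 : ℝ)..s, G τ) + ∫ τ in s..t, G τ := fun s t hs hst =>
    (intervalIntegral.integral_add_adjacent_intervals (hGi s hs)
      ((hGi s hs).symm.trans (hGi t (hs.trans hst)))).symm
  have hnn : ∀ s t, 0 ≤ s → s ≤ t → 0 ≤ ∫ τ in s..t, G τ := fun s t hs hst =>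
    intervalIntegral.integral_nonneg hst fun τ hτ => hG τ (hs.trans hτ.1)
  have hmono : Monotone F := fun s t hst => by
    have h1 : max s 0 ≤ max t 0 := max_le_max hst le_rfl
    have := hsplit _ _ (le_max_right s 0) h1
    have := hnn _ _ (le_max_right s 0) h1
    simp only [hF]
    linarith
  have hlim := tendsto_atTop_ciSup hmono ⟨K, by
    rintro _ ⟨t, rfl⟩
    exact hGK _ (le_max_right _ _)⟩
  set L := ⨆ t, F t
  have hle : ∀ t, F t ≤ L := fun t => hmono.ge_of_tendsto hlim t
  obtain ⟨t₀, ht₀⟩ := eventually_atTop.1 (hlim.eventually (lt_mem_nhds (sub_lt_self L hc)))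
  refine ⟨max t₀ 0, le_max_right _ _, fun s t hs hst => ?_⟩
  have hs0 : 0 ≤ s := (le_max_right _ _).trans hs
  have h1 := ht₀ s ((le_max_left _ _).trans hs)
  have h2 := hle t
  simp only [hF, max_eq_left hs0, max_eq_left (hs0.trans hst)] at h1 h2
  have := hsplit s t hs0 hst
  linarith

/-- A slowly varying signal that is, up to vanishing terms, a square integrable multiple of the
weight vanishes. -/
theorem IsWeight.isLittleO_of_sq_integrable (hW : IsWeight W) {v ε b g G : ℝ → ℝ} {C C' K : ℝ}
    (hv : ∀ T, 0 ≤ T → HasRateOn T v g) (hg : ∀ t, 0 ≤ t → |g t| ≤ C * W t)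
    (hvε : ∀ t, 0 ≤ t → v t = ε t + b t) (hb : b =o[atTop] W)
    (hG : ∀ t, 0 ≤ t → 0 ≤ G t) (hGi : ∀ t, 0 ≤ t → IntervalIntegrable G volume 0 t)
    (hGK : ∀ t, 0 ≤ t → ∫ s in (0 : ℝ)..t, G s ≤ K)
    (hε : ∀ t, 0 ≤ t → ε t ^ 2 ≤ C' * G t * W t ^ 2) : v =o[atTop] W := by
  rw [hW.isLittleO_iff] at hb ⊢
  intro c hc
  have hC : 0 ≤ C := by
    have h1 := (abs_nonneg _).trans (hg 0 le_rfl)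
    exact nonneg_of_mul_nonneg_left h1 (hW.pos le_rfl)
  set η := c / (2 * (C + 1)) with hη
  have hηpos : 0 < η := by positivity
  have hCη : C * η ≤ c / 2 := by
    rw [hη, mul_div_assoc', div_le_div_iff₀ (by positivity) (by positivity)]
    nlinarith
  obtain ⟨t₁, ht₁⟩ := eventually_atTop.1 (hb (c / 4) (by positivity))
  obtain ⟨t₂, ht₂0, ht₂⟩ := tendsto_integral_sub hG hGi hGK
    (c := c ^ 2 * η / (32 * (|C'| + 1))) (by positivity)
  filter_upwards [eventually_ge_atTop (max t₁ t₂ + η)] with t ht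
  set s := t - η with hs
  have hst₁ : t₁ ≤ s := by
    have := le_max_left t₁ t₂
    linarith
  have hst₂ : t₂ ≤ s := by
    have := le_max_right t₁ t₂
    linarith
  have hs0 : 0 ≤ s := ht₂0.trans hst₂
  have hst : s ≤ t := by linarith
  have hts : t - s = η := by rw [hs]; ring
  have ht0 : 0 ≤ t := hs0.trans hst
  have hWt := hW.pos ht0
  -- If `|v t| > c W t`, slow variation keeps `|v| ≥ (c / 2) W t` on the window `[t - η, t]`, and
  -- after removing `b` the bound `|ε| ≥ (c / 4) W t` remains. The integral of `G` over the window
  -- would then be at least twice the tail bound chosen above.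
  by_contra! hlt
  have hlow : ∀ τ ∈ Set.Icc s t, c ^ 2 / 16 * W t ^ 2 ≤ (|C'| + 1) * W t ^ 2 * G τ := by
    intro τ hτ
    have hτ0 := hs0.trans hτ.1
    have h1 := (hv t ht0).abs_sub_le hτ0 hτ.2 le_rfl (B := C * W t) fun τ' hτ' hτ't =>
      (hg τ' (hτ0.trans hτ')).trans
        (mul_le_mul_of_nonneg_left (hW.mono _ _ (hτ0.trans hτ') hτ't) hC)
    have h2 : C * W t * (t - τ) ≤ c / 2 * W t := by
      have h3 : C * W t * (t - τ) ≤ C * W t * η :=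
        mul_le_mul_of_nonneg_left (by linarith [hτ.1]) (by positivity)
      have h4 := mul_le_mul_of_nonneg_right hCη hWt.le
      nlinarith
    have h3 := (ht₁ τ (hst₁.trans hτ.1)).trans (mul_le_mul_of_nonneg_left
      (hW.mono τ t hτ0 hτ.2) (by positivity : 0 ≤ c / 4))
    have h4 : c / 4 * W t ≤ |ε τ| := by
      have e1 : v t = (v t - v τ) + (ε τ + b τ) := by rw [← hvε τ hτ0]; ring
      have e2 := abs_add_le (v t - v τ) (ε τ + b τ)
      have e3 := abs_add_le (ε τ) (b τ)
      rw [← e1] at e2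
      linarith
    have h5 := pow_le_pow_left₀ (by positivity) h4 2
    rw [sq_abs, mul_pow] at h5
    have h6 := hε τ hτ0
    have h7 : C' * G τ * W τ ^ 2 ≤ (|C'| + 1) * W t ^ 2 * G τ := by
      have hGτ := hG τ hτ0
      have e1 : C' * G τ ≤ (|C'| + 1) * G τ :=
        mul_le_mul_of_nonneg_right ((le_abs_self _).trans (by linarith)) hGτ
      have e2 : W τ ^ 2 ≤ W t ^ 2 := pow_le_pow_left₀ (hW.pos hτ0).le (hW.mono τ t hτ0 hτ.2) 2
      calc C' * G τ * W τ ^ 2 ≤ (|C'| + 1) * G τ * W τ ^ 2 :=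
            mul_le_mul_of_nonneg_right e1 (sq_nonneg _)
        _ ≤ (|C'| + 1) * G τ * W t ^ 2 := mul_le_mul_of_nonneg_left e2 (by positivity)
        _ = _ := by ring
    have h8 : c ^ 2 / 16 * W t ^ 2 = (c / 4) ^ 2 * W t ^ 2 := by ring
    linarith
  have hGi' : IntervalIntegrable G volume s t := (hGi s hs0).symm.trans (hGi t ht0)
  have hI := intervalIntegral.integral_mono_on hst (by simp)
    (hGi'.const_mul ((|C'| + 1) * W t ^ 2)) hlow
  rw [intervalIntegral.integral_const, intervalIntegral.integral_const_mul, smul_eq_mul, hts] at hI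
  have hI2 := mul_le_mul_of_nonneg_left (ht₂ s t hst₂ hst)
    (by positivity : 0 ≤ (|C'| + 1) * W t ^ 2)
  have h9 : (|C'| + 1) * W t ^ 2 * (c ^ 2 * η / (32 * (|C'| + 1))) =
      c ^ 2 / 32 * η * W t ^ 2 := by
    field_simp
  rw [h9] at hI2
  have h10 : 0 < c ^ 2 * η * W t ^ 2 := by positivity
  nlinarith

/-- The abstract form of the conclusions of `exists_iss_bound` and `exists_filter_bound`. -/
def ISSBound (K a : ℝ) (V z : ℝ → ℝ) : Prop :=
  0 < K ∧ 0 < a ∧ ∃ Q : ℝ, ∀ (T : ℝ) (β : ℝ → ℝ), 0 ≤ T →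
    (∀ t, 0 ≤ t → t ≤ T → IntervalIntegrable β volume 0 t) →
    (∀ t, 0 ≤ t → t ≤ T → V t ≤ β t) →
    z T ^ 2 ≤ K * (Real.exp (-a * T) * Q + ∫ s in (0 : ℝ)..T, Real.exp (-a * (T - s)) * β s)

theorem tendsto_exp_neg_mul {a : ℝ} (ha : 0 < a) :
    Tendsto (fun t : ℝ => Real.exp (-a * t)) atTop (𝓝 0) := by
  refine Real.tendsto_exp_atBot.comp ?_
  exact (tendsto_neg_atTop_atBot.comp (tendsto_id.const_mul_atTop ha)).congr fun t => by simp

/-- The majorant may depend on the final time, so that a monotone weight can be frozen at `W T`. The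
transient may have a constant `A` depending on the tolerance, since it dies out. -/
theorem ISSBound.isLittleO_of_eventually {K a : ℝ} {V z : ℝ → ℝ} (h : ISSBound K a V z)
    (hW : IsWeight W) (hev : ∀ c, 0 < c → ∃ A : ℝ, ∀ T, 0 ≤ T → ∃ β : ℝ → ℝ,
      (∀ t, 0 ≤ t → t ≤ T → IntervalIntegrable β volume 0 t) ∧
      (∀ t, 0 ≤ t → t ≤ T → V t ≤ β t) ∧
      ∫ s in (0 : ℝ)..T, Real.exp (-a * (T - s)) * β s ≤
        A * Real.exp (-(a / 2) * T) * W T ^ 2 + c * W T ^ 2) : z =o[atTop] W := by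
  obtain ⟨hK, ha, Q, hb⟩ := h
  rw [hW.isLittleO_iff]
  intro c hc
  -- Of the budget `c ^ 2 / K`, half is left to the persistent term and a quarter to each of the two
  -- transients.
  obtain ⟨A, hA⟩ := hev (c ^ 2 / (2 * K)) (by positivity)
  filter_upwards [((tendsto_exp_neg_mul ha).const_mul |Q|).eventually
      (gt_mem_nhds (show |Q| * 0 < c ^ 2 / (4 * K) by rw [mul_zero]; positivity)),
    ((tendsto_exp_neg_mul (half_pos ha)).const_mul |A|).eventually
      (gt_mem_nhds (show |A| * 0 < c ^ 2 / (4 * K) by rw [mul_zero]; positivity)),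
    eventually_ge_atTop 0] with T hQ hA' hT
  obtain ⟨β, hβi, hβ, hβI⟩ := hA T hT
  have h1 := hb T β hT hβi hβ
  have hW1 := hW.one_le T hT
  have hW2 : 1 ≤ W T ^ 2 := one_le_pow₀ hW1
  have e1 : Real.exp (-a * T) * Q ≤ c ^ 2 / (4 * K) * W T ^ 2 := by
    have e0 : Real.exp (-a * T) * Q ≤ |Q| * Real.exp (-a * T) := by
      rw [mul_comm]
      exact mul_le_mul_of_nonneg_right (le_abs_self Q) (Real.exp_pos _).le
    have : c ^ 2 / (4 * K) ≤ c ^ 2 / (4 * K) * W T ^ 2 :=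
      le_mul_of_one_le_right (by positivity) hW2
    linarith
  have e2 : A * Real.exp (-(a / 2) * T) * W T ^ 2 ≤ c ^ 2 / (4 * K) * W T ^ 2 := by
    refine mul_le_mul_of_nonneg_right ?_ (sq_nonneg _)
    exact (mul_le_mul_of_nonneg_right (le_abs_self A) (Real.exp_pos _).le).trans hA'.le
  have e3 : z T ^ 2 ≤ (c * W T) ^ 2 := by
    have e4 := mul_le_mul_of_nonneg_left (add_le_add e1 (hβI.trans (add_le_add_left e2 _))) hK.le
    refine h1.trans (e4.trans (le_of_eq ?_))
    field_simp
    ring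
  exact abs_le_of_sq_le_sq e3 (mul_nonneg hc.le (hW.pos hT).le)

theorem integral_exp_neg_sub_le {a T : ℝ} (ha : 0 < a) :
    ∫ s in (0 : ℝ)..T, Real.exp (-a * (T - s)) ≤ 1 / a := by
  have := integral_exp_mul_exp_le (a := a) (b := 0) (t := T) (by linarith)
  simpa using this

/-- Vanishing inputs give vanishing states. -/
theorem ISSBound.isLittleO {K a : ℝ} {V z : ℝ → ℝ} (h : ISSBound K a V z) (hW : IsWeight W) {C : ℝ}
    (hVC : ∀ t, 0 ≤ t → V t ≤ C * W t ^ 2)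
    (hVo : ∀ c, 0 < c → ∀ᶠ t in atTop, V t ≤ c * W t ^ 2) : z =o[atTop] W := by
  have ha := h.2.1
  refine h.isLittleO_of_eventually hW fun c hc => ?_
  obtain ⟨t₁, ht₁⟩ := eventually_atTop.1 (hVo (c * a) (by positivity))
  set t₀ := max t₁ 0 with ht₀
  -- Up to `t₀` only the crude bound `C W ^ 2` is available; `Q` is large enough for `Q exp (-(a /
  -- 2) s)` to dominate it on `[0, t₀]`, so this initial stretch becomes a transient.
  set Q := |C| * W t₀ ^ 2 * Real.exp (a / 4 * t₀) ^ 2 with hQ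
  refine ⟨Q * (2 / a), fun T hT => ⟨fun s => Q * Real.exp (-(a / 4) * s) ^ 2 + c * a * W T ^ 2,
    fun t _ _ => (by fun_prop : Continuous fun s : ℝ =>
      Q * Real.exp (-(a / 4) * s) ^ 2 + c * a * W T ^ 2).intervalIntegrable _ _,
      fun t ht htT => ?_, ?_⟩⟩
  · rcases le_total t t₀ with htt | htt
    · have h1 := hVC t ht
      have h2 : C * W t ^ 2 ≤ |C| * W t₀ ^ 2 :=
        mul_le_mul (le_abs_self C) (pow_le_pow_left₀ (hW.pos ht).le (hW.mono t t₀ ht htt) 2)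
          (sq_nonneg _) (abs_nonneg _)
      have h3 : 1 ≤ Real.exp (a / 4 * t₀) ^ 2 * Real.exp (-(a / 4) * t) ^ 2 := by
        rw [← mul_pow, ← Real.exp_add]
        refine one_le_pow₀ (Real.one_le_exp ?_)
        nlinarith
      have h4 : |C| * W t₀ ^ 2 ≤ Q * Real.exp (-(a / 4) * t) ^ 2 := by
        rw [hQ, mul_assoc]
        exact le_mul_of_one_le_right (by positivity) h3
      have h5 : 0 ≤ c * a * W T ^ 2 := by positivity
      linarith
    · have h1 := ht₁ t ((le_max_left _ _).trans htt)
      have h2 : c * a * W t ^ 2 ≤ c * a * W T ^ 2 :=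
        mul_le_mul_of_nonneg_left (pow_le_pow_left₀ (hW.pos ht).le (hW.mono t T ht htT) 2)
          (by positivity)
      have h3 : 0 ≤ Q * Real.exp (-(a / 4) * t) ^ 2 := by positivity
      linarith
  · have hc1 : Continuous fun s : ℝ => Real.exp (-a * (T - s)) * Real.exp (-(a / 4) * s) ^ 2 := by
      fun_prop
    have hc2 : Continuous fun s : ℝ => Real.exp (-a * (T - s)) := by fun_prop
    have e1 : ∀ s, Real.exp (-a * (T - s)) *
        (Q * Real.exp (-(a / 4) * s) ^ 2 + c * a * W T ^ 2) =
        Q * (Real.exp (-a * (T - s)) * Real.exp (-(a / 4) * s) ^ 2) +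
          c * a * W T ^ 2 * Real.exp (-a * (T - s)) := fun s => by ring
    simp only [e1]
    rw [intervalIntegral.integral_add ((hc1.const_mul _).intervalIntegrable _ _)
      ((hc2.const_mul _).intervalIntegrable _ _), intervalIntegral.integral_const_mul,
      intervalIntegral.integral_const_mul]
    have h1 := integral_exp_mul_exp_le (a := a) (b := a / 4) (t := T) (by linarith)
    have h2 := integral_exp_neg_sub_le (T := T) ha
    have hW1 : 1 ≤ W T ^ 2 := one_le_pow₀ (hW.one_le T hT)
    have hQ0 : 0 ≤ Q := by positivity
    refine add_le_add ?_ ?_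
    · have h3 : Real.exp (-(a / 4) * T) ^ 2 / (a - 2 * (a / 4)) =
          2 / a * Real.exp (-(a / 2) * T) := by
        rw [sq, ← Real.exp_add]
        have : -(a / 4) * T + -(a / 4) * T = -(a / 2) * T := by ring
        rw [this]
        field_simp
        ring
      rw [h3] at h1
      have h4 := mul_le_mul_of_nonneg_left h1 hQ0
      refine h4.trans ?_
      rw [← mul_assoc]
      exact le_mul_of_one_le_right (by positivity) hW1
    · have h3 := mul_le_mul_of_nonneg_left h2 (by positivity : 0 ≤ c * a * W T ^ 2)
      refine h3.trans (le_of_eq ?_)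
      field_simp

/-- Inputs bounded by a square integrable multiple of the weight give vanishing states. -/
theorem ISSBound.isLittleO_of_integrable {K a : ℝ} {V z : ℝ → ℝ} (h : ISSBound K a V z)
    (hW : IsWeight W) {C K' : ℝ} {G : ℝ → ℝ} (hG : ∀ t, 0 ≤ t → 0 ≤ G t)
    (hGi : ∀ t, 0 ≤ t → IntervalIntegrable G volume 0 t)
    (hGK : ∀ t, 0 ≤ t → ∫ s in (0 : ℝ)..t, G s ≤ K')
    (hVG : ∀ t, 0 ≤ t → V t ≤ C * G t * W t ^ 2) : z =o[atTop] W := by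
  have ha := h.2.1
  refine h.isLittleO_of_eventually hW fun c hc => ?_
  obtain ⟨t₀, ht₀, hint⟩ := tendsto_integral_sub hG hGi hGK (c := c / (|C| + 1)) (by positivity)
  have hK' : 0 ≤ K' := by simpa using hGK 0 le_rfl
  refine ⟨|C| * Real.exp (a * t₀) * K', fun T hT => ⟨fun s => |C| * W T ^ 2 * G s,
    fun t ht _ => (hGi t ht).const_mul _, fun t ht htT => ?_, ?_⟩⟩
  · have e2 : W t ^ 2 ≤ W T ^ 2 := pow_le_pow_left₀ (hW.pos ht).le (hW.mono t T ht htT) 2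
    calc V t ≤ C * G t * W t ^ 2 := hVG t ht
      _ ≤ |C| * G t * W t ^ 2 := mul_le_mul_of_nonneg_right
          (mul_le_mul_of_nonneg_right (le_abs_self C) (hG t ht)) (sq_nonneg _)
      _ ≤ |C| * G t * W T ^ 2 :=
          mul_le_mul_of_nonneg_left e2 (mul_nonneg (abs_nonneg _) (hG t ht))
      _ = _ := by ring
  · have hc2 : Continuous fun s : ℝ => Real.exp (-a * (T - s)) := by fun_prop
    have e1 : ∀ s, Real.exp (-a * (T - s)) * (|C| * W T ^ 2 * G s) =
        |C| * W T ^ 2 * (Real.exp (-a * (T - s)) * G s) := fun s => by ring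
    simp only [e1]
    rw [intervalIntegral.integral_const_mul]
    have hii : ∀ s t, 0 ≤ s → s ≤ t →
        IntervalIntegrable (fun s => Real.exp (-a * (T - s)) * G s) volume s t := fun s t hs hst =>
      ((hGi s hs).symm.trans (hGi t (hs.trans hst))).continuousOn_mul hc2.continuousOn
    -- The convolution is split at `t₀`: the earlier part is damped by the kernel, the later part
    -- has small energy. The minimum covers `T < t₀`, where the later part is empty.
    set t₁ := min t₀ T with ht₁
    have ht₁0 : 0 ≤ t₁ := le_min ht₀ hT
    have ht₁T : t₁ ≤ T := min_le_right _ _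
    have hfirst : ∫ s in (0 : ℝ)..t₁, Real.exp (-a * (T - s)) * G s ≤
        Real.exp (a * t₀) * K' * Real.exp (-(a / 2) * T) := by
      have e2 : ∫ s in (0 : ℝ)..t₁, Real.exp (-a * (T - s)) * G s ≤
          ∫ s in (0 : ℝ)..t₁, Real.exp (a * t₀) * Real.exp (-(a / 2) * T) * G s := by
        refine intervalIntegral.integral_mono_on ht₁0 (hii _ _ le_rfl ht₁0)
          ((hGi t₁ ht₁0).const_mul _) fun s hs => ?_
        refine mul_le_mul_of_nonneg_right ?_ (hG s hs.1)
        rw [← Real.exp_add, Real.exp_le_exp]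
        have := hs.2.trans (min_le_left t₀ T)
        nlinarith
      rw [intervalIntegral.integral_const_mul] at e2
      have := mul_le_mul_of_nonneg_left (hGK t₁ ht₁0)
        (by positivity : 0 ≤ Real.exp (a * t₀) * Real.exp (-(a / 2) * T))
      linarith
    have hsecond : ∫ s in t₁..T, Real.exp (-a * (T - s)) * G s ≤ c / (|C| + 1) := by
      rcases le_total t₀ T with h0 | h0
      · rw [ht₁, min_eq_left h0]
        refine le_trans ?_ (hint t₀ T le_rfl h0)
        refine intervalIntegral.integral_mono_on h0 (hii _ _ ht₀ h0)
          ((hGi t₀ ht₀).symm.trans (hGi T hT)) fun s hs => ?_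
        refine mul_le_of_le_one_left (hG s (ht₀.trans hs.1)) (Real.exp_le_one_iff.2 ?_)
        nlinarith [hs.2]
      · rw [ht₁, min_eq_right h0, intervalIntegral.integral_same]
        positivity
    rw [← intervalIntegral.integral_add_adjacent_intervals (hii _ _ le_rfl ht₁0)
      (hii _ _ ht₁0 ht₁T)]
    have h1 := mul_le_mul_of_nonneg_left (add_le_add hfirst hsecond)
      (by positivity : 0 ≤ |C| * W T ^ 2)
    refine h1.trans ?_
    have h2 : |C| * (c / (|C| + 1)) ≤ c := by
      rw [mul_div_assoc', div_le_iff₀ (by positivity)]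
      nlinarith [abs_nonneg C]
    have h3 := mul_le_mul_of_nonneg_right h2 (sq_nonneg (W T))
    nlinarith

end Tools

end PartialStateMRAC

namespace PartialStateMRAC

/-! ### Small normalized signals -/

/-- Nonnegative times. -/
abbrev NNTime : Type := {t : ℝ // 0 ≤ t}

theorem UBd.mul {ι : Type*} {w w' v v' : ι → ℝ} (h : UBd w v) (h' : UBd w' v') :
    UBd (fun p => w p * w' p) fun p => v p * v' p := by
  obtain ⟨c, hc⟩ := h
  obtain ⟨c', hc'⟩ := h'
  refine ⟨c * c', fun p => ?_⟩
  rw [abs_mul]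
  calc |v p| * |v' p| ≤ (c * w p) * (c' * w' p) :=
        mul_le_mul (hc p) (hc' p) (abs_nonneg _) ((abs_nonneg _).trans (hc p))
    _ = c * c' * (w p * w' p) := by ring

section Tools

variable {W v v' : ℝ → ℝ}

theorem isLittleO_mul_of_uBd (h : v =o[atTop] W) (h' : UBd (fun _ : NNTime => 1) fun p => v' p) :
    (fun t => v' t * v t) =o[atTop] W := by
  obtain ⟨c, hc⟩ := h'
  have h1 : v' =O[atTop] fun _ => (1 : ℝ) := by
    refine Asymptotics.IsBigO.of_bound c ?_
    filter_upwards [eventually_ge_atTop 0] with t ht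
    simpa using hc ⟨t, ht⟩
  simpa using h1.mul_isLittleO h

theorem isLittleO_of_uBd (hWt : Tendsto W atTop atTop)
    (h : UBd (fun _ : NNTime => 1) fun p => v p) : v =o[atTop] W := by
  have h1 : (fun _ : ℝ => (1 : ℝ)) =o[atTop] W :=
    (Asymptotics.isLittleO_const_left_of_ne one_ne_zero).2 (tendsto_norm_atTop_atTop.comp hWt)
  simpa using isLittleO_mul_of_uBd h1 h

theorem isLittleO_congr (h : v =o[atTop] W) (he : ∀ t, 0 ≤ t → v' t = v t) : v' =o[atTop] W :=
  h.congr' ((eventually_ge_atTop 0).mono fun t ht => (he t ht).symm) EventuallyEq.rfl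

theorem isLittleO_sum {α : Type*} (s : Finset α) {f : α → ℝ → ℝ} (h : ∀ a ∈ s, f a =o[atTop] W) :
    (fun t => ∑ a ∈ s, f a t) =o[atTop] W := by
  have := Asymptotics.IsLittleO.sum h
  rwa [Finset.sum_fn] at this

theorem isLittleO_mulVec {a b : Type*} [Fintype b] {x : ℝ → b → ℝ} (Q : Matrix a b ℝ)
    (h : ∀ j, (fun t => x t j) =o[atTop] W) (i : a) :
    (fun t => Q.mulVec (x t) i) =o[atTop] W :=
  isLittleO_sum Finset.univ fun j _ => (h j).const_mul_left (Q i j)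

/-- Stable filters map vanishing inputs to vanishing states. -/
theorem IsWeight.filter (hW : IsWeight W) {p : ℝ[X]} (hm : p.Monic) (hp : StablePoly p)
    {q : ℝ → ℕ → ℝ} (hq : ∀ T, 0 ≤ T → FilterOn T p v q)
    (hvC : UBd (fun t : NNTime => W t) fun t => v t) (hv : v =o[atTop] W) {k : ℕ}
    (hk : k ≤ p.natDegree) : (fun t => q t k) =o[atTop] W := by
  obtain ⟨K, a, hK, ha, hb⟩ := exists_filter_bound hm hp
  obtain ⟨c, hc⟩ := hvC
  have hlow : ∀ k < p.natDegree, (fun t => q t k) =o[atTop] W := by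
    intro k hk
    have hiss : ISSBound K a (fun t => v t ^ 2) fun t => q t k :=
      ⟨hK, ha, ∑ k ∈ Finset.range p.natDegree, q 0 k ^ 2, fun T β hT hβ hV =>
        hb T q (fun _ _ => 0) v β (fun k hk => by simpa using (hq T hT).1 k hk) (hq T hT).2 hβ
          (fun t ht htT => by simpa using hV t ht htT) T hT le_rfl k hk⟩
    refine hiss.isLittleO hW (C := c ^ 2) (fun t ht => ?_) fun d hd => ?_
    · rw [← sq_abs, ← mul_pow]
      exact pow_le_pow_left₀ (abs_nonneg _) (hc ⟨t, ht⟩) 2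
    · filter_upwards [hW.isLittleO_iff.1 hv (Real.sqrt d) (Real.sqrt_pos.2 hd)] with t ht
      rw [← sq_abs]
      have := pow_le_pow_left₀ (abs_nonneg _) ht 2
      rwa [mul_pow, Real.sq_sqrt hd.le] at this
  rcases hk.lt_or_eq with hk | rfl
  · exact hlow k hk
  · refine isLittleO_congr (hv.sub (isLittleO_sum (Finset.range p.natDegree)
      fun k hk => (hlow k (Finset.mem_range.1 hk)).const_mul_left (p.coeff k))) fun t ht => ?_
    exact (hq t ht).top_eq hm ht le_rfl

/-- If the first signal of a chain of derivatives vanishes, so do all the others. -/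
theorem IsWeight.chain (hW : IsWeight W) {q : ℝ → ℕ → ℝ} {g : ℝ → ℝ} {N : ℕ}
    (hq : ∀ k < N, ∀ T, 0 ≤ T → HasRateOn T (fun t => q t k) fun t => q t (k + 1))
    (hg : ∀ T, 0 ≤ T → HasRateOn T (fun t => q t N) g)
    (hqC : ∀ k ≤ N, UBd (fun t : NNTime => W t) fun t => q t k)
    (hgC : UBd (fun t : NNTime => W t) fun t => g t)
    (h0 : (fun t => q t 0) =o[atTop] W) {k : ℕ} (hk : k ≤ N) : (fun t => q t k) =o[atTop] W := by
  induction k with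
  | zero => exact h0
  | succ k ih =>
    have hb : (fun _ : ℝ => (0 : ℝ)) =o[atTop] W := Asymptotics.isLittleO_zero _ _
    have hr : ∀ T, 0 ≤ T → HasRateOn T (fun t => q t k) fun t => q t (k + 1) + 0 :=
      fun T hT => by simpa using hq k hk T hT
    rcases hk.lt_or_eq with hk1 | hk1
    · obtain ⟨c, hc⟩ := hqC (k + 1 + 1) hk1
      exact hW.isLittleO_of_rate hr (ih (by omega)) hb (hq (k + 1) hk1) (C := c)
        fun t ht => hc ⟨t, ht⟩
    · obtain ⟨c, hc⟩ := hgC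
      rw [← hk1] at hg
      exact hW.isLittleO_of_rate hr (ih (by omega)) hb hg (C := c) fun t ht => hc ⟨t, ht⟩

end Tools

variable {M n n₀ : ℕ}

/-- A closed loop trajectory with bounded parameter estimates and weight `W`. -/
structure WeightedLoop (A : Matrix (Fin n) (Fin n) ℝ)
    (B : Matrix (Fin n) (Fin M) ℝ) (C : Matrix (Fin M) (Fin n) ℝ) (C₀ : Matrix (Fin n₀) (Fin n) ℝ)
    (D : Design M n n₀) (r : ℝ → Fin M → ℝ) (I : InitialData M n n₀) (Kp : Matrix (Fin M) (Fin M) ℝ)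
    (K : ℝ) (W : ℝ → ℝ) (σ : Signals M n n₀) : Prop where
  loop : ∀ T, 0 ≤ T → IsClosedLoopOn T A B C C₀ D r I σ
  interactor : IsModifiedInteractor D.ξ (transferMatrix A B C) Kp
  weight : IsWeight W
  signals : SignalBound A B C D (fun t : NNTime => W t) (fun _ => σ) fun t => t
  params : ParamBound (fun _ : NNTime => σ) fun t => t
  rates : ParamRateBound D (fun _ : NNTime => σ) fun t => t
  energy : ∀ t, 0 ≤ t → ∀ i, ∫ s in (0 : ℝ)..t, σ.ε s i ^ 2 / σ.msq s ≤ K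

section

variable {A : Matrix (Fin n) (Fin n) ℝ} {B : Matrix (Fin n) (Fin M) ℝ}
  {C : Matrix (Fin M) (Fin n) ℝ} {C₀ : Matrix (Fin n₀) (Fin n) ℝ} {D : Design M n n₀}
  {r : ℝ → Fin M → ℝ} {I : InitialData M n n₀} {Kp : Matrix (Fin M) (Fin M) ℝ}
  {K : ℝ} {W : ℝ → ℝ} {σ : Signals M n n₀}

theorem WeightedLoop.one_le_msq (h : WeightedLoop A B C C₀ D r I Kp K W σ) {t : ℝ} (ht : 0 ≤ t) :
    1 ≤ σ.msq t :=
  (h.loop t ht).one_le_msq ht le_rfl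

/-- The rate of the `(a, i)` entry of `Θ`. -/
noncomputable def thetaRate (D : Design M n n₀) (σ : Signals M n n₀) (t : ℝ) (a : RegIdx M n n₀)
    (i : Fin M) : ℝ :=
  -((D.Ds * Matrix.vecMulVec (σ.ε t) (σ.ζ t)) i a) / σ.msq t

/-- Since `|ζ| ≤ m` and `D_s` is diagonal, column `i` of the rate of `Θ` is bounded by a multiple of
`|ε_i| / m`. It is therefore square integrable and not merely bounded, as the swapping argument
requires. -/
theorem WeightedLoop.thetaRate_uBd (h : WeightedLoop A B C C₀ D r I Kp K W σ)
    (a : RegIdx M n n₀) (i : Fin M) :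
    UBd (fun t : NNTime => Real.sqrt (σ.ε t i ^ 2 / σ.msq t)) fun t => thetaRate D σ t a i := by
  refine ⟨|D.sgn i * D.γ i|, fun ⟨t, ht⟩ => ?_⟩
  have hm : 0 < σ.msq t := one_pos.trans_le (h.one_le_msq ht)
  have hs : 0 < Real.sqrt (σ.msq t) := Real.sqrt_pos.2 hm
  have hζ : |σ.ζ t a| ≤ Real.sqrt (σ.msq t) := by
    refine Real.abs_le_sqrt ?_
    rw [(h.loop t ht).normalization t ht le_rfl]
    have h1 : σ.ζ t a ^ 2 ≤ σ.ζ t ⬝ᵥ σ.ζ t := by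
      rw [sq]
      exact Finset.single_le_sum (f := fun a => σ.ζ t a * σ.ζ t a) (fun _ _ => mul_self_nonneg _)
        (Finset.mem_univ a)
    have h2 : 0 ≤ σ.Xi t ⬝ᵥ σ.Xi t := Finset.sum_nonneg fun _ _ => mul_self_nonneg _
    have h3 : 0 ≤ ∑ i, σ.η t i ⬝ᵥ σ.η t i :=
      Finset.sum_nonneg fun _ _ => Finset.sum_nonneg fun _ _ => mul_self_nonneg _
    linarith
  have he : (D.Ds * Matrix.vecMulVec (σ.ε t) (σ.ζ t)) i a =
      (D.sgn i * D.γ i) * σ.ε t i * σ.ζ t a := by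
    rw [Matrix.mul_vecMulVec, Matrix.vecMulVec_apply, Design.Ds, Matrix.mulVec_diagonal]
  simp only [thetaRate]
  rw [he, Real.sqrt_div (sq_nonneg _), Real.sqrt_sq_eq_abs, abs_div, abs_neg, abs_mul, abs_mul,
    abs_of_pos hm, mul_div_assoc', div_le_div_iff₀ hm hs]
  calc |D.sgn i * D.γ i| * |σ.ε t i| * |σ.ζ t a| * Real.sqrt (σ.msq t)
      ≤ |D.sgn i * D.γ i| * |σ.ε t i| * Real.sqrt (σ.msq t) * Real.sqrt (σ.msq t) := by gcongr
    _ = |D.sgn i * D.γ i| * |σ.ε t i| * σ.msq t := by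
        rw [mul_assoc, Real.mul_self_sqrt hm.le]

theorem WeightedLoop.energy_nonneg (h : WeightedLoop A B C C₀ D r I Kp K W σ) (i : Fin M) (t : ℝ)
    (ht : 0 ≤ t) : 0 ≤ σ.ε t i ^ 2 / σ.msq t :=
  div_nonneg (sq_nonneg _) (zero_le_one.trans (h.one_le_msq ht))

theorem WeightedLoop.energy_integrable (h : WeightedLoop A B C C₀ D r I Kp K W σ) (i : Fin M)
    (t : ℝ) (ht : 0 ≤ t) : IntervalIntegrable (fun s => σ.ε s i ^ 2 / σ.msq s) volume 0 t :=
  (h.loop t ht).intervalIntegrable_eps_sq h.interactor i ht le_rfl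

/-- The swapping signal `Ξ` is small. -/
theorem WeightedLoop.xi_isLittleO (h : WeightedLoop A B C C₀ D r I Kp K W σ) (i : Fin M) :
    (fun t => σ.Xi t i) =o[atTop] W := by
  obtain ⟨K₁, a, hK₁, ha, hb⟩ := exists_filter_bound D.f_monic D.f_stable
  have hN := h.interactor.filter_degree_pos i
  -- Swapping: commuting `Θᵀ` with the filter gives a chain of integrators with zero input, since
  -- `Θᵀω` cancels, and with disturbances `Θ̇ᵀ q_ω`. These are products of a square integrable
  -- function and an `O(W)` signal, and `z · 0` is component `i` of `Ξ`.
  set z : ℝ → ℕ → ℝ := fun t k => ∑ c, σ.Θ t c i * σ.q_ω t c k - σ.q_Θω t i k with hz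
  set w : ℝ → ℕ → ℝ := fun t k => ∑ c, thetaRate D σ t c i * σ.q_ω t c k with hw
  have hzr : ∀ T, 0 ≤ T → ∀ k < D.f.natDegree,
      HasRateOn T (fun t => z t k) fun t => z t (k + 1) + w t k := by
    intro T hT k hk
    have hl := h.loop T hT
    refine ((HasRateOn.sum Finset.univ fun c _ =>
      (hl.law_Θ c i).mul ((hl.filter_ω.filter c).1 k hk)).sub
      ((hl.filter_Θω.filter i).1 k hk)).congr (fun _ _ _ => rfl) fun t _ _ => ?_
    simp only [hz, hw, thetaRate, Finset.sum_add_distrib]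
    ring
  have hzv : ∀ T, 0 ≤ T → ∀ t, 0 ≤ t → t ≤ T →
      ∑ k ∈ Finset.range (D.f.natDegree + 1), D.f.coeff k * z t k = 0 := by
    intro T hT t ht htT
    have hl := h.loop T hT
    simp only [hz, mul_sub, Finset.sum_sub_distrib, Finset.mul_sum]
    rw [(hl.filter_Θω.filter i).2 t ht htT, Finset.sum_comm, sub_eq_zero]
    refine Finset.sum_congr rfl fun c _ => ?_
    have : ∑ k ∈ Finset.range (D.f.natDegree + 1), D.f.coeff k * σ.q_ω t c k = σ.ω t c :=
      (hl.filter_ω.filter c).2 t ht htT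
    rw [← this, Finset.mul_sum]
    exact Finset.sum_congr rfl fun k _ => mul_left_comm _ _ _
  have hwC : ∀ k ∈ Finset.range D.f.natDegree,
      UBd (fun t : NNTime => Real.sqrt (σ.ε t i ^ 2 / σ.msq t) * W t) fun t => w t k :=
    fun k hk => UBd.sum Finset.univ fun c _ => (h.thetaRate_uBd c i).mul
      (h.signals.q_ω c k (Finset.mem_range.1 hk).le)
  obtain ⟨c, hc⟩ := UBd.sum _ fun k hk => (hwC k hk).mul_self (hwC k hk)
  have hiss : ISSBound K₁ a (fun t => ∑ k ∈ Finset.range D.f.natDegree, w t k ^ 2)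
      fun t => z t 0 :=
    ⟨hK₁, ha, ∑ k ∈ Finset.range D.f.natDegree, z 0 k ^ 2, fun T β hT hβ hV =>
      hb T z w (fun _ => 0) β (hzr T hT) (hzv T hT) hβ
        (fun t ht htT => by simpa using hV t ht htT) T hT le_rfl 0 hN⟩
  refine isLittleO_congr (hiss.isLittleO_of_integrable h.weight (h.energy_nonneg i)
    (h.energy_integrable i) (fun t ht => h.energy t ht i) (C := c) fun t ht => ?_) fun t ht => ?_
  · have h1 := (le_abs_self _).trans (hc ⟨t, ht⟩)
    simp only at h1
    have h2 : c * (Real.sqrt (σ.ε t i ^ 2 / σ.msq t) * W t *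
        (Real.sqrt (σ.ε t i ^ 2 / σ.msq t) * W t)) = c * (σ.ε t i ^ 2 / σ.msq t) * W t ^ 2 := by
      rw [mul_mul_mul_comm, Real.mul_self_sqrt (h.energy_nonneg i t ht)]
      ring
    rw [h2] at h1
    simpa only [sq (w t _)] using h1
  · have hl := h.loop t ht
    rw [hl.xi t ht le_rfl, Pi.sub_apply, hl.filter_Θω.out_one ht le_rfl i]
    simp only [hz]
    congr 1
    refine Finset.sum_congr rfl fun c _ => ?_
    rw [hl.filter_ω.out_one ht le_rfl c]
    rfl

/-- The filtered tracking error `ē` is small. -/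
theorem WeightedLoop.ebar_isLittleO (h : WeightedLoop A B C C₀ D r I Kp K W σ) (i : Fin M) :
    (fun t => σ.ebar t i) =o[atTop] W := by
  -- Strong induction over the channels: `ē_i` differs from `ε_i` by `θ_iᵀ η_i`, which involves only
  -- `ē_j` with `j < i`, and by a row of `Ψ Ξ`, already known to be small.
  refine WellFoundedLT.induction (motive := fun i => (fun t => σ.ebar t i) =o[atTop] W) i fun i ih => ?_
  obtain ⟨c, hc⟩ := h.signals.ebarRate i
  obtain ⟨c', hc'⟩ := h.signals.msq
  have hb : (fun t => -(∑ j, σ.θ t i j * σ.η t i j + ∑ j, σ.Ψ t i j * σ.Xi t j)) =o[atTop] W := by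
    refine Asymptotics.IsLittleO.neg_left ?_
    refine (isLittleO_sum _ fun j _ => ?_).add (isLittleO_sum _ fun j _ => ?_)
    · refine isLittleO_mul_of_uBd (isLittleO_congr (ih (Fin.castLE i.isLt.le j) ?_)
        fun t ht => (h.loop t ht).eta t ht le_rfl i j) (h.params.θ i j)
      exact j.isLt
    · exact isLittleO_mul_of_uBd (h.xi_isLittleO j) (h.params.Ψ i j)
  refine h.weight.isLittleO_of_sq_integrable (ε := fun t => σ.ε t i) (C := c) (C' := c')
    (fun T hT => (h.loop T hT).hasRateOn_ebar h.interactor.adjugate_natDegree_lt i)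
    (fun t ht => hc ⟨t, ht⟩) (fun t ht => ?_) hb (h.energy_nonneg i) (h.energy_integrable i)
    (fun t ht => h.energy t ht i) fun t ht => ?_
  · rw [(h.loop t ht).eps t ht le_rfl i]
    simp only [dotProduct, Matrix.mulVec]
    ring
  · have hm : 0 < σ.msq t := one_pos.trans_le (h.one_le_msq ht)
    have h1 := (le_abs_self _).trans (hc' ⟨t, ht⟩)
    simp only at h1
    have h2 := mul_le_mul_of_nonneg_left h1 (h.energy_nonneg i t ht)
    calc σ.ε t i ^ 2 = σ.ε t i ^ 2 / σ.msq t * σ.msq t := by field_simp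
      _ ≤ _ := h2
      _ = _ := by ring

end

end PartialStateMRAC

namespace PartialStateMRAC

/-! ### Boundedness of the closed loop and convergence of the tracking error -/

variable {M n n₀ : ℕ}

/-- The norm of the state of the linear part of the closed loop, plus one. -/
noncomputable def linNorm (D : Design M n n₀) (σ : Signals M n n₀) (t : ℝ) : ℝ :=
  1 + (∑ i, |σ.x t i| +
    (∑ j, ∑ k ∈ Finset.range D.Lam.natDegree, |σ.q_u t j k| +
    (∑ j, ∑ k ∈ Finset.range D.Lam.natDegree, |σ.q_y₀ t j k| +
    (∑ j, ∑ k ∈ Finset.range D.ξ.det.natDegree, |σ.q_r t j k| +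
    (∑ j, ∑ k ∈ Finset.range D.f.natDegree, |σ.q_ω t j k| +
    (∑ j, ∑ k ∈ Finset.range D.f.natDegree, |σ.q_Θω t j k| +
    ∑ j, ∑ k ∈ Finset.range D.f.natDegree, |σ.q_e t j k|))))))

theorem abs_le_sum_sum {b : Type*} [Fintype b] {N : ℕ} (q : b → ℕ → ℝ) {j : b} {k : ℕ}
    (hk : k < N) : |q j k| ≤ ∑ j, ∑ k ∈ Finset.range N, |q j k| :=
  (Finset.single_le_sum (f := fun k => |q j k|) (fun _ _ => abs_nonneg _)
    (Finset.mem_range.2 hk)).trans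
    (Finset.single_le_sum (f := fun j => ∑ k ∈ Finset.range N, |q j k|)
      (fun _ _ => Finset.sum_nonneg fun _ _ => abs_nonneg _) (Finset.mem_univ j))

theorem sum_sum_abs_nonneg {b : Type*} [Fintype b] (N : ℕ) (q : b → ℕ → ℝ) :
    0 ≤ ∑ j, ∑ k ∈ Finset.range N, |q j k| :=
  Finset.sum_nonneg fun _ _ => Finset.sum_nonneg fun _ _ => abs_nonneg _

theorem one_le_linNorm (D : Design M n n₀) (σ : Signals M n n₀) (t : ℝ) : 1 ≤ linNorm D σ t := by
  rw [linNorm]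
  have h0 : 0 ≤ ∑ i, |σ.x t i| := Finset.sum_nonneg fun _ _ => abs_nonneg _
  have h1 := sum_sum_abs_nonneg D.Lam.natDegree (σ.q_u t)
  have h2 := sum_sum_abs_nonneg D.Lam.natDegree (σ.q_y₀ t)
  have h3 := sum_sum_abs_nonneg D.ξ.det.natDegree (σ.q_r t)
  have h4 := sum_sum_abs_nonneg D.f.natDegree (σ.q_ω t)
  have h5 := sum_sum_abs_nonneg D.f.natDegree (σ.q_Θω t)
  have h6 := sum_sum_abs_nonneg D.f.natDegree (σ.q_e t)
  linarith

theorem stateBound_of_linNorm_le {ι : Type*} {D : Design M n n₀} {w : ι → ℝ}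
    {σ : ι → Signals M n n₀} {τ : ι → ℝ} (h : ∀ p, linNorm D (σ p) (τ p) ≤ w p) :
    StateBound D w σ τ := by
  have h0 : ∀ p, 0 ≤ ∑ i, |(σ p).x (τ p) i| := fun p => Finset.sum_nonneg fun _ _ => abs_nonneg _
  have h1 := fun p => sum_sum_abs_nonneg D.Lam.natDegree ((σ p).q_u (τ p))
  have h2 := fun p => sum_sum_abs_nonneg D.Lam.natDegree ((σ p).q_y₀ (τ p))
  have h3 := fun p => sum_sum_abs_nonneg D.ξ.det.natDegree ((σ p).q_r (τ p))
  have h4 := fun p => sum_sum_abs_nonneg D.f.natDegree ((σ p).q_ω (τ p))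
  have h5 := fun p => sum_sum_abs_nonneg D.f.natDegree ((σ p).q_Θω (τ p))
  have h6 := fun p => sum_sum_abs_nonneg D.f.natDegree ((σ p).q_e (τ p))
  have key : ∀ v : ι → ℝ, (∀ p, |v p| ≤ linNorm D (σ p) (τ p)) → UBd w v := fun v hv =>
    ⟨1, fun p => by rw [one_mul]; exact (hv p).trans (h p)⟩
  refine ⟨fun i => key _ fun p => ?_, fun j k hk => key _ fun p => ?_,
    fun j k hk => key _ fun p => ?_, fun j k hk => key _ fun p => ?_,
    fun j k hk => key _ fun p => ?_, fun j k hk => key _ fun p => ?_,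
    fun j k hk => key _ fun p => ?_⟩ <;> rw [linNorm]
  · have := Finset.single_le_sum (f := fun i => |(σ p).x (τ p) i|) (fun _ _ => abs_nonneg _)
      (Finset.mem_univ i)
    linarith [h1 p, h2 p, h3 p, h4 p, h5 p, h6 p]
  · linarith [h0 p, h2 p, h3 p, h4 p, h5 p, h6 p, abs_le_sum_sum ((σ p).q_u (τ p)) (j := j) hk]
  · linarith [h0 p, h1 p, h3 p, h4 p, h5 p, h6 p, abs_le_sum_sum ((σ p).q_y₀ (τ p)) (j := j) hk]
  · linarith [h0 p, h1 p, h2 p, h4 p, h5 p, h6 p, abs_le_sum_sum ((σ p).q_r (τ p)) (j := j) hk]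
  · linarith [h0 p, h1 p, h2 p, h3 p, h5 p, h6 p, abs_le_sum_sum ((σ p).q_ω (τ p)) (j := j) hk]
  · linarith [h0 p, h1 p, h2 p, h3 p, h4 p, h6 p, abs_le_sum_sum ((σ p).q_Θω (τ p)) (j := j) hk]
  · linarith [h0 p, h1 p, h2 p, h3 p, h4 p, h5 p, abs_le_sum_sum ((σ p).q_e (τ p)) (j := j) hk]

section

variable {A : Matrix (Fin n) (Fin n) ℝ} {B : Matrix (Fin n) (Fin M) ℝ}
  {C : Matrix (Fin M) (Fin n) ℝ} {C₀ : Matrix (Fin n₀) (Fin n) ℝ} {D : Design M n n₀}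
  {r : ℝ → Fin M → ℝ} {I : InitialData M n n₀} {Kp : Matrix (Fin M) (Fin M) ℝ}
  {K : ℝ} {W : ℝ → ℝ} {σ : Signals M n n₀} {Θs : Matrix (RegIdx M n n₀) (Fin M) ℝ}

/-- The control error `(Θ - Θ*)ᵀ ω` is small. -/
theorem WeightedLoop.control_error_isLittleO (h : WeightedLoop A B C C₀ D r I Kp K W σ)
    (hWt : Tendsto W atTop atTop) (hr_bdd : ∀ i, BoundedSignal fun t => r t i)
    (hδ : ∀ i, UBd (fun _ : NNTime => 1) fun t => σ.ebar t i -
      Kp.mulVec (σ.hΘω t - Θs.transpose.mulVec (σ.ζ t)) i) (i : Fin M) :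
    (fun t => ((σ.Θ t).transpose.mulVec (σ.ω t) - Θs.transpose.mulVec (σ.ω t)) i)
      =o[atTop] W := by
  have hN := h.interactor.filter_degree_pos i
  set N := D.f.natDegree with hNdef
  -- The states of the filter `1 / f` with input `(Θ - Θ*)ᵀω`. By the error model `Kp ρ₀` is `ē` up
  -- to a bounded term, and bounded terms are `o(W)` because `W → ∞`.
  set ρ : ℝ → ℕ → ℝ := fun t k => σ.q_Θω t i k - Θs.transpose.mulVec (fun a => σ.q_ω t a k) i with hρ
  set φ : ℝ → ℝ := fun t => ((σ.Θ t).transpose.mulVec (σ.ω t) - Θs.transpose.mulVec (σ.ω t)) i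
    with hφ
  have hfil : ∀ T, 0 ≤ T → FilterOn T D.f φ ρ := fun T hT =>
    (((h.loop T hT).filter_Θω.filter i).sub
      (FilterOn.mulVec Θs.transpose (h.loop T hT).filter_ω.filter i)).congr
      (fun _ _ _ => rfl) fun _ _ _ _ _ => rfl
  have hρC : ∀ k ≤ N, UBd (fun t : NNTime => W t) fun t => ρ t k := fun k hk =>
    (h.signals.q_Θω i k hk).sub (UBd.mulVec Θs.transpose (fun a => h.signals.q_ω a k hk) i)
  have hρ0 : (fun t => ρ t 0) =o[atTop] W := by
    have h1 : ∀ j, (fun t => σ.ebar t j - (σ.ebar t j -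
        Kp.mulVec (σ.hΘω t - Θs.transpose.mulVec (σ.ζ t)) j)) =o[atTop] W := fun j =>
      (h.ebar_isLittleO j).sub (isLittleO_of_uBd hWt (hδ j))
    refine isLittleO_congr (isLittleO_mulVec (x := fun t j => σ.ebar t j - (σ.ebar t j -
        Kp.mulVec (σ.hΘω t - Θs.transpose.mulVec (σ.ζ t)) j)) Kp⁻¹ h1 i) fun t ht => ?_
    have h2 : (fun j => σ.ebar t j - (σ.ebar t j -
        Kp.mulVec (σ.hΘω t - Θs.transpose.mulVec (σ.ζ t)) j)) =
        Kp.mulVec (σ.hΘω t - Θs.transpose.mulVec (σ.ζ t)) := by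
      ext j
      ring
    have h3 : (σ.ζ t) = fun a => σ.q_ω t a 0 :=
      funext fun a => (h.loop t ht).filter_ω.out_one ht le_rfl a
    rw [h2, Matrix.mulVec_mulVec, Matrix.nonsing_inv_mul _
      (isUnit_iff_ne_zero.2 h.interactor.nonsingular), Matrix.one_mulVec, Pi.sub_apply,
      (h.loop t ht).filter_Θω.out_one ht le_rfl i, h3]
  obtain ⟨N', hN'⟩ : ∃ N', N = N' + 1 := ⟨N - 1, by omega⟩
  -- The chain stops one order below the top: the state of order `N` contains `r`, which is only
  -- measurable and has no rate.
  have hchain : ∀ k ≤ N', (fun t => ρ t k) =o[atTop] W := fun k hk =>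
    h.weight.chain (N := N') (g := fun t => ρ t N) (fun k hk T hT => (hfil T hT).1 k (by omega))
      (fun T hT => by rw [hN']; exact (hfil T hT).1 N' (by omega))
      (fun k hk => hρC k (by omega)) (hρC N le_rfl) hρ0 hk
  -- The regressor is split into the components that possess an `O(W)` rate and the reference input,
  -- whose contribution is bounded and hence `o(W)`. The slow variation lemma is applied to the
  -- former only.
  set reg : ℝ → RegIdx M n n₀ → ℝ := fun t =>
    Sum.elim (σ.ω₁ t) (Sum.elim (σ.ω₂ t) (Sum.elim (σ.y₀ t) fun _ => 0)) with hreg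
  set regRate : ℝ → RegIdx M n n₀ → ℝ := fun t =>
    Sum.elim (fun lj => σ.q_u t lj.2 (lj.1 + 1)) (Sum.elim (fun lj => σ.q_y₀ t lj.2 (lj.1 + 1))
      (Sum.elim (C₀.mulVec (A.mulVec (σ.x t) + B.mulVec (σ.u t))) fun _ => 0)) with hregRate
  set ext : ℝ → RegIdx M n n₀ → ℝ := fun t =>
    Sum.elim (fun _ => 0) (Sum.elim (fun _ => 0) (Sum.elim (fun _ => 0) (r t))) with hext
  have hlt : ∀ l : Fin (n - n₀), l.val < D.Lam.natDegree := fun l => by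
    rw [D.Lam_degree]
    exact l.isLt
  have hregr : ∀ c T, 0 ≤ T → HasRateOn T (fun t => reg t c) fun t => regRate t c := by
    intro c T hT
    have hl := h.loop T hT
    rcases c with c | c | c | c
    · exact ((hl.filter₁.filter c.2).1 c.1 (hlt _)).congr
        (fun t ht htT => hl.filter₁.out_powerStack ht htT c) fun _ _ _ => rfl
    · exact ((hl.filter₂.filter c.2).1 c.1 (hlt _)).congr
        (fun t ht htT => hl.filter₂.out_powerStack ht htT c) fun _ _ _ => rfl
    · have : HasRateOn T (fun t => C₀.mulVec (σ.x t) c)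
          fun t => C₀.mulVec (A.mulVec (σ.x t) + B.mulVec (σ.u t)) c :=
        HasRateOn.sum Finset.univ fun k _ => (hl.state k).const_mul (C₀ c k)
      exact this.congr (fun t ht htT => congrFun (hl.partialState t ht htT) c) fun _ _ _ => rfl
    · exact HasRateOn.const T 0
  have hregC : ∀ c, UBd (fun t : NNTime => W t) fun t => reg t c := by
    rintro (c | c | c | c)
    · exact h.signals.ω₁ c
    · exact h.signals.ω₂ c
    · exact h.signals.y₀ c
    · exact UBd.zero
  have hregRC : ∀ c, UBd (fun t : NNTime => W t) fun t => regRate t c := by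
    rintro (c | c | c | c)
    · exact h.signals.q_u c.2 _ (hlt c.1)
    · exact h.signals.q_y₀ c.2 _ (hlt c.1)
    · exact UBd.mulVec (x := fun t : NNTime => A.mulVec (σ.x t) + B.mulVec (σ.u t)) C₀
        h.signals.stateRate c
    · exact UBd.zero
  have hextC : ∀ c, UBd (fun _ : NNTime => 1) fun t => ext t c := by
    rintro (c | c | c | c)
    · exact UBd.zero
    · exact UBd.zero
    · exact UBd.zero
    · obtain ⟨K, hK⟩ := hr_bdd c
      exact UBd.of_abs_le fun t => hK t t.2
  have hpar : ∀ c, UBd (fun _ : NNTime => 1) fun t => σ.Θ t c i - Θs c i := fun c =>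
    (h.params.Θ c i).sub (.of_eq (Θs c i) fun _ => rfl)
  set a : ℝ → ℝ := fun t => ∑ c, (σ.Θ t c i - Θs c i) * reg t c with ha
  set b : ℝ → ℝ := fun t => ∑ c, (σ.Θ t c i - Θs c i) * ext t c with hb
  have hφab : ∀ t, 0 ≤ t → φ t = a t + b t := by
    intro t ht
    simp only [hφ, ha, hb]
    rw [← Matrix.sub_mulVec, ← Finset.sum_add_distrib]
    refine Finset.sum_congr rfl fun c _ => ?_
    rw [← mul_add]
    congr 1
    rw [(h.loop t ht).regressor t ht le_rfl]
    rcases c with c | c | c | c <;> simp [hreg, hext]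
  have hbo : b =o[atTop] W := isLittleO_of_uBd hWt
    (UBd.sum Finset.univ fun c _ => (hextC c).mul_bdd (hpar c))
  have har : ∀ T, 0 ≤ T → HasRateOn T a fun t =>
      ∑ c, ((thetaRate D σ t c i - 0) * reg t c + (σ.Θ t c i - Θs c i) * regRate t c) :=
    fun T hT => HasRateOn.sum Finset.univ fun c _ =>
      (((h.loop T hT).law_Θ c i).sub (HasRateOn.const T (Θs c i))).mul (hregr c T hT)
  obtain ⟨c₁, hc₁⟩ : UBd (fun t : NNTime => W t) fun t =>
      ∑ c, ((thetaRate D σ t c i - 0) * reg t c + (σ.Θ t c i - Θs c i) * regRate t c) :=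
    UBd.sum Finset.univ fun c _ => ((hregC c).mul_bdd ((h.rates.Θ c i).sub UBd.zero)).add
      ((hregRC c).mul_bdd (hpar c))
  have hlow : (fun t => ∑ k ∈ Finset.range N, D.f.coeff k * ρ t k) =o[atTop] W :=
    isLittleO_sum _ fun k hk => (hchain k (by have := Finset.mem_range.1 hk; omega)).const_mul_left _
  have hao : a =o[atTop] W := by
    refine h.weight.isLittleO_of_rate (v := fun t => ρ t N')
      (b := fun t => b t - ∑ k ∈ Finset.range N, D.f.coeff k * ρ t k) (fun T hT => ?_)
      (hchain N' le_rfl) (hbo.sub hlow) har (C := c₁) fun t ht => hc₁ ⟨t, ht⟩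
    refine ((hfil T hT).1 N' (by omega)).congr (fun _ _ _ => rfl) fun t ht htT => ?_
    rw [← hN', (hfil T hT).top_eq D.f_monic ht htT, hφab t ht]
    ring
  exact isLittleO_congr (hao.add hbo) hφab

/-- Relative to an unbounded weight, the state of the linear part is small. -/
theorem WeightedLoop.linNorm_isLittleO (h : WeightedLoop A B C C₀ D r I Kp K W σ)
    (hWt : Tendsto W atTop atTop) (hr_bdd : ∀ i, BoundedSignal fun t => r t i)
    (hA : Hurwitz (A - B * Kp⁻¹ * interactorState D.ξ A C))
    (hω : ∀ i, UBd (fun _ : NNTime => 1) fun t => Θs.transpose.mulVec (σ.ω t) i -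
        (-(Kp⁻¹ * interactorState D.ξ A C).mulVec (σ.x t) + Kp⁻¹.mulVec (r t)) i)
    (hδ : ∀ i, UBd (fun _ : NNTime => 1) fun t => σ.ebar t i -
      Kp.mulVec (σ.hΘω t - Θs.transpose.mulVec (σ.ζ t)) i) :
    linNorm D σ =o[atTop] W := by
  have hW := h.weight
  have hφ := h.control_error_isLittleO hWt hr_bdd hδ
  have hr1 : ∀ i, UBd (fun _ : NNTime => 1) fun t => r t i := fun i => by
    obtain ⟨K, hK⟩ := hr_bdd i
    exact UBd.of_abs_le fun t => hK t t.2
  have hW1 : ∀ t : NNTime, 1 ≤ W t := fun t => hW.one_le t t.2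
  have hone : ∀ {v : NNTime → ℝ}, UBd (fun _ => 1) v → UBd (fun t : NNTime => W t) v :=
    fun hv => hv.mono (fun _ => zero_le_one) hW1
  set R := interactorState D.ξ A C with hR
  -- The deviation from the stabilizing state feedback, so that `ẋ = (A - B Kp⁻¹ R) x + B p`. It is
  -- the sum of the control error `(Θ - Θ*)ᵀω`, of the matching error and of `Kp⁻¹ r`, all of which
  -- are `o(W)`.
  set p : ℝ → Fin M → ℝ := fun t => σ.u t + (Kp⁻¹ * R).mulVec (σ.x t) with hp
  have hpo : ∀ i, (fun t => p t i) =o[atTop] W := by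
    intro i
    refine isLittleO_congr (((hφ i).add (isLittleO_of_uBd (v := fun t => Θs.transpose.mulVec (σ.ω t) i -
      (-(Kp⁻¹ * R).mulVec (σ.x t) + Kp⁻¹.mulVec (r t)) i) hWt (hω i))).add
      (isLittleO_mulVec (x := r) Kp⁻¹ (fun j => isLittleO_of_uBd hWt (hr1 j)) i)) fun t ht => ?_
    simp only [hp, Pi.add_apply, Pi.sub_apply, Pi.neg_apply]
    rw [(h.loop t ht).control t ht le_rfl]
    ring
  have hpC : ∀ i, UBd (fun t : NNTime => W t) fun t => p t i := fun i =>
    (h.signals.u i).add (UBd.mulVec (Kp⁻¹ * R) h.signals.x i)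
  have hx : ∀ i, (fun t => σ.x t i) =o[atTop] W := by
    intro i
    obtain ⟨K₁, a, hK₁, ha, hb⟩ := exists_iss_bound (A - B * Kp⁻¹ * R) hA
      (Matrix.aeval_self_charpoly _)
    have hiss : ISSBound K₁ a (fun t => B.mulVec (p t) ⬝ᵥ B.mulVec (p t)) fun t => σ.x t i :=
      ⟨hK₁, ha, σ.x 0 ⬝ᵥ σ.x 0, fun T β hT hβ hV => by
        have h1 : σ.x T i ^ 2 ≤ σ.x T ⬝ᵥ σ.x T := by
          rw [sq]
          exact Finset.single_le_sum (f := fun i => σ.x T i * σ.x T i)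
            (fun _ _ => mul_self_nonneg _) (Finset.mem_univ i)
        refine h1.trans (hb T σ.x (fun t => B.mulVec (p t)) β (fun j => ?_) hβ hV T hT le_rfl)
        refine ((h.loop T hT).state j).congr (fun _ _ _ => rfl) fun t _ _ => ?_
        simp only [hp]
        rw [Matrix.mulVec_add, Matrix.sub_mulVec, Matrix.mulVec_mulVec, ← Matrix.mul_assoc]
        simp only [Pi.add_apply, Pi.sub_apply]
        ring⟩
    obtain ⟨c, hc⟩ := UBd.sum Finset.univ fun j _ =>
      (UBd.mulVec (x := fun t : NNTime => p t) B hpC j).mul_self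
        (UBd.mulVec (x := fun t : NNTime => p t) B hpC j)
    refine hiss.isLittleO hW (C := c) (fun t ht => ?_) fun d hd => ?_
    · rw [sq]
      exact (le_abs_self _).trans (hc ⟨t, ht⟩)
    · have hsq : ∀ j, (fun t => B.mulVec (p t) j * B.mulVec (p t) j) =o[atTop]
          fun t => W t * W t := fun j => (isLittleO_mulVec B hpo j).mul (isLittleO_mulVec B hpo j)
      filter_upwards [Asymptotics.isLittleO_iff.1
        (isLittleO_sum Finset.univ fun j _ => hsq j) hd, eventually_ge_atTop 0] with t ht ht0
      rw [Real.norm_eq_abs, Real.norm_eq_abs, abs_mul_self, ← sq] at ht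
      exact (le_abs_self _).trans ht
  have hfil : ∀ {b : Type} {P : ℝ[X]} (_ : P.Monic) (_ : StablePoly P) {v : ℝ → b → ℝ}
      {q : ℝ → b → ℕ → ℝ} (_ : ∀ T, 0 ≤ T → ∀ j, FilterOn T P (fun t => v t j) fun t => q t j)
      (_ : ∀ j, UBd (fun t : NNTime => W t) fun t => v t j) (_ : ∀ j, (fun t => v t j) =o[atTop] W),
      ∀ j, ∀ k ≤ P.natDegree, (fun t => q t j k) =o[atTop] W :=
    fun hm hP _ _ hq hvC hv j k hk =>
      hW.filter hm hP (fun T hT => hq T hT j) (hvC j) (hv j) hk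
  have hu : ∀ i, (fun t => σ.u t i) =o[atTop] W := fun i =>
    isLittleO_congr ((hpo i).sub (isLittleO_mulVec (Kp⁻¹ * R) hx i)) fun t _ => by
      simp [hp]
  have hy₀ : ∀ i, (fun t => σ.y₀ t i) =o[atTop] W := fun i =>
    isLittleO_congr (isLittleO_mulVec C₀ hx i) fun t ht => by
      rw [(h.loop t ht).partialState t ht le_rfl]
  have hq_u := hfil D.Lam_monic D.Lam_stable (fun T hT => (h.loop T hT).filter₁.filter)
    h.signals.u hu
  have hq_y₀ := hfil D.Lam_monic D.Lam_stable (fun T hT => (h.loop T hT).filter₂.filter)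
    h.signals.y₀ hy₀
  have hq_r := hfil h.interactor.det_monic h.interactor.det_stable
    (fun T hT => (h.loop T hT).reference.filter) (fun j => hone (hr1 j))
    fun j => isLittleO_of_uBd hWt (hr1 j)
  have hlt : ∀ l : Fin (n - n₀), l.val ≤ D.Lam.natDegree := fun l => by
    rw [D.Lam_degree]
    exact l.isLt.le
  have hωo : ∀ c, (fun t => σ.ω t c) =o[atTop] W := by
    rintro (c | c | c | c)
    · exact isLittleO_congr (hq_u c.2 c.1 (hlt c.1)) fun t ht => by
        rw [(h.loop t ht).regressor t ht le_rfl]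
        exact (h.loop t ht).filter₁.out_powerStack ht le_rfl c
    · exact isLittleO_congr (hq_y₀ c.2 c.1 (hlt c.1)) fun t ht => by
        rw [(h.loop t ht).regressor t ht le_rfl]
        exact (h.loop t ht).filter₂.out_powerStack ht le_rfl c
    · exact isLittleO_congr (hy₀ c) fun t ht => by
        rw [(h.loop t ht).regressor t ht le_rfl]
        rfl
    · exact isLittleO_congr (isLittleO_of_uBd hWt (hr1 c)) fun t ht => by
        rw [(h.loop t ht).regressor t ht le_rfl]
  have hq_ω := hfil D.f_monic D.f_stable (fun T hT => (h.loop T hT).filter_ω.filter)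
    h.signals.ω hωo
  have hq_Θω := hfil D.f_monic D.f_stable (fun T hT => (h.loop T hT).filter_Θω.filter)
    h.signals.Θω fun i => isLittleO_congr (hu i) fun t ht => by
      rw [(h.loop t ht).control t ht le_rfl]
  have he : ∀ i, (fun t => σ.e t i) =o[atTop] W := by
    intro i
    have hym : (fun t => σ.y_m t i) =o[atTop] W := by
      refine isLittleO_congr (isLittleO_sum Finset.univ fun l _ =>
        isLittleO_sum (Finset.range (D.ξ.det.natDegree + 1)) fun k hk =>
          (hq_r l k (Nat.lt_succ_iff.1 (Finset.mem_range.1 hk))).const_mul_left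
            ((D.ξ.adjugate i l).coeff k)) fun t ht => ?_
      rw [(h.loop t ht).reference.out t ht le_rfl]
      exact Finset.sum_congr rfl fun l _ =>
        polyOp_eq_sum _ (h.interactor.adjugate_natDegree_lt i l).le
    refine isLittleO_congr ((isLittleO_mulVec C hx i).sub hym) fun t ht => ?_
    rw [(h.loop t ht).error t ht le_rfl, Pi.sub_apply, (h.loop t ht).output t ht le_rfl]
  have hq_e := hfil D.f_monic D.f_stable (fun T hT => (h.loop T hT).filter_e.filter)
    h.signals.e he
  have hss : ∀ {b : Type} [Fintype b] {N : ℕ} {q : ℝ → b → ℕ → ℝ},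
      (∀ j, ∀ k ≤ N, (fun t => q t j k) =o[atTop] W) →
      (fun t => ∑ j, ∑ k ∈ Finset.range N, |q t j k|) =o[atTop] W := fun hq =>
    isLittleO_sum _ fun j _ => isLittleO_sum _ fun k hk =>
      (hq j k (Finset.mem_range.1 hk).le).norm_left
  exact (isLittleO_of_uBd hWt (v := fun _ => 1) (.of_eq 1 fun _ => rfl)).add
    ((isLittleO_sum _ fun i _ => (hx i).norm_left).add ((hss hq_u).add ((hss hq_y₀).add
      ((hss hq_r).add ((hss hq_ω).add ((hss hq_Θω).add (hss hq_e)))))))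

/-- With bounded signals, the tracking error vanishes. -/
theorem WeightedLoop.error_tendsto (h : WeightedLoop A B C C₀ D r I Kp K (fun _ => 1) σ)
    (i : Fin M) : Tendsto (fun t => σ.e t i) atTop (𝓝 0) := by
  have hW := h.weight
  have hdeg : ∀ i j, (D.ξ i j).natDegree ≤ D.f.natDegree := fun i j =>
    (natDegree_le_maxDegree D.ξ i j).trans D.f_degree.ge
  have hq : ∀ i, ∀ k ≤ D.f.natDegree, (fun t => σ.q_e t i k) =o[atTop] fun _ : ℝ => (1 : ℝ) := by
    intro i
    -- The triangular system is solved row by row: row `i` expresses `ξ_ii(d/dt)` of the filtered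
    -- error `i` by `ē_i` and by filtered errors `j < i`, and `ξ_ii` is stable.
    refine WellFoundedLT.induction (motive := fun i => ∀ k ≤ D.f.natDegree,
      (fun t => σ.q_e t i k) =o[atTop] fun _ : ℝ => (1 : ℝ)) i fun i ih => ?_
    set v : ℝ → ℝ := fun t => σ.ebar t i -
      ∑ j, if j = i then 0 else polyOp (σ.q_e t j) (D.ξ i j) with hv
    have hvC : UBd (fun _ : NNTime => 1) fun t => v t := by
      refine (h.signals.ebar i).sub (UBd.sum Finset.univ fun j _ => ?_)
      split_ifs
      · exact UBd.zero
      · exact UBd.polyOp (hdeg i j) (h.signals.q_e j)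
    have hvo : v =o[atTop] fun _ : ℝ => (1 : ℝ) := by
      refine (h.ebar_isLittleO i).sub (isLittleO_sum Finset.univ fun j _ => ?_)
      rcases lt_trichotomy j i with hj | rfl | hj
      · simp only [hj.ne, if_false]
        exact isLittleO_congr (isLittleO_sum (Finset.range (D.f.natDegree + 1)) fun k hk =>
          (ih j hj k (Nat.lt_succ_iff.1 (Finset.mem_range.1 hk))).const_mul_left
            ((D.ξ i j).coeff k)) fun t _ => polyOp_eq_sum _ (hdeg i j)
      · simp only [if_true]
        exact Asymptotics.isLittleO_zero _ _
      · simp only [hj.ne', if_false, h.interactor.lower i j hj, map_zero]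
        exact Asymptotics.isLittleO_zero _ _
    have hfil : ∀ T, 0 ≤ T → FilterOn T (D.ξ i i) v fun t => σ.q_e t i := by
      intro T hT
      have hl := h.loop T hT
      refine ⟨fun k hk => (hl.filter_e.filter i).1 k (hk.trans_le (hdeg i i)),
        fun t ht htT => ?_⟩
      rw [← polyOp_eq_sum _ le_rfl]
      simp only [hv]
      rw [hl.filter_e.out t ht htT, ← Finset.sum_sub_distrib, Finset.sum_eq_single i]
      · simp
      · intro j _ hj
        simp [hj]
      · simp
    have h0 := hW.filter (h.interactor.diag_monic i) (h.interactor.diag_stable i) hfil hvC hvo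
      (Nat.zero_le _)
    intro k hk
    -- The degree of `ξ_ii` may be smaller than that of `f`, so the higher derivatives are obtained
    -- from slow variation. All orders up to `deg f` are needed to recover `e = f(d/dt) q_e`.
    exact hW.chain (N := D.f.natDegree)
      (fun k hk T hT => ((h.loop T hT).filter_e.filter i).1 k hk)
      (fun T hT => ((h.loop T hT).filter_e.filter i).hasRateOn_top D.f_monic
        ((h.loop T hT).hasRateOn_e h.interactor.adjugate_natDegree_lt i))
      (fun k hk => h.signals.q_e i k hk)
      ((h.signals.errorRate i).sub (UBd.sum _ fun k hk =>
        (h.signals.q_e i (k + 1) (Finset.mem_range.1 hk)).const_mul _)) h0 hk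
  refine (Asymptotics.isLittleO_one_iff ℝ).1 (isLittleO_congr (isLittleO_sum
    (Finset.range (D.f.natDegree + 1)) fun k hk =>
      (hq i k (Nat.lt_succ_iff.1 (Finset.mem_range.1 hk))).const_mul_left (D.f.coeff k))
        fun t ht => ?_)
  exact (((h.loop t ht).filter_e.filter i).2 t ht le_rfl).symm

end

end PartialStateMRAC

/-! ### The running maximum argument and the conclusion for a given trajectory -/

namespace PartialStateMRAC

variable {M n n₀ : ℕ} {A : Matrix (Fin n) (Fin n) ℝ} {B : Matrix (Fin n) (Fin M) ℝ}
  {C : Matrix (Fin M) (Fin n) ℝ} {C₀ : Matrix (Fin n₀) (Fin n) ℝ} {D : Design M n n₀}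
  {r : ℝ → Fin M → ℝ} {I : InitialData M n n₀} {Kp : Matrix (Fin M) (Fin M) ℝ}
  {σ : Signals M n n₀}

theorem IsClosedLoopOn.continuousOn_linNorm {T : ℝ} (h : IsClosedLoopOn T A B C C₀ D r I σ) :
    ContinuousOn (linNorm D σ) (Set.Icc 0 T) := by
  have hs : ∀ {b : Type} [Fintype b] {N : ℕ} {q : ℝ → b → ℕ → ℝ},
      (∀ j, ∀ k < N, ContinuousOn (fun t => q t j k) (Set.Icc 0 T)) →
      ContinuousOn (fun t => ∑ j, ∑ k ∈ Finset.range N, |q t j k|) (Set.Icc 0 T) := fun hq =>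
    continuousOn_finsetSum _ fun j _ => continuousOn_finsetSum _ fun k hk =>
      (hq j k (Finset.mem_range.1 hk)).abs
  refine continuousOn_const.add ((continuousOn_finsetSum _ fun i _ =>
    (h.state i).continuousOn.abs).add ((hs fun j k hk => ?_).add ((hs fun j k hk => ?_).add
      ((hs fun j k hk => ?_).add ((hs fun j k hk => ?_).add ((hs fun j k hk => ?_).add
        (hs fun j k hk => ?_)))))))
  · exact ((h.filter₁.filter j).1 k hk).continuousOn
  · exact ((h.filter₂.filter j).1 k hk).continuousOn
  · exact ((h.reference.filter j).1 k hk).continuousOn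
  · exact ((h.filter_ω.filter j).1 k hk).continuousOn
  · exact ((h.filter_Θω.filter j).1 k hk).continuousOn
  · exact ((h.filter_e.filter j).1 k hk).continuousOn

theorem UBd.boundedSignal {v : ℝ → ℝ} (h : UBd (fun _ : NNTime => 1) fun t => v t) :
    BoundedSignal v := by
  obtain ⟨c, hc⟩ := h
  exact ⟨c, fun t ht => by simpa using hc ⟨t, ht⟩⟩

/-- A continuous function which is `o` of its running maximum whenever the latter is unbounded is
bounded. -/
theorem exists_le_of_isLittleO_sSup {v : ℝ → ℝ} (hv1 : ∀ t, 1 ≤ v t)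
    (hv : ∀ T, 0 ≤ T → ContinuousOn v (Set.Icc 0 T))
    (h : ∀ W : ℝ → ℝ, IsWeight W → (∀ t, 0 ≤ t → v t ≤ W t) → Tendsto W atTop atTop →
      v =o[atTop] W) : ∃ c, ∀ t, 0 ≤ t → v t ≤ c := by
  set W : ℝ → ℝ := fun t => sSup (v '' Set.Icc 0 t) with hWdef
  have hbdd : ∀ t, 0 ≤ t → BddAbove (v '' Set.Icc 0 t) := fun t ht =>
    (isCompact_Icc.image_of_continuousOn (hv t ht)).bddAbove
  have hle : ∀ s t, 0 ≤ s → s ≤ t → v s ≤ W t := fun s t hs hst =>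
    le_csSup (hbdd t (hs.trans hst)) ⟨s, ⟨hs, hst⟩, rfl⟩
  have hW : IsWeight W := by
    refine ⟨fun t ht => (hv1 t).trans (hle t t ht le_rfl), fun s t hs hst => ?_⟩
    exact csSup_le_csSup (hbdd t (hs.trans hst)) ⟨v 0, 0, ⟨le_rfl, hs⟩, rfl⟩
      (Set.image_mono (Set.Icc_subset_Icc_right hst))
  by_contra! hcon
  have hWt : Tendsto W atTop atTop := by
    refine tendsto_atTop.2 fun b => ?_
    obtain ⟨t, ht, hbt⟩ := hcon b
    filter_upwards [eventually_ge_atTop t] with s hs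
    exact hbt.le.trans (hle t s ht hs)
  have ho := hW.isLittleO_iff.1 (h W hW (fun t ht => hle t t ht le_rfl) hWt) (1 / 2) (by norm_num)
  obtain ⟨t₁, ht₁⟩ := eventually_atTop.1 ho
  set t₂ := max t₁ 0 with ht₂
  obtain ⟨t, ht, hbt⟩ := hcon (W t₂)
  -- After `t₂` the function is at most half of its running maximum, so `W t` cannot exceed its
  -- value at `t₂`; this contradicts unboundedness.
  have h2 : W t ≤ max (W t₂) (W t / 2) := by
    refine csSup_le ⟨v 0, 0, ⟨le_rfl, ht⟩, rfl⟩ ?_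
    rintro _ ⟨s, hs, rfl⟩
    rcases le_total s t₂ with hst | hst
    · exact (hle s t₂ hs.1 hst).trans (le_max_left _ _)
    · have h3 := (le_abs_self _).trans (ht₁ s ((le_max_left _ _).trans hst))
      have h4 := hW.mono s t hs.1 hs.2
      exact le_max_of_le_right (by linarith)
  have h5 := hle t t ht le_rfl
  have h6 := hW.pos ht
  rcases le_max_iff.1 h2 with h7 | h7 <;> linarith

section

variable (h : IsClosedLoop A B C C₀ D r I σ)
  (hxi : IsModifiedInteractor D.ξ (transferMatrix A B C) Kp)
  (hobs : Observable A C₀) (hrank : C₀.rank = n₀)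
  (hminors : ∀ k, 1 ≤ k → k ≤ M → leadingMinor Kp k ≠ 0)
  (hsgn : ∀ i : Fin M, D.sgn i =
    Real.sign (leadingMinor Kp (i.val + 1) / leadingMinor Kp i.val))
  (hr_meas : Measurable r) (hr_bdd : ∀ i, BoundedSignal fun t => r t i)

include h hxi hobs hrank hminors hsgn hr_meas hr_bdd

/-- The trajectory is regarded as the family of its restrictions to `[0, t]`, indexed by `t ≥ 0`.
Constants uniform over this family are bounds on `[0, ∞)`, obtained by evaluation at the right end
points. -/
theorem IsClosedLoop.exists_param_bounds :
    ∃ (Θs : Matrix (RegIdx M n n₀) (Fin M) ℝ) (K : ℝ),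
      (∀ i, UBd (fun _ : NNTime => 1) fun t => Θs.transpose.mulVec (σ.ω t) i -
        (-(Kp⁻¹ * interactorState D.ξ A C).mulVec (σ.x t) + Kp⁻¹.mulVec (r t)) i) ∧
      (∀ i, UBd (fun _ : NNTime => 1) fun t => σ.ebar t i -
        Kp.mulVec (σ.hΘω t - Θs.transpose.mulVec (σ.ζ t)) i) ∧
      ParamBound (fun _ : NNTime => σ) (fun t => t) ∧
      ParamRateBound D (fun _ : NNTime => σ) (fun t => t) ∧
      ∀ t, 0 ≤ t → ∀ i, ∫ s in (0 : ℝ)..t, σ.ε s i ^ 2 / σ.msq s ≤ K := by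
  have hl : ∀ t : NNTime, IsClosedLoopOn (t : ℝ) A B C C₀ D r I σ := fun t => h.on t.2
  obtain ⟨Θs, hω, hδ⟩ := exists_error_model (T := fun t : NNTime => (t : ℝ)) (σ := fun _ => σ)
    hl hxi hobs hrank hr_meas hr_bdd
  obtain ⟨hθ, hΨ, hΘ, K, hK⟩ := exists_lyapunov_bound hl hxi hminors hsgn hδ
  set φ : NNTime → Times fun t : NNTime => (t : ℝ) := fun t => ⟨(t, t), t.2, le_rfl⟩ with hφ
  have hp : ParamBound (fun _ : NNTime => σ) (fun t => t) :=
    ⟨fun i k => (hθ i k).comp φ, fun i k => (hΨ i k).comp φ, fun a i => (hΘ a i).comp φ⟩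
  have hδ' := fun i => (hδ i).uBd.comp φ
  exact ⟨Θs, K, fun i => (hω i).uBd.comp φ, hδ', hp,
    hp.rateBound (fun t => t.2) (fun _ => le_rfl) hl hδ', fun t ht => hK ⟨t, ht⟩ t ht le_rfl⟩

theorem IsClosedLoop.allBounded_and_tendsto
    (hA : Hurwitz (A - B * Kp⁻¹ * interactorState D.ξ A C)) :
    AllBounded D σ ∧ Tendsto (fun t => σ.y t - σ.y_m t) atTop (𝓝 0) := by
  obtain ⟨Θs, K, hω, hδ, hp, hpr, hK⟩ :=
    h.exists_param_bounds hxi hobs hrank hminors hsgn hr_meas hr_bdd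
  have hl : ∀ T, 0 ≤ T → IsClosedLoopOn T A B C C₀ D r I σ := fun T hT => h.on hT
  have hsig : ∀ W : ℝ → ℝ, IsWeight W →
      StateBound D (fun t : NNTime => W t) (fun _ => σ) (fun t => t) →
      WeightedLoop A B C C₀ D r I Kp K W σ := fun W hW hs =>
    ⟨hl, hxi, hW, hs.signalBound hp (fun t => hW.one_le t t.2) (fun t => t.2) (fun _ => le_rfl)
      (fun t => hl t t.2) hxi hr_bdd, hp, hpr, hK⟩
  -- The weight is the running maximum of `linNorm`: with respect to it all signals are `O(W)`, and
  -- if it were unbounded the linear states would be `o(W)`.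
  obtain ⟨c, hc⟩ := exists_le_of_isLittleO_sSup (one_le_linNorm D σ)
    (fun T hT => (hl T hT).continuousOn_linNorm) fun W hW hle hWt =>
      (hsig W hW (stateBound_of_linNorm_le fun t => hle t t.2)).linNorm_isLittleO hWt hr_bdd hA
        hω hδ
  have hs : StateBound D (fun _ : NNTime => c) (fun _ => σ) (fun t => t) :=
    stateBound_of_linNorm_le fun t => hc t t.2
  have hone : ∀ {v : NNTime → ℝ}, UBd (fun _ => c) v → UBd (fun _ => 1) v := by
    rintro v ⟨c', hc'⟩
    exact ⟨c' * c, fun t => by simpa using hc' t⟩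
  -- With the states bounded, the constant weight `1` is admissible, and the same smallness
  -- statements become convergence to zero.
  have hw := hsig (fun _ => 1) ⟨fun _ _ => le_rfl, fun _ _ _ _ => le_rfl⟩
    ⟨fun i => hone (hs.x i), fun j k hk => hone (hs.q_u j k hk),
      fun j k hk => hone (hs.q_y₀ j k hk), fun j k hk => hone (hs.q_r j k hk),
      fun j k hk => hone (hs.q_ω j k hk), fun j k hk => hone (hs.q_Θω j k hk),
      fun j k hk => hone (hs.q_e j k hk)⟩
  have S := hw.signals
  refine ⟨?_, ?_⟩
  · have hmsq : UBd (fun _ : NNTime => 1) fun t => σ.msq t := by simpa using S.msq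
    exact
    { x := fun i => (S.x i).boundedSignal
      u := fun i => (S.u i).boundedSignal
      y := fun i => (S.y i).boundedSignal
      y₀ := fun i => (S.y₀ i).boundedSignal
      y_m := fun i => (S.y_m i).boundedSignal
      e := fun i => (S.e i).boundedSignal
      ω₁ := fun i => (S.ω₁ i).boundedSignal
      ω₂ := fun i => (S.ω₂ i).boundedSignal
      ω := fun i => (S.ω i).boundedSignal
      Θ₁ := fun a i => (hp.Θ (Sum.inl a) i).boundedSignal
      Θ₂ := fun a i => (hp.Θ (Sum.inr (Sum.inl a)) i).boundedSignal
      Θ₂₀ := fun a i => (hp.Θ (Sum.inr (Sum.inr (Sum.inl a))) i).boundedSignal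
      Θ₃ := fun i a => (hp.Θ (Sum.inr (Sum.inr (Sum.inr a))) i).boundedSignal
      θ := fun i k => (hp.θ i k).boundedSignal
      Ψ := fun i k => (hp.Ψ i k).boundedSignal
      ebar := fun i => (S.ebar i).boundedSignal
      η := fun i j => (S.η i j).boundedSignal
      ζ := fun i => (S.ζ i).boundedSignal
      hΘω := fun i => (S.hΘω i).boundedSignal
      Xi := fun i => (S.Xi i).boundedSignal
      ε := fun i => (S.ε i).boundedSignal
      msq := hmsq.boundedSignal
      q_u := fun j k hk => (S.q_u j k hk).boundedSignal
      q_y₀ := fun j k hk => (S.q_y₀ j k hk).boundedSignal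
      q_r := fun j k hk => (S.q_r j k hk).boundedSignal
      q_ω := fun j k hk => (S.q_ω j k hk).boundedSignal
      q_Θω := fun j k hk => (S.q_Θω j k hk).boundedSignal
      q_e := fun j k hk => (S.q_e j k hk).boundedSignal }
  · refine tendsto_pi_nhds.2 fun i => (hw.error_tendsto i).congr' ?_
    filter_upwards [eventually_ge_atTop 0] with t ht
    rw [h.error t ht]

end

end PartialStateMRAC

namespace PartialStateMRAC

/-! ### The closed loop as an ordinary differential equation -/

/-- Filter states up to the order of the filter, from those below it and the input. -/
noncomputable def completeState (p : ℝ[X]) (v : ℝ) (low : Fin p.natDegree → ℝ) (k : ℕ) : ℝ :=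
  if h : k < p.natDegree then low ⟨k, h⟩ else v - ∑ l : Fin p.natDegree, p.coeff l * low l

theorem completeState_of_lt {p : ℝ[X]} {v : ℝ} {low : Fin p.natDegree → ℝ} {k : ℕ}
    (h : k < p.natDegree) : completeState p v low k = low ⟨k, h⟩ := dif_pos h

theorem filterOn_completeState {T : ℝ} {p : ℝ[X]} (hm : p.Monic) {v : ℝ → ℝ}
    {low : ℝ → Fin p.natDegree → ℝ}
    (h : ∀ k : Fin p.natDegree, HasRateOn T (fun t => low t k)
      fun t => completeState p (v t) (low t) (k + 1)) :
    FilterOn T p v fun t => completeState p (v t) (low t) := by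
  refine ⟨fun k hk => (h ⟨k, hk⟩).congr (fun t _ _ => completeState_of_lt hk) fun _ _ _ => rfl,
    fun t _ _ => ?_⟩
  rw [Finset.sum_range_succ, hm.coeff_natDegree, Finset.sum_range]
  have h1 : completeState p (v t) (low t) p.natDegree =
      v t - ∑ l : Fin p.natDegree, p.coeff l * low t l := dif_neg (lt_irrefl _)
  have h2 : ∑ l : Fin p.natDegree, p.coeff l * completeState p (v t) (low t) l =
      ∑ l : Fin p.natDegree, p.coeff l * low t l :=
    Finset.sum_congr rfl fun l _ => by rw [completeState_of_lt l.isLt]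
  beta_reduce
  rw [h1, h2]
  ring

section Smooth

variable {E : Type*} [NormedAddCommGroup E] [NormedSpace ℝ E]

theorem contDiff_completeState {p : ℝ[X]} {v : E → ℝ} {low : E → Fin p.natDegree → ℝ}
    (hv : ContDiff ℝ 1 v) (hl : ∀ k, ContDiff ℝ 1 fun s => low s k) (k : ℕ) :
    ContDiff ℝ 1 fun s => completeState p (v s) (low s) k := by
  unfold completeState
  split_ifs
  · exact hl _
  · exact hv.sub (ContDiff.sum fun l _ => contDiff_const.mul (hl l))

theorem contDiff_polyOp {q : E → ℕ → ℝ} (hq : ∀ k, ContDiff ℝ 1 fun s => q s k) (g : ℝ[X]) :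
    ContDiff ℝ 1 fun s => polyOp (q s) g := by
  simp only [polyOp_eq_sum _ (le_refl g.natDegree)]
  exact ContDiff.sum fun k _ => contDiff_const.mul (hq k)

theorem contDiff_mulVec {a b : Type*} [Fintype b] {Q : E → Matrix a b ℝ} {v : E → b → ℝ}
    (hQ : ∀ i j, ContDiff ℝ 1 fun s => Q s i j) (hv : ∀ j, ContDiff ℝ 1 fun s => v s j) (i : a) :
    ContDiff ℝ 1 fun s => (Q s).mulVec (v s) i :=
  ContDiff.sum fun j _ => (hQ i j).mul (hv j)

theorem contDiff_dotProduct {b : Type*} [Fintype b] {v w : E → b → ℝ}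
    (hv : ∀ j, ContDiff ℝ 1 fun s => v s j) (hw : ∀ j, ContDiff ℝ 1 fun s => w s j) :
    ContDiff ℝ 1 fun s => v s ⬝ᵥ w s :=
  ContDiff.sum fun j _ => (hv j).mul (hw j)

end Smooth

variable {M n n₀ : ℕ}

/-- Indices of the states of the linear part of the closed loop. -/
abbrev LinIdx (D : Design M n n₀) : Type :=
  Fin n ⊕ (Fin M × Fin D.Lam.natDegree) ⊕ (Fin n₀ × Fin D.Lam.natDegree) ⊕
    (Fin M × Fin D.ξ.det.natDegree) ⊕ (RegIdx M n n₀ × Fin D.f.natDegree) ⊕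
    (Fin M × Fin D.f.natDegree) ⊕ (Fin M × Fin D.f.natDegree)

/-- Indices of the parameter estimates. -/
abbrev ParIdx (M n n₀ : ℕ) : Type :=
  (RegIdx M n n₀ × Fin M) ⊕ ((i : Fin M) × Fin i.val) ⊕ (Fin M × Fin M)

/-- Values of the reference input and of the states of the closed loop. -/
abbrev LoopPoint (D : Design M n n₀) : Type :=
  (Fin M → ℝ) × (LinIdx D ⊕ ParIdx M n n₀ → ℝ)

namespace LoopPoint

section Signals

variable (A : Matrix (Fin n) (Fin n) ℝ) (B : Matrix (Fin n) (Fin M) ℝ)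
  (C : Matrix (Fin M) (Fin n) ℝ) (C₀ : Matrix (Fin n₀) (Fin n) ℝ) {D : Design M n n₀}
  (s : LoopPoint D)

def x (i : Fin n) : ℝ := s.2 (.inl (.inl i))

def lowU (j : Fin M) (k : Fin D.Lam.natDegree) : ℝ := s.2 (.inl (.inr (.inl (j, k))))

def lowY₀ (j : Fin n₀) (k : Fin D.Lam.natDegree) : ℝ := s.2 (.inl (.inr (.inr (.inl (j, k)))))

def lowR (j : Fin M) (k : Fin D.ξ.det.natDegree) : ℝ :=
  s.2 (.inl (.inr (.inr (.inr (.inl (j, k))))))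

def lowω (j : RegIdx M n n₀) (k : Fin D.f.natDegree) : ℝ :=
  s.2 (.inl (.inr (.inr (.inr (.inr (.inl (j, k)))))))

def lowΘω (j : Fin M) (k : Fin D.f.natDegree) : ℝ :=
  s.2 (.inl (.inr (.inr (.inr (.inr (.inr (.inl (j, k))))))))

def lowE (j : Fin M) (k : Fin D.f.natDegree) : ℝ :=
  s.2 (.inl (.inr (.inr (.inr (.inr (.inr (.inr (j, k))))))))

def Θ : Matrix (RegIdx M n n₀) (Fin M) ℝ := fun a i => s.2 (.inr (.inl (a, i)))

def θ (i : Fin M) (j : Fin i.val) : ℝ := s.2 (.inr (.inr (.inl ⟨i, j⟩)))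

def Ψ : Matrix (Fin M) (Fin M) ℝ := fun i j => s.2 (.inr (.inr (.inr (i, j))))

def y : Fin M → ℝ := C.mulVec s.x

def y₀ : Fin n₀ → ℝ := C₀.mulVec s.x

noncomputable def q_r (j : Fin M) : ℕ → ℝ := completeState D.ξ.det (s.1 j) (s.lowR j)

noncomputable def y_m (i : Fin M) : ℝ := ∑ j, polyOp (s.q_r j) (D.ξ.adjugate i j)

noncomputable def e : Fin M → ℝ := s.y C - s.y_m

def ω₁ (lj : Fin (n - n₀) × Fin M) : ℝ := s.lowU lj.2 (Fin.cast D.Lam_degree.symm lj.1)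

def ω₂ (lj : Fin (n - n₀) × Fin n₀) : ℝ := s.lowY₀ lj.2 (Fin.cast D.Lam_degree.symm lj.1)

def ω : RegIdx M n n₀ → ℝ := Sum.elim s.ω₁ (Sum.elim s.ω₂ (Sum.elim (s.y₀ C₀) s.1))

def u : Fin M → ℝ := s.Θ.transpose.mulVec (s.ω C₀)

noncomputable def q_u (j : Fin M) : ℕ → ℝ := completeState D.Lam (s.u C₀ j) (s.lowU j)

noncomputable def q_y₀ (j : Fin n₀) : ℕ → ℝ := completeState D.Lam (s.y₀ C₀ j) (s.lowY₀ j)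

noncomputable def q_ω (j : RegIdx M n n₀) : ℕ → ℝ := completeState D.f (s.ω C₀ j) (s.lowω j)

noncomputable def q_Θω (j : Fin M) : ℕ → ℝ := completeState D.f (s.u C₀ j) (s.lowΘω j)

noncomputable def q_e (j : Fin M) : ℕ → ℝ := completeState D.f (s.e C j) (s.lowE j)

noncomputable def ebar (i : Fin M) : ℝ := ∑ j, polyOp (s.q_e C j) (D.ξ i j)

noncomputable def η (i : Fin M) (j : Fin i.val) : ℝ := s.ebar C (Fin.castLE i.isLt.le j)

noncomputable def ζ (i : RegIdx M n n₀) : ℝ :=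
  ∑ j, polyOp (s.q_ω C₀ j) ((1 : Matrix (RegIdx M n n₀) (RegIdx M n n₀) ℝ[X]) i j)

noncomputable def hΘω (i : Fin M) : ℝ :=
  ∑ j, polyOp (s.q_Θω C₀ j) ((1 : Matrix (Fin M) (Fin M) ℝ[X]) i j)

noncomputable def Xi : Fin M → ℝ := s.Θ.transpose.mulVec (s.ζ C₀) - s.hΘω C₀

noncomputable def ε (i : Fin M) : ℝ :=
  s.θ i ⬝ᵥ s.η C i + s.Ψ.mulVec (s.Xi C₀) i + s.ebar C i

noncomputable def msq : ℝ :=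
  1 + s.ζ C₀ ⬝ᵥ s.ζ C₀ + s.Xi C₀ ⬝ᵥ s.Xi C₀ + ∑ i, s.η C i ⬝ᵥ s.η C i

/-- The rates of the states of the linear part. -/
noncomputable def linRate : LinIdx D → ℝ :=
  Sum.elim (fun i => (A.mulVec s.x + B.mulVec (s.u C₀)) i) <|
  Sum.elim (fun jk => s.q_u C₀ jk.1 (jk.2 + 1)) <|
  Sum.elim (fun jk => s.q_y₀ C₀ jk.1 (jk.2 + 1)) <|
  Sum.elim (fun jk => s.q_r jk.1 (jk.2 + 1)) <|
  Sum.elim (fun jk => s.q_ω C₀ jk.1 (jk.2 + 1)) <|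
  Sum.elim (fun jk => s.q_Θω C₀ jk.1 (jk.2 + 1)) fun jk => s.q_e C jk.1 (jk.2 + 1)

/-- The adaptive laws. -/
noncomputable def parRate : ParIdx M n n₀ → ℝ :=
  Sum.elim (fun ai => -((D.Ds * Matrix.vecMulVec (s.ε C C₀) (s.ζ C₀)) ai.2 ai.1) / s.msq C C₀) <|
  Sum.elim (fun ij => -((D.Γθ ij.1).mulVec (s.ε C C₀ ij.1 • s.η C ij.1) ij.2) / s.msq C C₀)
    fun ij => -((D.Γ * Matrix.vecMulVec (s.ε C C₀) (s.Xi C₀)) ij.1 ij.2) / s.msq C C₀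

/-- The right hand side of the closed loop equations. -/
noncomputable def rate : LinIdx D ⊕ ParIdx M n n₀ → ℝ :=
  Sum.elim (s.linRate A B C C₀) (s.parRate C C₀)

theorem one_le_msq : 1 ≤ s.msq C C₀ := by
  have h : ∀ {b : Type} [Fintype b] (v : b → ℝ), 0 ≤ v ⬝ᵥ v := fun v =>
    Finset.sum_nonneg fun _ _ => mul_self_nonneg _
  have h1 := h (s.ζ C₀)
  have h2 := h (s.Xi C₀)
  have h3 : 0 ≤ ∑ i, s.η C i ⬝ᵥ s.η C i := Finset.sum_nonneg fun i _ => h _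
  rw [msq]
  linarith

end Signals

/-- All signals are polynomial in the states and `r`, and the only denominator is `m² ≥ 1`.
Continuous differentiability yields Lipschitz constants on balls, uniform over the bounded values of
`r`. -/
theorem contDiff_rate (A : Matrix (Fin n) (Fin n) ℝ) (B : Matrix (Fin n) (Fin M) ℝ)
    (C : Matrix (Fin M) (Fin n) ℝ) (C₀ : Matrix (Fin n₀) (Fin n) ℝ) (D : Design M n n₀) :
    ContDiff ℝ 1 fun s : LoopPoint D => s.rate A B C C₀ := by
  have hz : ∀ k, ContDiff ℝ 1 fun s : LoopPoint D => s.2 k := fun k => by fun_prop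
  have hr : ∀ i, ContDiff ℝ 1 fun s : LoopPoint D => s.1 i := fun i => by fun_prop
  have hmv : ∀ {a b : Type} [Fintype b] (Q : Matrix a b ℝ) {v : LoopPoint D → b → ℝ},
      (∀ j, ContDiff ℝ 1 fun s => v s j) → ∀ i, ContDiff ℝ 1 fun s => Q.mulVec (v s) i :=
    fun Q _ hv i => contDiff_mulVec (Q := fun _ => Q) (fun _ _ => contDiff_const) hv i
  have hx : ∀ i, ContDiff ℝ 1 fun s : LoopPoint D => s.x i := fun i => hz _
  have hy : ∀ i, ContDiff ℝ 1 fun s : LoopPoint D => s.y C i := hmv C hx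
  have hy₀ : ∀ i, ContDiff ℝ 1 fun s : LoopPoint D => s.y₀ C₀ i := hmv C₀ hx
  have hq_r : ∀ j k, ContDiff ℝ 1 fun s : LoopPoint D => s.q_r j k := fun j =>
    contDiff_completeState (hr j) fun _ => hz _
  have hy_m : ∀ i, ContDiff ℝ 1 fun s : LoopPoint D => s.y_m i := fun i =>
    ContDiff.sum fun j _ => contDiff_polyOp (hq_r j) _
  have he : ∀ i, ContDiff ℝ 1 fun s : LoopPoint D => s.e C i := fun i => (hy i).sub (hy_m i)
  have hω : ∀ c, ContDiff ℝ 1 fun s : LoopPoint D => s.ω C₀ c := by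
    rintro (c | c | c | c)
    · exact hz _
    · exact hz _
    · exact hy₀ c
    · exact hr c
  have hu : ∀ i, ContDiff ℝ 1 fun s : LoopPoint D => s.u C₀ i :=
    contDiff_mulVec (fun _ _ => hz _) hω
  have hq_u : ∀ j k, ContDiff ℝ 1 fun s : LoopPoint D => s.q_u C₀ j k := fun j =>
    contDiff_completeState (hu j) fun _ => hz _
  have hq_y₀ : ∀ j k, ContDiff ℝ 1 fun s : LoopPoint D => s.q_y₀ C₀ j k := fun j =>
    contDiff_completeState (hy₀ j) fun _ => hz _
  have hq_ω : ∀ j k, ContDiff ℝ 1 fun s : LoopPoint D => s.q_ω C₀ j k := fun j =>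
    contDiff_completeState (hω j) fun _ => hz _
  have hq_Θω : ∀ j k, ContDiff ℝ 1 fun s : LoopPoint D => s.q_Θω C₀ j k := fun j =>
    contDiff_completeState (hu j) fun _ => hz _
  have hq_e : ∀ j k, ContDiff ℝ 1 fun s : LoopPoint D => s.q_e C j k := fun j =>
    contDiff_completeState (he j) fun _ => hz _
  have hebar : ∀ i, ContDiff ℝ 1 fun s : LoopPoint D => s.ebar C i := fun i =>
    ContDiff.sum fun j _ => contDiff_polyOp (hq_e j) _
  have hη : ∀ i j, ContDiff ℝ 1 fun s : LoopPoint D => s.η C i j := fun i j => hebar _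
  have hζ : ∀ i, ContDiff ℝ 1 fun s : LoopPoint D => s.ζ C₀ i := fun i =>
    ContDiff.sum fun j _ => contDiff_polyOp (hq_ω j) _
  have hhΘω : ∀ i, ContDiff ℝ 1 fun s : LoopPoint D => s.hΘω C₀ i := fun i =>
    ContDiff.sum fun j _ => contDiff_polyOp (hq_Θω j) _
  have hXi : ∀ i, ContDiff ℝ 1 fun s : LoopPoint D => s.Xi C₀ i := fun i =>
    (contDiff_mulVec (fun _ _ => hz _) hζ i).sub (hhΘω i)
  have hε : ∀ i, ContDiff ℝ 1 fun s : LoopPoint D => s.ε C C₀ i := fun i =>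
    ((contDiff_dotProduct (fun _ => hz _) (hη i)).add
      (contDiff_mulVec (fun _ _ => hz _) hXi i)).add (hebar i)
  have hmsq : ContDiff ℝ 1 fun s : LoopPoint D => s.msq C C₀ :=
    ((contDiff_const.add (contDiff_dotProduct hζ hζ)).add (contDiff_dotProduct hXi hXi)).add
      (ContDiff.sum fun i _ => contDiff_dotProduct (hη i) (hη i))
  have hm0 : ∀ s : LoopPoint D, s.msq C C₀ ≠ 0 := fun s =>
    (one_pos.trans_le (s.one_le_msq C C₀)).ne'
  have hmul : ∀ {b : Type} (Q : Matrix (Fin M) (Fin M) ℝ) {v : LoopPoint D → b → ℝ},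
      (∀ j, ContDiff ℝ 1 fun s => v s j) → ∀ i j, ContDiff ℝ 1 fun s =>
        -((Q * Matrix.vecMulVec (s.ε C C₀) (v s)) i j) / s.msq C C₀ := fun Q _ hv i j => by
    simp only [Matrix.mul_vecMulVec, Matrix.vecMulVec_apply]
    exact ((hmv Q hε i).mul (hv j)).neg.div hmsq hm0
  refine contDiff_pi.2 ?_
  rintro ((i | jk | jk | jk | jk | jk | jk) | (ai | ij | ij))
  · exact (hmv A hx i).add (hmv B hu i)
  · exact hq_u _ _
  · exact hq_y₀ _ _
  · exact hq_r _ _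
  · exact hq_ω _ _
  · exact hq_Θω _ _
  · exact hq_e _ _
  · exact hmul D.Ds hζ ai.2 ai.1
  · exact (hmv (D.Γθ ij.1) (fun l => (hε ij.1).mul (hη ij.1 l)) ij.2).neg.div hmsq hm0
  · exact hmul D.Γ hXi ij.1 ij.2

end LoopPoint

end PartialStateMRAC

namespace PartialStateMRAC

/-! ### Existence of closed loop trajectories -/

/-- Gronwall's inequality for the squared norm. -/
theorem one_add_sum_sq_le_of_rate_le {ι : Type*} [Fintype ι] {T c : ℝ} {z f : ℝ → ι → ℝ}
    (h : ∀ k, HasRateOn T (fun t => z t k) fun t => f t k)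
    (hc : ∀ t, 0 ≤ t → t ≤ T → ∑ k, (f t k * z t k + z t k * f t k) ≤ c * (1 + ∑ k, z t k * z t k))
    {t : ℝ} (ht : 0 ≤ t) (htT : t ≤ T) :
    1 + ∑ k, z t k * z t k ≤ Real.exp (c * t) * (1 + ∑ k, z 0 k * z 0 k) := by
  have hV : HasRateOn T (fun t => 1 + ∑ k, z t k * z t k)
      fun t => 0 + ∑ k, (f t k * z t k + z t k * f t k) :=
    (HasRateOn.const T 1).add (HasRateOn.sum Finset.univ fun k _ => (h k).mul (h k))
  have := hV.le_of_rate_le (a := -c) (β := fun _ => 0)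
    (fun _ _ _ => intervalIntegrable_const) (fun t ht htT => by simpa using hc t ht htT) ht htT
  simpa using this

variable {M n n₀ : ℕ}

/-- The initial values of the states of the closed loop. -/
def InitialData.states (I : InitialData M n n₀) (D : Design M n n₀) :
    LinIdx D ⊕ ParIdx M n n₀ → ℝ :=
  Sum.elim
    (Sum.elim I.x <| Sum.elim (fun jk => I.c_u jk.1 jk.2) <|
      Sum.elim (fun jk => I.c_y₀ jk.1 jk.2) <| Sum.elim (fun jk => I.c_r jk.1 jk.2) <|
      Sum.elim (fun jk => I.c_ω jk.1 jk.2) <| Sum.elim (fun jk => I.c_Θω jk.1 jk.2)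
        fun jk => I.c_e jk.1 jk.2)
    (Sum.elim (fun ai => stack I.Θ₁ I.Θ₂ I.Θ₂₀ I.Θ₃ ai.1 ai.2) <|
      Sum.elim (fun ij => I.θ ij.1 ij.2) fun ij => I.Ψ ij.1 ij.2)

section

variable (A : Matrix (Fin n) (Fin n) ℝ) (B : Matrix (Fin n) (Fin M) ℝ)
  (C : Matrix (Fin M) (Fin n) ℝ) (C₀ : Matrix (Fin n₀) (Fin n) ℝ) {D : Design M n n₀}

/-- The signals of the closed loop as functions of its states and the reference input. -/
noncomputable def loopSignals (s : ℝ → LoopPoint D) : Signals M n n₀ where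
  x t := (s t).x
  u t := (s t).u C₀
  y t := (s t).y C
  y₀ t := (s t).y₀ C₀
  y_m t := (s t).y_m
  e t := (s t).e C
  ω₁ t := (s t).ω₁
  ω₂ t := (s t).ω₂
  ω t := (s t).ω C₀
  Θ₁ t := fun a i => (s t).Θ (.inl a) i
  Θ₂ t := fun a i => (s t).Θ (.inr (.inl a)) i
  Θ₂₀ t := fun a i => (s t).Θ (.inr (.inr (.inl a))) i
  Θ₃ t := fun i a => (s t).Θ (.inr (.inr (.inr a))) i
  θ t := (s t).θ
  Ψ t := (s t).Ψ
  ebar t := (s t).ebar C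
  η t := (s t).η C
  ζ t := (s t).ζ C₀
  hΘω t := (s t).hΘω C₀
  Xi t := (s t).Xi C₀
  ε t := (s t).ε C C₀
  msq t := (s t).msq C C₀
  q_u t := (s t).q_u C₀
  q_y₀ t := (s t).q_y₀ C₀
  q_r t := (s t).q_r
  q_ω t := (s t).q_ω C₀
  q_Θω t := (s t).q_Θω C₀
  q_e t := (s t).q_e C

theorem loopSignals_Θ (s : ℝ → LoopPoint D) (t : ℝ) : (loopSignals C C₀ s).Θ t = (s t).Θ := by
  ext a i
  rcases a with a | a | a | a <;> rfl

variable {A B C C₀} {r : ℝ → Fin M → ℝ} {I : InitialData M n n₀}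

theorem isClosedLoopOn_loopSignals {T : ℝ} (hT : 0 ≤ T) (hdet : D.ξ.det.Monic)
    {z : ℝ → LinIdx D ⊕ ParIdx M n n₀ → ℝ} (h0 : z 0 = I.states D)
    (hz : ∀ k, HasRateOn T (fun t => z t k)
      fun t => LoopPoint.rate A B C C₀ (D := D) (r t, z t) k) :
    IsClosedLoopOn T A B C C₀ D r I (loopSignals C C₀ fun t => ((r t, z t) : LoopPoint D)) where
  nonneg := hT
  state i := hz (.inl (.inl i))
  output _ _ _ := rfl
  partialState _ _ _ := rfl
  reference :=
    { filter := fun j => filterOn_completeState hdet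
        fun k => hz (.inl (.inr (.inr (.inr (.inl (j, k))))))
      init := fun j k hk => (completeState_of_lt hk).trans (congrFun h0 _)
      out := fun _ _ _ _ => rfl }
  error _ _ _ := rfl
  filter₁ :=
    { filter := fun j => filterOn_completeState D.Lam_monic fun k => hz (.inl (.inr (.inl (j, k))))
      init := fun j k hk => (completeState_of_lt hk).trans (congrFun h0 _)
      out := fun t _ _ lj => by
        rw [sum_polyOp_powerStack]
        have := completeState_of_lt (v := LoopPoint.u C₀ (D := D) (r t, z t) lj.2)
          (low := LoopPoint.lowU (D := D) (r t, z t) lj.2)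
          (lj.1.isLt.trans_eq D.Lam_degree.symm)
        exact this.symm }
  filter₂ :=
    { filter := fun j => filterOn_completeState D.Lam_monic
        fun k => hz (.inl (.inr (.inr (.inl (j, k)))))
      init := fun j k hk => (completeState_of_lt hk).trans (congrFun h0 _)
      out := fun t _ _ lj => by
        rw [sum_polyOp_powerStack]
        have := completeState_of_lt (v := LoopPoint.y₀ C₀ (D := D) (r t, z t) lj.2)
          (low := LoopPoint.lowY₀ (D := D) (r t, z t) lj.2)
          (lj.1.isLt.trans_eq D.Lam_degree.symm)
        exact this.symm }
  regressor _ _ _ := rfl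
  control t _ _ := by
    rw [loopSignals_Θ]
    rfl
  filter_e :=
    { filter := fun j => filterOn_completeState D.f_monic
        fun k => hz (.inl (.inr (.inr (.inr (.inr (.inr (.inr (j, k))))))))
      init := fun j k hk => (completeState_of_lt hk).trans (congrFun h0 _)
      out := fun _ _ _ _ => rfl }
  eta _ _ _ _ _ := rfl
  filter_ω :=
    { filter := fun j => filterOn_completeState D.f_monic
        fun k => hz (.inl (.inr (.inr (.inr (.inr (.inl (j, k)))))))
      init := fun j k hk => (completeState_of_lt hk).trans (congrFun h0 _)
      out := fun _ _ _ _ => rfl }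
  filter_Θω :=
    { filter := fun j => by
        simp only [loopSignals_Θ]
        exact filterOn_completeState D.f_monic
          fun k => hz (.inl (.inr (.inr (.inr (.inr (.inr (.inl (j, k))))))))
      init := fun j k hk => (completeState_of_lt hk).trans (congrFun h0 _)
      out := fun _ _ _ _ => rfl }
  xi t _ _ := by
    rw [loopSignals_Θ]
    rfl
  eps _ _ _ _ := rfl
  normalization _ _ _ := rfl
  law_θ i j := hz (.inr (.inr (.inl ⟨i, j⟩)))
  law_Θ a i := by
    simp only [loopSignals_Θ]
    exact hz (.inr (.inl (a, i)))
  law_Ψ i j := hz (.inr (.inr (.inr (i, j))))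
  init_x := funext fun i => congrFun h0 _
  init_Θ := by
    rw [loopSignals_Θ]
    ext a i
    exact congrFun h0 _
  init_θ := funext fun i => funext fun j => congrFun h0 _
  init_Ψ := funext fun i => funext fun j => congrFun h0 _

section Existence

variable {Kp : Matrix (Fin M) (Fin M) ℝ}
  (hxi : IsModifiedInteractor D.ξ (transferMatrix A B C) Kp)
  (hobs : Observable A C₀) (hrank : C₀.rank = n₀)
  (hminors : ∀ k, 1 ≤ k → k ≤ M → leadingMinor Kp k ≠ 0)
  (hsgn : ∀ i : Fin M, D.sgn i =
    Real.sign (leadingMinor Kp (i.val + 1) / leadingMinor Kp i.val))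
  (hr_meas : Measurable r) (hr_bdd : ∀ i, BoundedSignal fun t => r t i)

include hxi hobs hrank hminors hsgn hr_meas hr_bdd

/-- Trajectories do not escape in finite time, uniformly for given initial data. -/
theorem exists_state_bound {J : Type} {τ : J → ℝ} (hτ : ∀ j, 0 ≤ τ j) {T : ℝ} (hτT : ∀ j, τ j ≤ T)
    {z : J → ℝ → LinIdx D ⊕ ParIdx M n n₀ → ℝ} (h0 : ∀ j, z j 0 = I.states D)
    (hz : ∀ j k, HasRateOn (τ j) (fun t => z j t k)
      fun t => LoopPoint.rate A B C C₀ (D := D) (r t, z j t) k) (k : LinIdx D ⊕ ParIdx M n n₀) :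
    UBd (fun _ : J => 1) fun j => z j (τ j) k := by
  set σ : J → Signals M n n₀ := fun j => loopSignals C C₀ fun t => ((r t, z j t) : LoopPoint D)
    with hσ
  have hl : ∀ j, IsClosedLoopOn (τ j) A B C C₀ D r I (σ j) := fun j =>
    isClosedLoopOn_loopSignals (hτ j) hxi.det_monic (h0 j) (hz j)
  obtain ⟨Θs, -, hδ⟩ := exists_error_model hl hxi hobs hrank hr_meas hr_bdd
  obtain ⟨hθ, hΨ, hΘ, -⟩ := exists_lyapunov_bound hl hxi hminors hsgn hδ
  set φ : J → Times τ := fun j => ⟨(j, τ j), hτ j, le_rfl⟩ with hφ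
  rcases k with k | (ai | ij | ij)
  -- The Lyapunov estimate bounds the parameters independently of the linear states. Hence the rates
  -- of the latter are at most proportional to `w = √(1 + |z|²)`, with a constant common to the
  -- family, and Gronwall applies.
  · have hp : ParamBound (fun p : Times τ => σ p.1.1) fun p => p.1.2 := ⟨hθ, hΨ, hΘ⟩
    set V : Times τ → ℝ := fun p => 1 + ∑ k, z p.1.1 p.1.2 (.inl k) * z p.1.1 p.1.2 (.inl k)
      with hV
    have hV1 : ∀ p, 1 ≤ V p := fun p => by
      have : 0 ≤ ∑ k, z p.1.1 p.1.2 (.inl k) * z p.1.1 p.1.2 (.inl k) :=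
        Finset.sum_nonneg fun _ _ => mul_self_nonneg _
      simp only [hV]
      linarith
    set w : Times τ → ℝ := fun p => Real.sqrt (V p) with hw
    have hww : ∀ p, w p * w p = V p := fun p => Real.mul_self_sqrt (zero_le_one.trans (hV1 p))
    have hw1 : ∀ p, 1 ≤ w p := fun p => Real.one_le_sqrt.2 (hV1 p)
    have hzw : ∀ k, UBd w fun p : Times τ => z p.1.1 p.1.2 (.inl k) := fun k => ⟨1, fun p => by
      rw [one_mul]
      refine Real.abs_le_sqrt ?_
      have := Finset.single_le_sum (f := fun k => z p.1.1 p.1.2 (.inl k) * z p.1.1 p.1.2 (.inl k))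
        (fun _ _ => mul_self_nonneg _) (Finset.mem_univ k)
      simp only [hV, sq]
      linarith⟩
    have hs : StateBound D w (fun p : Times τ => σ p.1.1) fun p => p.1.2 :=
      ⟨fun i => hzw _,
        fun j k hk => (hzw (.inr (.inl (j, ⟨k, hk⟩)))).congr fun p => completeState_of_lt hk,
        fun j k hk => (hzw (.inr (.inr (.inl (j, ⟨k, hk⟩))))).congr
          fun p => completeState_of_lt hk,
        fun j k hk => (hzw (.inr (.inr (.inr (.inl (j, ⟨k, hk⟩)))))).congr
          fun p => completeState_of_lt hk,
        fun j k hk => (hzw (.inr (.inr (.inr (.inr (.inl (j, ⟨k, hk⟩))))))).congr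
          fun p => completeState_of_lt hk,
        fun j k hk => (hzw (.inr (.inr (.inr (.inr (.inr (.inl (j, ⟨k, hk⟩)))))))).congr
          fun p => completeState_of_lt hk,
        fun j k hk => (hzw (.inr (.inr (.inr (.inr (.inr (.inr (j, ⟨k, hk⟩)))))))).congr
          fun p => completeState_of_lt hk⟩
    have S := hs.signalBound hp hw1 (T := fun p => τ p.1.1) (fun p => p.2.1) (fun p => p.2.2)
      (fun p => hl p.1.1) hxi hr_bdd
    have hrate : ∀ k, UBd w fun p : Times τ =>
        LoopPoint.linRate A B C C₀ (D := D) (r p.1.2, z p.1.1 p.1.2) k := by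
      rintro (i | jk | jk | jk | jk | jk | jk)
      · exact S.stateRate i
      · exact S.q_u jk.1 _ jk.2.isLt
      · exact S.q_y₀ jk.1 _ jk.2.isLt
      · exact S.q_r jk.1 _ jk.2.isLt
      · exact S.q_ω jk.1 _ jk.2.isLt
      · exact S.q_Θω jk.1 _ jk.2.isLt
      · exact S.q_e jk.1 _ jk.2.isLt
    obtain ⟨c, hc⟩ := UBd.sum Finset.univ fun k _ =>
      ((hrate k).mul_self (hzw k)).add ((hzw k).mul_self (hrate k))
    set V₀ := 1 + ∑ k, I.states D (.inl k) * I.states D (.inl k) with hV₀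
    have hV₀0 : 0 ≤ V₀ := add_nonneg zero_le_one (Finset.sum_nonneg fun _ _ => mul_self_nonneg _)
    have hVτ : ∀ j, V (φ j) ≤ Real.exp (|c| * T) * V₀ := by
      intro j
      have h1 := one_add_sum_sq_le_of_rate_le (c := c) (fun k => hz j (.inl k))
        (fun t ht htT => by
          have := (le_abs_self _).trans (hc ⟨(j, t), ht, htT⟩)
          beta_reduce at this
          rw [hww] at this
          exact this) (hτ j) le_rfl
      refine h1.trans ?_
      rw [h0 j]
      refine mul_le_mul_of_nonneg_right (Real.exp_le_exp.2 ?_) hV₀0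
      exact mul_le_mul (le_abs_self c) (hτT j) (hτ j) (abs_nonneg c)
    refine UBd.of_abs_le (c := Real.sqrt (Real.exp (|c| * T) * V₀)) fun j => ?_
    refine Real.abs_le_sqrt (le_trans ?_ (hVτ j))
    have := Finset.single_le_sum (f := fun k => z j (τ j) (.inl k) * z j (τ j) (.inl k))
      (fun _ _ => mul_self_nonneg _) (Finset.mem_univ k)
    simp only [hV, hφ, sq]
    linarith
  · refine ((hΘ ai.1 ai.2).comp φ).congr fun j => ?_
    simp only [hσ, loopSignals_Θ]
    rfl
  · exact (hθ ij.1 ij.2).comp φ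
  · exact (hΨ ij.1 ij.2).comp φ

/-- Existence of closed loop trajectories on `[0, ∞)`. -/
theorem exists_isClosedLoop : ∃ σ : Signals M n n₀, IsClosedLoop A B C C₀ D r I σ := by
  have hF := LoopPoint.contDiff_rate A B C C₀ D
  set Φ : LoopPoint D → LinIdx D ⊕ ParIdx M n n₀ → ℝ := fun s => s.rate A B C C₀ with hΦ
  choose Kr hKr using hr_bdd
  set ρ : ℝ := ∑ i, |Kr i| with hρ
  have hρr : ∀ t, 0 ≤ t → ‖r t‖ ≤ ρ := fun t ht =>
    (pi_norm_le_iff_of_nonneg (Finset.sum_nonneg fun _ _ => abs_nonneg _)).2 fun i =>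
      ((hKr i t ht).trans (le_abs_self _)).trans
        (Finset.single_le_sum (f := fun i => |Kr i|) (fun _ _ => abs_nonneg _) (Finset.mem_univ i))
  have hlip : ∀ R : ℝ, ∃ L : ℝ, ∀ t, 0 ≤ t → ∀ x y : LinIdx D ⊕ ParIdx M n n₀ → ℝ,
      ‖x‖ ≤ R → ‖y‖ ≤ R → ‖Φ (r t, x) - Φ (r t, y)‖ ≤ L * ‖x - y‖ := by
    intro R
    obtain ⟨L, hL⟩ := hF.contDiffOn.exists_lipschitzOnWith one_ne_zero
      ((convex_closedBall (0 : Fin M → ℝ) ρ).prod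
        (convex_closedBall (0 : LinIdx D ⊕ ParIdx M n n₀ → ℝ) R))
      ((isCompact_closedBall _ _).prod (isCompact_closedBall _ _))
    refine ⟨L, fun t ht x y hx hy => ?_⟩
    have := hL.norm_sub_le (x := (r t, x)) (y := (r t, y))
      ⟨mem_closedBall_zero_iff.2 (hρr t ht), mem_closedBall_zero_iff.2 hx⟩
      ⟨mem_closedBall_zero_iff.2 (hρr t ht), mem_closedBall_zero_iff.2 hy⟩
    simpa [Prod.norm_def] using this
  have hzero : ∃ L : ℝ, ∀ t, 0 ≤ t → ‖Φ (r t, 0)‖ ≤ L := by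
    obtain ⟨L, hL⟩ := ((isCompact_closedBall (0 : Fin M → ℝ) ρ).prod
      (isCompact_singleton (x := (0 : LinIdx D ⊕ ParIdx M n n₀ → ℝ)))).exists_bound_of_continuousOn
        hF.continuous.continuousOn
    exact ⟨L, fun t ht => hL _ ⟨mem_closedBall_zero_iff.2 (hρr t ht), rfl⟩⟩
  have hcoord : ∀ {τ : ℝ} {z : ℝ → LinIdx D ⊕ ParIdx M n n₀ → ℝ},
      (∀ t, 0 ≤ t → t ≤ τ → IntervalIntegrable (fun s => Φ (r s, z s)) volume 0 t ∧
        z t = I.states D + ∫ s in (0 : ℝ)..t, Φ (r s, z s)) →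
      ∀ k, HasRateOn τ (fun t => z t k) fun t => Φ (r t, z t) k := fun hz k =>
    hasRateOn_clm hz (ContinuousLinearMap.proj k)
  have hinit : ∀ {τ : ℝ} {z : ℝ → LinIdx D ⊕ ParIdx M n n₀ → ℝ}, 0 ≤ τ →
      (∀ t, 0 ≤ t → t ≤ τ → IntervalIntegrable (fun s => Φ (r s, z s)) volume 0 t ∧
        z t = I.states D + ∫ s in (0 : ℝ)..t, Φ (r s, z s)) → z 0 = I.states D := fun hτ hz => by
    simpa using (hz 0 le_rfl hτ).2
  obtain ⟨z, -, hz⟩ := exists_integral_solution_of_apriori (F := fun t x => Φ (r t, x))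
    (I.states D) hlip hzero
    (fun x hx => (hF.continuous.measurable.comp
      (hr_meas.prodMk hx.measurable)).aestronglyMeasurable) fun T hT => by
      -- All solutions on all intervals `[0, τ]` with `τ ≤ T` form a single family, so that one
      -- bound serves for every one of them.
      let J := {p : ℝ × (ℝ → LinIdx D ⊕ ParIdx M n n₀ → ℝ) // (0 ≤ p.1 ∧ p.1 ≤ T) ∧
        ∀ t, 0 ≤ t → t ≤ p.1 → IntervalIntegrable (fun s => Φ (r s, p.2 s)) volume 0 t ∧
          p.2 t = I.states D + ∫ s in (0 : ℝ)..t, Φ (r s, p.2 s)}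
      have hb := exists_state_bound (J := J) (τ := fun j => j.1.1) (I := I) hxi hobs hrank hminors
        hsgn hr_meas (fun i => ⟨Kr i, hKr i⟩) (fun j => j.2.1.1) (T := T) (fun j => j.2.1.2)
        (z := fun j => j.1.2) (fun j => hinit j.2.1.1 j.2.2) fun j => hcoord j.2.2
      choose c hc using hb
      refine ⟨∑ k, |c k|, fun τ hτ hτT x _ hx => ?_⟩
      refine (pi_norm_le_iff_of_nonneg (Finset.sum_nonneg fun _ _ => abs_nonneg _)).2 fun k => ?_
      have h1 := hc k ⟨(τ, x), ⟨hτ, hτT⟩, hx⟩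
      rw [mul_one] at h1
      exact (h1.trans (le_abs_self _)).trans
        (Finset.single_le_sum (f := fun k => |c k|) (fun _ _ => abs_nonneg _) (Finset.mem_univ k))
  exact ⟨_, isClosedLoop_of_on fun T hT => isClosedLoopOn_loopSignals hT hxi.det_monic
    (hinit (τ := T) hT fun t ht _ => hz t ht) (hcoord fun t ht _ => hz t ht)⟩

end Existence

end

end PartialStateMRAC
-- Existence, boundedness and asymptotic tracking combined
theorem theorem3p2 {M n n₀ : ℕ}
    (A : Matrix (Fin n) (Fin n) ℝ) (B : Matrix (Fin n) (Fin M) ℝ)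
    (C : Matrix (Fin M) (Fin n) ℝ) (C₀ : Matrix (Fin n₀) (Fin n) ℝ)
    (D : PartialStateMRAC.Design M n n₀) (Kp : Matrix (Fin M) (Fin M) ℝ)
    -- stable zeros, stabilizability, detectability
    (hzeros : ∀ z : ℂ,
      PartialStateMRAC.IsTransmissionZero (PartialStateMRAC.transferMatrix A B C) z → z.re < 0)
    (hstab : PartialStateMRAC.Stabilizable A B) (hdet : PartialStateMRAC.Detectable A C)
    -- full rank, known modified left interactor
    (hfull : ∃ s : ℂ, (PartialStateMRAC.transferMatrix A B C s).det ≠ 0)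
    (hxi : PartialStateMRAC.IsModifiedInteractor D.ξ (PartialStateMRAC.transferMatrix A B C) Kp)
    -- measured partial state
    (hobs : PartialStateMRAC.Observable A C₀) (hrank : C₀.rank = n₀)
    -- nonzero leading principal minors, known signs
    (hminors : ∀ k, 1 ≤ k → k ≤ M → PartialStateMRAC.leadingMinor Kp k ≠ 0)
    (hsgn : ∀ i : Fin M, D.sgn i = Real.sign
      (PartialStateMRAC.leadingMinor Kp (i.val + 1) / PartialStateMRAC.leadingMinor Kp i.val))
    -- bounded reference input
    (r : ℝ → Fin M → ℝ) (hr_meas : Measurable r)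
    (hr_bdd : ∀ i, PartialStateMRAC.BoundedSignal fun t => r t i)
    (I : PartialStateMRAC.InitialData M n n₀) :
    (∃ σ : PartialStateMRAC.Signals M n n₀, PartialStateMRAC.IsClosedLoop A B C C₀ D r I σ) ∧
    ∀ σ : PartialStateMRAC.Signals M n n₀, PartialStateMRAC.IsClosedLoop A B C C₀ D r I σ →
      PartialStateMRAC.AllBounded D σ ∧
      Tendsto (fun t => σ.y t - σ.y_m t) atTop (𝓝 0) := by
  exact ⟨PartialStateMRAC.exists_isClosedLoop hxi hobs hrank hminors hsgn hr_meas hr_bdd,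
    fun σ h => h.allBounded_and_tendsto hxi hobs hrank hminors hsgn hr_meas hr_bdd
      (hxi.hurwitz hzeros hstab hdet)⟩
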